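/- **Conditional lower bound for 1-D distance oracles for colors.** *Model.* Algorithms are randomized word-RAM programs (fixed finite code, unit-cost arithmetic, bitwise operations, comparisons and memory access on $w$-bit words, and unit-cost uniformly random words). They are Las Vegas: whenever they halt, the answer is correct. An algorithm works for all word lengths $w \ge c(\lfloor\log_2 n\rfloor+1)$, where $n$ is the size of its input and $c$ is a constant of the algorithm, and time bounds depend only on $n$. *3SUM.* Given a set $A$ of $n$ integers, each of which fits in a (signed) word, decide whether there are three distinct $a,b,c\in A$ with $a+b=c$. The *3SUM conjecture* says that this requires expected time $\Omega(n^{2-o(1)})$, that is: no algorithm solves 3SUM in expected time $O(n^{2-\varepsilon})$ for a constant $\varepsilon>0$. The *3SUM conjecture for all large $n$* says that every bound $T(n)$ on the expected time of an algorithm for 3SUM satisfies $T(n)=\Omega(n^{2-\varepsilon})$ (for all large $n$) for every constant $\varepsilon>0$. *Oracles.* For an array $X$ of size $N$ with entries (colors) in $\{0,\dots,N-1\}$ and colors $a,b$ that occur in it, let $d(a,b)=\min\{|i-j| : X[i]=a,\ X[j]=b\}$. A 1-D distance oracle for colors with stretch $\alpha\ge 1$ preprocesses $X$ and then, for each query $(a,b)$,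 returns an integer $\hat d$ with $d(a,b)\le \hat d\le \alpha\, d(a,b)$. It has expected preprocessing time $t_p(N)$ and amortized expected query time $t_q(N)$ if, for every array of size $N$, every $m\ge 0$ and every sequence of $m$ queries, preprocessing and answering the $m$ queries take expected total time at most $t_p(N)+m\,t_q(N)$. **Theorem.** Let $\alpha\ge 1$ be a constant, and consider any 1-D distance oracle for colors with stretch $\alpha$, with expected preprocessing time $t_p(N)$ and amortized expected query time $t_q(N)$ on arrays of size $N$. Assume the 3SUM conjecture. Then for every constant $0<\gamma<1$ $$t_p(N)+N^{\frac{1+\gamma}{2-\gamma}}\,t_q(N)=\Omega\bigl(N^{\frac{2}{2-\gamma}-o(1)}\bigr).$$ Precisely: 1. Under the 3SUM conjecture, the left-hand side is not $O\bigl(N^{\frac{2}{2-\gamma}-\varepsilon}\bigr)$ for any constant $\varepsilon>0$. 2. Under the 3SUM conjecture for all large $n$, if the bounds $t_p$ and $t_q$ are nondecreasing, then for every constant $\varepsilon>0$ the left-hand side is $\Omega\bigl(N^{\frac{2}{2-\gamma}-\varepsilon}\bigr)$, with the bound holding for all large $N$. -/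

import Mathlib

open MeasureTheory Filter Asymptotics
open scoped NNReal ENNReal

/-! ### Randomized word RAM

A program is a fixed finite piece of code; it refers to finitely many registers and finitely many
arrays. On a machine of word length `w`, registers and array cells hold `w`-bit words, and every
array is addressed by words. Each elementary instruction and each test of a branch or loop costs
one step. -/

namespace WordRAM

/-- Unit-cost operations on two words. -/
inductive Op
  | add | sub | mul | div | mod | and | or | xor | shl | shr | eq | lt

/-- Words are unsigned residues modulo `2 ^ w`; comparisons return `1` or `0`. -/
def Op.eval {w : ℕ} : Op → BitVec w → BitVec w → BitVec w
  | .add, x, y => x + y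
  | .sub, x, y => x - y
  | .mul, x, y => x * y
  | .div, x, y => BitVec.ofNat w (x.toNat / y.toNat)
  | .mod, x, y => BitVec.ofNat w (x.toNat % y.toNat)
  | .and, x, y => x &&& y
  | .or, x, y => x ||| y
  | .xor, x, y => x ^^^ y
  | .shl, x, y => x <<< y.toNat
  | .shr, x, y => x >>> y.toNat
  | .eq, x, y => if x.toNat = y.toNat then BitVec.ofNat w 1 else BitVec.ofNat w 0
  | .lt, x, y => if x.toNat < y.toNat then BitVec.ofNat w 1 else BitVec.ofNat w 0

/-- Programs. Registers `r s t` and arrays `a` are named by natural numbers. -/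
inductive Prog
  /-- do nothing -/
  | skip
  /-- `r := k` -/
  | const (r k : ℕ)
  /-- `r := word length` -/
  | wordLength (r : ℕ)
  /-- `r := s ∘ t` -/
  | op (o : Op) (r s t : ℕ)
  /-- `r := a[s]` -/
  | load (r a s : ℕ)
  /-- `a[s] := t` -/
  | store (a s t : ℕ)
  /-- `r := ` a fresh uniformly random word -/
  | rand (r : ℕ)
  /-- `p; q` -/
  | seq (p q : Prog)
  /-- if `r ≠ 0` then `p` else `q` -/
  | ite (r : ℕ) (p q : Prog)
  /-- while `r ≠ 0` do `p` -/
  | loop (r : ℕ) (p : Prog)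

/-- A machine state: registers, arrays, and the random words that are still unused. -/
structure State (w : ℕ) where
  reg : ℕ → BitVec w
  mem : ℕ → BitVec w → BitVec w
  tape : ℕ → BitVec w

/-- Put the word `x` into register `r`. -/
def State.setReg {w : ℕ} (s : State w) (r : ℕ) (x : BitVec w) : State w :=
  { s with reg := Function.update s.reg r x }

/-- Put the word `x` into cell `i` of array `a`. -/
def State.setMem {w : ℕ} (s : State w) (a : ℕ) (i x : BitVec w) : State w :=
  { s with mem := Function.update s.mem a (Function.update (s.mem a) i x) }

/-- `Exec p s t s'`: started in state `s`, program `p` halts after exactly `t` steps in `s'`. -/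
inductive Exec {w : ℕ} : Prog → State w → ℕ → State w → Prop
  | skip (s : State w) : Exec .skip s 1 s
  | const (r k : ℕ) (s : State w) : Exec (.const r k) s 1 (s.setReg r (BitVec.ofNat w k))
  | wordLength (r : ℕ) (s : State w) :
      Exec (.wordLength r) s 1 (s.setReg r (BitVec.ofNat w w))
  | op (o : Op) (r i j : ℕ) (s : State w) :
      Exec (.op o r i j) s 1 (s.setReg r (o.eval (s.reg i) (s.reg j)))
  | load (r a i : ℕ) (s : State w) :
      Exec (.load r a i) s 1 (s.setReg r (s.mem a (s.reg i)))
  | store (a i j : ℕ) (s : State w) :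
      Exec (.store a i j) s 1 (s.setMem a (s.reg i) (s.reg j))
  | rand (r : ℕ) (s : State w) :
      Exec (.rand r) s 1 ({ s with tape := fun i => s.tape (i + 1) }.setReg r (s.tape 0))
  | seq {p q : Prog} {s s₁ s₂ : State w} {t₁ t₂ : ℕ} :
      Exec p s t₁ s₁ → Exec q s₁ t₂ s₂ → Exec (.seq p q) s (t₁ + t₂) s₂
  | ite_pos {r : ℕ} {p q : Prog} {s s' : State w} {t : ℕ} :
      s.reg r ≠ 0 → Exec p s t s' → Exec (.ite r p q) s (t + 1) s'
  | ite_neg {r : ℕ} {p q : Prog} {s s' : State w} {t : ℕ} :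
      s.reg r = 0 → Exec q s t s' → Exec (.ite r p q) s (t + 1) s'
  | loop_pos {r : ℕ} {p : Prog} {s s₁ s₂ : State w} {t₁ t₂ : ℕ} :
      s.reg r ≠ 0 → Exec p s t₁ s₁ → Exec (.loop r p) s₁ t₂ s₂ →
      Exec (.loop r p) s (t₁ + t₂ + 1) s₂
  | loop_neg {r : ℕ} {p : Prog} {s : State w} :
      s.reg r = 0 → Exec (.loop r p) s 1 s

/-- Initial state: the input length `n` is in register `0`, the input words are in cells
`0, …, n - 1` of array `0`, everything else is zero. -/
def initState {w : ℕ} (n : ℕ) (x : Fin n → BitVec w) (tape : ℕ → BitVec w) : State w where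
  reg := fun r => if r = 0 then BitVec.ofNat w n else 0
  mem := fun a i => if h : a = 0 ∧ i.toNat < n then x ⟨i.toNat, h.2⟩ else 0
  tape := tape

instance wordMeasurableSpace (w : ℕ) : MeasurableSpace (BitVec w) := ⊤

/-- The law of an infinite sequence of independent uniformly random words. -/
noncomputable def tapeMeasure (w : ℕ) : Measure (ℕ → BitVec w) :=
  Measure.infinitePi fun _ : ℕ => (PMF.uniformOfFintype (BitVec w)).toMeasure

/-- The number of steps of `p` from `s`; it is `∞` if `p` does not halt. -/
noncomputable def cost {w : ℕ} (p : Prog) (s : State w) : ℝ≥0∞ :=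
  ⨅ (t : ℕ) (_ : ∃ s', Exec p s t s'), (t : ℝ≥0∞)

/-- `Answers q s l ans t`: from state `s`, the queries in `l` are processed one after the other by
the program `q`, each on the memory left by its predecessor, with answers `ans` and in `t` steps
altogether. A query is placed in registers `0` and `1`; its answer is read from register `0`. -/
inductive Answers {w : ℕ} (q : Prog) :
    State w → List (BitVec w × BitVec w) → List (BitVec w) → ℕ → Prop
  | nil (s : State w) : Answers q s [] [] 0
  | cons {s s' : State w} {x y : BitVec w} {l : List (BitVec w × BitVec w)}
      {ans : List (BitVec w)} {t T : ℕ} :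
      Exec q ((s.setReg 0 x).setReg 1 y) t s' → Answers q s' l ans T →
      Answers q s ((x, y) :: l) (s'.reg 0 :: ans) (t + T)

/-- Preprocessing with `pre`, followed by the queries in `l`, each processed by `q`. -/
def Session {w : ℕ} (pre q : Prog) (s : State w) (l : List (BitVec w × BitVec w))
    (ans : List (BitVec w)) (t : ℕ) : Prop :=
  ∃ t₁ s₁ t₂, Exec pre s t₁ s₁ ∧ Answers q s₁ l ans t₂ ∧ t = t₁ + t₂

/-- The number of steps of preprocessing and all the queries; `∞` if this does not halt. -/
noncomputable def sessionCost {w : ℕ} (pre q : Prog) (s : State w)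
    (l : List (BitVec w × BitVec w)) : ℝ≥0∞ :=
  ⨅ (t : ℕ) (_ : ∃ ans, Session pre q s l ans t), (t : ℝ≥0∞)

end WordRAM

/-! ### 3SUM -/

/-- The integers `x i`, which are pairwise distinct in all uses below, contain three distinct
elements `a, b, c` with `a + b = c`. -/
def HasThreeSum {n : ℕ} (x : Fin n → ℤ) : Prop :=
  ∃ i j k : Fin n, i ≠ j ∧ i ≠ k ∧ j ≠ k ∧ x i + x j = x k

/-- `p` is a Las Vegas algorithm for 3SUM with expected running time at most `T n` on sets of `n`
integers, on every machine whose word length `w` is at least `c (⌊log₂ n⌋ + 1)` and for all integers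
that fit in a (two's complement) word. The answer is "yes" if register `0` ends up nonzero. -/
def SolvesThreeSum (p : WordRAM.Prog) (c : ℕ) (T : ℕ → ℝ≥0) : Prop :=
  ∀ n w : ℕ, c * (Nat.log 2 n + 1) ≤ w →
    ∀ x : Fin n → ℤ, Function.Injective x →
      (∀ i, -(2 : ℤ) ^ w ≤ 2 * x i ∧ 2 * x i < (2 : ℤ) ^ w) →
      (∀ tape t s',
        WordRAM.Exec p (WordRAM.initState n (fun i => BitVec.ofInt w (x i)) tape) t s' →
          (s'.reg 0 ≠ 0 ↔ HasThreeSum x)) ∧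
      ∫⁻ tape, WordRAM.cost p (WordRAM.initState n (fun i => BitVec.ofInt w (x i)) tape)
        ∂(WordRAM.tapeMeasure w) ≤ (T n : ℝ≥0∞)

/-- The 3SUM conjecture: no randomized algorithm solves 3SUM in expected time `O(n ^ (2 - ε))`
with a constant `ε > 0`. -/
def ThreeSumConjecture : Prop :=
  ∀ (p : WordRAM.Prog) (c : ℕ) (T : ℕ → ℝ≥0), SolvesThreeSum p c T →
    ∀ ε : ℝ, 0 < ε →
      ¬ (fun n : ℕ => (T n : ℝ)) =O[atTop] (fun n : ℕ => (n : ℝ) ^ (2 - ε))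

/-- The 3SUM conjecture with a lower bound that holds for all large `n`: the expected running time
of every randomized algorithm for 3SUM is `Ω(n ^ (2 - ε))` for every constant `ε > 0`. -/
def StrongThreeSumConjecture : Prop :=
  ∀ (p : WordRAM.Prog) (c : ℕ) (T : ℕ → ℝ≥0), SolvesThreeSum p c T →
    ∀ ε : ℝ, 0 < ε →
      (fun n : ℕ => (n : ℝ) ^ (2 - ε)) =O[atTop] (fun n : ℕ => (T n : ℝ))

/-! ### Distance oracles for colors -/

/-- The distance of two colors in an array: the least distance `|i - j|` of a position `i` of color
`a` from a position `j` of color `b`. It is used only for colors that occur in the array. -/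
noncomputable def colorDist {N : ℕ} (X : Fin N → Fin N) (a b : Fin N) : ℕ :=
  sInf {d | ∃ i j : Fin N, X i = a ∧ X j = b ∧ d = Nat.dist i j}

/-- The preprocessing program `pre` and the query program `qry` form a Las Vegas 1-D distance oracle
for colors with stretch `α`: on arrays of `N` colors from `{0, …, N - 1}` and on machines of word
length at least `c (⌊log₂ N⌋ + 1)`, each query for two colors `a, b` that occur in the array is
answered by some `d` with `colorDist X a b ≤ d ≤ α * colorDist X a b`. The expected preprocessing
time is at most `tp N` and the amortized expected query time at most `tq N`: preprocessing and any
`m` queries together take expected time at most `tp N + m * tq N`, for all `m ≥ 0`. -/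
def IsColorDistOracle (α : ℝ) (pre qry : WordRAM.Prog) (c : ℕ) (tp tq : ℕ → ℝ≥0) : Prop :=
  ∀ N w : ℕ, c * (Nat.log 2 N + 1) ≤ w →
    ∀ (X : Fin N → Fin N) (l : List (Fin N × Fin N)),
      (∀ ab ∈ l, ab.1 ∈ Set.range X ∧ ab.2 ∈ Set.range X) →
      (∀ tape ans t,
        WordRAM.Session pre qry (WordRAM.initState N (fun i => BitVec.ofNat w (X i)) tape)
            (l.map fun ab => (BitVec.ofNat w ab.1, BitVec.ofNat w ab.2)) ans t →
          List.Forall₂ (fun (ab : Fin N × Fin N) (d : BitVec w) =>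
            colorDist X ab.1 ab.2 ≤ d.toNat ∧ (d.toNat : ℝ) ≤ α * colorDist X ab.1 ab.2) l ans) ∧
      ∫⁻ tape, WordRAM.sessionCost pre qry
          (WordRAM.initState N (fun i => BitVec.ofNat w (X i)) tape)
          (l.map fun ab => (BitVec.ofNat w ab.1, BitVec.ofNat w ab.2))
        ∂(WordRAM.tapeMeasure w) ≤ ((tp N + l.length * tq N : ℝ≥0) : ℝ≥0∞)

/-! ### Determinism of programs, and running a program in renamed registers and arrays -/

namespace WordRAM

variable {w : ℕ}

/-! The proof turns a distance oracle into an algorithm for 3SUM. A random odd multiplier hashes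
every input word to its sign bit together with the leading `H` binary digits of its multiple modulo
`2 ^ w`. This hash is additive up to carries: a solution `a + b = c` forces `h a + h b = h c + j * 2
^ H - f` modulo `P = 8 * 2 ^ H` for one of eight carry patterns `(j, f)` (`Hashes.exists_match`). A
triple that violates the equation in words passes such a test with probability `O(2 ^ (-H))`
(`card_odd_mul_near_zero`), so that on average only `O(n + n ^ 3 / 2 ^ H)` spurious tests succeed
(`sum_card_spurious_le`).

Pairs with a prescribed hash sum `g` are detected as intersections of sets. Factor `P = R * S ^ 2`
and write `g = I * S ^ 2 + c' * S + c`. Then `h x + h y = g` modulo `P` if and only if `c - h x` and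
`h y - c' * S` agree modulo `S ^ 2` and their buckets, the quotients by `S ^ 2`, differ by `I`
modulo `R` (`match_iff`). A shift and a bucket thus define a subset of a universe of `S ^ 2`
elements, and such subsets become colours. Given `x` and `y`, only one pair of shifts makes the
residues agree, so the products of the numbers of colours of both kinds at an element add up to at
most `n ^ 2` (`sum_length_mul_length_le`). The colours at each element are cut into chunks of length
`b`, about `n / S`, and each pair of chunks is written down as a block; at most `4 * S ^ 2` blocks
arise (`sum_blocks_le`). Gaps of length `2 * b * M`, where `M` is at least the stretch, separate the
blocks. Hence colours with a common element have distance at most `2 * b` (`exists_near_of_common`),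
all other pairs of colours that are queried have distance more than `2 * b * M`
(`exists_common_of_near`), and the oracle tells the two cases apart.

A positive answer has to be verified, because it may come from a spurious pair. Buckets can be
unbalanced; therefore they are split into at most `2 * R` slots of at most `B = n / R + 1` elements,
and each slot gets a colour of its own. Verifying a query scans one slot and looks up the possible
partners by hash value. A query that fails the verification contains a spurious pair, and different
queries contain different ones, so all failures together cost `O(B)` per spurious pair; after the
first success nothing more is verified (`run_cCheck`).

With `g = k / D` slightly below `γ`, the parameters are about `R = n ^ g` and `S = n ^ (1 - g + 1 /
D)`. The array has size about `n * S = n ^ (2 - g + 1 / D)`, there are about `n ^ (1 + g)` queries,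
and the work outside of the oracle is `O(n ^ (2 - δ))` for some `δ > 0` (`exists_reduction`). As `N
≥ (n / 2) ^ (2 - γ)` up to rounding in the chosen scale, the number of queries is `O(N ^ ((1 + γ) /
(2 - γ)))`, and a fast oracle contradicts the conjecture. For a bound at all large `N`, one takes
the largest instance, up to constants, whose array fits into size `N` and uses monotonicity.

The remaining work is to carry this out on the word RAM. Commands with a semantics over the natural
numbers and a clock are compiled to programs (`Cmd.exec_compile`), and a system of degrees excludes
overflow (`Cmd.ok_of_wt`). The oracle runs in renamed registers and arrays (`Exec.embed`,
`Exec.of_embed`). The algorithm itself uses only the first random word; conditioned on it, the rest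
of the tape has the original law and is left to the oracle (`lintegral_tapeMeasure`). -/

theorem Exec.det {p : Prog} {s s₁ s₂ : State w} {t₁ t₂ : ℕ} (h₁ : Exec p s t₁ s₁)
    (h₂ : Exec p s t₂ s₂) : t₁ = t₂ ∧ s₁ = s₂ := by
  induction h₁ generalizing t₂ s₂ with
  | seq _ _ ih₁ ih₂ =>
    cases h₂ with
    | seq a b =>
      obtain ⟨rfl, rfl⟩ := ih₁ a
      obtain ⟨rfl, rfl⟩ := ih₂ b
      exact ⟨rfl, rfl⟩
  | ite_pos hr _ ih =>
    cases h₂ with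
    | ite_pos _ a => obtain ⟨rfl, rfl⟩ := ih a; exact ⟨rfl, rfl⟩
    | ite_neg hr' _ => exact absurd hr' hr
  | ite_neg hr _ ih =>
    cases h₂ with
    | ite_pos hr' _ => exact absurd hr hr'
    | ite_neg _ a => obtain ⟨rfl, rfl⟩ := ih a; exact ⟨rfl, rfl⟩
  | loop_pos hr _ _ ih₁ ih₂ =>
    cases h₂ with
    | loop_pos _ a b =>
      obtain ⟨rfl, rfl⟩ := ih₁ a
      obtain ⟨rfl, rfl⟩ := ih₂ b
      exact ⟨rfl, rfl⟩
    | loop_neg hr' => exact absurd hr' hr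
  | loop_neg hr =>
    cases h₂ with
    | loop_pos hr' _ _ => exact absurd hr hr'
    | loop_neg _ => exact ⟨rfl, rfl⟩
  | _ => cases h₂; exact ⟨rfl, rfl⟩

/-- Rename the registers `r` of a program to `3 * r + 2` and its arrays `a` to `2 * a + 1`. -/
def Prog.embed : Prog → Prog
  | .skip => .skip
  | .const r k => .const (3 * r + 2) k
  | .wordLength r => .wordLength (3 * r + 2)
  | .op o r s t => .op o (3 * r + 2) (3 * s + 2) (3 * t + 2)
  | .load r a s => .load (3 * r + 2) (2 * a + 1) (3 * s + 2)
  | .store a s t => .store (2 * a + 1) (3 * s + 2) (3 * t + 2)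
  | .rand r => .rand (3 * r + 2)
  | .seq p q => .seq p.embed q.embed
  | .ite r p q => .ite (3 * r + 2) p.embed q.embed
  | .loop r p => .loop (3 * r + 2) p.embed

/-- The part of a state that an embedded program sees. -/
def State.proj (s : State w) : State w where
  reg := fun r => s.reg (3 * r + 2)
  mem := fun a => s.mem (2 * a + 1)
  tape := s.tape

/-- Two states agree outside of the registers and arrays of embedded programs. -/
def SameOutside (s s' : State w) : Prop :=
  (∀ r, r % 3 ≠ 2 → s'.reg r = s.reg r) ∧ ∀ a, a % 2 ≠ 1 → s'.mem a = s.mem a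

theorem SameOutside.refl (s : State w) : SameOutside s s := ⟨fun _ _ => rfl, fun _ _ => rfl⟩

theorem SameOutside.trans {s₁ s₂ s₃ : State w} (h : SameOutside s₁ s₂) (h' : SameOutside s₂ s₃) :
    SameOutside s₁ s₃ :=
  ⟨fun r hr => (h'.1 r hr).trans (h.1 r hr), fun a ha => (h'.2 a ha).trans (h.2 a ha)⟩

theorem State.proj_setReg (s : State w) (r : ℕ) (x : BitVec w) :
    (s.setReg (3 * r + 2) x).proj = s.proj.setReg r x := by
  simp only [State.proj, State.setReg, State.mk.injEq, and_true]
  funext i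
  simp [Function.update_apply]

theorem State.proj_setMem (s : State w) (a : ℕ) (i x : BitVec w) :
    (s.setMem (2 * a + 1) i x).proj = s.proj.setMem a i x := by
  simp only [State.proj, State.setMem, State.mk.injEq, and_true, true_and]
  funext j
  simp only [Function.update_apply]
  by_cases h : j = a <;> simp [h]

theorem sameOutside_setReg (s : State w) (r : ℕ) (x : BitVec w) :
    SameOutside s (s.setReg (3 * r + 2) x) := by
  refine ⟨fun r' hr => ?_, fun _ _ => rfl⟩
  simp only [State.setReg, Function.update_apply]
  rw [if_neg (by rintro rfl; omega)]

theorem sameOutside_setMem (s : State w) (a : ℕ) (i x : BitVec w) :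
    SameOutside s (s.setMem (2 * a + 1) i x) := by
  refine ⟨fun _ _ => rfl, fun a' ha => ?_⟩
  simp only [State.setMem, Function.update_apply]
  rw [if_neg (by rintro rfl; omega)]

/-- The renaming is injective, and each instruction reads and writes renamed objects only, so a run
can be copied step by step with the same number of steps. The last clause protects the data of the
surrounding algorithm. -/
theorem Exec.embed {p : Prog} {s s₁ : State w} {t : ℕ} (h : Exec p s t s₁) :
    ∀ S : State w, S.proj = s →
      ∃ S₁, Exec p.embed S t S₁ ∧ S₁.proj = s₁ ∧ SameOutside S S₁ := by
  induction h with
  | skip s => exact fun S hS => ⟨S, .skip S, hS, .refl S⟩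
  | const r k s =>
    rintro S rfl
    exact ⟨_, .const _ _ S, S.proj_setReg _ _, sameOutside_setReg _ _ _⟩
  | wordLength r s =>
    rintro S rfl
    exact ⟨_, .wordLength _ S, S.proj_setReg _ _, sameOutside_setReg _ _ _⟩
  | op o r i j s =>
    rintro S rfl
    exact ⟨_, .op _ _ _ _ S, S.proj_setReg _ _, sameOutside_setReg _ _ _⟩
  | load r a i s =>
    rintro S rfl
    exact ⟨_, .load _ _ _ S, S.proj_setReg _ _, sameOutside_setReg _ _ _⟩
  | store a i j s =>
    rintro S rfl
    exact ⟨_, .store _ _ _ S, S.proj_setMem _ _ _, sameOutside_setMem _ _ _ _⟩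
  | rand r s =>
    rintro S rfl
    exact ⟨_, .rand _ S, State.proj_setReg _ _ _, sameOutside_setReg { S with tape := _ } _ _⟩
  | seq _ _ ih₁ ih₂ =>
    intro S hS
    obtain ⟨S₁, e₁, h₁, o₁⟩ := ih₁ S hS
    obtain ⟨S₂, e₂, h₂, o₂⟩ := ih₂ S₁ h₁
    exact ⟨S₂, .seq e₁ e₂, h₂, o₁.trans o₂⟩
  | ite_pos hr _ ih =>
    rintro S rfl
    obtain ⟨S₁, e₁, h₁, o₁⟩ := ih S rfl
    exact ⟨S₁, .ite_pos hr e₁, h₁, o₁⟩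
  | ite_neg hr _ ih =>
    rintro S rfl
    obtain ⟨S₁, e₁, h₁, o₁⟩ := ih S rfl
    exact ⟨S₁, .ite_neg hr e₁, h₁, o₁⟩
  | loop_pos hr _ _ ih₁ ih₂ =>
    rintro S rfl
    obtain ⟨S₁, e₁, h₁, o₁⟩ := ih₁ S rfl
    obtain ⟨S₂, e₂, h₂, o₂⟩ := ih₂ S₁ h₁
    exact ⟨S₂, .loop_pos hr e₁ e₂, h₂, o₁.trans o₂⟩
  | loop_neg hr =>
    rintro S rfl
    exact ⟨S, .loop_neg hr, rfl, .refl S⟩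

/-- The converse direction is needed for correctness: the guarantee of the oracle concerns its own
halting runs, and these have to be extracted from a halting run of the whole algorithm. -/
theorem Exec.of_embed {q : Prog} {S S₁ : State w} {t : ℕ} (h : Exec q S t S₁) :
    ∀ p : Prog, q = p.embed → Exec p S.proj t S₁.proj := by
  induction h with
  | seq _ _ ih₁ ih₂ =>
    intro p hp
    cases p <;> simp only [Prog.embed, reduceCtorEq, Prog.seq.injEq] at hp
    exact .seq (ih₁ _ hp.1) (ih₂ _ hp.2)
  | ite_pos hr _ ih =>
    intro p hp
    cases p <;> simp only [Prog.embed, reduceCtorEq, Prog.ite.injEq] at hp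
    obtain ⟨rfl, hp, -⟩ := hp
    exact .ite_pos hr (ih _ hp)
  | ite_neg hr _ ih =>
    intro p hp
    cases p <;> simp only [Prog.embed, reduceCtorEq, Prog.ite.injEq] at hp
    obtain ⟨rfl, -, hp⟩ := hp
    exact .ite_neg hr (ih _ hp)
  | loop_pos hr _ _ ih₁ ih₂ =>
    intro p hp
    cases p <;> simp only [Prog.embed, reduceCtorEq, Prog.loop.injEq] at hp
    obtain ⟨rfl, rfl⟩ := hp
    exact .loop_pos hr (ih₁ _ rfl) (ih₂ (.loop _ _) rfl)
  | loop_neg hr =>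
    intro p hp
    cases p <;> simp only [Prog.embed, reduceCtorEq, Prog.loop.injEq] at hp
    obtain ⟨rfl, rfl⟩ := hp
    exact .loop_neg hr
  | skip s =>
    intro p hp
    cases p <;> simp only [Prog.embed, reduceCtorEq] at hp
    exact .skip _
  | const r k s =>
    intro p hp
    cases p <;> simp only [Prog.embed, reduceCtorEq, Prog.const.injEq] at hp
    obtain ⟨rfl, rfl⟩ := hp
    rw [State.proj_setReg]; exact .const _ _ _
  | wordLength r s =>
    intro p hp
    cases p <;> simp only [Prog.embed, reduceCtorEq, Prog.wordLength.injEq] at hp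
    obtain rfl := hp
    rw [State.proj_setReg]; exact .wordLength _ _
  | op o r i j s =>
    intro p hp
    cases p <;> simp only [Prog.embed, reduceCtorEq, Prog.op.injEq] at hp
    obtain ⟨rfl, rfl, rfl, rfl⟩ := hp
    rw [State.proj_setReg]; exact .op _ _ _ _ _
  | load r a i s =>
    intro p hp
    cases p <;> simp only [Prog.embed, reduceCtorEq, Prog.load.injEq] at hp
    obtain ⟨rfl, rfl, rfl⟩ := hp
    rw [State.proj_setReg]; exact .load _ _ _ _
  | store a i j s =>
    intro p hp
    cases p <;> simp only [Prog.embed, reduceCtorEq, Prog.store.injEq] at hp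
    obtain ⟨rfl, rfl, rfl⟩ := hp
    rw [State.proj_setMem]; exact .store _ _ _ _
  | rand r s =>
    intro p hp
    cases p <;> simp only [Prog.embed, reduceCtorEq, Prog.rand.injEq] at hp
    obtain rfl := hp
    rw [State.proj_setReg]; exact .rand _ s.proj

end WordRAM

/-! ### A structured language with a clock and its compilation -/

namespace Imp

open WordRAM

/-- An abstract machine state: variables, arrays and a clock. -/
structure Env where
  v : ℕ → ℕ
  a : ℕ → ℕ → ℕ
  t : ℕ

/-- Binary operations; `addw`, `mulw` and `subw` are modulo `2 ^ w`. -/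
inductive Bop
  | add | mul | addw | mulw | subw | div | mod | shl | shr | eq | lt

def Bop.toOp : Bop → Op
  | .add => .add
  | .mul => .mul
  | .addw => .add
  | .mulw => .mul
  | .subw => .sub
  | .div => .div
  | .mod => .mod
  | .shl => .shl
  | .shr => .shr
  | .eq => .eq
  | .lt => .lt

def Bop.eval (w : ℕ) : Bop → ℕ → ℕ → ℕ
  | .add, x, y => x + y
  | .mul, x, y => x * y
  | .addw, x, y => (x + y) % 2 ^ w
  | .mulw, x, y => (x * y) % 2 ^ w
  | .subw, x, y => (2 ^ w - y + x) % 2 ^ w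
  | .div, x, y => x / y
  | .mod, x, y => x % y
  | .shl, x, y => (x * 2 ^ y) % 2 ^ w
  | .shr, x, y => x / 2 ^ y
  | .eq, x, y => if x = y then 1 else 0
  | .lt, x, y => if x < y then 1 else 0

/-- Exact `add` and `mul` are honest operations on natural numbers and agree with the machine only
under this condition. The wrapping versions serve where words are arbitrary. -/
def Bop.ok (w : ℕ) : Bop → ℕ → ℕ → Prop
  | .add, x, y => x + y < 2 ^ w
  | .mul, x, y => x * y < 2 ^ w
  | _, _, _ => True

/-- Expressions. -/
inductive Expr
  | lit (k : ℕ)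
  | var (v : ℕ)
  | wlen
  | get (a : ℕ) (e : Expr)
  | bin (o : Bop) (e₁ e₂ : Expr)

instance : Add Expr := ⟨.bin .add⟩
instance : Mul Expr := ⟨.bin .mul⟩
instance : Div Expr := ⟨.bin .div⟩
instance : Mod Expr := ⟨.bin .mod⟩

def Expr.eval (w : ℕ) (σ : Env) : Expr → ℕ
  | .lit k => k
  | .var v => σ.v v
  | .wlen => w
  | .get a e => σ.a a (e.eval w σ)
  | .bin o e₁ e₂ => o.eval w (e₁.eval w σ) (e₂.eval w σ)

def Expr.ok (w : ℕ) (σ : Env) : Expr → Prop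
  | .lit k => k < 2 ^ w
  | .var _ => True
  | .wlen => True
  | .get _ e => e.ok w σ
  | .bin o e₁ e₂ => e₁.ok w σ ∧ e₂.ok w σ ∧ o.ok w (e₁.eval w σ) (e₂.eval w σ)

def Expr.cost : Expr → ℕ
  | .lit _ => 1
  | .var _ => 1
  | .wlen => 1
  | .get _ e => e.cost + 1
  | .bin _ e₁ e₂ => e₁.cost + (e₂.cost + 1)

/-- Commands. `rep v e c` evaluates `e` once and runs `c` with `v = 0, 1, …` below this bound. -/
inductive Cmd
  | skip
  | set (v : ℕ) (e : Expr)
  | put (a : ℕ) (i e : Expr)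
  | seq (c d : Cmd)
  | ite (e : Expr) (c d : Cmd)
  | rep (v : ℕ) (e : Expr) (c : Cmd)

def Env.tick (σ : Env) (k : ℕ) : Env := { σ with t := σ.t + k }
def Env.setV (σ : Env) (r x : ℕ) : Env := { σ with v := Function.update σ.v r x }
def Env.setA (σ : Env) (a i x : ℕ) : Env :=
  { σ with a := Function.update σ.a a (Function.update (σ.a a) i x) }

/-- Run `f` with `v = 0, …, n - 1`. -/
def iter (f : Env → Env) (r : ℕ) : ℕ → Env → Env
  | 0, σ => σ
  | n + 1, σ => (f ((iter f r n σ).setV r n)).tick 5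

/-- The ticks are the step counts of the compiled code. A round of a loop has five steps besides its
body: the loop test, the copy of the counter, the constant `1`, the increment and the comparison.
Entering and leaving the loop adds three: the initial counter, the first comparison and the last
test. -/
def run (w : ℕ) : Cmd → Env → Env
  | .skip, σ => σ.tick 1
  | .set r e, σ => (σ.setV r (e.eval w σ)).tick (e.cost + 1)
  | .put a i e, σ => (σ.setA a (i.eval w σ) (e.eval w σ)).tick (i.cost + (e.cost + 1))
  | .seq c d, σ => run w d (run w c σ)
  | .ite e c d, σ =>
      if e.eval w σ ≠ 0 then run w c (σ.tick (e.cost + 1)) else run w d (σ.tick (e.cost + 1))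
  | .rep r e c, σ => iter (run w c) r (e.eval w σ) (σ.tick (e.cost + 3))

/-- No overflow occurs in a run of the command. -/
def Ok (w : ℕ) : Cmd → Env → Prop
  | .skip, _ => True
  | .set _ e, σ => e.ok w σ
  | .put _ i e, σ => i.ok w σ ∧ e.ok w σ
  | .seq c d, σ => Ok w c σ ∧ Ok w d (run w c σ)
  | .ite e c d, σ => e.ok w σ ∧ if e.eval w σ ≠ 0 then Ok w c (σ.tick (e.cost + 1))
      else Ok w d (σ.tick (e.cost + 1))
  | .rep r e c, σ => e.ok w σ ∧ ∀ i < e.eval w σ,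
      Ok w c ((iter (run w c) r i (σ.tick (e.cost + 3))).setV r i)

/-! ### Compilation -/

/-- Registers are divided by residues modulo 3: `3 * v` holds variable `v`, `3 * d + 1` is temporary
number `d`, and `3 * r + 2` belongs to the embedded oracle. The argument `d` is the first temporary
that may be overwritten. Copying is done by `or` of a register with itself. -/
def Expr.compile : Expr → ℕ → Prog
  | .lit k, d => .const (3 * d + 1) k
  | .var v, d => .op .or (3 * d + 1) (3 * v) (3 * v)
  | .wlen, d => .wordLength (3 * d + 1)
  | .get a e, d => .seq (e.compile d) (.load (3 * d + 1) a (3 * d + 1))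
  | .bin o e₁ e₂, d => .seq (e₁.compile d) (.seq (e₂.compile (d + 1))
      (.op o.toOp (3 * d + 1) (3 * d + 1) (3 * (d + 1) + 1)))

/-- In a loop the temporaries `d`, `d + 1`, `d + 2` hold the bound, the counter and the loop
condition. The body is compiled at level `d + 2`; it may destroy the condition, which is recomputed,
but not the bound and the counter. The loop variable is only a copy of the counter. -/
def Cmd.compile : Cmd → ℕ → Prog
  | .skip, _ => .skip
  | .set r e, d => .seq (e.compile d) (.op .or (3 * r) (3 * d + 1) (3 * d + 1))
  | .put a i e, d => .seq (i.compile d) (.seq (e.compile (d + 1))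
      (.store a (3 * d + 1) (3 * (d + 1) + 1)))
  | .seq c c', d => .seq (c.compile d) (c'.compile d)
  | .ite e c c', d => .seq (e.compile d) (.ite (3 * d + 1) (c.compile d) (c'.compile d))
  | .rep r e c, d =>
      .seq (e.compile d) (.seq (.const (3 * (d + 1) + 1) 0)
        (.seq (.op .lt (3 * (d + 2) + 1) (3 * (d + 1) + 1) (3 * d + 1))
          (.loop (3 * (d + 2) + 1)
            (.seq (.op .or (3 * r) (3 * (d + 1) + 1) (3 * (d + 1) + 1))
              (.seq (c.compile (d + 2))
                (.seq (.const (3 * (d + 2) + 1) 1)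
                  (.seq (.op .add (3 * (d + 1) + 1) (3 * (d + 1) + 1) (3 * (d + 2) + 1))
                    (.op .lt (3 * (d + 2) + 1) (3 * (d + 1) + 1) (3 * d + 1)))))))))

variable {w : ℕ}

/-- The machine state `s` represents the abstract state `σ`. -/
structure Rel (σ : Env) (s : State w) : Prop where
  reg : ∀ v, (s.reg (3 * v)).toNat = σ.v v
  mem : ∀ a (i : BitVec w), (s.mem a i).toNat = σ.a a i.toNat

/-- The hidden registers below `d`, the registers of embedded programs and the tape agree. -/
structure Keeps (d : ℕ) (s s' : State w) : Prop where
  hid : ∀ k < d, s'.reg (3 * k + 1) = s.reg (3 * k + 1)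
  emb : ∀ k, s'.reg (3 * k + 2) = s.reg (3 * k + 2)
  tape : s'.tape = s.tape

theorem Keeps.refl (d : ℕ) (s : State w) : Keeps d s s := ⟨fun _ _ => rfl, fun _ => rfl, rfl⟩

theorem Keeps.trans {d : ℕ} {s₁ s₂ s₃ : State w} (h : Keeps d s₁ s₂) (h' : Keeps d s₂ s₃) :
    Keeps d s₁ s₃ :=
  ⟨fun k hk => (h'.hid k hk).trans (h.hid k hk), fun k => (h'.emb k).trans (h.emb k),
    h'.tape.trans h.tape⟩

theorem Keeps.mono {d d' : ℕ} {s s' : State w} (h : Keeps d s s') (hd : d' ≤ d) : Keeps d' s s' :=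
  ⟨fun k hk => h.hid k (hk.trans_le hd), h.emb, h.tape⟩

theorem keeps_setReg_hidden (s : State w) (d k : ℕ) (x : BitVec w) (h : d ≤ k) :
    Keeps d s (s.setReg (3 * k + 1) x) := by
  refine ⟨fun j hj => ?_, fun j => ?_, rfl⟩ <;>
  · simp only [State.setReg, Function.update_apply]
    rw [if_neg (by omega)]

theorem keeps_setReg_var (s : State w) (d k : ℕ) (x : BitVec w) :
    Keeps d s (s.setReg (3 * k) x) := by
  refine ⟨fun j hj => ?_, fun j => ?_, rfl⟩ <;>
  · simp only [State.setReg, Function.update_apply]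
    rw [if_neg (by omega)]

theorem Rel.setReg_hidden {σ : Env} {s : State w} (h : Rel σ s) (k : ℕ) (x : BitVec w) :
    Rel σ (s.setReg (3 * k + 1) x) := by
  refine ⟨fun v => ?_, h.mem⟩
  simp only [State.setReg, Function.update_apply]
  rw [if_neg (by omega)]
  exact h.reg v

theorem Rel.setReg_var {σ : Env} {s : State w} (h : Rel σ s) (k : ℕ) (x : BitVec w) {n : ℕ}
    (hx : x.toNat = n) : Rel (σ.setV k n) (s.setReg (3 * k) x) := by
  refine ⟨fun v => ?_, h.mem⟩
  simp only [State.setReg, Env.setV, Function.update_apply]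
  by_cases hv : v = k
  · simp [hv, hx]
  · rw [if_neg (by omega), if_neg hv]
    exact h.reg v

theorem Rel.setMem {σ : Env} {s : State w} (h : Rel σ s) (a : ℕ) (i x : BitVec w) {m n : ℕ}
    (hi : i.toNat = m) (hx : x.toNat = n) : Rel (σ.setA a m n) (s.setMem a i x) := by
  refine ⟨h.reg, fun b j => ?_⟩
  simp only [State.setMem, Env.setA, Function.update_apply]
  by_cases hb : b = a
  · subst hb
    by_cases hj : j = i
    · simp [hj, hi, hx]
    · have : j.toNat ≠ m := fun h' => hj (BitVec.eq_of_toNat_eq (h'.trans hi.symm))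
      simp [hj, this, h.mem]
  · simp [hb, h.mem]

theorem Rel.tick {σ : Env} {s : State w} (h : Rel σ s) (k : ℕ) : Rel (σ.tick k) s :=
  ⟨h.reg, h.mem⟩

theorem reg_setReg_self (s : State w) (r : ℕ) (x : BitVec w) : (s.setReg r x).reg r = x := by
  simp [State.setReg]

theorem reg_setReg_of_ne (s : State w) {r r' : ℕ} (x : BitVec w) (h : r' ≠ r) :
    (s.setReg r x).reg r' = s.reg r' := by
  simp [State.setReg, h]

theorem Op.toNat_eval_or_self (x : BitVec w) : Op.eval .or x x = x := by
  simp [Op.eval]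

theorem toNat_eval_toOp (hw : 0 < w) (o : Bop) (x y : BitVec w) (h : o.ok w x.toNat y.toNat) :
    (o.toOp.eval x y).toNat = o.eval w x.toNat y.toNat := by
  have h1 : 1 < 2 ^ w := Nat.one_lt_two_pow hw.ne'
  have hx := x.isLt
  have hy := y.isLt
  cases o <;> simp only [Bop.toOp, Op.eval, Bop.eval, Bop.ok] at h ⊢
  · rw [BitVec.toNat_add, Nat.mod_eq_of_lt h]
  · rw [BitVec.toNat_mul, Nat.mod_eq_of_lt h]
  · rw [BitVec.toNat_add]
  · rw [BitVec.toNat_mul]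
  · rw [BitVec.toNat_sub]
  · rw [BitVec.toNat_ofNat, Nat.mod_eq_of_lt ((Nat.div_le_self _ _).trans_lt hx)]
  · rw [BitVec.toNat_ofNat, Nat.mod_eq_of_lt ((Nat.mod_le _ _).trans_lt hx)]
  · rw [BitVec.toNat_shiftLeft, Nat.shiftLeft_eq]
  · rw [BitVec.toNat_ushiftRight, Nat.shiftRight_eq_div_pow]
  · split_ifs <;> simp [Nat.mod_eq_of_lt h1]
  · split_ifs <;> simp [Nat.mod_eq_of_lt h1]

/-- The value of the first operand survives the evaluation of the second one, because code at level
`d + 1` keeps temporary `d`. -/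
theorem Expr.exec_compile (hw : 0 < w) {σ : Env} (e : Expr) :
    ∀ {s : State w} (d : ℕ), Rel σ s → e.ok w σ →
      ∃ s', Exec (e.compile d) s e.cost s' ∧ Rel σ s' ∧ Keeps d s s' ∧
        (s'.reg (3 * d + 1)).toNat = e.eval w σ := by
  induction e with
  | lit k =>
    intro s d h ok
    refine ⟨_, .const _ _ s, h.setReg_hidden _ _, keeps_setReg_hidden _ _ _ _ le_rfl, ?_⟩
    rw [reg_setReg_self, BitVec.toNat_ofNat]
    exact Nat.mod_eq_of_lt ok
  | var v =>
    intro s d h ok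
    refine ⟨_, .op _ _ _ _ s, h.setReg_hidden _ _, keeps_setReg_hidden _ _ _ _ le_rfl, ?_⟩
    rw [reg_setReg_self, Op.toNat_eval_or_self]
    exact h.reg v
  | wlen =>
    intro s d h ok
    refine ⟨_, .wordLength _ s, h.setReg_hidden _ _, keeps_setReg_hidden _ _ _ _ le_rfl, ?_⟩
    rw [reg_setReg_self, BitVec.toNat_ofNat]
    exact Nat.mod_eq_of_lt Nat.lt_two_pow_self
  | get a e ih =>
    intro s d h ok
    obtain ⟨s₁, ex, h₁, k₁, v₁⟩ := ih d h ok
    refine ⟨_, .seq ex (.load _ _ _ _), h₁.setReg_hidden _ _,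
      k₁.trans (keeps_setReg_hidden _ _ _ _ le_rfl), ?_⟩
    rw [reg_setReg_self, h₁.mem, v₁]
    rfl
  | bin o e₁ e₂ ih₁ ih₂ =>
    intro s d h ok
    obtain ⟨s₁, ex₁, h₁, k₁, v₁⟩ := ih₁ d h ok.1
    obtain ⟨s₂, ex₂, h₂, k₂, v₂⟩ := ih₂ (d + 1) h₁ ok.2.1
    refine ⟨_, .seq ex₁ (.seq ex₂ (.op _ _ _ _ _)), h₂.setReg_hidden _ _,
      (k₁.trans (k₂.mono d.le_succ)).trans (keeps_setReg_hidden _ _ _ _ le_rfl), ?_⟩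
    rw [reg_setReg_self, toNat_eval_toOp hw, v₂, k₂.hid d d.lt_succ_self, v₁]
    · rfl
    · rw [v₂, k₂.hid d d.lt_succ_self, v₁]; exact ok.2.2

/-- A compiled command runs as the abstract one, in the time measured by the clock. -/
theorem Cmd.exec_compile (hw : 0 < w) (c : Cmd) :
    ∀ {σ : Env} {s : State w} (d : ℕ), Rel σ s → Ok w c σ →
      ∃ s' t, Exec (c.compile d) s t s' ∧ (run w c σ).t = σ.t + t ∧ Rel (run w c σ) s' ∧
        Keeps d s s' := by
  induction c with
  | skip => exact fun {σ s} d h _ => ⟨s, 1, .skip s, rfl, h.tick 1, .refl _ _⟩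
  | set v e =>
    intro σ s d h ok
    obtain ⟨s₁, ex, h₁, k₁, v₁⟩ := e.exec_compile hw d h ok
    refine ⟨_, _, .seq ex (.op _ _ _ _ _), rfl, (h₁.setReg_var v _ ?_).tick _,
      k₁.trans (keeps_setReg_var _ _ _ _)⟩
    rw [Op.toNat_eval_or_self, v₁]
  | put a i e =>
    intro σ s d h ok
    obtain ⟨s₁, ex₁, h₁, k₁, v₁⟩ := i.exec_compile hw d h ok.1
    obtain ⟨s₂, ex₂, h₂, k₂, v₂⟩ := e.exec_compile hw (d + 1) h₁ ok.2
    refine ⟨_, _, .seq ex₁ (.seq ex₂ (.store _ _ _ _)), rfl, (h₂.setMem a _ _ ?_ v₂).tick _,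
      (k₁.trans (k₂.mono d.le_succ)).trans ⟨fun _ _ => rfl, fun _ => rfl, rfl⟩⟩
    rw [k₂.hid d d.lt_succ_self, v₁]
  | seq c₁ c₂ ih₁ ih₂ =>
    intro σ s d h ok
    obtain ⟨s₁, t₁, ex₁, e₁, h₁, k₁⟩ := ih₁ d h ok.1
    obtain ⟨s₂, t₂, ex₂, e₂, h₂, k₂⟩ := ih₂ d h₁ ok.2
    exact ⟨s₂, t₁ + t₂, .seq ex₁ ex₂, by rw [run, e₂, e₁, add_assoc], h₂, k₁.trans k₂⟩
  | ite e c₁ c₂ ih₁ ih₂ =>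
    intro σ s d h ok
    obtain ⟨s₁, ex, h₁, k₁, v₁⟩ := e.exec_compile hw d h ok.1
    have ok₂ := ok.2
    by_cases he : e.eval w σ = 0
    · rw [if_neg (not_not.2 he)] at ok₂
      obtain ⟨s₂, t₂, ex₂, e₂, h₂, k₂⟩ := ih₂ d (h₁.tick (e.cost + 1)) ok₂
      refine ⟨s₂, _, .seq ex (.ite_neg (BitVec.eq_of_toNat_eq ?_) ex₂), ?_, ?_, k₁.trans k₂⟩
      · rw [v₁, he]; simp
      · rw [run, if_neg (not_not.2 he), e₂, Env.tick]; ring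
      · rwa [run, if_neg (not_not.2 he)]
    · rw [if_pos he] at ok₂
      obtain ⟨s₂, t₂, ex₂, e₂, h₂, k₂⟩ := ih₁ d (h₁.tick (e.cost + 1)) ok₂
      refine ⟨s₂, _, .seq ex (.ite_pos (fun h0 => he ?_) ex₂), ?_, ?_, k₁.trans k₂⟩
      · rw [← v₁, h0]; simp
      · rw [run, if_pos he, e₂, Env.tick]; ring
      · rwa [run, if_pos he]
  | rep r e c ih =>
    intro σ s d h ok
    obtain ⟨s₁, ex, h₁, k₁, v₁⟩ := e.exec_compile hw d h ok.1
    set n := e.eval w σ with hn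
    set τ : ℕ → Env := fun i => iter (run w c) r i (σ.tick (e.cost + 3)) with hτ
    have hnw : n < 2 ^ w := by rw [← v₁]; exact (s₁.reg (3 * d + 1)).isLt
    have h1w : 1 < 2 ^ w := Nat.one_lt_two_pow hw.ne'
    -- the loop, run from a state in which the counter is `n - j`
    have key : ∀ j ≤ n, ∀ s₂ : State w, Rel (τ (n - j)) s₂ → (s₂.reg (3 * d + 1)).toNat = n →
        (s₂.reg (3 * (d + 1) + 1)).toNat = n - j →
        (s₂.reg (3 * (d + 2) + 1) ≠ 0 ↔ 0 < j) →
        ∃ s₃ t, Exec (.loop (3 * (d + 2) + 1)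
            (.seq (.op .or (3 * r) (3 * (d + 1) + 1) (3 * (d + 1) + 1))
              (.seq (c.compile (d + 2))
                (.seq (.const (3 * (d + 2) + 1) 1)
                  (.seq (.op .add (3 * (d + 1) + 1) (3 * (d + 1) + 1) (3 * (d + 2) + 1))
                    (.op .lt (3 * (d + 2) + 1) (3 * (d + 1) + 1) (3 * d + 1))))))) s₂ (t + 1) s₃ ∧
          (τ n).t = (τ (n - j)).t + t ∧ Rel (τ n) s₃ ∧ Keeps d s₂ s₃ := by
      intro j
      induction j with
      | zero =>
        intro _ s₂ hs₂ _ _ hc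
        refine ⟨s₂, 0, .loop_neg (by simpa using hc), rfl, hs₂, .refl _ _⟩
      | succ j ihj =>
        intro hj s₂ hs₂ hb hi hc
        have hlt : n - (j + 1) < n := by omega
        have hs₃ := hs₂.setReg_var (n := n - (j + 1)) r (Op.eval .or (s₂.reg (3 * (d + 1) + 1))
          (s₂.reg (3 * (d + 1) + 1))) (by rw [Op.toNat_eval_or_self, hi])
        set s₃ := s₂.setReg (3 * r) (Op.eval .or (s₂.reg (3 * (d + 1) + 1))
          (s₂.reg (3 * (d + 1) + 1)))
        have k₃ : Keeps (d + 2) s₂ s₃ := keeps_setReg_var _ _ _ _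
        obtain ⟨s₄, t₄, ex₄, e₄, h₄, k₄⟩ := ih (d + 2) hs₃ (ok.2 _ hlt)
        have k₂₄ := k₃.trans k₄
        set s₅ := s₄.setReg (3 * (d + 2) + 1) (BitVec.ofNat w 1) with hs₅
        set s₆ := s₅.setReg (3 * (d + 1) + 1) (Op.eval .add (s₅.reg (3 * (d + 1) + 1))
          (s₅.reg (3 * (d + 2) + 1))) with hs₆
        set s₇ := s₆.setReg (3 * (d + 2) + 1) (Op.eval .lt (s₆.reg (3 * (d + 1) + 1))
          (s₆.reg (3 * d + 1))) with hs₇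
        have k₇ : Keeps d s₂ s₇ := (k₂₄.mono (by omega)).trans
          (((keeps_setReg_hidden _ _ _ _ (by omega)).trans
            (keeps_setReg_hidden _ _ _ _ (by omega))).trans
            (keeps_setReg_hidden _ _ _ _ (by omega)))
        have b₆ : (s₆.reg (3 * d + 1)).toNat = n := by
          rw [hs₆, reg_setReg_of_ne _ _ (by omega), hs₅, reg_setReg_of_ne _ _ (by omega),
            k₂₄.hid d (by omega), hb]
        have i₆ : (s₆.reg (3 * (d + 1) + 1)).toNat = n - j := by
          rw [hs₆, reg_setReg_self]
          have := toNat_eval_toOp hw .add (s₅.reg (3 * (d + 1) + 1)) (s₅.reg (3 * (d + 2) + 1))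
          have e1 : (s₅.reg (3 * (d + 1) + 1)).toNat = n - (j + 1) := by
            rw [hs₅, reg_setReg_of_ne _ _ (by omega), k₂₄.hid (d + 1) (by omega), hi]
          have e2 : (s₅.reg (3 * (d + 2) + 1)).toNat = 1 := by
            rw [hs₅, reg_setReg_self, BitVec.toNat_ofNat, Nat.mod_eq_of_lt h1w]
          rw [e1, e2] at this
          simp only [Bop.ok, Bop.eval, Bop.toOp] at this
          rw [this (by omega)]
          omega
        have hrel₇ : Rel (τ (n - j)) s₇ := by
          have : n - j = (n - (j + 1)) + 1 := by omega
          rw [this]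
          exact (((h₄.setReg_hidden _ _).setReg_hidden _ _).setReg_hidden _ _).tick 5
        have hτt : (τ (n - j)).t = (τ (n - (j + 1))).t + t₄ + 5 := by
          have : n - j = (n - (j + 1)) + 1 := by omega
          rw [this]
          change (run w c _).t + 5 = _
          rw [e₄]
          rfl
        obtain ⟨s₈, t₈, ex₈, e₈, h₈, k₈⟩ := ihj (by omega) s₇ hrel₇
          (by rw [hs₇, reg_setReg_of_ne _ _ (by omega), b₆])
          (by rw [hs₇, reg_setReg_of_ne _ _ (by omega), i₆])
          (by
            rw [hs₇, reg_setReg_self, Op.eval, i₆, b₆]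
            by_cases hj0 : j = 0
            · simp [hj0]
            · rw [if_pos (by omega)]
              refine ⟨fun _ => by omega, fun _ h0 => ?_⟩
              have := congrArg BitVec.toNat h0
              simp [Nat.mod_eq_of_lt h1w] at this)
        refine ⟨s₈, t₄ + 5 + t₈, ?_, ?_, h₈, k₇.trans k₈⟩
        · have := Exec.loop_pos (hc.2 (by omega))
            (.seq (.op .or (3 * r) (3 * (d + 1) + 1) (3 * (d + 1) + 1) s₂) (.seq ex₄
              (.seq (.const (3 * (d + 2) + 1) 1 s₄) (.seq (.op .add _ _ _ s₅)
                (.op .lt _ _ _ s₆))))) ex₈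
          convert this using 1
          ring
        · rw [e₈, hτt]; ring
    set s₂ := s₁.setReg (3 * (d + 1) + 1) (BitVec.ofNat w 0) with hs₂
    set s₃ := s₂.setReg (3 * (d + 2) + 1) (Op.eval .lt (s₂.reg (3 * (d + 1) + 1))
      (s₂.reg (3 * d + 1))) with hs₃
    have b₂ : (s₂.reg (3 * d + 1)).toNat = n := by
      rw [hs₂, reg_setReg_of_ne _ _ (by omega), v₁]
    have i₂ : (s₂.reg (3 * (d + 1) + 1)).toNat = 0 := by
      rw [hs₂, reg_setReg_self]; simp
    obtain ⟨s₄, t₄, ex₄, e₄, h₄, k₄⟩ := key n le_rfl s₃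
      (by
        rw [Nat.sub_self]
        exact ((h₁.setReg_hidden _ _).setReg_hidden _ _).tick _)
      (by rw [hs₃, reg_setReg_of_ne _ _ (by omega), b₂])
      (by rw [hs₃, reg_setReg_of_ne _ _ (by omega), i₂, Nat.sub_self])
      (by
        rw [hs₃, reg_setReg_self, Op.eval, i₂, b₂]
        by_cases hj0 : n = 0
        · simp [hj0]
        · rw [if_pos (by omega)]
          refine ⟨fun _ => by omega, fun _ h0 => ?_⟩
          have := congrArg BitVec.toNat h0
          simp [Nat.mod_eq_of_lt h1w] at this)
    refine ⟨s₄, _, .seq ex (.seq (.const _ _ _) (.seq (.op _ _ _ _ _) ex₄)), ?_, h₄,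
      k₁.trans (((keeps_setReg_hidden _ _ _ _ (by omega)).trans
        (keeps_setReg_hidden _ _ _ _ (by omega))).trans k₄)⟩
    change (τ n).t = _
    rw [e₄, Nat.sub_self]
    simp only [hτ, iter, Env.tick]
    ring

end Imp

namespace Imp

/-! ### Degrees: a type system that excludes overflow -/

/-- Degrees of variables and arrays: an object of degree `d < 30` holds numbers below `V ^ d`, other
objects hold arbitrary words. The variables in `pos` are positive and constant. -/
structure Ty where
  v : ℕ → ℕ
  a : ℕ → ℕ
  pos : ℕ → Bool

def bnd (V w d : ℕ) : ℕ := if d < 30 then V ^ d else 2 ^ w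

structure Bounded (Γ : Ty) (V w : ℕ) (σ : Env) : Prop where
  v : ∀ r, σ.v r < bnd V w (Γ.v r)
  a : ∀ a i, σ.a a i < bnd V w (Γ.a a)
  pos : ∀ r, Γ.pos r = true → 0 < σ.v r

def Expr.posVar (Γ : Ty) : Expr → Bool
  | .var r => Γ.pos r
  | _ => false

/-- A sum gains one degree because `V ≥ 2`. A remainder by a variable known to be positive has at
most the degree of the divisor; in this way counters in loops, which have no bound visible to the
types, are given one. -/
def Expr.deg (Γ : Ty) : Expr → ℕ
  | .lit _ => 1
  | .var r => Γ.v r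
  | .wlen => 30
  | .get a _ => Γ.a a
  | .bin .add e₁ e₂ => max (e₁.deg Γ) (e₂.deg Γ) + 1
  | .bin .mul e₁ e₂ => e₁.deg Γ + e₂.deg Γ
  | .bin .div e₁ _ => e₁.deg Γ
  | .bin .shr e₁ _ => e₁.deg Γ
  | .bin .mod e₁ e₂ => if e₂.posVar Γ then min (e₁.deg Γ) (e₂.deg Γ) else e₁.deg Γ
  | .bin .eq _ _ => 1
  | .bin .lt _ _ => 1
  | .bin .addw _ _ => 30
  | .bin .mulw _ _ => 30
  | .bin .subw _ _ => 30
  | .bin .shl _ _ => 30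

def Bop.strict : Bop → Bool
  | .add => true
  | .mul => true
  | _ => false

/-- Only exact additions and multiplications can overflow, so only these must stay below degree 30.
-/
def Expr.wt (Γ : Ty) : Expr → Bool
  | .get _ e => e.wt Γ
  | .bin o e₁ e₂ => e₁.wt Γ && e₂.wt Γ &&
      (!o.strict || decide ((Expr.bin o e₁ e₂).deg Γ < 30))
  | _ => true

def Expr.litsBelow (V : ℕ) : Expr → Prop
  | .lit k => k < V
  | .get _ e => e.litsBelow V
  | .bin _ e₁ e₂ => e₁.litsBelow V ∧ e₂.litsBelow V
  | _ => True

def Cmd.wt (Γ : Ty) : Cmd → Bool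
  | .skip => true
  | .set r e => e.wt Γ && decide (e.deg Γ ≤ Γ.v r) && !Γ.pos r
  | .put a i e => i.wt Γ && e.wt Γ && decide (e.deg Γ ≤ Γ.a a)
  | .seq c d => c.wt Γ && d.wt Γ
  | .ite e c d => e.wt Γ && c.wt Γ && d.wt Γ
  | .rep r e c => e.wt Γ && decide (e.deg Γ ≤ Γ.v r) && !Γ.pos r && c.wt Γ

def Cmd.litsBelow (V : ℕ) : Cmd → Prop
  | .skip => True
  | .set _ e => e.litsBelow V
  | .put _ i e => i.litsBelow V ∧ e.litsBelow V
  | .seq c d => c.litsBelow V ∧ d.litsBelow V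
  | .ite e c d => e.litsBelow V ∧ c.litsBelow V ∧ d.litsBelow V
  | .rep _ e c => e.litsBelow V ∧ c.litsBelow V

variable {Γ : Ty} {V w : ℕ}

theorem bnd_mono (hV : 2 ≤ V) (hVw : V ^ 30 ≤ 2 ^ w) {d d' : ℕ} (h : d ≤ d') :
    bnd V w d ≤ bnd V w d' := by
  unfold bnd
  split_ifs with h₁ h₂ h₂
  · exact Nat.pow_le_pow_right (by omega) h
  · exact (Nat.pow_le_pow_right (by omega) h₁.le).trans hVw
  · omega
  · exact le_rfl

theorem bnd_le (hV : 2 ≤ V) (hVw : V ^ 30 ≤ 2 ^ w) (d : ℕ) : bnd V w d ≤ 2 ^ w := by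
  unfold bnd
  split_ifs with h₁
  · exact (Nat.pow_le_pow_right (by omega) h₁.le).trans hVw
  · exact le_rfl

theorem Expr.eval_lt (hV : 2 ≤ V) (hVw : V ^ 30 ≤ 2 ^ w) {σ : Env} (hσ : Bounded Γ V w σ)
    (e : Expr) : e.wt Γ = true → e.litsBelow V →
      e.eval w σ < bnd V w (e.deg Γ) ∧ e.ok w σ := by
  have h2w : 0 < 2 ^ w := by positivity
  have h1V : bnd V w 1 = V := by simp [bnd]
  have hVw' : V ≤ 2 ^ w := by rw [← h1V]; exact bnd_le hV hVw 1
  have h30 : bnd V w 30 = 2 ^ w := by simp [bnd]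
  induction e with
  | lit k => exact fun _ h => ⟨by rw [Expr.deg, h1V]; exact h, lt_of_lt_of_le h hVw'⟩
  | var v => exact fun _ _ => ⟨hσ.v v, trivial⟩
  | wlen => exact fun _ _ => ⟨by simpa [Expr.deg, h30, Expr.eval] using Nat.lt_two_pow_self, trivial⟩
  | get a e ih => exact fun h h' => ⟨hσ.a _ _, (ih h h').2⟩
  | bin o e₁ e₂ ih₁ ih₂ =>
    intro h h'
    rw [Expr.wt, Bool.and_eq_true, Bool.and_eq_true, Bool.or_eq_true, Bool.not_eq_true',
      decide_eq_true_iff] at h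
    obtain ⟨⟨hw₁, hw₂⟩, hs⟩ := h
    obtain ⟨l₁, ok₁⟩ := ih₁ hw₁ h'.1
    obtain ⟨l₂, ok₂⟩ := ih₂ hw₂ h'.2
    have hmod : ∀ x : ℕ, x % 2 ^ w < bnd V w 30 := fun x => by rw [h30]; exact Nat.mod_lt _ h2w
    have hone : ∀ p : Prop, ∀ [Decidable p], (if p then 1 else 0) < bnd V w 1 := fun p _ => by
      rw [h1V]; split_ifs <;> omega
    simp only [Expr.eval, Expr.ok]
    cases o with
    | add =>
      have hd : max (e₁.deg Γ) (e₂.deg Γ) + 1 < 30 := by simpa [Bop.strict, Expr.deg] using hs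
      have key : e₁.eval w σ + e₂.eval w σ < bnd V w (max (e₁.deg Γ) (e₂.deg Γ) + 1) := by
        have m₁ := lt_of_lt_of_le l₁ (bnd_mono hV hVw (le_max_left (e₁.deg Γ) (e₂.deg Γ)))
        have m₂ := lt_of_lt_of_le l₂ (bnd_mono hV hVw (le_max_right (e₁.deg Γ) (e₂.deg Γ)))
        rw [bnd, if_pos (by omega)] at m₁ m₂
        rw [bnd, if_pos hd, pow_succ]
        nlinarith [Nat.one_le_pow (max (e₁.deg Γ) (e₂.deg Γ)) V (by omega)]
      exact ⟨key, ok₁, ok₂, lt_of_lt_of_le key (bnd_le hV hVw _)⟩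
    | mul =>
      have hd : e₁.deg Γ + e₂.deg Γ < 30 := by simpa [Bop.strict, Expr.deg] using hs
      have key : e₁.eval w σ * e₂.eval w σ < bnd V w (e₁.deg Γ + e₂.deg Γ) := by
        rw [bnd, if_pos (by omega)] at l₁ l₂
        rw [bnd, if_pos hd, pow_add]
        exact Nat.mul_lt_mul'' l₁ l₂
      exact ⟨key, ok₁, ok₂, lt_of_lt_of_le key (bnd_le hV hVw _)⟩
    | addw => exact ⟨hmod _, ok₁, ok₂, trivial⟩
    | mulw => exact ⟨hmod _, ok₁, ok₂, trivial⟩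
    | subw => exact ⟨hmod _, ok₁, ok₂, trivial⟩
    | shl => exact ⟨hmod _, ok₁, ok₂, trivial⟩
    | div => exact ⟨(Nat.div_le_self _ _).trans_lt l₁, ok₁, ok₂, trivial⟩
    | shr => exact ⟨(Nat.div_le_self _ _).trans_lt l₁, ok₁, ok₂, trivial⟩
    | mod =>
      refine ⟨?_, ok₁, ok₂, trivial⟩
      have m₁ := (Nat.mod_le (e₁.eval w σ) (e₂.eval w σ)).trans_lt l₁
      simp only [Expr.deg]
      split_ifs with hp
      · rcases min_choice (e₁.deg Γ) (e₂.deg Γ) with h | h <;> rw [h]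
        · exact m₁
        · refine (Nat.mod_lt _ ?_).trans l₂
          cases e₂ <;> simp only [Expr.posVar, Bool.false_eq_true] at hp
          exact hσ.pos _ hp
      · exact m₁
    | eq => exact ⟨hone _, ok₁, ok₂, trivial⟩
    | lt => exact ⟨hone _, ok₁, ok₂, trivial⟩

theorem Bounded.tick {σ : Env} (h : Bounded Γ V w σ) (k : ℕ) : Bounded Γ V w (σ.tick k) :=
  ⟨h.v, h.a, h.pos⟩

theorem Bounded.setV {σ : Env} (h : Bounded Γ V w σ) {r x : ℕ} (hx : x < bnd V w (Γ.v r))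
    (hr : Γ.pos r = false) : Bounded Γ V w (σ.setV r x) := by
  refine ⟨fun k => ?_, h.a, fun k hk => ?_⟩
  · simp only [Env.setV, Function.update_apply]
    split_ifs with hk
    · exact hk ▸ hx
    · exact h.v k
  · simp only [Env.setV, Function.update_apply]
    rw [if_neg (by rintro rfl; simp [hr] at hk)]
    exact h.pos k hk

theorem Bounded.setA {σ : Env} (h : Bounded Γ V w σ) {a i x : ℕ} (hx : x < bnd V w (Γ.a a)) :
    Bounded Γ V w (σ.setA a i x) := by
  refine ⟨h.v, fun b j => ?_, h.pos⟩
  simp only [Env.setA, Function.update_apply]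
  by_cases hb : b = a
  · subst hb
    by_cases hj : j = i
    · simpa [hj] using hx
    · simpa [hj] using h.a b j
  · simpa [hb] using h.a b j

/-- Well-typed commands do not overflow. -/
theorem Cmd.ok_of_wt (hV : 2 ≤ V) (hVw : V ^ 30 ≤ 2 ^ w) (c : Cmd) :
    ∀ {σ : Env}, Bounded Γ V w σ → c.wt Γ = true → c.litsBelow V →
      Ok w c σ ∧ Bounded Γ V w (run w c σ) := by
  induction c with
  | skip => exact fun hσ _ _ => ⟨trivial, hσ.tick 1⟩
  | set r e =>
    intro σ hσ h h'
    simp only [Cmd.wt, Bool.and_eq_true, decide_eq_true_iff, Bool.not_eq_true'] at h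
    obtain ⟨l, ok⟩ := e.eval_lt hV hVw hσ h.1.1 h'
    exact ⟨ok, (hσ.setV (lt_of_lt_of_le l (bnd_mono hV hVw h.1.2)) h.2).tick _⟩
  | put a i e =>
    intro σ hσ h h'
    simp only [Cmd.wt, Bool.and_eq_true, decide_eq_true_iff] at h
    obtain ⟨l₁, ok₁⟩ := i.eval_lt hV hVw hσ h.1.1 h'.1
    obtain ⟨l, ok⟩ := e.eval_lt hV hVw hσ h.1.2 h'.2
    exact ⟨⟨ok₁, ok⟩, (hσ.setA (lt_of_lt_of_le l (bnd_mono hV hVw h.2))).tick _⟩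
  | seq c d ih₁ ih₂ =>
    intro σ hσ h h'
    simp only [Cmd.wt, Bool.and_eq_true] at h
    obtain ⟨o₁, b₁⟩ := ih₁ hσ h.1 h'.1
    obtain ⟨o₂, b₂⟩ := ih₂ b₁ h.2 h'.2
    exact ⟨⟨o₁, o₂⟩, b₂⟩
  | ite e c d ih₁ ih₂ =>
    intro σ hσ h h'
    simp only [Cmd.wt, Bool.and_eq_true] at h
    obtain ⟨l, ok⟩ := e.eval_lt hV hVw hσ h.1.1 h'.1
    obtain ⟨o₁, b₁⟩ := ih₁ (hσ.tick (e.cost + 1)) h.1.2 h'.2.1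
    obtain ⟨o₂, b₂⟩ := ih₂ (hσ.tick (e.cost + 1)) h.2 h'.2.2
    simp only [Ok, run]
    split_ifs
    · exact ⟨⟨ok, o₁⟩, b₁⟩
    · exact ⟨⟨ok, o₂⟩, b₂⟩
  | rep r e c ih =>
    intro σ hσ h h'
    simp only [Cmd.wt, Bool.and_eq_true, decide_eq_true_iff, Bool.not_eq_true'] at h
    obtain ⟨l, ok⟩ := e.eval_lt hV hVw hσ h.1.1.1 h'.1
    have hr := lt_of_lt_of_le l (bnd_mono hV hVw h.1.1.2)
    have key : ∀ n ≤ e.eval w σ, Bounded Γ V w (iter (run w c) r n (σ.tick (e.cost + 3))) := by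
      intro n
      induction n with
      | zero => exact fun _ => hσ.tick _
      | succ n ihn => exact fun hn => (ih ((ihn (by omega)).setV (by omega) h.1.2) h.2 h'.2).2.tick 5
    exact ⟨⟨ok, fun i hi => (ih ((key i hi.le).setV (by omega) h.1.2) h.2 h'.2).1⟩, key _ le_rfl⟩

/-! ### Frame rules and loops -/

/-- The variables that a command may change. -/
def Cmd.wv : Cmd → List ℕ
  | .skip => []
  | .set r _ => [r]
  | .put _ _ _ => []
  | .seq c d => c.wv ++ d.wv
  | .ite _ c d => c.wv ++ d.wv
  | .rep r _ c => r :: c.wv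

/-- The arrays that a command may change. -/
def Cmd.wa : Cmd → List ℕ
  | .skip => []
  | .set _ _ => []
  | .put a _ _ => [a]
  | .seq c d => c.wa ++ d.wa
  | .ite _ c d => c.wa ++ d.wa
  | .rep _ _ c => c.wa

theorem run_v (c : Cmd) {r : ℕ} : ∀ {σ : Env}, r ∉ c.wv → (run w c σ).v r = σ.v r := by
  induction c with
  | skip => exact fun _ => rfl
  | set r' e => exact fun h => Function.update_of_ne (by simpa [Cmd.wv] using h) _ _
  | put a i e => exact fun _ => rfl
  | seq c d ih₁ ih₂ =>
    intro σ h
    simp only [Cmd.wv, List.mem_append, not_or] at h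
    exact (ih₂ h.2).trans (ih₁ h.1)
  | ite e c d ih₁ ih₂ =>
    intro σ h
    simp only [Cmd.wv, List.mem_append, not_or] at h
    simp only [run]
    split_ifs
    · exact ih₁ h.1
    · exact ih₂ h.2
  | rep r' e c ih =>
    intro σ h
    simp only [Cmd.wv, List.mem_cons, not_or] at h
    have key : ∀ n, (iter (run w c) r' n (σ.tick (e.cost + 3))).v r = σ.v r := by
      intro n
      induction n with
      | zero => rfl
      | succ n ihn =>
        refine (ih h.2).trans (Eq.trans ?_ ihn)
        exact Function.update_of_ne h.1 _ _
    exact key _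

theorem run_a (c : Cmd) {a : ℕ} : ∀ {σ : Env}, a ∉ c.wa → (run w c σ).a a = σ.a a := by
  induction c with
  | skip => exact fun _ => rfl
  | set r' e => exact fun _ => rfl
  | put a' i e => exact fun h => Function.update_of_ne (by simpa [Cmd.wa] using h) _ _
  | seq c d ih₁ ih₂ =>
    intro σ h
    simp only [Cmd.wa, List.mem_append, not_or] at h
    exact (ih₂ h.2).trans (ih₁ h.1)
  | ite e c d ih₁ ih₂ =>
    intro σ h
    simp only [Cmd.wa, List.mem_append, not_or] at h
    simp only [run]
    split_ifs
    · exact ih₁ h.1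
    · exact ih₂ h.2
  | rep r' e c ih =>
    intro σ h
    have key : ∀ n, (iter (run w c) r' n (σ.tick (e.cost + 3))).a a = σ.a a := by
      intro n
      induction n with
      | zero => rfl
      | succ n ihn => exact (ih h).trans ihn
    exact key _

theorem iter_v {c : Cmd} {r r' n : ℕ} {σ : Env} (h : r' ∉ c.wv) (h' : r' ≠ r) :
    (iter (run w c) r n σ).v r' = σ.v r' := by
  induction n with
  | zero => rfl
  | succ n ihn => exact (run_v c h).trans ((Function.update_of_ne h' _ _).trans ihn)

theorem iter_a {c : Cmd} {r a n : ℕ} {σ : Env} (h : a ∉ c.wa) :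
    (iter (run w c) r n σ).a a = σ.a a := by
  induction n with
  | zero => rfl
  | succ n ihn => exact (run_a c h).trans ihn

/-- The loop rule. The invariant may mention the values of variables and arrays that the loop does
not change, as they are before the loop. -/
theorem run_for {c : Cmd} {r : ℕ} {e : Expr} {σ : Env} (I : ℕ → Env → Prop)
    (h0 : I 0 (σ.tick (e.cost + 3)))
    (hs : ∀ i < e.eval w σ, ∀ τ : Env, (∀ x, x ∉ (Cmd.rep r e c).wv → τ.v x = σ.v x) →
      (∀ a, a ∉ c.wa → τ.a a = σ.a a) → I i τ → I (i + 1) ((run w c (τ.setV r i)).tick 5)) :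
    I (e.eval w σ) (run w (.rep r e c) σ) := by
  have key : ∀ n ≤ e.eval w σ, I n (iter (run w c) r n (σ.tick (e.cost + 3))) := by
    intro n
    induction n with
    | zero => exact fun _ => h0
    | succ n ihn =>
      intro hn
      refine hs n (by omega) _ (fun x hx => ?_) (fun a ha => ?_) (ihn (by omega))
      · simp only [Cmd.wv, List.mem_cons, not_or] at hx
        exact iter_v hx.2 hx.1
      · exact iter_a ha
  exact key _ le_rfl

end Imp

/-! ### Conditioning the random tape on its first word -/

namespace WordRAM

variable {w : ℕ}

/-- Put a word in front of a tape. -/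
def consTape (a : BitVec w) (t : ℕ → BitVec w) : ℕ → BitVec w
  | 0 => a
  | i + 1 => t i

/-- An embedding and not only a measurable map: the integral then transforms for every integrand,
and the measurability of running times never has to be proved. -/
theorem measurableEmbedding_consTape (a : BitVec w) : MeasurableEmbedding (consTape a) := by
  refine MeasurableEmbedding.of_measurable_inverse (g := fun t i => t (i + 1)) ?_ ?_ ?_ ?_
  · refine measurable_pi_lambda _ fun i => ?_
    cases i with
    | zero => exact measurable_const
    | succ i => exact measurable_pi_apply i
  · have : Set.range (consTape a) = (fun t : ℕ → BitVec w => t 0) ⁻¹' {a} := by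
      ext t
      constructor
      · rintro ⟨t, rfl⟩; rfl
      · intro h
        refine ⟨fun i => t (i + 1), funext fun i => ?_⟩
        cases i with
        | zero => exact h.symm
        | succ i => rfl
    rw [this]
    exact measurable_pi_apply 0 trivial
  · exact measurable_pi_lambda _ fun i => measurable_pi_apply (i + 1)
  · exact fun _ => rfl

instance : IsProbabilityMeasure (tapeMeasure w) := by
  unfold tapeMeasure; infer_instance

theorem uniform_toMeasure_eq_sum (t : Set (BitVec w)) :
    (PMF.uniformOfFintype (BitVec w)).toMeasure t
      = ∑ a : BitVec w, (2 ^ w : ℝ≥0∞)⁻¹ * t.indicator 1 a := by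
  classical
  rw [PMF.toMeasure_apply_fintype]
  refine Finset.sum_congr rfl fun a _ => ?_
  have hc : Fintype.card (BitVec w) = 2 ^ w := by
    rw [Fintype.card_congr BitVec.equivFin.toEquiv, Fintype.card_fin]
  by_cases h : a ∈ t <;> simp [h, hc]

/-- The first word of a random tape is uniformly random and independent of the others. -/
theorem tapeMeasure_eq_sum :
    tapeMeasure w = ∑ a : BitVec w, (2 ^ w : ℝ≥0∞)⁻¹ • (tapeMeasure w).map (consTape a) := by
  classical
  symm
  refine Measure.eq_infinitePi _ fun s t ht => ?_
  set μ := (PMF.uniformOfFintype (BitVec w)).toMeasure with hμ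
  -- A cylinder over an arbitrary finite set is one over an initial segment with some full sides.
  -- The segment is nonempty, so that its first coordinate can be split off.
  obtain ⟨n, hn⟩ : ∃ n, s ⊆ Finset.range (n + 1) := by
    refine ⟨s.sup id, fun i hi => Finset.mem_range.2 (Nat.lt_succ_of_le ?_)⟩
    exact Finset.le_sup (f := id) hi
  set t' : ℕ → Set (BitVec w) := fun i => if i ∈ s then t i else Set.univ with ht'
  have hset : (s : Set ℕ).pi t = (Finset.range (n + 1) : Set ℕ).pi t' := by
    ext x
    simp only [Set.mem_pi, Finset.mem_coe, ht']
    constructor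
    · intro h i _
      split_ifs with hi
      · exact h i hi
      · trivial
    · intro h i hi
      have := h i (hn hi)
      rwa [if_pos hi] at this
  have hprod : ∏ i ∈ s, μ (t i) = ∏ i ∈ Finset.range (n + 1), μ (t' i) := by
    rw [← Finset.prod_subset hn]
    · exact Finset.prod_congr rfl fun i hi => by simp [ht', hi]
    · intro i _ hi
      simp [ht', hi]
  rw [hset, hprod, Finset.prod_range_succ', Measure.finsetSum_apply]
  have hpre : ∀ a : BitVec w, ((tapeMeasure w).map (consTape a))
      ((Finset.range (n + 1) : Set ℕ).pi t')
      = (∏ i ∈ Finset.range n, μ (t' (i + 1))) * (t' 0).indicator 1 a := by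
    intro a
    rw [(measurableEmbedding_consTape a).map_apply]
    by_cases ha : a ∈ t' 0
    · have : consTape a ⁻¹' ((Finset.range (n + 1) : Set ℕ).pi t')
          = (Finset.range n : Set ℕ).pi fun i => t' (i + 1) := by
        ext x
        simp only [Set.mem_preimage, Set.mem_pi, Finset.mem_coe, Finset.mem_range]
        constructor
        · exact fun h i hi => h (i + 1) (by omega)
        · intro h i hi
          cases i with
          | zero => exact ha
          | succ i => exact h i (by omega)
      have hm : ∀ s : Set (BitVec w), MeasurableSet s := fun _ => trivial
      rw [this, tapeMeasure, Measure.infinitePi_pi _ fun _ _ => hm _]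
      simp [ha, hμ]
    · have : consTape a ⁻¹' ((Finset.range (n + 1) : Set ℕ).pi t') = ∅ := by
        ext x
        simp only [Set.mem_preimage, Set.mem_pi, Finset.mem_coe, Finset.mem_range,
          Set.mem_empty_iff_false, iff_false]
        exact fun h => ha (h 0 (by omega))
      rw [this]
      simp [ha]
  simp only [Measure.smul_apply, hpre, smul_eq_mul]
  rw [hμ, uniform_toMeasure_eq_sum (t' 0), Finset.mul_sum]
  exact Finset.sum_congr rfl fun a _ => by ring

/-- Condition on the first random word; the integrand need not be measurable. -/
theorem lintegral_tapeMeasure (f : (ℕ → BitVec w) → ℝ≥0∞) :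
    ∫⁻ t, f t ∂(tapeMeasure w)
      = ∑ a : BitVec w, (2 ^ w : ℝ≥0∞)⁻¹ * ∫⁻ t, f (consTape a t) ∂(tapeMeasure w) := by
  conv_lhs => rw [tapeMeasure_eq_sum]
  rw [lintegral_finsetSum_measure]
  refine Finset.sum_congr rfl fun a _ => ?_
  rw [lintegral_smul_measure, (measurableEmbedding_consTape a).lintegral_map]
  rfl

end WordRAM

/-! ### Multiplication by a random odd word -/

/-- For odd `o`, the product `(2 r + 1) o` modulo `2 ^ (j + 1)` determines `r` modulo `2 ^ j`. -/
theorem modEq_of_odd_mul_modEq {j o r r' : ℕ} (ho : Odd o)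
    (h : (2 * r + 1) * o ≡ (2 * r' + 1) * o [MOD 2 ^ (j + 1)]) : r ≡ r' [MOD 2 ^ j] := by
  have hc : Nat.gcd (2 ^ (j + 1)) o = 1 :=
    (Nat.Coprime.pow_left _ (Nat.coprime_two_left.2 ho))
  have h1 : 2 * r + 1 ≡ 2 * r' + 1 [MOD 2 ^ (j + 1)] := Nat.ModEq.cancel_right_of_coprime hc h
  have h2 : 2 * r ≡ 2 * r' [MOD 2 * 2 ^ j] := by
    rw [← pow_succ']; exact Nat.ModEq.add_right_cancel' 1 h1
  exact Nat.ModEq.mul_left_cancel' (by norm_num) h2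

/-- Multiplying a nonzero word `d` by a random odd word gives a value close to `0` modulo `2 ^ w`
only with probability `O(2 ^ (-H))`. -/
theorem card_odd_mul_near_zero {w H d : ℕ} (hH : H ≤ w) (hd : ¬ 2 ^ w ∣ d) :
    ((Finset.range (2 ^ w)).filter fun r =>
      ((2 * r + 1) * d) % 2 ^ w < 2 * 2 ^ (w - H) ∨
        2 ^ w < ((2 * r + 1) * d) % 2 ^ w + 2 * 2 ^ (w - H)).card ≤ 8 * 2 ^ (w - H) := by
  have hd0 : d ≠ 0 := by rintro rfl; simp at hd
  -- With `d = 2 ^ k * o` and `o` odd, the product modulo `2 ^ w` is `2 ^ k` times an odd residue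
  -- modulo `2 ^ (j + 1)`, where `w = k + j + 1`.
  obtain ⟨k, o, ho, rfl⟩ := Nat.exists_eq_two_pow_mul_odd hd0
  have hk : k < w := by
    by_contra! h
    exact hd (Dvd.dvd.mul_right (pow_dvd_pow 2 h) o)
  obtain ⟨j, rfl⟩ : ∃ j, w = k + (j + 1) := ⟨w - k - 1, by omega⟩
  set w := k + (j + 1) with hw
  have hval : ∀ r, ((2 * r + 1) * (2 ^ k * o)) % 2 ^ w
      = 2 ^ k * (((2 * r + 1) * o) % 2 ^ (j + 1)) := by
    intro r
    rw [hw, pow_add, ← Nat.mul_mod_mul_left]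
    congr 1; ring
  have hodd : ∀ r, Odd (((2 * r + 1) * o) % 2 ^ (j + 1)) := by
    intro r
    rw [Nat.odd_iff, pow_succ', Nat.mod_mul_right_mod]
    exact Nat.odd_iff.1 (Odd.mul ⟨r, rfl⟩ ho)
  have hlt : ∀ r, ((2 * r + 1) * o) % 2 ^ (j + 1) < 2 ^ (j + 1) := fun r =>
    Nat.mod_lt _ (by positivity)
  simp_rw [hval]
  have hwk : 2 ^ w = 2 ^ k * 2 ^ (j + 1) := by rw [hw, pow_add]
  rcases Nat.lt_or_ge (w - H) k with hkH | hkH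
  · -- an odd multiple of `2 ^ k` is not close to zero
    have h2 : 2 * 2 ^ (w - H) ≤ 2 ^ k := by
      rw [← pow_succ']; exact Nat.pow_le_pow_right (by norm_num) hkH
    rw [Finset.filter_false_of_mem, Finset.card_empty]
    · exact Nat.zero_le _
    · rintro r -
      have h0 := (hodd r).pos
      have h1 := hlt r
      set v := ((2 * r + 1) * o) % 2 ^ (j + 1)
      have e1 : 2 ^ k * 1 ≤ 2 ^ k * v := Nat.mul_le_mul_left _ h0
      have e2 : 2 ^ k * (v + 1) ≤ 2 ^ k * 2 ^ (j + 1) := Nat.mul_le_mul_left _ h1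
      rw [mul_add] at e2
      omega
  · obtain ⟨l, hl⟩ : ∃ l, w - H = k + l := ⟨w - H - k, by omega⟩
    rw [hl]
    have hpl : 2 ^ (k + l) = 2 ^ k * 2 ^ l := pow_add _ _ _
    have hk0 : 0 < 2 ^ k := by positivity
    -- `r` is determined by the value and by its leading `k + 1` bits
    set J := Finset.range (2 * 2 ^ l) ∪ Finset.Ico (2 ^ (j + 1) - 2 * 2 ^ l) (2 ^ (j + 1)) with hJ
    have hJc : J.card ≤ 4 * 2 ^ l := by
      refine (Finset.card_union_le _ _).trans ?_
      rw [Finset.card_range, Nat.card_Ico]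
      omega
    -- There are at most `4 * 2 ^ l` admissible residues. Each of them fixes `r` modulo `2 ^ j` and
    -- leaves `k + 1` leading bits free.
    calc _ ≤ (J ×ˢ Finset.range (2 ^ (k + 1))).card := by
          refine Finset.card_le_card_of_injOn
            (fun r => (((2 * r + 1) * o) % 2 ^ (j + 1), r / 2 ^ j)) ?_ ?_
          · intro r hr
            simp only [Finset.coe_filter, Finset.mem_range, Set.mem_ofPred_eq] at hr
            simp only [Finset.coe_product, Set.mem_prod, Finset.mem_coe, hJ, Finset.mem_union,
              Finset.mem_range, Finset.mem_Ico]
            have h1 := hlt r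
            set v := ((2 * r + 1) * o) % 2 ^ (j + 1)
            refine ⟨?_, ?_⟩
            · rcases hr.2 with h | h
              · left
                rw [hpl] at h
                have : 2 ^ k * v < 2 ^ k * (2 * 2 ^ l) := by linarith
                exact Nat.lt_of_mul_lt_mul_left this
              · right
                refine ⟨?_, h1⟩
                rw [hpl, hwk] at h
                have : 2 ^ k * 2 ^ (j + 1) < 2 ^ k * (v + 2 * 2 ^ l) := by linarith
                have := Nat.lt_of_mul_lt_mul_left this
                omega
            · rw [Nat.div_lt_iff_lt_mul (by positivity), ← pow_add]
              have : k + 1 + j = w := by omega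
              rw [this]; exact hr.1
          · intro r _ r' _ h
            simp only [Prod.mk.injEq] at h
            have hm : r % 2 ^ j = r' % 2 ^ j := modEq_of_odd_mul_modEq ho h.1
            rw [← Nat.div_add_mod r (2 ^ j), ← Nat.div_add_mod r' (2 ^ j), h.2, hm]
      _ = J.card * 2 ^ (k + 1) := by rw [Finset.card_product, Finset.card_range]
      _ ≤ 4 * 2 ^ l * 2 ^ (k + 1) := Nat.mul_le_mul_right _ hJc
      _ = 8 * 2 ^ (k + l) := by rw [pow_succ, pow_add]; ring

/-! ### From hash sums to intersections of sets -/

/-- The data of the reduction: `n` numbers with hash values `h`, a number `R` of buckets, a number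
`S` of shifts, the weight `HH` of a carry and the stretch `M`. -/
structure Par where
  n : ℕ
  R : ℕ
  S : ℕ
  HH : ℕ
  M : ℕ
  h : ℕ → ℕ

namespace Par

variable (p : Par)

/-- The size of the universe of each bucket. -/
def S2 : ℕ := p.S * p.S
/-- The modulus of the hash values. -/
def P : ℕ := p.R * p.S2
/-- The maximal number of elements of a colour. -/
def B : ℕ := p.n / p.R + 1
/-- The width of half a block. -/
def b : ℕ := p.n / p.S + 1
/-- The threshold for distances of colours with a common element. -/
def thr : ℕ := (p.b + p.b) * p.M
/-- The distance of consecutive blocks. -/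
def W : ℕ := p.b + p.b + p.thr
def R2 : ℕ := p.R + p.R
/-- The number of colours of the first kind. -/
def nA : ℕ := p.R2 * p.S
def base : ℕ := 1 + p.nA + p.thr + p.R * p.S + p.thr
/-- The number of queries. -/
def m : ℕ := 16 * p.n * p.R
/-- The space for a list. -/
def st : ℕ := p.n * p.S + p.b + 1
/-- The size of the array of colours. -/
def N : ℕ := p.base + 4 * p.S2 * p.W
/-- An upper bound for all counters. -/
def cap : ℕ := p.N + p.m + p.st

/-- Representatives modulo `P` of `c - h x` and, for `fB`, of `h y - c * S`. The factor `P - 1`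
plays the role of `-1`, which keeps all quantities natural numbers. -/
def fA (c x : ℕ) : ℕ := (c + (p.P - 1) * p.h x) % p.P
def fB (c y : ℕ) : ℕ := (p.h y + (p.P - 1) * (c * p.S)) % p.P
def buck (c x : ℕ) : ℕ := p.fA c x / p.S2
def elA (c x : ℕ) : ℕ := p.fA c x % p.S2
def elB (c y : ℕ) : ℕ := p.fB c y % p.S2
/-- The position of `x` when the elements are sorted by buckets. -/
def pos (c x : ℕ) : ℕ :=
  Nat.count (fun y => p.buck c y < p.buck c x) p.n +
    Nat.count (fun y => p.buck c y = p.buck c x) x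
-- The sorted elements are cut every `B` positions and, in addition, between buckets. Since `pos /
-- B` never decreases in the sorted order and the bucket grows at each boundary, the sum separates
-- buckets, and it takes fewer than `2 * R` values.
def slot (c x : ℕ) : ℕ := p.buck c x + p.pos c x / p.B
-- Numbering starts at 1 because colour 0 fills the unused cells of the array.
def colA (c x : ℕ) : ℕ := 1 + c * p.R2 + p.slot c x
def colB (c y : ℕ) : ℕ := 1 + p.nA + (c * p.R + p.fB c y / p.S2)

/-- The pairs `(c, i)` with `i < n`, in lexicographic order, below `(c, i)`. -/
def evs (n c i : ℕ) : List (ℕ × ℕ) :=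
  ((List.range c).flatMap fun c' => (List.range n).map (Prod.mk c')) ++ (List.range i).map (Prod.mk c)

theorem evs_succ (n c i : ℕ) : evs n c (i + 1) = evs n c i ++ [(c, i)] := by
  simp [evs, List.range_succ]

theorem evs_zero (n : ℕ) : evs n 0 0 = [] := rfl

theorem evs_carry (n c : ℕ) : evs n (c + 1) 0 = evs n c n := by
  simp [evs, List.range_succ]

theorem mem_evs {n c : ℕ} {e : ℕ × ℕ} : e ∈ evs n c 0 ↔ e.1 < c ∧ e.2 < n := by
  obtain ⟨x, y⟩ := e
  simp [evs]

theorem length_evs (n c i : ℕ) : (evs n c i).length = c * n + i := by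
  simp [evs]

theorem nodup_evs (n c : ℕ) : (evs n c 0).Nodup := by
  simp only [evs, List.range_zero, List.map_nil, List.append_nil]
  rw [List.nodup_flatMap]
  refine ⟨fun x _ => List.nodup_range.map fun a b h => by simpa using h, ?_⟩
  refine List.nodup_range.imp_of_mem fun {a b} _ _ hab => ?_
  intro e he he'
  simp only [List.mem_map] at he he'
  obtain ⟨_, _, rfl⟩ := he
  obtain ⟨_, _, h⟩ := he'
  exact hab (Prod.mk.inj h).1.symm

/-- The values of the events with a given key, in the order of the events. -/
def bucket {α : Type*} (E : List α) (key val : α → ℕ) (k : ℕ) : List ℕ :=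
  (E.filter fun e => key e = k).map val

theorem bucket_append {α : Type*} (E : List α) (key val : α → ℕ) (e : α) :
    bucket (E ++ [e]) key val
      = Function.update (bucket E key val) (key e) (bucket E key val (key e) ++ [val e]) := by
  funext k
  by_cases h : k = key e
  · subst h; simp [bucket]
  · rw [Function.update_of_ne h]
    simp [bucket, List.filter_append, Ne.symm h]

theorem mem_bucket {α : Type*} {E : List α} {key val : α → ℕ} {k v : ℕ} :
    v ∈ bucket E key val k ↔ ∃ e ∈ E, key e = k ∧ val e = v := by
  simp [bucket, and_assoc]

theorem length_bucket_le {α : Type*} (E : List α) (key val : α → ℕ) (k : ℕ) :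
    (bucket E key val k).length ≤ E.length := by
  rw [bucket, List.length_map]; exact List.length_filter_le _ _

/-- For an element `u` of the universe, `LA u` and `LB u` list the colours of both kinds whose sets
contain `u`. `ML` lists the members of a colour of the first kind, and `HL` the indices with a given
hash value. -/
def LA : ℕ → List ℕ :=
  bucket (evs p.n p.S 0) (fun e => p.elA e.1 e.2) (fun e => p.colA e.1 e.2)
def LB : ℕ → List ℕ :=
  bucket (evs p.n p.S 0) (fun e => p.elB e.1 e.2) (fun e => p.colB e.1 e.2)
def ML : ℕ → List ℕ := bucket (evs p.n p.S 0) (fun e => p.colA e.1 e.2) Prod.snd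
def HL : ℕ → List ℕ := bucket (List.range p.n) p.h id

/-- The query `q` belongs to the element `qz q`, the carries `qe q` and the slot `qs q`. -/
def qz (q : ℕ) : ℕ := q / (p.R2 * 8)
def qe (q : ℕ) : ℕ := q / p.R2 % 8
def qs (q : ℕ) : ℕ := q % p.R2
-- The hash sum that belongs to the carry pattern `e`: the parity of `e` is the carry out of the
-- discarded low digits, and `e / 2` is the multiple of `2 ^ H` caused by wrap-around of the leading
-- digits and by the sign bits.
def gval (z e : ℕ) : ℕ := (p.h z + e / 2 * p.HH + (p.P - 1) * (e % 2)) % p.P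
def qg (q : ℕ) : ℕ := p.gval (p.qz q) (p.qe q)
def q1 (q : ℕ) : ℕ := 1 + p.qg q % p.S * p.R2 + p.qs q
-- The bucket of the partner is that of the queried slot plus `g / S2`. A slot does not reveal its
-- bucket, so the table `ip` supplies it.
def q2 (ip : ℕ → ℕ) (q : ℕ) : ℕ :=
  1 + p.nA + (p.qg q / p.S % p.S * p.R + (ip (p.q1 q) + p.qg q / p.S2) % p.R)

variable {p}

theorem S2_pos (hS : 0 < p.S) : 0 < p.S2 := Nat.mul_pos hS hS
theorem P_pos (hR : 0 < p.R) (hS : 0 < p.S) : 0 < p.P := Nat.mul_pos hR (S2_pos hS)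

theorem pred_mul_cast {P : ℕ} (hP : 0 < P) (x : ℕ) :
    (((P - 1 : ℕ) : ℤ) * x) ≡ -x [ZMOD P] := by
  rw [Nat.cast_sub hP, Nat.cast_one, Int.modEq_iff_dvd]
  exact ⟨-x, by ring⟩

theorem fA_cast (hP : 0 < p.P) (c x : ℕ) : (p.fA c x : ℤ) ≡ c - p.h x [ZMOD p.P] := by
  unfold fA
  push_cast
  refine (Int.mod_modEq _ _).trans ?_
  rw [sub_eq_add_neg]
  exact Int.ModEq.add_left _ (pred_mul_cast hP _)

theorem fB_cast (hP : 0 < p.P) (c y : ℕ) : (p.fB c y : ℤ) ≡ p.h y - c * p.S [ZMOD p.P] := by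
  unfold fB
  push_cast
  refine (Int.mod_modEq _ _).trans ?_
  rw [sub_eq_add_neg]
  refine Int.ModEq.add_left _ ?_
  have := pred_mul_cast hP (c * p.S)
  push_cast at this
  exact this

theorem buck_lt (hR : 0 < p.R) (hS : 0 < p.S) (c x : ℕ) : p.buck c x < p.R := by
  unfold buck
  rw [Nat.div_lt_iff_lt_mul (S2_pos hS)]
  exact Nat.mod_lt _ (P_pos hR hS)

/-- Two elements sum to `g` if and only if they meet in the sets of the corresponding colours. -/
theorem match_iff (hR : 0 < p.R) (hS : 0 < p.S) {g x y : ℕ} (hg : g < p.P) :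
    (p.h x + p.h y) % p.P = g ↔ p.elA (g % p.S) x = p.elB (g / p.S % p.S) y ∧
      p.fB (g / p.S % p.S) y / p.S2 = (p.buck (g % p.S) x + g / p.S2) % p.R := by
  have hP := P_pos hR hS
  have hS2 := S2_pos hS
  set c₀ := g % p.S
  set c₁ := g / p.S % p.S
  set I := g / p.S2
  have hgd : g = I * p.S2 + c₁ * p.S + c₀ := by
    have h1 := Nat.div_add_mod g p.S
    have h2 := Nat.div_add_mod (g / p.S) p.S
    have h3 : g / p.S / p.S = I := by rw [Nat.div_div_eq_div_mul]; rfl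
    rw [h3] at h2
    calc g = p.S * (p.S * I + c₁) + c₀ := by rw [h2, h1]
      _ = _ := by rw [S2]; ring
  -- Subtracting `h x + c₁ * S` from both sides separates `y` from `x`.
  have e1 : (p.h x + p.h y) % p.P = g ↔ (p.fB c₁ y : ℤ) ≡ p.fA c₀ x + I * p.S2 [ZMOD p.P] := by
    have : (p.h x + p.h y) % p.P = g ↔ ((p.h x : ℤ) + p.h y) ≡ g [ZMOD p.P] := by
      have h1 := Int.natCast_modEq_iff (a := p.h x + p.h y) (b := g) (n := p.P)
      push_cast at h1
      rw [h1, Nat.ModEq, Nat.mod_eq_of_lt hg]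
    rw [this, hgd]
    push_cast
    have ha := fA_cast hP c₀ x
    have hb := fB_cast hP c₁ y
    constructor
    · intro h
      refine hb.trans (Int.ModEq.trans ?_ (ha.symm.add_right _))
      have h' := h.add_right (-(p.h x : ℤ) - c₁ * p.S)
      ring_nf at h' ⊢
      exact h'
    · intro h
      have h' := (hb.symm.trans (h.trans (ha.add_right _))).add_right ((p.h x : ℤ) + c₁ * p.S)
      ring_nf at h' ⊢
      exact h'
  have e2 : (p.fB c₁ y : ℤ) ≡ p.fA c₀ x + I * p.S2 [ZMOD p.P]
      ↔ p.fB c₁ y = ((p.buck c₀ x + I) % p.R) * p.S2 + p.elA c₀ x := by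
    have h1 := Int.natCast_modEq_iff (a := p.fB c₁ y) (b := p.fA c₀ x + I * p.S2) (n := p.P)
    push_cast at h1
    -- Adding a multiple of `S2` keeps the residue modulo `S2` and rotates the bucket modulo `R`.
    have h2 : (p.fA c₀ x + I * p.S2) % p.P
        = ((p.buck c₀ x + I) % p.R) * p.S2 + p.elA c₀ x := by
      have h3 : p.fA c₀ x + I * p.S2 = p.elA c₀ x + p.S2 * (p.buck c₀ x + I) := by
        have := Nat.mod_add_div (p.fA c₀ x) p.S2
        unfold elA buck
        linarith
      have h4 : p.elA c₀ x < p.S2 := Nat.mod_lt _ hS2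
      rw [h3, P, Nat.mul_comm p.R, Nat.mod_mul, Nat.add_mul_mod_self_left, Nat.mod_eq_of_lt h4,
        Nat.add_mul_div_left _ _ hS2, Nat.div_eq_of_lt h4, Nat.zero_add]
      ring
    rw [h1, Nat.ModEq, h2, Nat.mod_eq_of_lt (show p.fB c₁ y < p.P from Nat.mod_lt _ hP)]
  rw [e1, e2]
  have h4 : p.elA c₀ x < p.S2 := Nat.mod_lt _ hS2
  constructor
  · intro h
    unfold elB
    rw [h]
    constructor
    · rw [Nat.mul_add_mod', Nat.mod_eq_of_lt h4]
    · rw [Nat.mul_comm, Nat.mul_add_div hS2, Nat.div_eq_of_lt h4, Nat.add_zero]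
  · rintro ⟨h, h'⟩
    rw [← h', h]
    exact (Nat.div_add_mod' _ _).symm

/-! ### Slots -/

theorem count_lt_add_count_eq (f : ℕ → ℕ) (j n : ℕ) :
    Nat.count (fun y => f y < j) n + Nat.count (fun y => f y = j) n
      = Nat.count (fun y => f y < j + 1) n := by
  induction n with
  | zero => simp
  | succ n ih =>
    simp only [Nat.count_succ]
    split_ifs <;> omega

theorem count_congr_lt {q q' : ℕ → Prop} [DecidablePred q] [DecidablePred q'] {n : ℕ}
    (h : ∀ k < n, q k → q' k) : Nat.count q n ≤ Nat.count q' n := by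
  induction n with
  | zero => simp
  | succ n ih =>
    have := ih fun k hk => h k (by omega)
    have h' := h n (by omega)
    simp only [Nat.count_succ]
    split_ifs <;> first | omega | simp_all

theorem count_eq_lt (f : ℕ → ℕ) {j x n : ℕ} (hx : x < n) (h : f x = j) :
    Nat.count (fun y => f y = j) x < Nat.count (fun y => f y = j) n :=
  Nat.count_strict_mono h hx

theorem pos_lt_of_buck_lt {c x y : ℕ} (hx : x < p.n) (h : p.buck c x < p.buck c y) :
    p.pos c x < p.pos c y := by
  unfold pos
  have h1 := count_eq_lt (p.buck c) hx rfl
  have h2 := count_lt_add_count_eq (p.buck c) (p.buck c x) p.n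
  have h3 : Nat.count (fun z => p.buck c z < p.buck c x + 1) p.n
      ≤ Nat.count (fun z => p.buck c z < p.buck c y) p.n :=
    count_congr_lt fun k _ hk => by omega
  omega

theorem pos_lt {c x : ℕ} (hx : x < p.n) : p.pos c x < p.n := by
  unfold pos
  have h1 := count_eq_lt (p.buck c) hx rfl
  have h2 := count_lt_add_count_eq (p.buck c) (p.buck c x) p.n
  have h3 := Nat.count_le (p := fun z => p.buck c z < p.buck c x + 1) (n := p.n)
  omega

theorem pos_lt_of_lt {c x y : ℕ} (h : p.buck c x = p.buck c y) (hxy : x < y) :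
    p.pos c x < p.pos c y := by
  unfold pos
  have h1 := count_eq_lt (p.buck c) (x := x) (n := y) (j := p.buck c y) hxy h
  rw [h]
  omega

theorem B_pos : 0 < p.B := Nat.succ_pos _

/-- From a bucket to a later one the bucket number strictly increases, while `pos / B` does not
decrease. -/
theorem buck_eq_of_slot_eq {c x y : ℕ} (hx : x < p.n) (hy : y < p.n)
    (h : p.slot c x = p.slot c y) : p.buck c x = p.buck c y := by
  by_contra hne
  rcases Nat.lt_or_gt_of_ne hne with hlt | hlt
  · have := Nat.div_le_div_right (c := p.B) (pos_lt_of_buck_lt hx hlt).le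
    unfold slot at h
    omega
  · have := Nat.div_le_div_right (c := p.B) (pos_lt_of_buck_lt hy hlt).le
    unfold slot at h
    omega

theorem n_le_R_mul_B (hR : 0 < p.R) : p.n ≤ p.R * p.B := by
  unfold B
  have := Nat.div_add_mod p.n p.R
  have := Nat.mod_lt p.n hR
  nlinarith

theorem n_le_S_mul_b (hS : 0 < p.S) : p.n ≤ p.S * p.b := by
  unfold b
  have := Nat.div_add_mod p.n p.S
  have := Nat.mod_lt p.n hS
  nlinarith

theorem slot_lt (hR : 0 < p.R) (hS : 0 < p.S) {c x : ℕ} (hx : x < p.n) : p.slot c x < p.R2 := by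
  have h1 := buck_lt hR hS c x
  have h2 : p.pos c x / p.B < p.R := by
    rw [Nat.div_lt_iff_lt_mul B_pos]
    exact (pos_lt hx).trans_le (n_le_R_mul_B hR)
  unfold slot R2
  omega

theorem colA_inj (hR : 0 < p.R) (hS : 0 < p.S) {c x : ℕ} (hx : x < p.n) {c' s : ℕ} (hs : s < p.R2)
    (h : p.colA c x = 1 + c' * p.R2 + s) : c = c' ∧ p.slot c x = s := by
  have h1 := slot_lt hR hS (c := c) hx
  unfold colA at h
  have h0 : 0 < p.R2 := by omega
  have h2 : (p.slot c x + p.R2 * c) = (s + p.R2 * c') := by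
    rw [Nat.mul_comm p.R2 c, Nat.mul_comm p.R2 c']; omega
  have h3 := congrArg (· % p.R2) h2
  have h4 := congrArg (· / p.R2) h2
  simp only [Nat.add_mul_mod_self_left, Nat.mod_eq_of_lt h1, Nat.mod_eq_of_lt hs] at h3
  simp only [Nat.add_mul_div_left _ _ h0, Nat.div_eq_of_lt h1, Nat.div_eq_of_lt hs] at h4
  omega

theorem buck_eq_of_colA_eq (hR : 0 < p.R) (hS : 0 < p.S) {c x c' x' : ℕ} (hx : x < p.n)
    (hx' : x' < p.n) (h : p.colA c x = p.colA c' x') : p.buck c x = p.buck c' x' := by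
  obtain ⟨rfl, h'⟩ := colA_inj hR hS hx (slot_lt hR hS hx') h
  exact buck_eq_of_slot_eq hx hx' h'

theorem colA_le (hR : 0 < p.R) (hS : 0 < p.S) {c x : ℕ} (hx : x < p.n) (hc : c < p.S) :
    1 ≤ p.colA c x ∧ p.colA c x ≤ p.nA := by
  have h1 := slot_lt hR hS (c := c) hx
  unfold colA nA
  have : (c + 1) * p.R2 ≤ p.S * p.R2 := Nat.mul_le_mul_right _ hc
  rw [Nat.mul_comm p.R2 p.S]
  have : (c + 1) * p.R2 = c * p.R2 + p.R2 := by ring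
  omega

/-- A colour has at most `B` elements. -/
theorem length_ML_le (hR : 0 < p.R) (hS : 0 < p.S) (k : ℕ) : (p.ML k).length ≤ p.B := by
  rw [ML, bucket, List.length_map]
  set l := (evs p.n p.S 0).filter fun e => p.colA e.1 e.2 = k with hl
  have hnd : l.Nodup := (nodup_evs _ _).filter _
  rw [← List.toFinset_card_of_nodup hnd, ← Finset.card_range p.B]
  have hmem : ∀ e ∈ l.toFinset, e.2 < p.n ∧ p.colA e.1 e.2 = k := by
    intro e he
    rw [List.mem_toFinset, hl, List.mem_filter, mem_evs] at he
    exact ⟨he.1.2, by simpa using he.2⟩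
  -- Elements of one colour share the bucket and the quotient `pos / B`; the remainder modulo `B`
  -- then identifies the position, and with it the element.
  refine Finset.card_le_card_of_injOn (fun e => p.pos e.1 e.2 % p.B) ?_ ?_
  · exact fun e _ => Finset.mem_coe.2 (Finset.mem_range.2 (Nat.mod_lt _ B_pos))
  · rintro ⟨c, x⟩ he ⟨c', x'⟩ he' h
    obtain ⟨hx, hk⟩ := hmem _ he
    obtain ⟨hx', hk'⟩ := hmem _ he'
    simp only at hx hk hx' hk' h
    obtain ⟨rfl, hs⟩ := colA_inj hR hS hx (slot_lt hR hS hx') (hk.trans hk'.symm)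
    have hb := buck_eq_of_slot_eq hx hx' hs
    have hq : p.pos c x / p.B = p.pos c x' / p.B := by
      unfold slot at hs; omega
    have hp : p.pos c x = p.pos c x' := by
      rw [← Nat.div_add_mod (p.pos c x) p.B, ← Nat.div_add_mod (p.pos c x') p.B, hq, h]
    have : x = x' := by
      by_contra hne
      rcases Nat.lt_or_gt_of_ne hne with hlt | hlt
      · have := pos_lt_of_lt hb hlt; omega
      · have := pos_lt_of_lt hb.symm hlt; omega
    rw [this]

/-! ### The number of blocks -/

/-- Quotient plus one instead of a rounded-up quotient: the last chunk may be empty, but there is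
always at least one. -/
def nbA (u : ℕ) : ℕ := (p.LA u).length / p.b + 1
def nbB (u : ℕ) : ℕ := (p.LB u).length / p.b + 1

theorem sum_length_bucket_le {α : Type*} (E : List α) (key val : α → ℕ) (n : ℕ) :
    ∑ u ∈ Finset.range n, (bucket E key val u).length ≤ E.length := by
  induction E using List.reverseRecOn with
  | nil => simp [bucket]
  | append_singleton E e ih =>
    rw [bucket_append, List.length_append, List.length_singleton]
    have : ∀ u, (Function.update (bucket E key val) (key e)
        (bucket E key val (key e) ++ [val e]) u).length
        = (bucket E key val u).length + if u = key e then 1 else 0 := by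
      intro u
      by_cases hu : u = key e
      · subst hu; simp
      · simp [hu]
    simp_rw [this]
    rw [Finset.sum_add_distrib, Finset.sum_ite_eq']
    split_ifs <;> omega

theorem length_LA (u : ℕ) : (p.LA u).length
    = ((Finset.range p.S ×ˢ Finset.range p.n).filter fun e => p.elA e.1 e.2 = u).card := by
  rw [LA, bucket, List.length_map, ← List.toFinset_card_of_nodup ((nodup_evs _ _).filter _)]
  congr 1
  ext e
  simp [mem_evs]

theorem length_LB (u : ℕ) : (p.LB u).length
    = ((Finset.range p.S ×ˢ Finset.range p.n).filter fun e => p.elB e.1 e.2 = u).card := by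
  rw [LB, bucket, List.length_map, ← List.toFinset_card_of_nodup ((nodup_evs _ _).filter _)]
  congr 1
  ext e
  simp [mem_evs]

/-- If `(c, x)` and `(c', y)` meet in `u`, then `c + c' * S` is congruent to `h x + h y` modulo `S ^
2`. As `c + c' * S < S ^ 2`, the elements `x` and `y` determine both shifts, and these determine
`u`. Hence the incidences inject into the pairs `(x, y)`. -/
theorem sum_length_mul_length_le (hR : 0 < p.R) (hS : 0 < p.S) :
    ∑ u ∈ Finset.range p.S2, (p.LA u).length * (p.LB u).length ≤ p.n * p.n := by
  have hP := P_pos hR hS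
  simp_rw [length_LA, length_LB, ← Finset.card_product]
  rw [← Finset.card_sigma]
  calc _ ≤ (Finset.range p.n ×ˢ Finset.range p.n).card := by
        refine Finset.card_le_card_of_injOn (fun e => (e.2.1.2, e.2.2.2)) ?_ ?_
        · rintro ⟨u, ⟨c, x⟩, c', y⟩ he
          simp only [Finset.coe_sigma, Set.mem_sigma_iff, Finset.mem_coe, Finset.mem_product,
            Finset.mem_filter, Finset.mem_range] at he ⊢
          exact ⟨he.2.1.1.2, he.2.2.1.2⟩
        · rintro ⟨u, ⟨c, x⟩, c', y⟩ he ⟨v, ⟨d, x₁⟩, d', y₁⟩ he' h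
          simp only [Finset.coe_sigma, Set.mem_sigma_iff, Finset.mem_coe, Finset.mem_product,
            Finset.mem_filter, Finset.mem_range, Prod.mk.injEq] at he he' h
          obtain ⟨rfl, rfl⟩ := h
          obtain ⟨-, ⟨⟨hc, hx⟩, e₁⟩, ⟨hc', hy⟩, e₂⟩ := he
          obtain ⟨-, ⟨⟨hd, -⟩, e₃⟩, ⟨hd', -⟩, e₄⟩ := he'
          have key : ∀ c c', p.elA c x = p.elB c' y →
              ((c + c' * p.S : ℕ) : ℤ) ≡ p.h x + p.h y [ZMOD p.S2] := by
            intro c c' he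
            have hd : (p.S2 : ℤ) ∣ p.P := ⟨p.R, by rw [P]; push_cast; ring⟩
            have h1 := (fA_cast hP c x).of_dvd hd
            have h2 := (fB_cast hP c' y).of_dvd hd
            have h3 : (p.fA c x : ℤ) ≡ p.fB c' y [ZMOD p.S2] := by
              rw [Int.natCast_modEq_iff]; exact he
            have h4 := ((h1.symm.trans h3).trans h2).add_right ((p.h x : ℤ) + c' * p.S)
            push_cast
            ring_nf at h4 ⊢
            exact h4
          have h5 := (key c c' (e₁.trans e₂.symm)).trans (key d d' (e₃.trans e₄.symm)).symm
          rw [Int.natCast_modEq_iff] at h5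
          have lt : ∀ c c', c < p.S → c' < p.S → c + c' * p.S < p.S2 := by
            intro c c' hc hc'
            have : (c' + 1) * p.S ≤ p.S * p.S := Nat.mul_le_mul_right _ hc'
            unfold S2
            nlinarith
          have h6 : c + c' * p.S = d + d' * p.S := by
            rw [← Nat.mod_eq_of_lt (lt c c' hc hc'), ← Nat.mod_eq_of_lt (lt d d' hd hd')]
            exact h5
          have h7 := congrArg (· % p.S) h6
          have h8 := congrArg (· / p.S) h6
          simp only [Nat.add_mul_mod_self_right, Nat.mod_eq_of_lt hc, Nat.mod_eq_of_lt hd] at h7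
          simp only [Nat.add_mul_div_right _ _ hS, Nat.div_eq_of_lt hc, Nat.div_eq_of_lt hd,
            Nat.zero_add] at h8
          subst h7 h8
          rw [← e₁, ← e₃]
    _ = p.n * p.n := by rw [Finset.card_product, Finset.card_range]

/-- There is room for all blocks. -/
theorem sum_blocks_le (hR : 0 < p.R) (hS : 0 < p.S) :
    ∑ u ∈ Finset.range p.S2, p.nbA u * p.nbB u ≤ 4 * p.S2 := by
  have hb : 0 < p.b := Nat.succ_pos _
  have hn := n_le_S_mul_b (p := p) hS
  refine Nat.le_of_mul_le_mul_left (c := p.b * p.b) ?_ (Nat.mul_pos hb hb)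
  -- Expanding the product of the two numbers of chunks gives four terms. Since `n ≤ S * b`, each of
  -- them contributes at most `b ^ 2 * S ^ 2` to the sum over `u`.
  have h1 : ∀ u, p.b * p.b * (p.nbA u * p.nbB u)
      ≤ (p.LA u).length * (p.LB u).length + p.b * (p.LA u).length + p.b * (p.LB u).length
        + p.b * p.b := by
    intro u
    have e1 := Nat.div_mul_le_self (p.LA u).length p.b
    have e2 := Nat.div_mul_le_self (p.LB u).length p.b
    have e3 := Nat.mul_le_mul e1 e2
    unfold nbA nbB
    nlinarith
  have hA : ∑ u ∈ Finset.range p.S2, (p.LA u).length ≤ p.S * p.n := by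
    have := sum_length_bucket_le (evs p.n p.S 0) (fun e => p.elA e.1 e.2)
      (fun e => p.colA e.1 e.2) p.S2
    rwa [length_evs] at this
  have hB : ∑ u ∈ Finset.range p.S2, (p.LB u).length ≤ p.S * p.n := by
    have := sum_length_bucket_le (evs p.n p.S 0) (fun e => p.elB e.1 e.2)
      (fun e => p.colB e.1 e.2) p.S2
    rwa [length_evs] at this
  rw [Finset.mul_sum]
  refine (Finset.sum_le_sum fun u _ => h1 u).trans ?_
  rw [Finset.sum_add_distrib, Finset.sum_add_distrib, Finset.sum_add_distrib, ← Finset.mul_sum,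
    ← Finset.mul_sum, Finset.sum_const, Finset.card_range, smul_eq_mul]
  have h2 := sum_length_mul_length_le (p := p) hR hS
  have h3 : p.n * p.n ≤ (p.S * p.b) * (p.S * p.b) := Nat.mul_le_mul hn hn
  have h4 : p.b * (p.S * p.n) ≤ p.b * (p.S * (p.S * p.b)) := by gcongr
  have h5 := Nat.mul_le_mul_left p.b hA
  have h6 := Nat.mul_le_mul_left p.b hB
  have h7 : (p.S * p.b) * (p.S * p.b) = p.b * p.b * p.S2 := by rw [S2]; ring
  have h8 : p.b * (p.S * (p.S * p.b)) = p.b * p.b * p.S2 := by rw [S2]; ring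
  have h9 : p.S2 * (p.b * p.b) = p.b * p.b * p.S2 := by ring
  rw [h9]
  linarith

end Par

namespace Par

variable (p : Par)

/-! ### The array of colours -/

/-- The header lists all colours of the first kind and, after a gap, those of the second kind. -/
def hdr (q : ℕ) : ℕ :=
  if q < 1 + p.nA then q
  else if 1 + p.nA + p.thr ≤ q ∧ q < 1 + p.nA + p.thr + p.R * p.S then q - p.thr else 0

/-- A block `(u, i, j)` holds the `i`-th chunk of `LA u` and the `j`-th chunk of `LB u`. -/
def blockCell (e : ℕ × ℕ × ℕ) (r : ℕ) : ℕ :=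
  if r < p.b then (p.LA e.1).getD (e.2.1 * p.b + r) 0
  else if r < p.b + p.b then (p.LB e.1).getD (e.2.2 * p.b + (r - p.b)) 0 else 0

/-- The array with the blocks in the list `E`. -/
def cell (E : List (ℕ × ℕ × ℕ)) (q : ℕ) : ℕ :=
  if q < p.base then p.hdr q
  else match E[(q - p.base) / p.W]? with
    | none => 0
    | some e => p.blockCell e ((q - p.base) % p.W)

def blocks : List (ℕ × ℕ × ℕ) :=
  (List.range p.S2).flatMap fun u => (List.range (p.nbA u)).flatMap fun i =>
    (List.range (p.nbB u)).map fun j => (u, i, j)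

def X : ℕ → ℕ := p.cell p.blocks

variable {p}

theorem b_pos : 0 < p.b := Nat.succ_pos _
theorem W_pos : 0 < p.W := by have := b_pos (p := p); unfold W; omega
theorem base_le_N : p.base ≤ p.N := Nat.le_add_right _ _

theorem length_blocks : p.blocks.length = ∑ u ∈ Finset.range p.S2, p.nbA u * p.nbB u := by
  simp only [blocks, List.length_flatMap, List.length_map, List.length_range, List.map_const',
    List.sum_replicate, smul_eq_mul]
  rfl

theorem length_blocks_le (hR : 0 < p.R) (hS : 0 < p.S) : p.blocks.length ≤ 4 * p.S2 := by
  rw [length_blocks]; exact sum_blocks_le hR hS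

theorem mem_LA (hR : 0 < p.R) (hS : 0 < p.S) {u a : ℕ} (h : a ∈ p.LA u) : 1 ≤ a ∧ a ≤ p.nA := by
  obtain ⟨e, he, -, rfl⟩ := mem_bucket.1 h
  rw [mem_evs] at he
  exact colA_le hR hS he.2 he.1

theorem mem_LB (hR : 0 < p.R) (hS : 0 < p.S) {u a : ℕ} (h : a ∈ p.LB u) :
    1 + p.nA ≤ a ∧ a < 1 + p.nA + p.R * p.S := by
  obtain ⟨e, he, -, rfl⟩ := mem_bucket.1 h
  rw [mem_evs] at he
  have h1 : p.fB e.1 e.2 / p.S2 < p.R := by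
    rw [Nat.div_lt_iff_lt_mul (S2_pos hS)]
    exact Nat.mod_lt _ (P_pos hR hS)
  have h2 : (e.1 + 1) * p.R ≤ p.S * p.R := Nat.mul_le_mul_right _ he.1
  have h3 : (e.1 + 1) * p.R = e.1 * p.R + p.R := by ring
  rw [Nat.mul_comm p.R p.S]
  simp only [colB]
  generalize p.fB e.1 e.2 / p.S2 = g at *
  omega

theorem getD_mem {l : List ℕ} {i a : ℕ} (h : l.getD i 0 = a) (ha : a ≠ 0) : a ∈ l := by
  rw [List.getD_eq_getElem?_getD] at h
  by_cases hi : i < l.length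
  · rw [List.getElem?_eq_getElem hi] at h
    exact h ▸ List.getElem_mem hi
  · rw [List.getElem?_eq_none (by omega)] at h
    exact absurd h.symm ha

theorem X_of_lt {q : ℕ} (h : q < p.base) : p.X q = p.hdr q := if_pos h

/-- A nonzero entry behind the header belongs to a block. -/
theorem X_of_ge {q : ℕ} (h : p.base ≤ q) (h0 : p.X q ≠ 0) :
    ∃ (k r : ℕ) (e : ℕ × ℕ × ℕ), q = p.base + k * p.W + r ∧ r < p.b + p.b ∧ p.blocks[k]? = some e ∧
      p.X q = p.blockCell e r := by
  have hX : p.X q = _ := if_neg (not_lt.2 h)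
  rw [hX] at h0 ⊢
  cases he : p.blocks[(q - p.base) / p.W]? with
  | none => rw [he] at h0; exact absurd rfl h0
  | some e =>
    rw [he] at h0
    refine ⟨(q - p.base) / p.W, (q - p.base) % p.W, e, ?_, ?_, he, rfl⟩
    · have := Nat.div_add_mod' (q - p.base) p.W
      omega
    · by_contra hr
      refine h0 ?_
      simp only [blockCell]
      rw [if_neg (by omega), if_neg (by omega)]

theorem X_block {k r : ℕ} {e : ℕ × ℕ × ℕ} (hr : r < p.W) (he : p.blocks[k]? = some e) :
    p.X (p.base + k * p.W + r) = p.blockCell e r := by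
  have hX : p.X (p.base + k * p.W + r) = _ := if_neg (by omega)
  rw [hX]
  have h1 : p.base + k * p.W + r - p.base = r + k * p.W := by omega
  rw [h1, Nat.add_mul_div_right _ _ W_pos, Nat.div_eq_of_lt hr, Nat.zero_add,
    Nat.add_mul_mod_self_right, Nat.mod_eq_of_lt hr, he]

theorem colours_lt_N : 1 + p.nA + p.R * p.S ≤ p.N := by
  have := base_le_N (p := p)
  unfold base at this
  omega

theorem X_lt (hR : 0 < p.R) (hS : 0 < p.S) (q : ℕ) : p.X q < p.N := by
  have hc := colours_lt_N (p := p)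
  by_cases h0 : p.X q = 0
  · omega
  by_cases hq : q < p.base
  · rw [X_of_lt hq] at h0 ⊢
    unfold hdr at h0 ⊢
    split_ifs at h0 ⊢ <;> omega
  · obtain ⟨k, r, e, -, -, -, h⟩ := X_of_ge (not_lt.1 hq) h0
    rw [h] at h0 ⊢
    simp only [blockCell] at h0 ⊢
    split_ifs at h0 ⊢
    · have := mem_LA hR hS (getD_mem rfl h0); omega
    · have := mem_LB hR hS (getD_mem rfl h0); omega
    · exact absurd rfl h0

theorem X_eq_zero (hR : 0 < p.R) (hS : 0 < p.S) {q : ℕ} (hq : p.N ≤ q) : p.X q = 0 := by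
  by_contra h0
  obtain ⟨k, r, e, rfl, hr, he, -⟩ := X_of_ge (base_le_N.trans hq) h0
  have h1 := (List.getElem?_eq_some_iff.1 he).1
  have h2 := length_blocks_le (p := p) hR hS
  have h3 : (k + 1) * p.W ≤ 4 * p.S2 * p.W := Nat.mul_le_mul_right _ (by omega)
  have h4 : (k + 1) * p.W = k * p.W + p.W := by ring
  unfold N at hq
  have h5 : p.b + p.b ≤ p.W := by unfold W; omega
  omega

theorem X_colourA {a : ℕ} (ha : a ≤ p.nA) : p.X a = a := by
  rw [X_of_lt (by unfold base; omega), hdr, if_pos (by omega)]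

theorem X_colourB {j : ℕ} (hj : j < p.R * p.S) : p.X (1 + p.nA + p.thr + j) = 1 + p.nA + j := by
  by_cases ht : p.thr = 0
  · rw [X_of_lt (by unfold base; omega), hdr]
    rw [if_neg (by omega), if_pos (by omega)]
    omega
  · rw [X_of_lt (by unfold base; omega), hdr]
    rw [if_neg (by omega), if_pos (by omega)]
    omega

/-- Colours that occur close to each other have a common element. -/
theorem exists_common_of_near (hR : 0 < p.R) (hS : 0 < p.S) {q q' : ℕ}
    (h1 : 1 ≤ p.X q) (h2 : p.X q ≤ p.nA) (h3 : 1 + p.nA ≤ p.X q')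
    (hd : Nat.dist q q' ≤ p.thr) : ∃ u, p.X q ∈ p.LA u ∧ p.X q' ∈ p.LB u := by
  rw [Nat.dist] at hd
  by_cases hq : q < p.base
  · have e1 := X_of_lt hq
    -- Within the header, the gap keeps colours of the first kind more than `thr` away from those of
    -- the second kind; a second gap separates the header from the blocks.
    have hqa : q ≤ p.nA := by
      rw [e1] at h1 h2
      unfold hdr at h1 h2
      split_ifs at h1 h2 <;> omega
    by_cases hq' : q' < p.base
    · rw [X_of_lt hq'] at h3
      unfold hdr at h3
      split_ifs at h3 <;> omega
    · unfold base at hq'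
      omega
  · obtain ⟨k, r, e, hk, hr, he, hX⟩ := X_of_ge (not_lt.1 hq) (by omega)
    by_cases hq' : q' < p.base
    · rw [X_of_lt hq'] at h3
      have hb : p.base = 1 + p.nA + p.thr + p.R * p.S + p.thr := rfl
      unfold hdr at h3
      split_ifs at h3 <;> omega
    · obtain ⟨k', r', e', hk', hr', he', hX'⟩ := X_of_ge (not_lt.1 hq') (by omega)
      -- Blocks start at multiples of `W = 2 * b + thr` and use offsets below `2 * b` only, so
      -- positions used by different blocks are more than `thr` apart.
      have hkk : k = k' := by
        by_contra hne
        have hW : p.W = p.b + p.b + p.thr := rfl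
        rcases Nat.lt_or_gt_of_ne hne with hlt | hlt
        · have := Nat.mul_le_mul_right p.W (show k + 1 ≤ k' from hlt)
          have h4 : (k + 1) * p.W = k * p.W + p.W := by ring
          omega
        · have := Nat.mul_le_mul_right p.W (show k' + 1 ≤ k from hlt)
          have h4 : (k' + 1) * p.W = k' * p.W + p.W := by ring
          omega
      subst hkk
      rw [he] at he'
      obtain rfl := Option.some.inj he'
      refine ⟨e.1, ?_, ?_⟩
      · rw [hX] at h1 h2 ⊢
        simp only [blockCell] at h1 h2 ⊢
        split_ifs at h1 h2 ⊢
        · exact getD_mem rfl (by omega)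
        · have := mem_LB hR hS (getD_mem rfl (Nat.one_le_iff_ne_zero.1 h1)); omega
      · rw [hX'] at h3 ⊢
        simp only [blockCell] at h3 ⊢
        split_ifs at h3 ⊢
        · have := mem_LA hR hS (getD_mem rfl (lt_of_lt_of_le (by omega) h3).ne'); omega
        · exact getD_mem rfl (by omega)

/-- Colours with a common element occur close to each other. -/
theorem exists_near_of_common (hR : 0 < p.R) (hS : 0 < p.S) {u a a' : ℕ} (hu : u < p.S2)
    (ha : a ∈ p.LA u) (ha' : a' ∈ p.LB u) :
    ∃ q q', q < p.N ∧ q' < p.N ∧ p.X q = a ∧ p.X q' = a' ∧ Nat.dist q q' ≤ p.b + p.b := by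
  obtain ⟨i, hi, rfl⟩ := List.mem_iff_getElem.1 ha
  obtain ⟨j, hj, rfl⟩ := List.mem_iff_getElem.1 ha'
  have hb := b_pos (p := p)
  have hmem : (u, i / p.b, j / p.b) ∈ p.blocks := by
    simp only [blocks, List.mem_flatMap, List.mem_range, List.mem_map, Prod.mk.injEq]
    exact ⟨u, hu, _, Nat.lt_succ_of_le (Nat.div_le_div_right hi.le), _,
      Nat.lt_succ_of_le (Nat.div_le_div_right hj.le), rfl, rfl, rfl⟩
  obtain ⟨k, hk⟩ := List.mem_iff_getElem?.1 hmem
  have him := Nat.mod_lt i hb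
  have hjm := Nat.mod_lt j hb
  have hW : p.W = p.b + p.b + p.thr := rfl
  have e1 := X_block (p := p) (r := i % p.b) (by omega) hk
  have e2 := X_block (p := p) (r := p.b + j % p.b) (by omega) hk
  have e3 : p.blockCell (u, i / p.b, j / p.b) (i % p.b) = (p.LA u)[i] := by
    simp only [blockCell]
    rw [if_pos him, Nat.div_add_mod', List.getD_eq_getElem _ _ hi]
  have e4 : p.blockCell (u, i / p.b, j / p.b) (p.b + j % p.b) = (p.LB u)[j] := by
    simp only [blockCell]
    rw [if_neg (by omega), if_pos (by omega), Nat.add_sub_cancel_left, Nat.div_add_mod',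
      List.getD_eq_getElem _ _ hj]
  rw [e3] at e1
  rw [e4] at e2
  have hlt : ∀ q, p.X q ≠ 0 → q < p.N := fun q h => by
    by_contra h'
    exact h (X_eq_zero hR hS (not_lt.1 h'))
  refine ⟨_, _, hlt _ ?_, hlt _ ?_, e1, e2, ?_⟩
  · rw [e1]; have := mem_LA hR hS ha; omega
  · rw [e2]; have := mem_LB hR hS ha'; omega
  · rw [Nat.dist]; omega

end Par

/-! ### The commands of the reduction -/

namespace Imp

open Par

variable {w : ℕ}

@[simp] theorem setV_v (σ : Env) (r x k : ℕ) : (σ.setV r x).v k = if k = r then x else σ.v k := by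
  simp [Env.setV, Function.update_apply]
@[simp] theorem setV_a (σ : Env) (r x : ℕ) : (σ.setV r x).a = σ.a := rfl
@[simp] theorem setV_t (σ : Env) (r x : ℕ) : (σ.setV r x).t = σ.t := rfl
@[simp] theorem setA_v (σ : Env) (a i x : ℕ) : (σ.setA a i x).v = σ.v := rfl
@[simp] theorem setA_t (σ : Env) (a i x : ℕ) : (σ.setA a i x).t = σ.t := rfl
@[simp] theorem setA_a (σ : Env) (a i x b : ℕ) :
    (σ.setA a i x).a b = if b = a then Function.update (σ.a a) i x else σ.a b := by
  simp [Env.setA, Function.update_apply]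
@[simp] theorem tick_v (σ : Env) (k : ℕ) : (σ.tick k).v = σ.v := rfl
@[simp] theorem tick_a (σ : Env) (k : ℕ) : (σ.tick k).a = σ.a := rfl
@[simp] theorem tick_t (σ : Env) (k : ℕ) : (σ.tick k).t = σ.t + k := rfl

section
variable (σ : Env)
@[simp] theorem eval_lit (k : ℕ) : (Expr.lit k).eval w σ = k := rfl
@[simp] theorem eval_var (k : ℕ) : (Expr.var k).eval w σ = σ.v k := rfl
@[simp] theorem eval_wlen : Expr.wlen.eval w σ = w := rfl
@[simp] theorem eval_get (a : ℕ) (e : Expr) : (Expr.get a e).eval w σ = σ.a a (e.eval w σ) := rfl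
@[simp] theorem eval_add (e f : Expr) : (e + f).eval w σ = e.eval w σ + f.eval w σ := rfl
@[simp] theorem eval_mul (e f : Expr) : (e * f).eval w σ = e.eval w σ * f.eval w σ := rfl
@[simp] theorem eval_div (e f : Expr) : (e / f).eval w σ = e.eval w σ / f.eval w σ := rfl
@[simp] theorem eval_mod (e f : Expr) : (e % f).eval w σ = e.eval w σ % f.eval w σ := rfl
@[simp] theorem eval_bin (o : Bop) (e f : Expr) :
    (Expr.bin o e f).eval w σ = o.eval w (e.eval w σ) (f.eval w σ) := rfl
end

section
variable (V : ℕ) (e f : Expr)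
theorem litsBelow_div : (e / f).litsBelow V = (e.litsBelow V ∧ f.litsBelow V) := rfl
end

@[simp] theorem cost_lit (k : ℕ) : (Expr.lit k).cost = 1 := rfl
@[simp] theorem cost_var (k : ℕ) : (Expr.var k).cost = 1 := rfl
@[simp] theorem cost_wlen : Expr.wlen.cost = 1 := rfl
@[simp] theorem cost_get (a : ℕ) (e : Expr) : (Expr.get a e).cost = e.cost + 1 := rfl
@[simp] theorem cost_add (e f : Expr) : (e + f).cost = e.cost + (f.cost + 1) := rfl
@[simp] theorem cost_mul (e f : Expr) : (e * f).cost = e.cost + (f.cost + 1) := rfl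
@[simp] theorem cost_div (e f : Expr) : (e / f).cost = e.cost + (f.cost + 1) := rfl
@[simp] theorem cost_mod (e f : Expr) : (e % f).cost = e.cost + (f.cost + 1) := rfl
@[simp] theorem cost_bin (o : Bop) (e f : Expr) :
    (Expr.bin o e f).cost = e.cost + (f.cost + 1) := rfl

@[simp] theorem run_skip (σ : Env) : run w .skip σ = σ.tick 1 := rfl
@[simp] theorem run_set (r : ℕ) (e : Expr) (σ : Env) :
    run w (.set r e) σ = (σ.setV r (e.eval w σ)).tick (e.cost + 1) := rfl
@[simp] theorem run_put (a : ℕ) (i e : Expr) (σ : Env) :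
    run w (.put a i e) σ = (σ.setA a (i.eval w σ) (e.eval w σ)).tick (i.cost + (e.cost + 1)) := rfl
@[simp] theorem run_seq (c d : Cmd) (σ : Env) : run w (.seq c d) σ = run w d (run w c σ) := rfl
theorem run_ite (e : Expr) (c d : Cmd) (σ : Env) : run w (.ite e c d) σ =
    if e.eval w σ ≠ 0 then run w c (σ.tick (e.cost + 1)) else run w d (σ.tick (e.cost + 1)) := rfl

/-! ### Lists in memory -/

/-- The arrays `ca` and `da` hold the lists `F k`: their lengths, and their entries from cell
`k * s` on, followed by zeros. -/
def Lists (σ : Env) (ca da s : ℕ) (F : ℕ → List ℕ) : Prop :=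
  (∀ k, σ.a ca k = (F k).length) ∧ ∀ k, ∀ j < s, σ.a da (k * s + j) = (F k).getD j 0

/-- Append variable `v` to the list with number `k` (a variable). -/
def app (ca da k v : ℕ) : Cmd :=
  .seq (.put da (.var k * .var 17 + .get ca (.var k)) (.var v))
    -- The remainder modulo `cap`, which is in variable 11, never changes the count; it is there to
    -- bound its degree.
    (.put ca (.var k) ((.get ca (.var k) + .lit 1) % .var 11))

@[simp] theorem run_app_v (ca da k v : ℕ) (σ : Env) : (run w (app ca da k v) σ).v = σ.v := rfl
@[simp] theorem run_app_t (ca da k v : ℕ) (σ : Env) : (run w (app ca da k v) σ).t = σ.t + 16 := rfl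
theorem run_app_a {ca da k v x : ℕ} (h : x ≠ ca) (h' : x ≠ da) (σ : Env) :
    (run w (app ca da k v) σ).a x = σ.a x :=
  run_a _ (by simp [app, Cmd.wa, h, h'])

theorem mul_add_injective {s k k' j j' : ℕ} (hj : j < s) (hj' : j' < s)
    (h : k * s + j = k' * s + j') : k = k' ∧ j = j' := by
  have h1 := congrArg (· / s) h
  have h2 := congrArg (· % s) h
  have hs : 0 < s := by omega
  simp only [Nat.mul_comm _ s, Nat.mul_add_div hs, Nat.div_eq_of_lt hj, Nat.div_eq_of_lt hj',
    Nat.mul_add_mod, Nat.mod_eq_of_lt hj, Nat.mod_eq_of_lt hj', Nat.add_zero] at h1 h2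
  exact ⟨h1, h2⟩

theorem getD_append_singleton (l : List ℕ) (x j : ℕ) :
    (l ++ [x]).getD j 0 = if j = l.length then x else l.getD j 0 := by
  simp only [List.getD_eq_getElem?_getD]
  rcases Nat.lt_trichotomy j l.length with h | h | h
  · rw [List.getElem?_append_left h, if_neg h.ne]
  · subst h; simp
  · rw [if_neg h.ne', List.getElem?_eq_none (by simp; omega), List.getElem?_eq_none h.le]

theorem Lists.run_app {σ : Env} {ca da s k v : ℕ} {F : ℕ → List ℕ} (h : Lists σ ca da s F)
    (hs : σ.v 17 = s) (hc : ca ≠ da) (hlen : (F (σ.v k)).length < s) (hcap : s < σ.v 11) :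
    Lists (run w (app ca da k v) σ) ca da s
      (Function.update F (σ.v k) (F (σ.v k) ++ [σ.v v])) := by
  have e1 : ∀ x, (run w (app ca da k v) σ).a ca x
      = if x = σ.v k then (F (σ.v k)).length + 1 else (F x).length := by
    intro x
    have : (σ.a ca (σ.v k) + 1) % σ.v 11 = (F (σ.v k)).length + 1 := by
      rw [h.1, Nat.mod_eq_of_lt (by omega)]
    simp only [app, run_seq, run_put, tick_a, setA_a, eval_var, eval_mod, eval_add, eval_get,
      eval_lit, if_true, if_neg hc, this, tick_v, setA_v, Function.update_apply, h.1 x]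
  have e2 : ∀ x, (run w (app ca da k v) σ).a da x
      = if x = σ.v k * s + (F (σ.v k)).length then σ.v v else σ.a da x := by
    intro x
    simp only [app, run_seq, run_put, tick_a, setA_a, eval_var, eval_mul, eval_add, eval_get,
      if_true, if_neg hc.symm, hs, Function.update_apply, h.1]
  refine ⟨fun x => ?_, fun x j hj => ?_⟩
  · rw [e1]
    by_cases hx : x = σ.v k
    · subst hx; simp
    · simp [hx]
  · rw [e2]
    by_cases hx : x = σ.v k
    · rw [hx, Function.update_self, getD_append_singleton]
      by_cases hj' : j = (F (σ.v k)).length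
      · simp [hj']
      · rw [if_neg (by omega), if_neg hj', h.2 _ _ hj]
    · rw [Function.update_of_ne hx, if_neg, h.2 _ _ hj]
      intro h'
      exact hx (mul_add_injective hj hlen h').1

theorem Lists.congr {σ τ : Env} {ca da s : ℕ} {F : ℕ → List ℕ} (h : Lists σ ca da s F)
    (h1 : τ.a ca = σ.a ca) (h2 : τ.a da = σ.a da) : Lists τ ca da s F := by
  unfold Lists
  rw [h1, h2]
  exact h

theorem Lists.nil {σ : Env} {ca da s : ℕ} (h1 : σ.a ca = 0) (h2 : σ.a da = 0) :
    Lists σ ca da s fun _ => [] := by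
  simp [Lists, h1, h2]

/-! ### The programs -/

/-- The parameters are in memory. -/
structure Ctx (p : Par) (σ : Env) : Prop where
  n : σ.v 1 = p.n
  R : σ.v 3 = p.R
  S : σ.v 4 = p.S
  S2 : σ.v 5 = p.S2
  P : σ.v 6 = p.P
  B : σ.v 7 = p.B
  b : σ.v 8 = p.b
  W : σ.v 9 = p.W
  thr : σ.v 10 = p.thr
  cap : σ.v 11 = p.cap
  N : σ.v 12 = p.N
  R2 : σ.v 13 = p.R2
  nA : σ.v 14 = p.nA
  base : σ.v 15 = p.base
  m : σ.v 16 = p.m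
  st : σ.v 17 = p.st
  HH : σ.v 18 = p.HH
  P1 : σ.v 20 = p.P - 1
  h : σ.a 2 = p.h

/-- Variables 1 to 20 are reserved for the input length, the random word and the parameters.
Variable 0 is exempt because the verification writes its verdict there. -/
theorem Ctx.congr {p : Par} {σ τ : Env} (h : Ctx p σ) (hv : ∀ x < 21, x ≠ 0 → τ.v x = σ.v x)
    (ha : τ.a 2 = σ.a 2) : Ctx p τ where
  n := (hv _ (by norm_num) (by norm_num)).trans h.n
  R := (hv _ (by norm_num) (by norm_num)).trans h.R
  S := (hv _ (by norm_num) (by norm_num)).trans h.S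
  S2 := (hv _ (by norm_num) (by norm_num)).trans h.S2
  P := (hv _ (by norm_num) (by norm_num)).trans h.P
  B := (hv _ (by norm_num) (by norm_num)).trans h.B
  b := (hv _ (by norm_num) (by norm_num)).trans h.b
  W := (hv _ (by norm_num) (by norm_num)).trans h.W
  thr := (hv _ (by norm_num) (by norm_num)).trans h.thr
  cap := (hv _ (by norm_num) (by norm_num)).trans h.cap
  N := (hv _ (by norm_num) (by norm_num)).trans h.N
  R2 := (hv _ (by norm_num) (by norm_num)).trans h.R2
  nA := (hv _ (by norm_num) (by norm_num)).trans h.nA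
  base := (hv _ (by norm_num) (by norm_num)).trans h.base
  m := (hv _ (by norm_num) (by norm_num)).trans h.m
  st := (hv _ (by norm_num) (by norm_num)).trans h.st
  HH := (hv _ (by norm_num) (by norm_num)).trans h.HH
  P1 := (hv _ (by norm_num) (by norm_num)).trans h.P1
  h := ha.trans h.h

/-- A command does not touch the parameters. -/
def Cmd.low (c : Cmd) : Bool := c.wv.all (fun x => decide (21 ≤ x ∨ x = 0)) && !c.wa.contains 2

theorem Cmd.low_spec {c : Cmd} (h : c.low = true) : (∀ x < 21, x ≠ 0 → x ∉ c.wv) ∧ 2 ∉ c.wa := by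
  simp only [Cmd.low, Bool.and_eq_true, List.all_eq_true, decide_eq_true_eq, Bool.not_eq_true',
    List.contains_eq_mem, decide_eq_false_iff_not] at h
  exact ⟨fun x hx hx0 hm => by have := h.1 x hm; omega, h.2⟩

theorem Ctx.run {p : Par} {σ : Env} (h : Ctx p σ) {c : Cmd} (hc : c.low = true) :
    Ctx p (run w c σ) :=
  h.congr (fun x hx hx0 => run_v c ((Cmd.low_spec hc).1 x hx hx0)) (run_a c (Cmd.low_spec hc).2)

/-- The loop rule with parameters. -/
theorem run_for_ctx {p : Par} {c : Cmd} {r : ℕ} {e : Expr} {σ : Env} (hσ : Ctx p σ)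
    (hc : (Cmd.rep r e c).low = true) (I : ℕ → Env → Prop)
    (h0 : I 0 (σ.tick (e.cost + 3)))
    (hs : ∀ i < e.eval w σ, ∀ τ : Env, (∀ x, x ∉ (Cmd.rep r e c).wv → τ.v x = σ.v x) →
      (∀ a, a ∉ c.wa → τ.a a = σ.a a) → Ctx p (τ.setV r i) → I i τ →
      I (i + 1) ((run w c (τ.setV r i)).tick 5)) :
    I (e.eval w σ) (run w (.rep r e c) σ) := by
  refine run_for I h0 fun i hi τ hv ha hI => hs i hi τ hv ha ?_ hI
  have hl := Cmd.low_spec hc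
  refine hσ.congr (fun x hx hx0 => ?_) (ha 2 hl.2)
  rw [setV_v, if_neg, hv x (hl.1 x hx hx0)]
  rintro rfl
  exact hl.1 x hx hx0 (List.mem_cons_self)

def cKeys : Cmd := .rep 21 (.var 1) (.seq (.set 25 (.get 2 (.var 21))) (app 4 6 25 21))

/-- Counting sort by buckets, for the shift in variable 35: array 8 first counts the buckets,
`cPrefix` replaces the counts by starting positions, and `cSlot` advances these as it assigns
positions. -/
def cCount : Cmd :=
  .rep 21 (.var 1) (.seq
    (.set 25 (.var 35 * .var 3 + (.var 35 + .var 20 * .get 2 (.var 21)) % .var 6 / .var 5))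
    (.put 8 (.var 25) ((.get 8 (.var 25) + .lit 1) % .var 11)))

def cPrefix : Cmd :=
  .seq (.set 31 (.lit 0)) (.rep 23 (.var 3)
    (.seq (.set 25 (.var 35 * .var 3 + .var 23))
    (.seq (.set 27 (.get 8 (.var 25)))
    (.seq (.put 8 (.var 25) (.var 31))
      (.set 31 ((.var 31 + .var 27) % .var 11))))))

def cSlot : Cmd :=
  .seq (.set 28 ((.var 35 + .var 20 * .get 2 (.var 21)) % .var 6))
  (.seq (.set 25 (.var 35 * .var 3 + .var 28 / .var 5))
  (.seq (.set 27 (.get 8 (.var 25)))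
  (.seq (.put 8 (.var 25) ((.var 27 + .lit 1) % .var 11))
  (.seq (.set 29 (.lit 1 + .var 35 * .var 13 + (.var 28 / .var 5 + .var 27 / .var 7)))
    (.put 22 (.var 29) (.var 28 / .var 5))))))

def cAssign : Cmd :=
  .rep 21 (.var 1) (.seq cSlot (.seq (app 10 12 29 21) (.seq (.set 26 (.var 28 % .var 5))
    (app 14 16 26 29))))

def cA : Cmd := .rep 35 (.var 4) (.seq cCount (.seq cPrefix cAssign))

def cB : Cmd := .rep 35 (.var 4) (.rep 21 (.var 1)
  (.seq (.set 28 ((.get 2 (.var 21) + .var 20 * (.var 35 * .var 4)) % .var 6))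
  (.seq (.set 29 (.lit 1 + .var 14 + (.var 35 * .var 3 + .var 28 / .var 5)))
  (.seq (.set 26 (.var 28 % .var 5))
    (app 18 20 26 29)))))

def cHead : Cmd :=
  .seq (.rep 21 (.lit 1 + .var 14) (.put 1 (.var 21) (.var 21)))
    (.rep 21 (.var 3 * .var 4)
      (.put 1 (.lit 1 + .var 14 + .var 10 + .var 21) (.lit 1 + .var 14 + .var 21)))

/-- Variable 30 is the start of the block. Reading behind the end of a list yields 0, the filler
colour, so incomplete chunks need no special treatment. -/
def cBlock : Cmd :=
  .seq (.rep 24 (.var 8)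
      (.seq (.put 1 (.var 30 + .var 24) (.get 16 (.var 36 * .var 17 + (.var 21 * .var 8 + .var 24))))
        (.put 1 (.var 30 + (.var 8 + .var 24))
          (.get 20 (.var 36 * .var 17 + (.var 23 * .var 8 + .var 24))))))
    (.set 30 ((.var 30 + .var 9) % .var 11))

def cEmit : Cmd :=
  .seq (.set 30 (.var 15)) (.rep 36 (.var 5) (.rep 21 (.get 14 (.var 36) / .var 8 + .lit 1)
    (.rep 23 (.get 18 (.var 36) / .var 8 + .lit 1) cBlock)))

def cQuery : Cmd :=
  .rep 21 (.var 16)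
    (.seq (.set 22 (.var 21 / (.var 13 * .lit 8)))
    (.seq (.set 23 (.var 21 / .var 13 % .lit 8))
    (.seq (.set 24 (.var 21 % .var 13))
    (.seq (.set 25 ((.get 2 (.var 22) + .var 23 / .lit 2 * .var 18 + .var 20 * (.var 23 % .lit 2)) % .var 6))
    (.seq (.put 28 (.var 21) (.var 25))
    (.seq (.set 26 (.lit 1 + .var 25 % .var 4 * .var 13 + .var 24))
    (.seq (.put 24 (.var 21) (.var 26))
      (.put 26 (.var 21) (.lit 1 + .var 14 + (.var 25 / .var 4 % .var 4 * .var 3 +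
        (.get 22 (.var 26) + .var 25 / .var 5) % .var 3)))))))))) 

/-- The construction of the array of colours and of the queries. -/
def cBuild : Cmd :=
  .seq cKeys (.seq cA (.seq cB (.seq cHead (.seq cEmit cQuery))))

/-- The sum is compared modulo `2 ^ w` only. Signed overflow needs no test here, since the matching
of the hash values, which include the signs, excludes it. -/
def cTest : Cmd :=
  .ite (.bin .eq (.bin .addw (.get 0 (.var 27)) (.get 0 (.var 29))) (.get 0 (.var 22)))
    (.ite (.bin .eq (.var 27) (.var 29)) .skip
      (.ite (.bin .eq (.var 27) (.var 22)) .skip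
        (.ite (.bin .eq (.var 29) (.var 22)) .skip (.set 0 (.lit 1))))) .skip

/-- For each member of the first colour, the hash value of a partner is computed, and the list of
all elements with that hash value is searched. -/
def cVerify : Cmd :=
  .seq (.set 26 (.get 24 (.var 21)))
  (.seq (.set 22 (.var 21 / (.var 13 * .lit 8)))
  (.rep 23 (.get 10 (.var 26))
    (.seq (.set 27 (.get 12 (.var 26 * .var 17 + .var 23)))
    (.seq (.set 28 ((.get 28 (.var 21) + .var 20 * .get 2 (.var 27)) % .var 6))
    (.rep 24 (.get 4 (.var 28))
      (.seq (.set 29 (.get 6 (.var 28 * .var 17 + .var 24))) cTest))))))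

/-- The verification of the answers. -/
def cCheck : Cmd :=
  .seq (.set 0 (.lit 0)) (.rep 21 (.var 16)
    -- After a success the remaining rounds do nothing, so the cost of a successful verification is
    -- paid only once.
    (.ite (.var 0) .skip (.ite (.bin .lt (.get 30 (.var 21)) (.var 10 + .lit 1)) cVerify .skip)))

/-- The degrees of the variables and arrays. -/
def ty : Ty where
  v := fun x => [1, 1, 30, 1, 1, 2, 3, 2, 2, 5, 4, 11, 9, 2, 3, 7, 3, 4, 3, 30, 3,
    12, 12, 12, 12, 13, 16, 12, 3, 16, 11, 11].getD x 2
  a := fun x => if x = 0 ∨ x = 30 then 30 else if x = 2 then 5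
    else if x ∈ [4, 8, 10, 14, 18] then 11 else if x ∈ [6, 12] then 12
    else if x ∈ [22, 28] then 13 else 16
  pos := fun x => decide (x ∈ [3, 4, 5, 6, 11, 13])

theorem cBuild_wt : cBuild.wt ty = true := by decide
theorem cBuild_litsBelow {V : ℕ} (h : 16 ≤ V) : cBuild.litsBelow V := by
  simp only [cBuild, cKeys, cA, cCount, cPrefix, cAssign, cSlot, cB, cHead, cEmit, cBlock, cQuery, app,
    Cmd.litsBelow, litsBelow_div, Expr.litsBelow,
    and_true, true_and]
  omega

theorem cCheck_litsBelow {V : ℕ} (h : 16 ≤ V) : cCheck.litsBelow V := by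
  simp only [cCheck, cVerify, cTest,
    Cmd.litsBelow, litsBelow_div, Expr.litsBelow,
    and_true, true_and]
  omega

end Imp

/-! ### Correctness and running time of the construction -/

namespace Imp

open Par

variable {w : ℕ} {p : Par} {σ : Env}

theorem st_lt_cap (p : Par) : p.st < p.cap := by
  unfold cap N base; omega

theorem n_lt_st (hS : 0 < p.S) : p.n < p.st := by
  have := Nat.le_mul_of_pos_right p.n hS
  unfold st; omega

theorem run_cKeys (hσ : Ctx p σ) (hS : 0 < p.S) (h4 : σ.a 4 = 0) (h6 : σ.a 6 = 0) :
    Lists (run w cKeys σ) 4 6 p.st p.HL ∧ (run w cKeys σ).t ≤ σ.t + 4 + 30 * p.n := by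
  have key := run_for_ctx (w := w) hσ (by decide : cKeys.low = true)
    (fun i τ => Lists τ 4 6 p.st (bucket (List.range i) p.h id) ∧ τ.t ≤ σ.t + 4 + 30 * i)
    ⟨Lists.nil h4 h6, by simp⟩ ?_
  · simpa [hσ.n, cKeys, HL] using key
  · intro i hi τ hv ha hc ⟨hl, ht⟩
    have hin : i < p.n := by simpa [hσ.n] using hi
    set τ' := ((τ.setV 21 i).setV 25 (p.h i)).tick 3 with hτ'
    have e : run w (.set 25 (.get 2 (.var 21))) (τ.setV 21 i) = τ' := by
      simp [hτ', ← hc.h]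
    have hlen := length_bucket_le (List.range i) p.h id (p.h i)
    rw [List.length_range] at hlen
    have h17 : τ'.v 17 = p.st := by
      have := hc.st
      simpa [hτ'] using this
    have h11 : τ'.v 11 = p.cap := by
      have := hc.cap
      simpa [hτ'] using this
    have hl' : Lists τ' 4 6 p.st (bucket (List.range i) p.h id) := hl
    have := hl'.run_app (w := w) (k := 25) (v := 21) h17 (by norm_num)
      (by
        simp only [hτ', tick_v, setV_v, if_true]
        have := n_lt_st (p := p) hS
        omega)
      (by rw [h11]; exact st_lt_cap p)
    rw [run_seq, e]
    refine ⟨?_, ?_⟩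
    · rw [List.range_succ, bucket_append]
      exact this
    · simp [hτ']; omega

theorem run_cCount (hR : 0 < p.R) (hS : 0 < p.S) {c : ℕ} (hσ : Ctx p σ) (h35 : σ.v 35 = c)
    (h8 : ∀ k, c * p.R ≤ k → σ.a 8 k = 0) :
    (∀ j < p.R, (run w cCount σ).a 8 (c * p.R + j) = Nat.count (fun y => p.buck c y = j) p.n) ∧
      (∀ k, (c + 1) * p.R ≤ k → (run w cCount σ).a 8 k = 0) ∧
      (run w cCount σ).t ≤ σ.t + 4 + 60 * p.n := by
  have key := run_for_ctx (w := w) hσ (by decide : cCount.low = true)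
    (fun i τ => (∀ j < p.R, τ.a 8 (c * p.R + j) = Nat.count (fun y => p.buck c y = j) i) ∧
      (∀ k, (c + 1) * p.R ≤ k → τ.a 8 k = 0) ∧ τ.t ≤ σ.t + 4 + 60 * i)
    ⟨fun j _ => by simpa using h8 _ (Nat.le_add_right _ _),
      fun k hk => by simpa using h8 k (le_trans (Nat.mul_le_mul_right _ c.le_succ) hk), by simp⟩ ?_
  · simpa [hσ.n, cCount] using key
  · intro i hi τ hv ha hc ⟨hl, hz, ht⟩
    have hin : i < p.n := by simpa [hσ.n] using hi
    have h35' : τ.v 35 = c := (hv 35 (by decide)).trans h35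
    have h20 : τ.v 20 = p.P - 1 := by simpa using hc.P1
    have h3 : τ.v 3 = p.R := by simpa using hc.R
    have h6 : τ.v 6 = p.P := by simpa using hc.P
    have h5 : τ.v 5 = p.S2 := by simpa using hc.S2
    have h11 : τ.v 11 = p.cap := by simpa using hc.cap
    have h2 : τ.a 2 = p.h := by simpa using hc.h
    have hb : (c + (p.P - 1) * p.h i) % p.P / p.S2 = p.buck c i := rfl
    have hbR := buck_lt hR hS c i
    have hcnt := Nat.count_le (p := fun y => p.buck c y = p.buck c i) (n := i)
    have hcap : (Nat.count (fun y => p.buck c y = p.buck c i) i + 1) % p.cap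
        = Nat.count (fun y => p.buck c y = p.buck c i) i + 1 := by
      have := n_lt_st (p := p) hS
      have := st_lt_cap p
      exact Nat.mod_eq_of_lt (by omega)
    refine ⟨fun j hj => ?_, fun k hk => ?_, ?_⟩
    · simp only [run_seq, run_set, run_put, tick_a, setA_a, if_true, eval_add, eval_mul, eval_var,
        eval_div, eval_mod, eval_get, eval_lit, setV_v, setV_a, tick_v, Nat.reduceEqDiff, if_false,
        h35', h20, h3, h6, h5, h11, h2, hb, hl _ hbR, hcap, Function.update_apply, hl j hj,
        Nat.count_succ, Nat.add_left_cancel_iff]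
      split_ifs with h1 h2 h2
      · subst h1; rfl
      · exact absurd h1.symm h2
      · exact absurd h2.symm h1
      · rfl
    · simp only [run_seq, run_set, run_put, tick_a, setA_a, if_true, eval_add, eval_mul, eval_var,
        eval_div, eval_mod, eval_get, eval_lit, setV_v, setV_a, tick_v, Nat.reduceEqDiff, if_false,
        h35', h20, h3, h6, h5, h11, h2, hb, Function.update_apply, hz k hk]
      rw [if_neg]
      rw [Nat.add_mul] at hk
      omega
    · simp
      omega

theorem run_cPrefix (hS : 0 < p.S) {c : ℕ} (hσ : Ctx p σ) (h35 : σ.v 35 = c)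
    (h8 : ∀ j < p.R, σ.a 8 (c * p.R + j) = Nat.count (fun y => p.buck c y = j) p.n)
    (hz : ∀ k, (c + 1) * p.R ≤ k → σ.a 8 k = 0) :
    (∀ j < p.R, (run w cPrefix σ).a 8 (c * p.R + j) = Nat.count (fun y => p.buck c y < j) p.n) ∧
      (∀ k, (c + 1) * p.R ≤ k → (run w cPrefix σ).a 8 k = 0) ∧
      (run w cPrefix σ).t ≤ σ.t + 6 + 60 * p.R := by
  set σ' := (σ.setV 31 0).tick 2 with hσ'
  have e : run w (.set 31 (.lit 0)) σ = σ' := rfl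
  rw [cPrefix, run_seq, e]
  have hσc : Ctx p σ' := hσ.run (c := .set 31 (.lit 0)) (w := w) (by decide)
  have key := run_for_ctx (w := w) hσc (c := (.seq (.set 25 (.var 35 * .var 3 + .var 23))
      (.seq (.set 27 (.get 8 (.var 25)))
      (.seq (.put 8 (.var 25) (.var 31))
        (.set 31 ((.var 31 + .var 27) % .var 11)))))) (r := 23) (e := .var 3) (by decide)
    (fun i τ => (∀ j < p.R, τ.a 8 (c * p.R + j) = if j < i then
        Nat.count (fun y => p.buck c y < j) p.n else Nat.count (fun y => p.buck c y = j) p.n) ∧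
      (∀ k, (c + 1) * p.R ≤ k → τ.a 8 k = 0) ∧ τ.v 31 = Nat.count (fun y => p.buck c y < i) p.n ∧
      τ.t ≤ σ.t + 6 + 60 * i)
    ⟨fun j hj => by simpa [hσ'] using h8 j hj, fun k hk => by simpa [hσ'] using hz k hk,
      by simp [hσ'], by simp [hσ']⟩ ?_
  · have h3 : σ'.v 3 = p.R := hσc.R
    rw [eval_var, h3] at key
    refine ⟨fun j hj => ?_, key.2.1, key.2.2.2⟩
    rw [key.1 j hj, if_pos hj]
  · intro i hi τ hv ha hc ⟨hl, hz, hacc, ht⟩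
    have h3' : σ'.v 3 = p.R := hσc.R
    have hiR : i < p.R := by simpa [h3'] using hi
    have h35' : τ.v 35 = c := (hv 35 (by decide)).trans h35
    have h3 : τ.v 3 = p.R := by simpa using hc.R
    have h11 : τ.v 11 = p.cap := by simpa using hc.cap
    have hli : τ.a 8 (c * p.R + i) = Nat.count (fun y => p.buck c y = i) p.n := by
      rw [hl i hiR, if_neg (lt_irrefl _)]
    have hcnt := Nat.count_le (p := fun y => p.buck c y < i + 1) (n := p.n)
    have hcap : (Nat.count (fun y => p.buck c y < i) p.n
        + Nat.count (fun y => p.buck c y = i) p.n) % p.cap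
        = Nat.count (fun y => p.buck c y < i + 1) p.n := by
      have := n_lt_st (p := p) hS
      have := st_lt_cap p
      rw [count_lt_add_count_eq]
      exact Nat.mod_eq_of_lt (by omega)
    refine ⟨fun j hj => ?_, fun k hk => ?_, ?_, ?_⟩
    · simp only [run_seq, run_set, run_put, tick_a, setA_a, if_true, eval_add, eval_mul, eval_var,
        eval_get, setV_v, setV_a, tick_v, Nat.reduceEqDiff, if_false,
        h35', h3, Function.update_apply, Nat.add_left_cancel_iff, hacc, hl j hj]
      split_ifs with h1 h2 h2 <;> first | omega | (subst h1; rfl)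
    · simp only [run_seq, run_set, run_put, tick_a, setA_a, if_true, eval_add, eval_mul, eval_var,
        eval_get, setV_v, setV_a, tick_v, Nat.reduceEqDiff, if_false,
        h35', h3, Function.update_apply, hz k hk]
      rw [if_neg]
      rw [Nat.add_mul] at hk
      omega
    · simp [h35', h3, h11, hacc, hli, hcap]
    · simp
      omega

theorem evs_snd_lt {n c i : ℕ} (hi : i ≤ n) {e : ℕ × ℕ} (he : e ∈ evs n c i) : e.2 < n := by
  simp only [evs, List.mem_append, List.mem_flatMap, List.mem_range, List.mem_map] at he
  rcases he with ⟨_, _, _, h, rfl⟩ | ⟨_, h, rfl⟩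
  · exact h
  · exact lt_of_lt_of_le h hi

theorem evs_lt_st {c i : ℕ} (hc : c < p.S) (hi : i < p.n) : (evs p.n c i).length < p.st := by
  rw [length_evs, st]
  have : (c + 1) * p.n ≤ p.S * p.n := Nat.mul_le_mul_right _ hc
  have h1 : (c + 1) * p.n = c * p.n + p.n := by ring
  have h2 : p.S * p.n = p.n * p.S := Nat.mul_comm _ _
  omega

/-- The table entry of a bucket is its starting position plus the number of its elements treated so
far. When element `i` is treated, this is by definition its position. -/
theorem run_cSlot (hR : 0 < p.R) (hS : 0 < p.S) {c i : ℕ} (hc : Ctx p σ) (h35 : σ.v 35 = c)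
    (h21 : σ.v 21 = i) (hi : i < p.n)
    (hl : ∀ j < p.R, σ.a 8 (c * p.R + j) = Nat.count (fun y => p.buck c y < j) p.n
      + Nat.count (fun y => p.buck c y = j) i) :
    (∀ k, (run w cSlot σ).a 8 k = if k = c * p.R + p.buck c i then p.pos c i + 1 else σ.a 8 k) ∧
      (run w cSlot σ).v 28 = p.fA c i ∧ (run w cSlot σ).v 29 = p.colA c i ∧
      (∀ k, (run w cSlot σ).a 22 k = if k = p.colA c i then p.buck c i else σ.a 22 k) ∧
      (run w cSlot σ).t ≤ σ.t + 100 := by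
  have h20 : σ.v 20 = p.P - 1 := hc.P1
  have h3 : σ.v 3 = p.R := hc.R
  have h6 : σ.v 6 = p.P := hc.P
  have h5 : σ.v 5 = p.S2 := hc.S2
  have h7 : σ.v 7 = p.B := hc.B
  have h13 : σ.v 13 = p.R2 := hc.R2
  have h11 : σ.v 11 = p.cap := hc.cap
  have h2 : σ.a 2 = p.h := hc.h
  have hf : (c + (p.P - 1) * p.h i) % p.P = p.fA c i := rfl
  have hb : p.fA c i / p.S2 = p.buck c i := rfl
  have hbR := buck_lt hR hS c i
  have hp : σ.a 8 (c * p.R + p.buck c i) = p.pos c i := hl _ hbR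
  have hcol : 1 + c * p.R2 + (p.buck c i + p.pos c i / p.B) = p.colA c i := rfl
  have hcap : (p.pos c i + 1) % p.cap = p.pos c i + 1 := by
    have := n_lt_st (p := p) hS
    have := st_lt_cap p
    have := pos_lt (p := p) (c := c) hi
    exact Nat.mod_eq_of_lt (by omega)
  simp only [cSlot, run_seq, run_set, run_put, tick_a, setA_a, if_true, eval_add, eval_mul, eval_var,
    eval_div, eval_mod, eval_get, eval_lit, setV_v, setV_a, tick_v, setA_v, Nat.reduceEqDiff,
    if_false, h35, h21, h20, h3, h6, h5, h7, h13, h11, h2, hf, hb, hp, hcol, hcap,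
    Function.update_apply, implies_true, true_and]
  simp

theorem run_cAssign (hR : 0 < p.R) (hS : 0 < p.S) {c : ℕ} (hc : c < p.S) (hσ : Ctx p σ)
    (h35 : σ.v 35 = c)
    (h8 : ∀ j < p.R, σ.a 8 (c * p.R + j) = Nat.count (fun y => p.buck c y < j) p.n)
    (hz : ∀ k, (c + 1) * p.R ≤ k → σ.a 8 k = 0)
    (hM : Lists σ 10 12 p.st (bucket (evs p.n c 0) (fun e => p.colA e.1 e.2) Prod.snd))
    (hL : Lists σ 14 16 p.st
      (bucket (evs p.n c 0) (fun e => p.elA e.1 e.2) (fun e => p.colA e.1 e.2)))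
    (hI : ∀ e ∈ evs p.n c 0, σ.a 22 (p.colA e.1 e.2) = p.buck e.1 e.2) :
    (∀ k, (c + 1) * p.R ≤ k → (run w cAssign σ).a 8 k = 0) ∧
    Lists (run w cAssign σ) 10 12 p.st
      (bucket (evs p.n c p.n) (fun e => p.colA e.1 e.2) Prod.snd) ∧
    Lists (run w cAssign σ) 14 16 p.st
      (bucket (evs p.n c p.n) (fun e => p.elA e.1 e.2) (fun e => p.colA e.1 e.2)) ∧
    (∀ e ∈ evs p.n c p.n, (run w cAssign σ).a 22 (p.colA e.1 e.2) = p.buck e.1 e.2) ∧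
    (run w cAssign σ).t ≤ σ.t + 4 + 150 * p.n := by
  have key := run_for_ctx (w := w) hσ (by decide : cAssign.low = true)
    (fun i τ => (∀ j < p.R, τ.a 8 (c * p.R + j) = Nat.count (fun y => p.buck c y < j) p.n
        + Nat.count (fun y => p.buck c y = j) i) ∧
      (∀ k, (c + 1) * p.R ≤ k → τ.a 8 k = 0) ∧
      Lists τ 10 12 p.st (bucket (evs p.n c i) (fun e => p.colA e.1 e.2) Prod.snd) ∧
      Lists τ 14 16 p.st
        (bucket (evs p.n c i) (fun e => p.elA e.1 e.2) (fun e => p.colA e.1 e.2)) ∧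
      (∀ e ∈ evs p.n c i, τ.a 22 (p.colA e.1 e.2) = p.buck e.1 e.2) ∧
      τ.t ≤ σ.t + 4 + 150 * i)
    ⟨fun j hj => by simpa using h8 j hj, fun k hk => by simpa using hz k hk,
      hM.congr rfl rfl, hL.congr rfl rfl, hI, by simp⟩ ?_
  · rw [eval_var, hσ.n] at key
    exact key.2
  · intro i hi τ hv ha hc' ⟨hl, hz, hM, hL, hI, ht⟩
    have hin : i < p.n := by simpa [hσ.n] using hi
    have h35' : (τ.setV 21 i).v 35 = c := by simpa using (hv 35 (by decide)).trans h35
    obtain ⟨s8, s28, s29, s22, st⟩ := run_cSlot (w := w) hR hS hc' h35' (by simp) hin hl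
    set τ₁ := run w cSlot (τ.setV 21 i) with hτ₁
    have hc₁ : Ctx p τ₁ := hc'.run (by decide)
    have f21 : τ₁.v 21 = i := (run_v cSlot (by decide)).trans (by simp)
    have fM : Lists τ₁ 10 12 p.st _ := hM.congr (run_a cSlot (by decide)) (run_a cSlot (by decide))
    have fL : Lists τ₁ 14 16 p.st _ := hL.congr (run_a cSlot (by decide)) (run_a cSlot (by decide))
    rw [run_seq, run_seq, run_seq, ← hτ₁]
    have gM := fM.run_app (w := w) (k := 29) (v := 21) hc₁.st (by norm_num)
      ((length_bucket_le _ _ _ _).trans_lt (evs_lt_st hc hin)) (by rw [hc₁.cap]; exact st_lt_cap p)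
    set τ₂ := run w (app 10 12 29 21) τ₁ with hτ₂
    have hv₂ : τ₂.v = τ₁.v := rfl
    have gL : Lists τ₂ 14 16 p.st _ :=
      fL.congr (run_app_a (by norm_num) (by norm_num) _) (run_app_a (by norm_num) (by norm_num) _)
    have a8 : τ₂.a 8 = τ₁.a 8 := run_app_a (by norm_num) (by norm_num) _
    have a22 : τ₂.a 22 = τ₁.a 22 := run_app_a (by norm_num) (by norm_num) _
    set τ₃ := run w (.set 26 (.var 28 % .var 5)) τ₂ with hτ₃
    have v26 : τ₃.v 26 = p.elA c i := by
      rw [hτ₃, run_set, tick_v, setV_v, if_pos rfl, eval_mod, eval_var, eval_var, hv₂, s28, hc₁.S2]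
      rfl
    have v29 : τ₃.v 29 = p.colA c i := by
      rw [hτ₃, run_set, tick_v, setV_v, if_neg (by norm_num), hv₂, s29]
    have v17 : τ₃.v 17 = p.st := by
      rw [hτ₃, run_set, tick_v, setV_v, if_neg (by norm_num), hv₂, hc₁.st]
    have v11 : τ₃.v 11 = p.cap := by
      rw [hτ₃, run_set, tick_v, setV_v, if_neg (by norm_num), hv₂, hc₁.cap]
    have gL₃ : Lists τ₃ 14 16 p.st _ := gL.congr rfl rfl
    have kL := gL₃.run_app (w := w) (k := 26) (v := 29) v17 (by norm_num)
      ((length_bucket_le _ _ _ _).trans_lt (evs_lt_st hc hin)) (by rw [v11]; exact st_lt_cap p)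
    rw [v26, v29] at kL
    rw [s29, f21] at gM
    set τ₄ := run w (app 14 16 26 29) τ₃ with hτ₄
    have b8 : τ₄.a 8 = τ₁.a 8 := (run_app_a (by norm_num) (by norm_num) _).trans a8
    have b22 : τ₄.a 22 = τ₁.a 22 := (run_app_a (by norm_num) (by norm_num) _).trans a22
    have b10 : τ₄.a 10 = τ₂.a 10 := run_app_a (by norm_num) (by norm_num) _
    have b12 : τ₄.a 12 = τ₂.a 12 := run_app_a (by norm_num) (by norm_num) _
    have bt : τ₄.t = τ₁.t + 16 + 4 + 16 := by
      rw [hτ₄, run_app_t, hτ₃, run_set, tick_t, setV_t, hτ₂, run_app_t]; rfl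
    clear_value τ₄ τ₃ τ₂ τ₁
    have hτt : (τ.setV 21 i).t = τ.t := rfl
    rw [setV_a] at s8 s22
    refine ⟨fun j hj => ?_, fun k hk => ?_, ?_, ?_, ?_, ?_⟩
    · rw [tick_a, b8, s8, hl j hj, Nat.count_succ]
      simp only [Nat.add_left_cancel_iff]
      split_ifs with h1 h2 h2
      · subst h1; rfl
      · exact absurd h1.symm h2
      · exact absurd h2.symm h1
      · rfl
    · rw [tick_a, b8, s8, hz k hk, if_neg]
      have := buck_lt hR hS c i
      rw [Nat.add_mul] at hk
      omega
    · rw [evs_succ, bucket_append]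
      exact gM.congr b10 b12
    · rw [evs_succ, bucket_append]
      exact kL.congr rfl rfl
    · intro e he
      rw [tick_a, b22, s22]
      rw [evs_succ, List.mem_append, List.mem_singleton] at he
      -- Overwriting the entry of a colour seen before is harmless, because elements of equal colour
      -- lie in the same bucket.
      split_ifs with h
      · rcases he with he | rfl
        · exact (buck_eq_of_colA_eq hR hS (evs_snd_lt hin.le he) hin h).symm
        · rfl
      · rcases he with he | rfl
        · exact hI e he
        · exact absurd rfl h
    · rw [tick_t, bt]
      omega

/-- The part of the memory that the construction for the first kind of colours fills. -/
theorem run_cA (hR : 0 < p.R) (hS : 0 < p.S) (hσ : Ctx p σ) (h8 : σ.a 8 = 0)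
    (h10 : σ.a 10 = 0) (h12 : σ.a 12 = 0) (h14 : σ.a 14 = 0) (h16 : σ.a 16 = 0) :
    Lists (run w cA σ) 10 12 p.st p.ML ∧ Lists (run w cA σ) 14 16 p.st p.LA ∧
    (∀ c < p.S, ∀ x < p.n, (run w cA σ).a 22 (p.colA c x) = p.buck c x) ∧
    (run w cA σ).t ≤ σ.t + 4 + (30 + 300 * p.n + 60 * p.R) * p.S := by
  have key := run_for_ctx (w := w) hσ (by decide : cA.low = true)
    (fun c τ => (∀ k, c * p.R ≤ k → τ.a 8 k = 0) ∧
      Lists τ 10 12 p.st (bucket (evs p.n c 0) (fun e => p.colA e.1 e.2) Prod.snd) ∧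
      Lists τ 14 16 p.st
        (bucket (evs p.n c 0) (fun e => p.elA e.1 e.2) (fun e => p.colA e.1 e.2)) ∧
      (∀ e ∈ evs p.n c 0, τ.a 22 (p.colA e.1 e.2) = p.buck e.1 e.2) ∧
      τ.t ≤ σ.t + 4 + (30 + 300 * p.n + 60 * p.R) * c)
    ⟨fun k _ => by simp [h8], Lists.nil h10 h12, Lists.nil h14 h16, by simp [evs_zero], by simp⟩ ?_
  · rw [eval_var, hσ.S] at key
    refine ⟨key.2.1, key.2.2.1, fun c hc x hx => ?_, key.2.2.2.2⟩
    exact key.2.2.2.1 (c, x) (mem_evs.2 ⟨hc, hx⟩)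
  · intro c hi τ hv ha hc' ⟨hz, hM, hL, hI, ht⟩
    have hcS : c < p.S := by simpa [hσ.S] using hi
    have h35 : (τ.setV 35 c).v 35 = c := by simp
    obtain ⟨c8, cz, ct⟩ := run_cCount (w := w) hR hS hc' h35 hz
    rw [run_seq, run_seq]
    set τ₁ := run w cCount (τ.setV 35 c) with hτ₁
    have hc₁ : Ctx p τ₁ := hc'.run (by decide)
    have h35₁ : τ₁.v 35 = c := (run_v cCount (by decide)).trans h35
    obtain ⟨d8, dz, dt⟩ := run_cPrefix (w := w) hS hc₁ h35₁ c8 cz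
    set τ₂ := run w cPrefix τ₁ with hτ₂
    have hc₂ : Ctx p τ₂ := hc₁.run (by decide)
    have h35₂ : τ₂.v 35 = c := (run_v cPrefix (by decide)).trans h35₁
    have fr : ∀ a, a ≠ 8 → τ₂.a a = τ.a a := by
      intro a ha
      refine (run_a cPrefix ?_).trans ((run_a cCount ?_).trans rfl)
      · simpa [cPrefix, Cmd.wa] using ha
      · simpa [cCount, Cmd.wa] using ha
    obtain ⟨e8, eM, eL, eI, et⟩ := run_cAssign (w := w) hR hS hcS hc₂ h35₂ d8 dz
      (hM.congr (fr _ (by norm_num)) (fr _ (by norm_num)))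
      (hL.congr (fr _ (by norm_num)) (fr _ (by norm_num)))
      (by rw [fr _ (by norm_num)]; exact hI)
    rw [evs_carry]
    refine ⟨fun k hk => e8 k hk, eM.congr rfl rfl, eL.congr rfl rfl, eI, ?_⟩
    have h1 : (τ.setV 35 c).t = τ.t := rfl
    have h2 : (30 + 300 * p.n + 60 * p.R) * (c + 1)
        = (30 + 300 * p.n + 60 * p.R) * c + (30 + 300 * p.n + 60 * p.R) := by ring
    rw [tick_t, h2]
    omega

end Imp

namespace Par

variable {p : Par}

theorem cell_eq_zero {E : List (ℕ × ℕ × ℕ)} {q : ℕ} (h : p.base + E.length * p.W ≤ q) :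
    p.cell E q = 0 := by
  unfold cell
  rw [if_neg (by omega), List.getElem?_eq_none]
  rw [Nat.le_div_iff_mul_le W_pos]
  omega

theorem cell_append (E : List (ℕ × ℕ × ℕ)) (e : ℕ × ℕ × ℕ) (q : ℕ) :
    p.cell (E ++ [e]) q
      = if p.base + E.length * p.W ≤ q ∧ q < p.base + E.length * p.W + p.W
        then p.blockCell e (q - (p.base + E.length * p.W)) else p.cell E q := by
  have hW := W_pos (p := p)
  split_ifs with h
  · obtain ⟨r, rfl⟩ := Nat.exists_eq_add_of_le h.1
    unfold cell
    have h1 : p.base + E.length * p.W + r - p.base = r + E.length * p.W := by omega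
    have hr : r < p.W := by omega
    rw [if_neg (by omega), h1, Nat.add_mul_div_right _ _ hW, Nat.div_eq_of_lt hr, Nat.zero_add,
      Nat.add_mul_mod_self_right, Nat.mod_eq_of_lt hr, Nat.add_sub_cancel_left]
    simp
  · by_cases hq : q < p.base
    · simp [cell, hq]
    · unfold cell
      rw [if_neg hq, if_neg hq]
      rcases Nat.lt_or_ge q (p.base + E.length * p.W) with h1 | h1
      · rw [List.getElem?_append_left]
        rw [Nat.div_lt_iff_lt_mul hW]
        omega
      · have h2 : E.length + 1 ≤ (q - p.base) / p.W := by
          rw [Nat.le_div_iff_mul_le hW, Nat.add_mul]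
          omega
        rw [List.getElem?_eq_none (by simpa using h2), List.getElem?_eq_none (by omega)]

end Par

namespace Imp

open Par

variable {w : ℕ} {p : Par} {σ : Env}

/-- The part of the memory that the construction for the second kind of colours fills. -/
theorem run_cB (hσ : Ctx p σ) (h18 : σ.a 18 = 0) (h20 : σ.a 20 = 0) :
    Lists (run w cB σ) 18 20 p.st p.LB ∧
    (run w cB σ).t ≤ σ.t + 4 + (10 + 100 * p.n) * p.S := by
  have key := run_for_ctx (w := w) hσ (by decide : cB.low = true)
    (fun c τ => Lists τ 18 20 p.st
        (bucket (evs p.n c 0) (fun e => p.elB e.1 e.2) (fun e => p.colB e.1 e.2)) ∧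
      τ.t ≤ σ.t + 4 + (10 + 100 * p.n) * c)
    ⟨Lists.nil h18 h20, by simp⟩ ?_
  · rw [eval_var, hσ.S] at key
    exact key
  · intro c hi τ hv ha hc ⟨hL, ht⟩
    have hcS : c < p.S := by simpa [hσ.S] using hi
    have key := run_for_ctx (w := w) hc (r := 21) (e := .var 1)
      (c := (.seq (.set 28 ((.get 2 (.var 21) + .var 20 * (.var 35 * .var 4)) % .var 6))
        (.seq (.set 29 (.lit 1 + .var 14 + (.var 35 * .var 3 + .var 28 / .var 5)))
        (.seq (.set 26 (.var 28 % .var 5)) (app 18 20 26 29))))) (by decide)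
      (fun i τ' => Lists τ' 18 20 p.st
          (bucket (evs p.n c i) (fun e => p.elB e.1 e.2) (fun e => p.colB e.1 e.2)) ∧
        τ'.t ≤ τ.t + 4 + 100 * i)
      ⟨hL.congr rfl rfl, by simp⟩ ?_
    · rw [eval_var, hc.n] at key
      rw [evs_carry]
      refine ⟨key.1.congr rfl rfl, ?_⟩
      rw [tick_t]
      have h2 := key.2
      have h3 : (10 + 100 * p.n) * (c + 1) = (10 + 100 * p.n) * c + (10 + 100 * p.n) := by ring
      omega
    · intro i hi τ' hv' ha' hc' ⟨hL', ht'⟩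
      have hin : i < p.n := by rwa [eval_var, hc.n] at hi
      have h35 : τ'.v 35 = c := (hv' 35 (by decide)).trans (by simp)
      have k20 : τ'.v 20 = p.P - 1 := by simpa using hc'.P1
      have k3 : τ'.v 3 = p.R := by simpa using hc'.R
      have k4 : τ'.v 4 = p.S := by simpa using hc'.S
      have k6 : τ'.v 6 = p.P := by simpa using hc'.P
      have k5 : τ'.v 5 = p.S2 := by simpa using hc'.S2
      have k14 : τ'.v 14 = p.nA := by simpa using hc'.nA
      have k11 : τ'.v 11 = p.cap := by simpa using hc'.cap
      have k17 : τ'.v 17 = p.st := by simpa using hc'.st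
      have k2 : τ'.a 2 = p.h := by simpa using hc'.h
      have hf : (p.h i + (p.P - 1) * (c * p.S)) % p.P = p.fB c i := rfl
      set τ₁ := run w (.set 26 (.var 28 % .var 5)) (run w
        (.set 29 (.lit 1 + .var 14 + (.var 35 * .var 3 + .var 28 / .var 5))) (run w
        (.set 28 ((.get 2 (.var 21) + .var 20 * (.var 35 * .var 4)) % .var 6))
          (τ'.setV 21 i))) with hτ₁
      have e26 : τ₁.v 26 = p.elB c i := by
        simp [hτ₁, h35, k20, k3, k4, k6, k5, k14, k2, hf, elB]
      have e29 : τ₁.v 29 = p.colB c i := by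
        simp [hτ₁, h35, k20, k3, k4, k6, k5, k14, k2, hf, colB]
      have e17 : τ₁.v 17 = p.st := by simp [hτ₁, k17]
      have e11 : τ₁.v 11 = p.cap := by simp [hτ₁, k11]
      have et : τ₁.t ≤ τ'.t + 50 := by simp [hτ₁]
      have eL : Lists τ₁ 18 20 p.st _ := hL'.congr rfl rfl
      have := eL.run_app (w := w) (k := 26) (v := 29) e17 (by norm_num)
        ((length_bucket_le _ _ _ _).trans_lt (evs_lt_st hcS hin)) (by rw [e11]; exact st_lt_cap p)
      rw [e26, e29] at this
      rw [evs_succ, bucket_append, run_seq, run_seq, run_seq, ← hτ₁]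
      clear_value τ₁
      refine ⟨this.congr rfl rfl, ?_⟩
      rw [tick_t, run_app_t]
      omega

theorem run_cHead (hσ : Ctx p σ) (h1 : σ.a 1 = 0) :
    (∀ q, (run w cHead σ).a 1 q = p.cell [] q) ∧
    (run w cHead σ).t ≤ σ.t + 20 + 30 * p.N := by
  have key := run_for_ctx (w := w) hσ (r := 21) (e := .lit 1 + .var 14)
    (c := .put 1 (.var 21) (.var 21)) (by decide)
    (fun i τ => (∀ q, τ.a 1 q = if q < i then q else 0) ∧ τ.t ≤ σ.t + 10 + 30 * i)
    ⟨fun q => by simp [h1], by simp⟩ ?_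
  · simp only [eval_add, eval_lit, eval_var, hσ.nA] at key
    rw [cHead, run_seq]
    have hc : Ctx p (run w (.rep 21 (.lit 1 + .var 14) (.put 1 (.var 21) (.var 21))) σ) :=
      hσ.run (by decide)
    set τ := run w (.rep 21 (.lit 1 + .var 14) (.put 1 (.var 21) (.var 21))) σ
    have key' := run_for_ctx (w := w) hc (r := 21) (e := .var 3 * .var 4)
      (c := .put 1 (.lit 1 + .var 14 + .var 10 + .var 21) (.lit 1 + .var 14 + .var 21)) (by decide)
      (fun i τ' => (∀ q, τ'.a 1 q = if q < 1 + p.nA then q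
        else if 1 + p.nA + p.thr ≤ q ∧ q < 1 + p.nA + p.thr + i then q - p.thr else 0) ∧
        τ'.t ≤ τ.t + 10 + 30 * i)
      ⟨fun q => ?_, by simp⟩ ?_
    · simp only [eval_mul, eval_var, hc.R, hc.S] at key'
      refine ⟨fun q => ?_, ?_⟩
      · rw [key'.1 q]
        by_cases hq : q < p.base
        · simp [cell, hq, hdr]
        · simp only [cell, hq, if_false]
          unfold base at hq
          rw [if_neg (by omega), if_neg (by omega)]
          simp
      · have := colours_lt_N (p := p)
        omega
    · rw [tick_a, key.1 q]
      split_ifs <;> first | rfl | omega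
    · intro i hi τ' hv ha hc' ⟨hX, ht⟩
      have k14 : τ'.v 14 = p.nA := by simpa using hc'.nA
      have k10 : τ'.v 10 = p.thr := by simpa using hc'.thr
      refine ⟨fun q => ?_, ?_⟩
      · simp only [run_put, tick_a, setA_a, if_true, setV_a, eval_add, eval_lit, eval_var, setV_v,
          Nat.reduceEqDiff, if_false, k14, k10, Function.update_apply, hX q]
        split_ifs <;> omega
      · simp; omega
  · intro i hi τ hv ha hc ⟨hX, ht⟩
    refine ⟨fun q => ?_, ?_⟩
    · simp only [run_put, tick_a, setA_a, if_true, setV_a, eval_var, setV_v,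
        Function.update_apply, hX q]
      split_ifs <;> omega
    · simp; omega

theorem lt_st_of_lt_nb {l : List ℕ} {i k : ℕ} (hl : l.length ≤ p.n * p.S)
    (hi : i < l.length / p.b + 1) (hk : k < p.b) : i * p.b + k < p.st := by
  have h1 : i * p.b ≤ l.length / p.b * p.b := Nat.mul_le_mul_right _ (by omega)
  have h2 := Nat.div_mul_le_self l.length p.b
  unfold st
  omega

theorem length_LA_le (u : ℕ) : (p.LA u).length ≤ p.n * p.S := by
  refine (length_bucket_le _ _ _ _).trans ?_
  rw [length_evs, Nat.mul_comm]
  omega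

theorem length_LB_le (u : ℕ) : (p.LB u).length ≤ p.n * p.S := by
  refine (length_bucket_le _ _ _ _).trans ?_
  rw [length_evs, Nat.mul_comm]
  omega

theorem run_cBlock (hσ : Ctx p σ) (hA : Lists σ 14 16 p.st p.LA) (hB : Lists σ 18 20 p.st p.LB)
    {E : List (ℕ × ℕ × ℕ)} {u i j : ℕ} (h36 : σ.v 36 = u) (h21 : σ.v 21 = i) (h23 : σ.v 23 = j)
    (hi : i < p.nbA u) (hj : j < p.nbB u) (hE : E.length < 4 * p.S2)
    (h30 : σ.v 30 = p.base + E.length * p.W) (hX : ∀ q, σ.a 1 q = p.cell E q) :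
    (run w cBlock σ).v 30 = p.base + (E.length + 1) * p.W ∧
      (∀ q, (run w cBlock σ).a 1 q = p.cell (E ++ [(u, i, j)]) q) ∧
      (run w cBlock σ).t ≤ σ.t + 10 + 70 * p.b := by
  set s := p.base + E.length * p.W with hs
  have key := run_for_ctx (w := w) hσ (r := 24) (e := .var 8)
    (c := (.seq (.put 1 (.var 30 + .var 24) (.get 16 (.var 36 * .var 17 + (.var 21 * .var 8 + .var 24))))
        (.put 1 (.var 30 + (.var 8 + .var 24))
          (.get 20 (.var 36 * .var 17 + (.var 23 * .var 8 + .var 24)))))) (by decide)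
    -- Both halves of the block grow simultaneously. The gap is not written at all; it is zero
    -- because nothing was stored behind the previous blocks.
    (fun k τ => (∀ q, τ.a 1 q = if s ≤ q ∧ q < s + k ∨ s + p.b ≤ q ∧ q < s + p.b + k
        then p.blockCell (u, i, j) (q - s) else p.cell E q) ∧ τ.t ≤ σ.t + 4 + 70 * k)
    ⟨fun q => ?_, by simp⟩ ?_
  · rw [eval_var, hσ.b] at key
    rw [cBlock, run_seq]
    set τ := run w (.rep 24 (.var 8)
      (.seq (.put 1 (.var 30 + .var 24) (.get 16 (.var 36 * .var 17 + (.var 21 * .var 8 + .var 24))))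
        (.put 1 (.var 30 + (.var 8 + .var 24))
          (.get 20 (.var 36 * .var 17 + (.var 23 * .var 8 + .var 24)))))) σ with hτ
    have v30 : τ.v 30 = s := (run_v _ (by decide)).trans h30
    have v9 : τ.v 9 = p.W := (run_v _ (by decide)).trans hσ.W
    have v11 : τ.v 11 = p.cap := (run_v _ (by decide)).trans hσ.cap
    refine ⟨?_, fun q => ?_, ?_⟩
    · simp only [run_set, tick_v, setV_v, if_true, eval_mod, eval_add, eval_var, v30, v9, v11]
      have h1 : (E.length + 1) * p.W ≤ 4 * p.S2 * p.W := Nat.mul_le_mul_right _ hE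
      have h2 : (E.length + 1) * p.W = E.length * p.W + p.W := by ring
      rw [Nat.mod_eq_of_lt]
      · rw [hs, h2, add_assoc]
      · have : 0 < p.st := by unfold st; omega
        unfold cap N
        omega
    · rw [run_set, tick_a, setV_a, key.1 q, cell_append, ← hs]
      have hW : p.W = p.b + p.b + p.thr := rfl
      by_cases h1 : s ≤ q ∧ q < s + p.W
      · rw [if_pos h1]
        split_ifs with h2
        · rfl
        · rw [cell_eq_zero h1.1, blockCell, if_neg (by omega), if_neg (by omega)]
      · rw [if_neg h1, if_neg (by omega)]
    · have := key.2
      simp only [run_set, tick_t, setV_t, cost_mod, cost_add, cost_var]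
      omega
  · rw [tick_a, hX q, if_neg (by omega)]
  · intro k hk τ hv ha hc ⟨hq, ht⟩
    have hkb : k < p.b := by simpa [hσ.b] using hk
    have k30 : τ.v 30 = s := (hv 30 (by decide)).trans h30
    have k36 : τ.v 36 = u := (hv 36 (by decide)).trans h36
    have k21 : τ.v 21 = i := (hv 21 (by decide)).trans h21
    have k23 : τ.v 23 = j := (hv 23 (by decide)).trans h23
    have k17 : τ.v 17 = p.st := by simpa using hc.st
    have k8 : τ.v 8 = p.b := by simpa using hc.b
    have rA : τ.a 16 (u * p.st + (i * p.b + k)) = p.blockCell (u, i, j) k := by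
      rw [ha 16 (by decide), hA.2 u _ (lt_st_of_lt_nb (length_LA_le u) hi hkb), blockCell,
        if_pos hkb]
    have rB : τ.a 20 (u * p.st + (j * p.b + k)) = p.blockCell (u, i, j) (p.b + k) := by
      rw [ha 20 (by decide), hB.2 u _ (lt_st_of_lt_nb (length_LB_le u) hj hkb), blockCell,
        if_neg (by omega), if_pos (by omega), Nat.add_sub_cancel_left]
    refine ⟨fun q => ?_, ?_⟩
    · simp only [run_seq, run_put, tick_a, setA_a, if_true, setV_a, eval_add, eval_mul, eval_var,
        eval_get, setV_v, tick_v, setA_v, Nat.reduceEqDiff, if_false, k30, k36, k21, k23, k17, k8,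
        rA, rB, Function.update_apply, hq q]
      by_cases h1 : q = s + (p.b + k)
      · subst h1
        rw [if_pos rfl, if_pos (by omega)]
        congr 1; omega
      · rw [if_neg h1]
        by_cases h2 : q = s + k
        · subst h2
          rw [if_pos rfl, if_pos (by omega)]
          congr 1; omega
        · rw [if_neg h2]
          by_cases h3 : s ≤ q ∧ q < s + k ∨ s + p.b ≤ q ∧ q < s + p.b + k
          · rw [if_pos h3, if_pos (by omega)]
          · rw [if_neg h3, if_neg (by omega)]
    · simp; omega

end Imp

namespace Par

variable {p : Par}

/-- The blocks for the elements below `u`. -/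
def blocksBelow (p : Par) (u : ℕ) : List (ℕ × ℕ × ℕ) :=
  (List.range u).flatMap fun u => (List.range (p.nbA u)).flatMap fun i =>
    (List.range (p.nbB u)).map fun j => (u, i, j)

def rowBlocks (p : Par) (u i : ℕ) : List (ℕ × ℕ × ℕ) :=
  (List.range i).flatMap fun i => (List.range (p.nbB u)).map fun j => (u, i, j)

theorem length_rowBlocks (u i : ℕ) : (p.rowBlocks u i).length = i * p.nbB u := by
  simp [rowBlocks]

theorem rowBlocks_succ (u i : ℕ) :
    p.rowBlocks u (i + 1) = p.rowBlocks u i ++ (List.range (p.nbB u)).map fun j => (u, i, j) := by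
  simp [rowBlocks, List.range_succ]

theorem blocksBelow_succ (u : ℕ) :
    p.blocksBelow (u + 1) = p.blocksBelow u ++ p.rowBlocks u (p.nbA u) := by
  simp [blocksBelow, rowBlocks, List.range_succ]

theorem length_blocksBelow_le (hR : 0 < p.R) (hS : 0 < p.S) {u : ℕ} (hu : u ≤ p.S2) :
    (p.blocksBelow u).length ≤ 4 * p.S2 := by
  refine le_trans ?_ (length_blocks_le hR hS)
  obtain ⟨k, hk⟩ := Nat.exists_eq_add_of_le hu
  have : p.blocks = p.blocksBelow (u + k) := by rw [← hk]; rfl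
  rw [this]
  clear this hk
  induction k with
  | zero => exact le_rfl
  | succ k ih =>
    rw [← Nat.add_assoc, blocksBelow_succ, List.length_append]
    omega

theorem nbA_pos (u : ℕ) : 0 < p.nbA u := Nat.succ_pos _
theorem nbB_pos (u : ℕ) : 0 < p.nbB u := Nat.succ_pos _

end Par

namespace Imp

open Par

variable {w : ℕ} {p : Par} {σ : Env}

def cEmitRow : Cmd := .rep 23 (.get 18 (.var 36) / .var 8 + .lit 1) cBlock

theorem run_cEmitRow (hσ : Ctx p σ) (hA : Lists σ 14 16 p.st p.LA) (hB : Lists σ 18 20 p.st p.LB)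
    {E : List (ℕ × ℕ × ℕ)} {u i : ℕ} (h36 : σ.v 36 = u) (h21 : σ.v 21 = i)
    (hi : i < p.nbA u) (hE : E.length + p.nbB u ≤ 4 * p.S2)
    (h30 : σ.v 30 = p.base + E.length * p.W) (hX : ∀ q, σ.a 1 q = p.cell E q) :
    (run w cEmitRow σ).v 30
        = p.base + (E ++ (List.range (p.nbB u)).map fun j => (u, i, j)).length * p.W ∧
      (∀ q, (run w cEmitRow σ).a 1 q
        = p.cell (E ++ (List.range (p.nbB u)).map fun j => (u, i, j)) q) ∧
      (run w cEmitRow σ).t ≤ σ.t + 10 + (15 + 70 * p.b) * p.nbB u := by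
  have hev : (Expr.get 18 (.var 36) / .var 8 + .lit 1).eval w σ = p.nbB u := by
    simp [h36, hB.1, hσ.b, nbB]
  have key := run_for_ctx (w := w) hσ (r := 23) (e := .get 18 (.var 36) / .var 8 + .lit 1)
    (c := cBlock) (by decide)
    (fun j τ => τ.v 30 = p.base + (E ++ (List.range j).map fun j => (u, i, j)).length * p.W ∧
      (∀ q, τ.a 1 q = p.cell (E ++ (List.range j).map fun j => (u, i, j)) q) ∧
      τ.t ≤ σ.t + 10 + (15 + 70 * p.b) * j)
    ⟨by simpa using h30, by simpa using hX, by simp⟩ ?_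
  · rw [hev] at key
    exact key
  · intro j hj τ hv ha hc ⟨h1, h2, h3⟩
    rw [hev] at hj
    have := run_cBlock (w := w) (σ := τ.setV 23 j) hc
      (hA.congr (ha 14 (by decide)) (ha 16 (by decide)))
      (hB.congr (ha 18 (by decide)) (ha 20 (by decide)))
      (E := E ++ (List.range j).map fun j => (u, i, j)) (u := u) (i := i) (j := j)
      (by simpa using (hv 36 (by decide)).trans h36)
      (by simpa using (hv 21 (by decide)).trans h21) (by simp) hi hj
      (by simp; omega) (by simpa using h1) h2
    obtain ⟨g1, g2, g3⟩ := this
    rw [List.range_succ, List.map_append, List.map_singleton, ← List.append_assoc]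
    refine ⟨?_, g2, ?_⟩
    · rw [tick_v, g1]
      simp [Nat.add_assoc]
    · have h4 : (15 + 70 * p.b) * (j + 1) = (15 + 70 * p.b) * j + (15 + 70 * p.b) := by ring
      have h5 : (τ.setV 23 j).t = τ.t := rfl
      rw [tick_t]
      omega

def cEmitEl : Cmd := .rep 21 (.get 14 (.var 36) / .var 8 + .lit 1) cEmitRow

theorem run_cEmitEl (hσ : Ctx p σ) (hA : Lists σ 14 16 p.st p.LA) (hB : Lists σ 18 20 p.st p.LB)
    {E : List (ℕ × ℕ × ℕ)} {u : ℕ} (h36 : σ.v 36 = u)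
    (hE : E.length + p.nbA u * p.nbB u ≤ 4 * p.S2)
    (h30 : σ.v 30 = p.base + E.length * p.W) (hX : ∀ q, σ.a 1 q = p.cell E q) :
    (run w cEmitEl σ).v 30 = p.base + (E ++ p.rowBlocks u (p.nbA u)).length * p.W ∧
      (∀ q, (run w cEmitEl σ).a 1 q = p.cell (E ++ p.rowBlocks u (p.nbA u)) q) ∧
      (run w cEmitEl σ).t ≤ σ.t + 10 + (30 + 70 * p.b) * (p.nbA u * p.nbB u) := by
  have hev : (Expr.get 14 (.var 36) / .var 8 + .lit 1).eval w σ = p.nbA u := by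
    simp [h36, hA.1, hσ.b, nbA]
  have key := run_for_ctx (w := w) hσ (r := 21) (e := .get 14 (.var 36) / .var 8 + .lit 1)
    (c := cEmitRow) (by decide)
    (fun i τ => τ.v 30 = p.base + (E ++ p.rowBlocks u i).length * p.W ∧
      (∀ q, τ.a 1 q = p.cell (E ++ p.rowBlocks u i) q) ∧
      τ.t ≤ σ.t + 10 + (30 + 70 * p.b) * (i * p.nbB u))
    ⟨by simpa [rowBlocks] using h30, by simpa [rowBlocks] using hX, by simp⟩ ?_
  · rw [hev] at key
    exact key
  · intro i hi τ hv ha hc ⟨h1, h2, h3⟩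
    rw [hev] at hi
    have hlen : (E ++ p.rowBlocks u i).length + p.nbB u ≤ 4 * p.S2 := by
      rw [List.length_append, length_rowBlocks]
      have h4 : (i + 1) * p.nbB u ≤ p.nbA u * p.nbB u := Nat.mul_le_mul_right _ hi
      rw [Nat.add_mul] at h4
      omega
    obtain ⟨g1, g2, g3⟩ := run_cEmitRow (w := w) (σ := τ.setV 21 i) hc
      (hA.congr (ha 14 (by decide)) (ha 16 (by decide)))
      (hB.congr (ha 18 (by decide)) (ha 20 (by decide)))
      (E := E ++ p.rowBlocks u i) (u := u) (i := i)
      (by simpa using (hv 36 (by decide)).trans h36) (by simp) hi hlen (by simpa using h1) h2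
    rw [rowBlocks_succ, ← List.append_assoc]
    refine ⟨g1, g2, ?_⟩
    have h5 : (τ.setV 21 i).t = τ.t := rfl
    have h6 := nbB_pos (p := p) u
    rw [tick_t]
    have h7 : (30 + 70 * p.b) * ((i + 1) * p.nbB u)
      = (30 + 70 * p.b) * (i * p.nbB u) + (15 + 70 * p.b) * p.nbB u + 15 * p.nbB u := by ring
    omega

theorem run_cEmit (hR : 0 < p.R) (hS : 0 < p.S) (hσ : Ctx p σ) (hA : Lists σ 14 16 p.st p.LA)
    (hB : Lists σ 18 20 p.st p.LB) (hX : ∀ q, σ.a 1 q = p.cell [] q) :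
    (∀ q, (run w cEmit σ).a 1 q = p.X q) ∧ (run w cEmit σ).t ≤ σ.t + 10 + 70 * p.N := by
  have hc : Ctx p (run w (.set 30 (.var 15)) σ) := hσ.run (by decide)
  have key := run_for_ctx (w := w) hc (r := 36) (e := .var 5) (c := cEmitEl) (by decide)
    (fun u τ => τ.v 30 = p.base + (p.blocksBelow u).length * p.W ∧
      (∀ q, τ.a 1 q = p.cell (p.blocksBelow u) q) ∧
      τ.t ≤ σ.t + 10 + (45 + 70 * p.b) * (p.blocksBelow u).length)
    ⟨by simp [blocksBelow, hσ.base], by simpa [blocksBelow] using hX, by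
      simp [blocksBelow]⟩ ?_
  · rw [eval_var, hc.S2] at key
    refine ⟨key.2.1, key.2.2.trans ?_⟩
    have h1 := length_blocksBelow_le (p := p) hR hS le_rfl
    have h2 : (45 + 70 * p.b) * (p.blocksBelow p.S2).length ≤ (45 + 70 * p.b) * (4 * p.S2) :=
      Nat.mul_le_mul_left _ h1
    have hb := b_pos (p := p)
    have hW : p.b + p.b ≤ p.W := by unfold W; omega
    have h3 : (45 + 70 * p.b) * (4 * p.S2) ≤ 70 * p.W * (4 * p.S2) :=
      Nat.mul_le_mul_right _ (by omega)
    have h4 : 70 * p.W * (4 * p.S2) = 70 * (4 * p.S2 * p.W) := by ring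
    unfold N
    omega
  · intro u hu τ hv ha hcu ⟨h1, h2, h3⟩
    rw [eval_var, hc.S2] at hu
    have hlen : (p.blocksBelow u).length + p.nbA u * p.nbB u ≤ 4 * p.S2 := by
      have := length_blocksBelow_le (p := p) hR hS (u := u + 1) hu
      rwa [blocksBelow_succ, List.length_append, length_rowBlocks] at this
    obtain ⟨g1, g2, g3⟩ := run_cEmitEl (w := w) (σ := τ.setV 36 u) hcu
      (hA.congr (ha 14 (by decide)) (ha 16 (by decide)))
      (hB.congr (ha 18 (by decide)) (ha 20 (by decide)))
      (E := p.blocksBelow u) (u := u) (by simp) hlen (by simpa using h1) h2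
    rw [blocksBelow_succ]
    refine ⟨g1, g2, ?_⟩
    have h5 : (τ.setV 36 u).t = τ.t := rfl
    have h6 := Nat.mul_pos (nbA_pos (p := p) u) (nbB_pos (p := p) u)
    rw [tick_t, List.length_append, length_rowBlocks]
    have h7 : (45 + 70 * p.b) * ((p.blocksBelow u).length + p.nbA u * p.nbB u)
      = (45 + 70 * p.b) * (p.blocksBelow u).length + (30 + 70 * p.b) * (p.nbA u * p.nbB u)
        + 15 * (p.nbA u * p.nbB u) := by ring
    omega

theorem run_cQuery (hσ : Ctx p σ) :
    (∀ q < p.m, (run w cQuery σ).a 24 q = p.q1 q ∧ (run w cQuery σ).a 26 q = p.q2 (σ.a 22) q ∧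
      (run w cQuery σ).a 28 q = p.qg q) ∧
    (run w cQuery σ).t ≤ σ.t + 4 + 200 * p.m := by
  have key := run_for_ctx (w := w) hσ (by decide : cQuery.low = true)
    (fun i τ => (∀ q < i, τ.a 24 q = p.q1 q ∧ τ.a 26 q = p.q2 (σ.a 22) q ∧ τ.a 28 q = p.qg q) ∧
      τ.t ≤ σ.t + 4 + 200 * i)
    ⟨by simp, by simp⟩ ?_
  · rw [eval_var, hσ.m] at key
    exact key
  · intro i hi τ hv ha hc ⟨h1, h2⟩
    have k2 : τ.a 2 = p.h := by simpa using hc.h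
    have k3 : τ.v 3 = p.R := by simpa using hc.R
    have k4 : τ.v 4 = p.S := by simpa using hc.S
    have k5 : τ.v 5 = p.S2 := by simpa using hc.S2
    have k6 : τ.v 6 = p.P := by simpa using hc.P
    have k13 : τ.v 13 = p.R2 := by simpa using hc.R2
    have k14 : τ.v 14 = p.nA := by simpa using hc.nA
    have k18 : τ.v 18 = p.HH := by simpa using hc.HH
    have k20 : τ.v 20 = p.P - 1 := by simpa using hc.P1
    have k22 : τ.a 22 = σ.a 22 := ha 22 (by decide)
    have hg : (p.h (i / (p.R2 * 8)) + i / p.R2 % 8 / 2 * p.HH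
      + (p.P - 1) * (i / p.R2 % 8 % 2)) % p.P = p.qg i := rfl
    have hq1 : 1 + p.qg i % p.S * p.R2 + i % p.R2 = p.q1 i := rfl
    have hq2 : 1 + p.nA + (p.qg i / p.S % p.S * p.R + (σ.a 22 (p.q1 i) + p.qg i / p.S2) % p.R)
      = p.q2 (σ.a 22) i := rfl
    refine ⟨fun q hq => ?_, ?_⟩
    · simp only [run_seq, run_set, run_put, tick_a, setA_a, if_true, setV_a, eval_add, eval_mul,
        eval_div, eval_mod, eval_lit, eval_var, eval_get, setV_v, tick_v, setA_v, Nat.reduceEqDiff,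
        if_false, k2, k3, k4, k5, k6, k13, k14, k18, k20, k22, hg, hq1, hq2, Function.update_apply]
      by_cases h : q = i
      · subst h; simp
      · simp only [if_neg h]
        exact h1 q (by omega)
    · simp; omega

/-- The memory after the construction. -/
structure Built (p : Par) (σ : Env) : Prop where
  ctx : Ctx p σ
  HL : Lists σ 4 6 p.st p.HL
  ML : Lists σ 10 12 p.st p.ML
  ip : ∀ c < p.S, ∀ x < p.n, σ.a 22 (p.colA c x) = p.buck c x
  q : ∀ q < p.m, σ.a 24 q = p.q1 q ∧ σ.a 26 q = p.q2 (σ.a 22) q ∧ σ.a 28 q = p.qg q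

/-- The tables indexed by shifts and elements, or by shifts and buckets, are no larger than the
array of colours. This makes the construction linear in the size of the array and the number of
queries. -/
theorem le_N (hS : 0 < p.S) : p.n * p.S ≤ p.N ∧ p.R * p.S ≤ p.N ∧ p.S ≤ p.N := by
  have h1 := n_le_S_mul_b (p := p) hS
  have hb := b_pos (p := p)
  have hW : p.b ≤ p.W := by unfold W; omega
  have h2 : p.n * p.S ≤ p.S2 * p.W := by
    calc p.n * p.S ≤ p.S * p.b * p.S := Nat.mul_le_mul_right _ h1
      _ = p.S2 * p.b := by rw [S2]; ring
      _ ≤ _ := Nat.mul_le_mul_left _ hW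
  have h3 : p.S ≤ p.S2 * p.W := by
    calc p.S ≤ p.S2 := Nat.le_mul_of_pos_left _ hS
      _ ≤ _ := Nat.le_mul_of_pos_right _ (by omega)
  have h4 : p.N = p.base + 4 * (p.S2 * p.W) := by rw [N]; ring
  have h5 : p.R * p.S ≤ p.base := by unfold base; omega
  omega

theorem run_cBuild (hR : 0 < p.R) (hS : 0 < p.S) (hσ : Ctx p σ)
    (h0 : ∀ a ∈ [1, 4, 6, 8, 10, 12, 14, 16, 18, 20], σ.a a = 0) :
    Built p (run w cBuild σ) ∧ (∀ q, (run w cBuild σ).a 1 q = p.X q) ∧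
      (run w cBuild σ).t ≤ σ.t + 2000 * (p.N + p.m) := by
  simp only [cBuild, run_seq]
  obtain ⟨a1, a2⟩ := run_cKeys (w := w) hσ hS (h0 _ (by decide)) (h0 _ (by decide))
  have c1 : Ctx p (run w cKeys σ) := hσ.run (by decide)
  have z1 : ∀ a ∈ [1, 8, 10, 12, 14, 16, 18, 20], (run w cKeys σ).a a = 0 := fun a ha =>
    (run_a cKeys (by revert a; decide)).trans (h0 a (by revert a; decide))
  set σ₁ := run w cKeys σ
  obtain ⟨b1, b2, b3, b4⟩ := run_cA (w := w) hR hS c1 (z1 _ (by decide)) (z1 _ (by decide))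
    (z1 _ (by decide)) (z1 _ (by decide)) (z1 _ (by decide))
  have c2 : Ctx p (run w cA σ₁) := c1.run (by decide)
  have z2 : ∀ a ∈ [1, 18, 20], (run w cA σ₁).a a = 0 := fun a ha =>
    (run_a cA (by revert a; decide)).trans (z1 a (by revert a; decide))
  have a1₂ : Lists (run w cA σ₁) 4 6 p.st p.HL := a1.congr (run_a _ (by decide)) (run_a _ (by decide))
  set σ₂ := run w cA σ₁
  obtain ⟨d1, d2⟩ := run_cB (w := w) c2 (z2 _ (by decide)) (z2 _ (by decide))
  have c3 : Ctx p (run w cB σ₂) := c2.run (by decide)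
  have z3 : (run w cB σ₂).a 1 = 0 := (run_a cB (by decide)).trans (z2 1 (by decide))
  have f3 : ∀ a ∈ [4, 6, 10, 12, 14, 16, 22], (run w cB σ₂).a a = σ₂.a a := fun a ha =>
    run_a cB (by revert a; decide)
  set σ₃ := run w cB σ₂
  obtain ⟨e1, e2⟩ := run_cHead (w := w) c3 z3
  have c4 : Ctx p (run w cHead σ₃) := c3.run (by decide)
  have f4 : ∀ a ∈ [4, 6, 10, 12, 14, 16, 18, 20, 22], (run w cHead σ₃).a a = σ₃.a a := fun a ha =>
    run_a cHead (by revert a; decide)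
  set σ₄ := run w cHead σ₃
  obtain ⟨g1, g2⟩ := run_cEmit (w := w) hR hS c4
    (b2.congr ((f4 _ (by decide)).trans (f3 _ (by decide)))
      ((f4 _ (by decide)).trans (f3 _ (by decide))))
    (d1.congr (f4 _ (by decide)) (f4 _ (by decide))) e1
  have c5 : Ctx p (run w cEmit σ₄) := c4.run (by decide)
  have f5 : ∀ a ∈ [4, 6, 10, 12, 22], (run w cEmit σ₄).a a = σ₄.a a := fun a ha =>
    run_a cEmit (by revert a; decide)
  set σ₅ := run w cEmit σ₄
  obtain ⟨i1, i2⟩ := run_cQuery (w := w) c5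
  have c6 : Ctx p (run w cQuery σ₅) := c5.run (by decide)
  have f6 : ∀ a ∈ [1, 4, 6, 10, 12, 22], (run w cQuery σ₅).a a = σ₅.a a := fun a ha =>
    run_a cQuery (by revert a; decide)
  set σ₆ := run w cQuery σ₅
  have tot : ∀ a ∈ [4, 6, 10, 12, 22], σ₆.a a = σ₂.a a := fun a ha =>
    ((f6 a (by revert a; decide)).trans (f5 a ha)).trans
      ((f4 a (by revert a; decide)).trans (f3 a (by revert a; decide)))
  refine ⟨⟨c6, ?_, ?_, ?_, ?_⟩, ?_, ?_⟩
  · exact a1₂.congr (tot _ (by decide)) (tot _ (by decide))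
  · exact b1.congr (tot _ (by decide)) (tot _ (by decide))
  · rw [tot _ (by decide)]; exact b3
  · rw [f6 22 (by decide)]; exact i1
  · rw [f6 1 (by decide)]; exact g1
  · obtain ⟨l1, l2, l3⟩ := le_N (p := p) hS
    have l4 : p.n ≤ p.m := by
      unfold m
      calc p.n ≤ p.n * p.R := Nat.le_mul_of_pos_right _ hR
        _ ≤ _ := Nat.mul_le_mul_right _ (by omega)
    have l5 : 1 ≤ p.N := by have := base_le_N (p := p); unfold base at this; omega
    have m1 : (30 + 300 * p.n + 60 * p.R) * p.S
      = 30 * p.S + 300 * (p.n * p.S) + 60 * (p.R * p.S) := by ring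
    have m2 : (10 + 100 * p.n) * p.S = 10 * p.S + 100 * (p.n * p.S) := by ring
    omega

end Imp

/-! ### Charging the verification to spurious pairs -/

theorem List.sum_range_getD (l : List ℕ) (f : ℕ → ℕ) :
    ∑ i ∈ Finset.range l.length, f (l.getD i 0) = (l.map f).sum := by
  induction l with
  | nil => simp
  | cons x l ih =>
    rw [List.length_cons, Finset.sum_range_succ', List.map_cons, List.sum_cons, ← ih, add_comm]
    simp

theorem List.exists_getD_iff (l : List ℕ) (P : ℕ → Prop) :
    (∃ i < l.length, P (l.getD i 0)) ↔ ∃ x ∈ l, P x := by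
  constructor
  · rintro ⟨i, hi, h⟩
    rw [List.getD_eq_getElem _ _ hi] at h
    exact ⟨_, List.getElem_mem hi, h⟩
  · rintro ⟨x, hx, h⟩
    obtain ⟨i, hi, rfl⟩ := List.getElem_of_mem hx
    exact ⟨i, hi, by rwa [List.getD_eq_getElem _ _ hi]⟩

namespace Par

variable {p : Par}

/-- The hash value that a partner of `x` has in query `q`. -/
def key (p : Par) (q x : ℕ) : ℕ := (p.qg q + (p.P - 1) * p.h x) % p.P

theorem key_eq_iff (hR : 0 < p.R) (hS : 0 < p.S) (hh : ∀ x, p.h x < p.P) {q x y : ℕ} :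
    p.h y = p.key q x ↔ (p.h x + p.h y) % p.P = p.qg q := by
  have hP := P_pos hR hS
  have hg : p.qg q < p.P := Nat.mod_lt _ hP
  have e := pred_mul_cast hP (p.h x)
  have h1 : p.h y = p.key q x ↔ (p.h y : ℤ) ≡ p.qg q - p.h x [ZMOD p.P] := by
    have h2 := Int.natCast_modEq_iff (a := p.h y) (b := p.qg q + (p.P - 1) * p.h x) (n := p.P)
    rw [Nat.ModEq, Nat.mod_eq_of_lt (hh y)] at h2
    unfold key
    rw [← h2]
    push_cast
    rw [sub_eq_add_neg]
    exact ⟨fun h => h.trans (Int.ModEq.add_left _ e), fun h => h.trans (Int.ModEq.add_left _ e.symm)⟩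
  have h3 := Int.natCast_modEq_iff (a := p.h x + p.h y) (b := p.qg q) (n := p.P)
  rw [Nat.ModEq, Nat.mod_eq_of_lt hg] at h3
  rw [h1, ← h3]
  push_cast
  constructor
  · intro h
    have := h.add_left (p.h x : ℤ)
    rwa [add_sub_cancel] at this
  · intro h
    have := h.sub_right (p.h x : ℤ)
    rwa [add_sub_cancel_left] at this

/-- The pairs with the right hash values that are found in query `q`. -/
def hits (p : Par) (q : ℕ) : Finset ((ℕ × ℕ) × ℕ) :=
  ((Finset.range p.S ×ˢ Finset.range p.n) ×ˢ Finset.range p.n).filter fun e =>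
    p.colA e.1.1 e.1.2 = p.q1 q ∧ (p.h e.1.2 + p.h e.2) % p.P = p.qg q

theorem mem_hits {q : ℕ} {e : (ℕ × ℕ) × ℕ} : e ∈ p.hits q ↔
    ((e.1.1 < p.S ∧ e.1.2 < p.n) ∧ e.2 < p.n) ∧ p.colA e.1.1 e.1.2 = p.q1 q ∧
      (p.h e.1.2 + p.h e.2) % p.P = p.qg q := by
  simp [hits]

theorem mem_HL {k y : ℕ} : y ∈ p.HL k ↔ y < p.n ∧ p.h y = k := by
  simp [HL, mem_bucket]

theorem mem_ML {k x : ℕ} : x ∈ p.ML k ↔ ∃ c < p.S, x < p.n ∧ p.colA c x = k := by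
  rw [ML, mem_bucket]
  constructor
  · rintro ⟨e, he, rfl, rfl⟩
    exact ⟨e.1, (mem_evs.1 he).1, (mem_evs.1 he).2, rfl⟩
  · rintro ⟨c, hc, hx, rfl⟩
    exact ⟨(c, x), mem_evs.2 ⟨hc, hx⟩, rfl, rfl⟩

theorem length_HL (k : ℕ) :
    (p.HL k).length = ((Finset.range p.n).filter fun y => p.h y = k).card := by
  rw [HL, bucket, List.length_map, ← List.toFinset_card_of_nodup (List.nodup_range.filter _)]
  congr 1
  ext
  simp

/-- The inner loops of the verification of one query run through its hits exactly once. Hash values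
are reduced modulo `P`, so looking up the key finds all partners. -/
theorem card_hits (hR : 0 < p.R) (hS : 0 < p.S) (hh : ∀ x, p.h x < p.P) (q : ℕ) :
    ((p.ML (p.q1 q)).map fun x => (p.HL (p.key q x)).length).sum = (p.hits q).card := by
  have h1 : p.hits q = (((evs p.n p.S 0).filter fun e => p.colA e.1 e.2 = p.q1 q).toFinset.sigma
      fun e => (Finset.range p.n).filter fun y => p.h y = p.key q e.2).map
        (Equiv.sigmaEquivProd _ _).toEmbedding := by
    ext ⟨⟨c, x⟩, y⟩
    simp only [mem_hits, Finset.mem_map_equiv, Equiv.sigmaEquivProd_symm_apply, Finset.mem_sigma,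
      List.mem_toFinset, List.mem_filter, mem_evs, decide_eq_true_eq, Finset.mem_filter,
      Finset.mem_range, key_eq_iff hR hS hh]
    tauto
  rw [h1, Finset.card_map, Finset.card_sigma, List.sum_toFinset _ ((nodup_evs _ _).filter _),
    ML, bucket, List.map_map]
  congr 1
  refine List.map_congr_left fun e _ => ?_
  exact length_HL _

/-- Pairs `x, y` and elements `z` whose hash values are consistent with `x + y = z`, although `G`
does not hold. -/
noncomputable def spurious (p : Par) (G : ℕ → ℕ → ℕ → Prop) : Finset (ℕ × ℕ × ℕ × ℕ) := by
  classical exact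
  (Finset.range p.n ×ˢ Finset.range p.n ×ˢ Finset.range p.n ×ˢ Finset.range 8).filter fun e =>
    (p.h e.1 + p.h e.2.1) % p.P = p.gval e.2.2.1 e.2.2.2 ∧ ¬ G e.1 e.2.1 e.2.2.1

theorem mem_spurious {G : ℕ → ℕ → ℕ → Prop} {x y z e : ℕ} : (x, y, z, e) ∈ p.spurious G ↔
    (x < p.n ∧ y < p.n ∧ z < p.n ∧ e < 8) ∧
      (p.h x + p.h y) % p.P = p.gval z e ∧ ¬ G x y z := by
  simp [spurious]

theorem qz_lt (hR : 0 < p.R) {q : ℕ} (hq : q < p.m) : p.qz q < p.n := by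
  unfold qz
  rw [Nat.div_lt_iff_lt_mul (by unfold R2; omega)]
  refine hq.trans_le ?_
  unfold m R2
  apply le_of_eq
  ring

/-- The query can be recovered from the indices and the carries of a hit: `z` and `e` fix the hash
sum `g`, this fixes the shift `g % S`, and the slot of `x` for that shift is the last coordinate of
the query. So hits of different queries give different spurious quadruples. -/
theorem sum_card_hits_le (hR : 0 < p.R) (hS : 0 < p.S) (G : ℕ → ℕ → ℕ → Prop) (Q : Finset ℕ)
    (hQ : ∀ q ∈ Q, q < p.m ∧ ∀ e ∈ p.hits q, ¬ G e.1.2 e.2 (p.qz q)) :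
    ∑ q ∈ Q, (p.hits q).card ≤ (p.spurious G).card := by
  have hR2 : 0 < p.R2 := by unfold R2; omega
  rw [← Finset.card_sigma]
  refine Finset.card_le_card_of_injOn
    (fun e : (_ : ℕ) × ((ℕ × ℕ) × ℕ) => (e.2.1.2, e.2.2, p.qz e.1, p.qe e.1)) ?_ ?_
  · rintro ⟨q, ⟨c, x⟩, y⟩ he
    rw [Finset.mem_coe, Finset.mem_sigma] at he
    obtain ⟨h1, h2⟩ := hQ q he.1
    have h3 := mem_hits.1 he.2
    exact mem_spurious.2 ⟨⟨h3.1.1.2, h3.1.2, qz_lt hR h1, Nat.mod_lt _ (by norm_num)⟩, h3.2.2,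
      h2 _ he.2⟩
  · rintro ⟨q, ⟨c, x⟩, y⟩ he ⟨q', ⟨c', x'⟩, y'⟩ he' heq
    rw [Finset.mem_coe, Finset.mem_sigma] at he he'
    simp only [Prod.mk.injEq] at heq
    obtain ⟨rfl, rfl, hz, hee⟩ := heq
    have h3 := mem_hits.1 he.2
    have h3' := mem_hits.1 he'.2
    have hs : ∀ q, p.qs q < p.R2 := fun q => Nat.mod_lt _ hR2
    have hg : p.qg q = p.qg q' := by unfold qg; rw [hz, hee]
    obtain ⟨k1, k2⟩ := colA_inj hR hS h3.1.1.2 (hs q) h3.2.1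
    obtain ⟨k1', k2'⟩ := colA_inj hR hS h3'.1.1.2 (hs q') h3'.2.1
    rw [← hg, ← k1] at k1'
    simp only at k1 k2 k1' k2'
    subst k1'
    have hss : p.qs q = p.qs q' := k2.symm.trans k2'
    have : q = q' := by
      have e1 := Nat.div_add_mod q p.R2
      have e2 := Nat.div_add_mod q' p.R2
      have e3 := Nat.div_add_mod (q / p.R2) 8
      have e4 := Nat.div_add_mod (q' / p.R2) 8
      have e5 : q / p.R2 / 8 = q' / p.R2 / 8 := by
        rw [Nat.div_div_eq_div_mul, Nat.div_div_eq_div_mul]; exact hz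
      have e6 : q / p.R2 % 8 = q' / p.R2 % 8 := hee
      have e7 : q % p.R2 = q' % p.R2 := hss
      rw [← e1, ← e2, ← e3, ← e4, e5, e6, e7]
    subst this
    rfl

end Par

/-! ### Correctness and running time of the verification -/

namespace Imp

open Par

variable {w : ℕ} {p : Par} {σ : Env}

/-- The condition of the test in the verification. -/
def Good (w : ℕ) (A : ℕ → ℕ) (x y z : ℕ) : Prop :=
  (A x + A y) % 2 ^ w = A z ∧ x ≠ y ∧ x ≠ z ∧ y ≠ z

theorem run_ite_eq (e f : Expr) (c d : Cmd) (σ : Env) : run w (.ite (.bin .eq e f) c d) σ =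
    if e.eval w σ = f.eval w σ then run w c (σ.tick (e.cost + (f.cost + 1) + 1))
      else run w d (σ.tick (e.cost + (f.cost + 1) + 1)) := by
  rw [run_ite, eval_bin, cost_bin]
  by_cases h : e.eval w σ = f.eval w σ <;> simp [Bop.eval, h]

theorem run_cTest : ((run w cTest σ).v 0 ≠ 0 ↔
      σ.v 0 ≠ 0 ∨ Good w (σ.a 0) (σ.v 27) (σ.v 29) (σ.v 22)) ∧
    (run w cTest σ).t ≤ σ.t + 30 := by
  simp only [cTest, run_ite_eq, Good]
  split_ifs with h1 h2 h3 h4 <;> refine ⟨?_, by simp [add_assoc]⟩ <;>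
    simp only [eval_bin, Bop.eval, eval_get, eval_var, tick_v] at * <;>
    simp only [run_skip, run_set, tick_v, setV_v, if_true, eval_lit] <;> tauto

def cVerifyEl : Cmd :=
  .rep 24 (.get 4 (.var 28)) (.seq (.set 29 (.get 6 (.var 28 * .var 17 + .var 24))) cTest)

theorem run_cVerifyEl (hS : 0 < p.S) (hσ : Built p σ) {k : ℕ} (h28 : σ.v 28 = k) :
    ((run w cVerifyEl σ).v 0 ≠ 0 ↔
      σ.v 0 ≠ 0 ∨ ∃ y ∈ p.HL k, Good w (σ.a 0) (σ.v 27) y (σ.v 22)) ∧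
    (run w cVerifyEl σ).t ≤ σ.t + 5 + 50 * (p.HL k).length := by
  have hlen : (p.HL k).length < p.st := by
    refine ((length_bucket_le _ _ _ _).trans_eq List.length_range).trans_lt ?_
    exact n_lt_st hS
  have key := run_for_ctx (w := w) hσ.ctx (by decide : cVerifyEl.low = true)
    (fun j τ => (τ.v 0 ≠ 0 ↔
      σ.v 0 ≠ 0 ∨ ∃ i < j, Good w (σ.a 0) (σ.v 27) ((p.HL k).getD i 0) (σ.v 22)) ∧
      τ.t ≤ σ.t + 5 + 50 * j) ⟨by simp, by simp⟩ ?_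
  · rw [eval_get, eval_var, h28, hσ.HL.1] at key
    rw [List.exists_getD_iff _ (fun y => Good w (σ.a 0) (σ.v 27) y (σ.v 22))] at key
    exact key
  · intro j hj τ hv ha hc ⟨h1, h2⟩
    rw [eval_get, eval_var, h28, hσ.HL.1] at hj
    set τ' := run w (.set 29 (.get 6 (.var 28 * .var 17 + .var 24))) (τ.setV 24 j) with hτ'
    have e28 : τ.v 28 = k := (hv 28 (by decide)).trans h28
    have e17 : τ.v 17 = p.st := by simpa using hc.st
    have f29 : τ'.v 29 = (p.HL k).getD j 0 := by
      rw [hτ']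
      simp only [run_set, tick_v, setV_v, if_true, eval_get, eval_add, eval_mul, eval_var,
        setV_a, Nat.reduceEqDiff, if_false, e28, e17, ha 6 (by decide)]
      exact hσ.HL.2 _ _ (by omega)
    have f27 : τ'.v 27 = σ.v 27 := by rw [hτ']; simpa using hv 27 (by decide)
    have f22 : τ'.v 22 = σ.v 22 := by rw [hτ']; simpa using hv 22 (by decide)
    have f0 : τ'.v 0 = τ.v 0 := by rw [hτ']; simp
    have fa : τ'.a 0 = σ.a 0 := ha 0 (by decide)
    have ft : τ'.t = τ.t + 7 := by rw [hτ']; simp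
    have hrun : run w (.seq (.set 29 (.get 6 (.var 28 * .var 17 + .var 24))) cTest) (τ.setV 24 j)
      = run w cTest τ' := rfl
    obtain ⟨g1, g2⟩ := run_cTest (w := w) (σ := τ')
    rw [f29, f27, f22, f0, fa, h1] at g1
    refine ⟨?_, ?_⟩
    · rw [tick_v, hrun, g1, or_assoc]
      refine or_congr_right ?_
      simp only [Nat.lt_succ_iff_lt_or_eq, or_and_right, exists_or, exists_eq_left]
    · rw [tick_t, hrun]
      omega


def cVerifyBody : Cmd :=
  .seq (.set 27 (.get 12 (.var 26 * .var 17 + .var 23)))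
    (.seq (.set 28 ((.get 28 (.var 21) + .var 20 * .get 2 (.var 27)) % .var 6)) cVerifyEl)

theorem length_ML_lt_st (k : ℕ) : (p.ML k).length < p.st := by
  refine (length_bucket_le _ _ _ _).trans_lt ?_
  rw [length_evs, st, Nat.add_zero, Nat.mul_comm]
  omega

theorem run_cVerify (hR : 0 < p.R) (hS : 0 < p.S) (hσ : Built p σ) {q : ℕ} (hq : q < p.m)
    (h21 : σ.v 21 = q) (hh : ∀ x, p.h x < p.P) :
    ((run w cVerify σ).v 0 ≠ 0 ↔ σ.v 0 ≠ 0 ∨ ∃ x ∈ p.ML (p.q1 q), ∃ y ∈ p.HL (p.key q x),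
      Good w (σ.a 0) x y (p.qz q)) ∧
    (run w cVerify σ).t ≤ σ.t + 30 + 40 * (p.ML (p.q1 q)).length + 50 * (p.hits q).card := by
  set σ₁ := run w (.seq (.set 26 (.get 24 (.var 21))) (.set 22 (.var 21 / (.var 13 * .lit 8)))) σ
    with hσ₁
  have c1 : Ctx p σ₁ := hσ.ctx.run (by decide)
  have f26 : σ₁.v 26 = p.q1 q := by
    rw [hσ₁]; simp [h21, (hσ.q q hq).1]
  have f22 : σ₁.v 22 = p.qz q := by
    rw [hσ₁]; simp [h21, hσ.ctx.R2, qz]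
  have f21 : σ₁.v 21 = q := by
    rw [hσ₁]; simp [h21]
  have f0 : σ₁.v 0 = σ.v 0 := by
    rw [hσ₁]; simp
  have fa : σ₁.a = σ.a := rfl
  have ft : σ₁.t = σ.t + 9 := by rw [hσ₁]; simp
  have b1 : Built p σ₁ := ⟨c1, hσ.HL, hσ.ML, hσ.ip, hσ.q⟩
  have hrun : run w cVerify σ = run w (.rep 23 (.get 10 (.var 26)) cVerifyBody) σ₁ := rfl
  have key := run_for_ctx (w := w) c1
    (by decide : (Cmd.rep 23 (.get 10 (.var 26)) cVerifyBody).low = true)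
    (fun i τ => (τ.v 0 ≠ 0 ↔ σ.v 0 ≠ 0 ∨ ∃ j < i, ∃ y ∈ p.HL (p.key q ((p.ML (p.q1 q)).getD j 0)),
        Good w (σ.a 0) ((p.ML (p.q1 q)).getD j 0) y (p.qz q)) ∧
      τ.t ≤ σ.t + 30 + 40 * i +
        50 * ∑ j ∈ Finset.range i, (p.HL (p.key q ((p.ML (p.q1 q)).getD j 0))).length)
    ⟨by simp [f0], by simp [ft]⟩ ?_
  · rw [eval_get, eval_var, f26, b1.ML.1, ← hrun] at key
    rw [List.exists_getD_iff _ (fun x => ∃ y ∈ p.HL (p.key q x), Good w (σ.a 0) x y (p.qz q)),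
      List.sum_range_getD _ (fun x => (p.HL (p.key q x)).length), card_hits hR hS hh] at key
    exact key
  · intro i hi τ hv ha hc ⟨h1, h2⟩
    rw [eval_get, eval_var, f26, b1.ML.1] at hi
    have hist := hi.trans (length_ML_lt_st (p.q1 q))
    set τ₁ := run w (.set 27 (.get 12 (.var 26 * .var 17 + .var 23))) (τ.setV 23 i) with hτ₁
    set x := (p.ML (p.q1 q)).getD i 0 with hx
    have ha' : ∀ a, τ.a a = σ.a a := fun a => ha a (by simp [cVerifyBody, cVerifyEl, cTest, Cmd.wa])
    have g26 : τ.v 26 = p.q1 q := (hv 26 (by decide)).trans f26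
    have g17 : τ.v 17 = p.st := by simpa using hc.st
    have g20 : τ.v 20 = p.P - 1 := by simpa using hc.P1
    have g6 : τ.v 6 = p.P := by simpa using hc.P
    have g2 : τ.a 2 = p.h := by simpa using hc.h
    have g21 : τ.v 21 = q := (hv 21 (by decide)).trans f21
    have g27 : τ₁.v 27 = x := by
      rw [hτ₁]
      simp only [run_set, tick_v, setV_v, if_true, eval_get, eval_add, eval_mul, eval_var,
        setV_a, Nat.reduceEqDiff, if_false, g26, g17, ha' 12]
      exact hσ.ML.2 _ _ hist
    set τ₂ := run w (.set 28 ((.get 28 (.var 21) + .var 20 * .get 2 (.var 27)) % .var 6)) τ₁ with hτ₂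
    have k28 : τ₂.v 28 = p.key q x := by
      have e28 : τ₁.a 28 q = p.qg q := by
        rw [show τ₁.a 28 = σ.a 28 from ha' 28]; exact (hσ.q q hq).2.2
      have e2 : τ₁.a 2 = p.h := g2
      have e21 : τ₁.v 21 = q := by rw [hτ₁]; simpa using g21
      have e20 : τ₁.v 20 = p.P - 1 := by rw [hτ₁]; simpa using g20
      have e6 : τ₁.v 6 = p.P := by rw [hτ₁]; simpa using g6
      rw [hτ₂]
      simp only [run_set, tick_v, setV_v, if_true, eval_get, eval_add, eval_mul, eval_var,
        eval_mod, g27, e28, e2, e21, e20, e6, Par.key]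
    have k27 : τ₂.v 27 = x := by rw [hτ₂]; simpa using g27
    have k22 : τ₂.v 22 = p.qz q := by
      rw [hτ₂, hτ₁]; simpa using (hv 22 (by decide)).trans f22
    have k0 : τ₂.v 0 = τ.v 0 := by rw [hτ₂, hτ₁]; simp
    have kt : τ₂.t = τ.t + 17 := by rw [hτ₂, hτ₁]; simp
    have ka : ∀ a, τ₂.a a = σ.a a := ha'
    have kc : Ctx p τ₂ := (hc.run (c := .set 27 _) rfl).run (c := .set 28 _) rfl
    have kb : Built p τ₂ := ⟨kc, hσ.HL.congr (ka _) (ka _), hσ.ML.congr (ka _) (ka _),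
      by rw [ka]; exact hσ.ip, by rw [ka, ka, ka, ka]; exact hσ.q⟩
    obtain ⟨r1, r2⟩ := run_cVerifyEl (w := w) hS kb k28
    have hrun' : run w cVerifyBody (τ.setV 23 i) = run w cVerifyEl τ₂ := rfl
    rw [hrun', tick_v, tick_t, r1, k0, h1, k27, k22, ka, Finset.sum_range_succ]
    refine ⟨?_, by rw [← hx]; omega⟩
    rw [or_assoc]
    refine or_congr_right ?_
    simp only [Nat.lt_succ_iff_lt_or_eq, or_and_right, exists_or, exists_eq_left, ← hx]

/-- Query `q` finds a solution. -/
def Finds (w : ℕ) (A : ℕ → ℕ) (p : Par) (q : ℕ) : Prop :=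
  ∃ e ∈ p.hits q, Good w A e.1.2 e.2 (p.qz q)

theorem finds_iff (hR : 0 < p.R) (hS : 0 < p.S) (hh : ∀ x, p.h x < p.P) {A : ℕ → ℕ} {q : ℕ} :
    (∃ x ∈ p.ML (p.q1 q), ∃ y ∈ p.HL (p.key q x), Good w A x y (p.qz q)) ↔ Finds w A p q := by
  constructor
  · rintro ⟨x, hx, y, hy, hg⟩
    obtain ⟨c, hc, hxn, hcol⟩ := mem_ML.1 hx
    obtain ⟨hyn, hk⟩ := mem_HL.1 hy
    exact ⟨((c, x), y), mem_hits.2 ⟨⟨⟨hc, hxn⟩, hyn⟩, hcol, (key_eq_iff hR hS hh).1 hk⟩, hg⟩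
  · rintro ⟨⟨⟨c, x⟩, y⟩, he, hg⟩
    obtain ⟨⟨⟨hc, hx⟩, hy⟩, hcol, hsum⟩ := mem_hits.1 he
    exact ⟨x, mem_ML.2 ⟨c, hc, hx, hcol⟩, y, mem_HL.2 ⟨hy, (key_eq_iff hR hS hh).2 hsum⟩, hg⟩

theorem card_hits_le (hR : 0 < p.R) (hS : 0 < p.S) (hh : ∀ x, p.h x < p.P) (q : ℕ) :
    (p.hits q).card ≤ p.B * p.n := by
  rw [← card_hits hR hS hh]
  refine (List.sum_le_card_nsmul _ p.n ?_).trans ?_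
  · intro k hk
    obtain ⟨x, _, rfl⟩ := List.mem_map.1 hk
    exact (length_bucket_le _ _ _ _).trans_eq List.length_range
  · rw [List.length_map, smul_eq_mul]
    exact Nat.mul_le_mul_right _ (length_ML_le hR hS _)

/-- A verification costs a constant, plus `O(B)` for the members of the colour, plus the number of
hits. If it fails, then all hits are spurious and, by `hit`, there is at least one; this pays for
the whole verification up to a factor `O(B + 1)`. At most one verification succeeds, and it has at
most `B * n` hits. -/
theorem run_cCheck (hR : 0 < p.R) (hS : 0 < p.S) (hσ : Built p σ) (hh : ∀ x, p.h x < p.P)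
    (hit : ∀ q < p.m, σ.a 30 q ≤ p.thr → (p.hits q).Nonempty) :
    ((run w cCheck σ).v 0 ≠ 0 ↔ ∃ q < p.m, σ.a 30 q ≤ p.thr ∧ Finds w (σ.a 0) p q) ∧
    (run w cCheck σ).t ≤ σ.t + 10 + 50 * p.m
      + 200 * (p.B + 1) * ((p.spurious (Good w (σ.a 0))).card + (p.n + 1)) := by
  classical
  set A := σ.a 0 with hA
  set f : ℕ → ℕ := fun q => if σ.a 30 q ≤ p.thr ∧ ¬ Finds w A p q then (p.hits q).card else 0 with hf
  have c1 : Ctx p (run w (.set 0 (.lit 0)) σ) := hσ.ctx.run (by decide)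
  have hrun : run w cCheck σ = run w (.rep 21 (.var 16)
    (.ite (.var 0) .skip (.ite (.bin .lt (.get 30 (.var 21)) (.var 10 + .lit 1)) cVerify .skip)))
      (run w (.set 0 (.lit 0)) σ) := rfl
  have key := run_for_ctx (w := w) c1 (r := 21) (e := .var 16) (c :=
    .ite (.var 0) .skip (.ite (.bin .lt (.get 30 (.var 21)) (.var 10 + .lit 1)) cVerify .skip))
    (by decide)
    -- The sum of `f` collects the failures, and the last summand pays for the only success.
    (fun i τ => (τ.v 0 ≠ 0 ↔ ∃ q < i, σ.a 30 q ≤ p.thr ∧ Finds w A p q) ∧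
      τ.t ≤ σ.t + 10 + 50 * i + 200 * (p.B + 1) * ∑ q ∈ Finset.range i, f q
        + if τ.v 0 = 0 then 0 else 200 * (p.B + 1) * (p.n + 1)) ⟨by simp, by simp⟩ ?_
  · rw [eval_var, c1.m, ← hrun] at key
    refine ⟨key.1, key.2.trans ?_⟩
    have h1 : ∑ q ∈ Finset.range p.m, f q ≤ (p.spurious (Good w A)).card := by
      rw [hf, ← Finset.sum_filter]
      refine sum_card_hits_le hR hS _ _ fun q hq => ?_
      rw [Finset.mem_filter, Finset.mem_range] at hq
      exact ⟨hq.1, fun e he hg => hq.2.2 ⟨e, he, hg⟩⟩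
    have h2 := Nat.mul_le_mul_left (200 * (p.B + 1)) h1
    have h3 : (if (run w cCheck σ).v 0 = 0 then 0 else 200 * (p.B + 1) * (p.n + 1))
        ≤ 200 * (p.B + 1) * (p.n + 1) := by
      split_ifs
      · exact Nat.zero_le _
      · exact le_rfl
    have h4 := Nat.mul_add (200 * (p.B + 1)) (p.spurious (Good w A)).card (p.n + 1)
    omega
  · intro i hi τ hv ha hc ⟨h1, h2⟩
    rw [eval_var, c1.m] at hi
    have ha' : ∀ a, τ.a a = σ.a a := fun a => ha a (by simp [cVerify, cTest, Cmd.wa])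
    have hex : (∃ q < i + 1, σ.a 30 q ≤ p.thr ∧ Finds w A p q)
        ↔ (∃ q < i, σ.a 30 q ≤ p.thr ∧ Finds w A p q) ∨ (σ.a 30 i ≤ p.thr ∧ Finds w A p i) := by
      simp only [Nat.lt_succ_iff_lt_or_eq, or_and_right, exists_or, exists_eq_left]
    have hfi : 200 * (p.B + 1) * ∑ q ∈ Finset.range (i + 1), f q
      = 200 * (p.B + 1) * ∑ q ∈ Finset.range i, f q + 200 * (p.B + 1) * f i := by
      rw [Finset.sum_range_succ, Nat.mul_add]
    rw [hex, hfi, run_ite]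
    have e0 : (Expr.var 0).eval w (τ.setV 21 i) = τ.v 0 := by simp
    rw [e0]
    by_cases h0 : τ.v 0 = 0
    · rw [if_neg (not_not.2 h0), run_ite]
      rw [if_pos h0] at h2
      have h1' : ¬ ∃ q < i, σ.a 30 q ≤ p.thr ∧ Finds w A p q := fun h => h1.2 h h0
      set τ₁ := (τ.setV 21 i).tick ((Expr.var 0).cost + 1) with hτ₁
      have g10 : τ.v 10 = p.thr := by simpa using hc.thr
      have e1 : (Expr.bin .lt (.get 30 (.var 21)) (.var 10 + .lit 1)).eval w τ₁ ≠ 0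
          ↔ σ.a 30 i ≤ p.thr := by
        simp [hτ₁, Bop.eval, g10, ha' 30]
      by_cases hle : σ.a 30 i ≤ p.thr
      · rw [if_pos (e1.2 hle)]
        set τ₂ := τ₁.tick ((Expr.bin .lt (.get 30 (.var 21)) (.var 10 + .lit 1)).cost + 1) with hτ₂
        have kc : Ctx p τ₂ := hc.congr (fun _ _ _ => rfl) rfl
        have ka : ∀ a, τ₂.a a = σ.a a := ha'
        have kb : Built p τ₂ := ⟨kc, hσ.HL.congr (ka _) (ka _), hσ.ML.congr (ka _) (ka _),
          by rw [ka]; exact hσ.ip, by rw [ka, ka, ka, ka]; exact hσ.q⟩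
        obtain ⟨r1, r2⟩ := run_cVerify (w := w) hR hS kb hi (by simp [hτ₂, hτ₁]) hh
        rw [finds_iff hR hS hh] at r1
        have k0 : τ₂.v 0 = 0 := by simp [hτ₂, hτ₁, h0]
        have kt : τ₂.t = τ.t + 9 := by simp [hτ₂, hτ₁]
        have hB := length_ML_le (p := p) hR hS (p.q1 i)
        rw [ka, ← hA] at r1
        refine ⟨?_, ?_⟩
        · rw [tick_v, r1, k0]
          simp [h1', hle]
        · rw [tick_t, tick_v]
          by_cases hF : Finds w A p i
          · have : (run w cVerify τ₂).v 0 ≠ 0 := r1.2 (Or.inr hF)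
            rw [if_neg this]
            have hc := card_hits_le hR hS hh i
            have e5 : 200 * (p.B + 1) * (p.n + 1)
              = 200 * (p.B * p.n) + 200 * p.B + 200 * p.n + 200 := by ring
            omega
          · have : ¬ (run w cVerify τ₂).v 0 ≠ 0 := fun h => (r1.1 h).elim (fun h => h k0) hF
            rw [if_pos (not_not.1 this)]
            have hfi' : f i = (p.hits i).card := if_pos ⟨hle, hF⟩
            -- At least one hit, hence a factor that absorbs the scan of the slot and the constants.
            have hpos := Finset.card_pos.2 (hit i hi hle)
            obtain ⟨k, hk⟩ := Nat.exists_eq_add_of_le' hpos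
            have e6 : 200 * (p.B + 1) * f i = 200 * p.B * k + 200 * p.B + 200 * k + 200 := by
              rw [hfi', hk]; ring
            have e7 : 0 ≤ 200 * p.B * k := Nat.zero_le _
            omega
      · rw [if_neg (fun h => hle (e1.1 h))]
        refine ⟨?_, ?_⟩
        · simp [hτ₁, h0, hle]
          simpa using h1'
        · simp [hτ₁, h0]
          omega
    · rw [if_pos h0]
      rw [if_neg h0] at h2
      refine ⟨?_, ?_⟩
      · have := h1.1 h0
        simp [h0, this]
      · simp [h0]
        omega

end Imp

/-! ### Small distances correspond to matching hash values -/

namespace Par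

variable {p : Par}

/-- The array of colours. -/
def colours (p : Par) (hR : 0 < p.R) (hS : 0 < p.S) : Fin p.N → Fin p.N :=
  fun i => ⟨p.X i, X_lt hR hS i⟩

theorem qs_lt (hR : 0 < p.R) (q : ℕ) : p.qs q < p.R2 := Nat.mod_lt _ (by unfold R2; omega)

theorem q1_bounds (hR : 0 < p.R) (hS : 0 < p.S) (q : ℕ) : 1 ≤ p.q1 q ∧ p.q1 q ≤ p.nA := by
  have h1 := qs_lt (p := p) hR q
  have h2 : (p.qg q % p.S + 1) * p.R2 ≤ p.S * p.R2 := Nat.mul_le_mul_right _ (Nat.mod_lt _ hS)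
  rw [Nat.add_mul, Nat.mul_comm p.S] at h2
  unfold q1 nA
  omega

theorem mul_add_lt_mul {c a R S : ℕ} (hc : c < S) (ha : a < R) : c * R + a < R * S := by
  have h2 : (c + 1) * R ≤ S * R := Nat.mul_le_mul_right _ hc
  rw [Nat.add_mul, Nat.mul_comm S] at h2
  omega

theorem q2_bounds (hR : 0 < p.R) (hS : 0 < p.S) (ip : ℕ → ℕ) (q : ℕ) :
    1 + p.nA ≤ p.q2 ip q ∧ p.q2 ip q < 1 + p.nA + p.R * p.S := by
  unfold q2
  have := mul_add_lt_mul (Nat.mod_lt (p.qg q / p.S) hS)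
    (Nat.mod_lt (ip (p.q1 q) + p.qg q / p.S2) hR)
  omega

theorem q1_lt (hR : 0 < p.R) (hS : 0 < p.S) (q : ℕ) : p.q1 q < p.N := by
  have := q1_bounds hR hS q
  have := colours_lt_N (p := p)
  omega

theorem q2_lt (hR : 0 < p.R) (hS : 0 < p.S) (ip : ℕ → ℕ) (q : ℕ) : p.q2 ip q < p.N := by
  have := q2_bounds hR hS ip q
  have := colours_lt_N (p := p)
  omega

/-- The oracle promises nothing about colours that do not occur. Listing all colours in the header
makes every query legitimate, even for an empty slot. -/
theorem q1_mem_range (hR : 0 < p.R) (hS : 0 < p.S) (q : ℕ) :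
    (⟨p.q1 q, q1_lt hR hS q⟩ : Fin p.N) ∈ Set.range (p.colours hR hS) :=
  ⟨⟨p.q1 q, q1_lt hR hS q⟩, Fin.ext (X_colourA (q1_bounds hR hS q).2)⟩

theorem q2_mem_range (hR : 0 < p.R) (hS : 0 < p.S) (ip : ℕ → ℕ) (q : ℕ) :
    (⟨p.q2 ip q, q2_lt hR hS ip q⟩ : Fin p.N) ∈ Set.range (p.colours hR hS) := by
  obtain ⟨h1, h2⟩ := q2_bounds hR hS ip q
  obtain ⟨j, hj⟩ := Nat.exists_eq_add_of_le h1
  have hjR : j < p.R * p.S := by omega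
  have := base_le_N (p := p)
  refine ⟨⟨1 + p.nA + p.thr + j, by unfold base at this; omega⟩, Fin.ext ?_⟩
  exact (X_colourB hjR).trans hj.symm

/-- The list of queries. -/
def queries (p : Par) (hR : 0 < p.R) (hS : 0 < p.S) (ip : ℕ → ℕ) : List (Fin p.N × Fin p.N) :=
  (List.range p.m).map fun q => (⟨p.q1 q, q1_lt hR hS q⟩, ⟨p.q2 ip q, q2_lt hR hS ip q⟩)

theorem div_eq_of_mul_add_eq {c c' a a' R : ℕ} (ha : a < R) (ha' : a' < R)
    (h : c * R + a = c' * R + a') : c = c' ∧ a = a' := by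
  have hR : 0 < R := by omega
  have h1 := congrArg (· / R) h
  have h2 := congrArg (· % R) h
  simp only [Nat.mul_comm _ R, Nat.mul_add_div hR, Nat.div_eq_of_lt ha, Nat.div_eq_of_lt ha',
    Nat.mul_add_mod, Nat.mod_eq_of_lt ha, Nat.mod_eq_of_lt ha', Nat.add_zero] at h1 h2
  exact ⟨h1, h2⟩

theorem fB_div_lt (hR : 0 < p.R) (hS : 0 < p.S) (c y : ℕ) : p.fB c y / p.S2 < p.R := by
  rw [Nat.div_lt_iff_lt_mul (S2_pos hS)]
  exact Nat.mod_lt _ (P_pos hR hS)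

variable {ip : ℕ → ℕ}

/-- A small distance of the colours of a query is caused by a pair with the right hash values. -/
theorem hits_nonempty (hR : 0 < p.R) (hS : 0 < p.S)
    (hip : ∀ c < p.S, ∀ x < p.n, ip (p.colA c x) = p.buck c x) {q : ℕ}
    (h : colorDist (p.colours hR hS) ⟨p.q1 q, q1_lt hR hS q⟩ ⟨p.q2 ip q, q2_lt hR hS ip q⟩ ≤ p.thr) :
    (p.hits q).Nonempty := by
  obtain ⟨i₁, hi₁⟩ := q1_mem_range hR hS q
  obtain ⟨j₁, hj₁⟩ := q2_mem_range hR hS ip q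
  have hne : {d | ∃ i j, p.colours hR hS i = ⟨p.q1 q, q1_lt hR hS q⟩ ∧
      p.colours hR hS j = ⟨p.q2 ip q, q2_lt hR hS ip q⟩ ∧ d = Nat.dist i j}.Nonempty :=
    ⟨_, i₁, j₁, hi₁, hj₁, rfl⟩
  obtain ⟨i, j, hi, hj, hd⟩ := Nat.sInf_mem hne
  rw [colorDist, hd] at h
  have hi' : p.X i = p.q1 q := congrArg Fin.val hi
  have hj' : p.X j = p.q2 ip q := congrArg Fin.val hj
  have b1 := q1_bounds hR hS q
  have b2 := q2_bounds hR hS ip q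
  obtain ⟨u, h1, h2⟩ := exists_common_of_near hR hS (q := i) (q' := j) (by omega) (by omega)
    (by omega) h
  rw [hi', LA, mem_bucket] at h1
  rw [hj', LB, mem_bucket] at h2
  obtain ⟨⟨c, x⟩, he, hu, hc⟩ := h1
  obtain ⟨⟨c', y⟩, he', hu', hc'⟩ := h2
  rw [mem_evs] at he he'
  simp only at he he' hu hu' hc hc'
  obtain ⟨k1, k2⟩ := colA_inj hR hS he.2 (qs_lt hR q) hc
  have hP := P_pos hR hS
  have hg : p.qg q < p.P := Nat.mod_lt _ hP
  unfold colB q2 at hc'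
  obtain ⟨k3, k4⟩ := div_eq_of_mul_add_eq (fB_div_lt hR hS c' y) (Nat.mod_lt _ hR)
    (Nat.add_left_cancel hc')
  refine ⟨((c, x), y), mem_hits.2 ⟨⟨he, he'.2⟩, hc, ?_⟩⟩
  rw [match_iff hR hS hg, ← k1, ← k3]
  refine ⟨hu.trans hu'.symm, ?_⟩
  rw [k4, ← hc, hip c he.1 x he.2]

/-- Every pair with the right hash values causes a small distance. -/
theorem exists_query (hR : 0 < p.R) (hS : 0 < p.S)
    (hip : ∀ c < p.S, ∀ x < p.n, ip (p.colA c x) = p.buck c x) {x y z e : ℕ} (hx : x < p.n)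
    (hy : y < p.n) (hz : z < p.n) (he : e < 8) (h : (p.h x + p.h y) % p.P = p.gval z e) :
    ∃ q < p.m, p.qz q = z ∧ (∃ c, ((c, x), y) ∈ p.hits q) ∧
      colorDist (p.colours hR hS) ⟨p.q1 q, q1_lt hR hS q⟩ ⟨p.q2 ip q, q2_lt hR hS ip q⟩
        ≤ p.b + p.b := by
  have hP := P_pos hR hS
  set g := p.gval z e with hgdef
  have hg : g < p.P := Nat.mod_lt _ hP
  set c := g % p.S with hc
  set c' := g / p.S % p.S with hc'
  have hcS : c < p.S := Nat.mod_lt _ hS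
  have hcS' : c' < p.S := Nat.mod_lt _ hS
  have hs := slot_lt hR hS (c := c) hx
  have hR2 : 0 < p.R2 := by omega
  -- The query with coordinates `z`, `e` and the slot of `x` for the shift `c`.
  set q := (z * 8 + e) * p.R2 + p.slot c x with hq
  have e0 : q / p.R2 = z * 8 + e := by
    rw [hq, Nat.mul_comm, Nat.mul_add_div hR2, Nat.div_eq_of_lt hs, Nat.add_zero]
  have e1 : p.qz q = z := by
    rw [qz, ← Nat.div_div_eq_div_mul, e0]; omega
  have e2 : p.qe q = e := by
    rw [qe, e0]; omega
  have e3 : p.qs q = p.slot c x := by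
    rw [qs, hq, Nat.mul_comm, Nat.mul_add_mod, Nat.mod_eq_of_lt hs]
  have eg : p.qg q = g := by rw [qg, e1, e2]
  have eq1 : p.q1 q = p.colA c x := by rw [q1, eg, e3, colA]
  obtain ⟨m1, m2⟩ := (match_iff hR hS hg).1 h
  have eq2 : p.q2 ip q = p.colB c' y := by
    rw [q2, eg, eq1, hip c hcS x hx, colB, m2]
  have hqm : q < p.m := by
    have : (z * 8 + e + 1) * p.R2 ≤ (p.n * 8) * p.R2 := Nat.mul_le_mul_right _ (by omega)
    have h2 : (z * 8 + e + 1) * p.R2 = (z * 8 + e) * p.R2 + p.R2 := by ring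
    have h3 : p.m = (p.n * 8) * p.R2 := by unfold m R2; ring
    omega
  refine ⟨q, hqm, e1, ⟨c, mem_hits.2 ⟨⟨⟨hcS, hx⟩, hy⟩, eq1.symm, by rw [eg]; exact h⟩⟩, ?_⟩
  have hu : p.elA c x < p.S2 := Nat.mod_lt _ (S2_pos hS)
  have la : p.q1 q ∈ p.LA (p.elA c x) := by
    rw [LA, mem_bucket]
    exact ⟨(c, x), mem_evs.2 ⟨hcS, hx⟩, rfl, eq1.symm⟩
  have lb : p.q2 ip q ∈ p.LB (p.elA c x) := by
    rw [LB, mem_bucket]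
    exact ⟨(c', y), mem_evs.2 ⟨hcS', hy⟩, m1.symm, eq2.symm⟩
  obtain ⟨i, j, hi, hj, k1, k2, k3⟩ := exists_near_of_common hR hS hu la lb
  refine (Nat.sInf_le ?_).trans k3
  exact ⟨⟨i, hi⟩, ⟨j, hj⟩, Fin.ext k1, Fin.ext k2, rfl⟩

end Par

/-! ### The hash function -/

namespace Par

/-- The leading `H` digits of a multiple of `x` modulo `2 ^ w`. -/
def top (w H r x : ℕ) : ℕ := (2 * r + 1) * x % 2 ^ w / 2 ^ (w - H)

/-- The hash value of the word `x`: its sign and leading digits of a multiple. -/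
def hsh (w H r x : ℕ) : ℕ := x / 2 ^ (w - 1) * (2 * 2 ^ H) + top w H r x

variable {w H r : ℕ}

theorem top_lt (hH : H ≤ w) (x : ℕ) : top w H r x < 2 ^ H := by
  unfold top
  rw [Nat.div_lt_iff_lt_mul (by positivity), ← pow_add, Nat.add_sub_cancel' hH]
  exact Nat.mod_lt _ (by positivity)

theorem sign_le {x : ℕ} (hw : 0 < w) (hx : x < 2 ^ w) : x / 2 ^ (w - 1) ≤ 1 := by
  rw [← Nat.lt_succ_iff, Nat.div_lt_iff_lt_mul (by positivity)]
  have : 2 ^ w = 2 * 2 ^ (w - 1) := by rw [← pow_succ']; congr 1; omega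
  omega

theorem hsh_lt (hw : 0 < w) (hH : H ≤ w) {x : ℕ} (hx : x < 2 ^ w) :
    hsh w H r x < 3 * 2 ^ H := by
  have h1 := Nat.mul_le_mul_right (2 * 2 ^ H) (sign_le hw hx)
  have h2 := top_lt (r := r) hH x
  unfold hsh
  omega

/-- Sums of words are sums of leading digits, up to carries. -/
theorem exists_carry (hH : H ≤ w) {x y z : ℕ} (h : (x + y) % 2 ^ w = z) :
    ∃ k e, k ≤ 1 ∧ e ≤ 1 ∧ top w H r x + top w H r y + e = top w H r z + k * 2 ^ H := by
  set Q := 2 ^ (w - H) with hQ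
  have hQ0 : 0 < Q := by positivity
  have hW : 2 ^ w = Q * 2 ^ H := by rw [hQ, ← pow_add]; congr 1; omega
  have hW0 : 0 < 2 ^ w := by positivity
  set u : ℕ → ℕ := fun x => (2 * r + 1) * x % 2 ^ w with hu
  have ul : ∀ x, u x < 2 ^ w := fun x => Nat.mod_lt _ hW0
  have key : (u x + u y) % 2 ^ w = u z := by
    simp only [hu]
    rw [← Nat.add_mod, ← Nat.mul_add, ← h, Nat.mul_mod_mod]
  have h3 := Nat.div_add_mod (u x + u y) (2 ^ w)
  rw [key] at h3
  set k := (u x + u y) / 2 ^ w with hk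
  have hk1 : k ≤ 1 := by
    rw [← Nat.lt_succ_iff, hk, Nat.div_lt_iff_lt_mul hW0]
    have := ul x; have := ul y
    omega
  have d : ∀ x, u x = Q * top w H r x + u x % Q := fun x => (Nat.div_add_mod (u x) Q).symm
  have m : ∀ x, u x % Q < Q := fun x => Nat.mod_lt _ hQ0
  have mx := m x; have my := m y; have mz := m z
  rw [d x, d y, d z] at h3
  have e1 : Q * (top w H r z + k * 2 ^ H) + u z % Q
      = Q * (top w H r x + top w H r y) + (u x % Q + u y % Q) := by
    rw [hW] at h3
    linarith
  -- `k` counts the wrap-around modulo `2 ^ w`; the other witness is the carry out of the discarded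
  -- low digits.
  refine ⟨k, (u x % Q + u y % Q) / Q, hk1, ?_, ?_⟩
  · rw [← Nat.lt_succ_iff, Nat.div_lt_iff_lt_mul hQ0]; omega
  · have := congrArg (· / Q) e1
    simp only [Nat.mul_add_div hQ0, Nat.div_eq_of_lt mz] at this
    omega

theorem exists_sign (hw : 0 < w) {x : ℤ} (h1 : -(2 : ℤ) ^ w ≤ 2 * x) (h2 : 2 * x < (2 : ℤ) ^ w) :
    ∃ s : ℕ, (BitVec.ofInt w x).toNat / 2 ^ (w - 1) = s ∧
      ((BitVec.ofInt w x).toNat : ℤ) = x + s * 2 ^ w ∧ ((s = 0 ∧ 0 ≤ x) ∨ (s = 1 ∧ x < 0)) := by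
  have hW : (2 : ℤ) ^ w = 2 * 2 ^ (w - 1) := by rw [← pow_succ']; congr 1; omega
  have hW' : 2 ^ w = 2 * 2 ^ (w - 1) := by rw [← pow_succ']; congr 1; omega
  have e : ((BitVec.ofInt w x).toNat : ℤ) = x % 2 ^ w := by
    rw [BitVec.toNat_ofInt, Int.toNat_of_nonneg]
    · norm_cast
    · exact Int.emod_nonneg _ (by positivity)
  have hlt := (BitVec.ofInt w x).isLt
  generalize (BitVec.ofInt w x).toNat = a at *
  have hp : 0 < 2 ^ (w - 1) := by positivity
  have hc : ((2 ^ (w - 1) : ℕ) : ℤ) = 2 ^ (w - 1) := by push_cast; rfl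
  rcases lt_or_ge x 0 with hx | hx
  · have e1 : x % 2 ^ w = x + 2 ^ w := by
      rw [← Int.add_mul_emod_self_left x (2 ^ w) 1, mul_one]
      exact Int.emod_eq_of_lt (by omega) (by omega)
    rw [e1] at e
    refine ⟨1, ?_, by push_cast; omega, Or.inr ⟨rfl, hx⟩⟩
    apply Nat.div_eq_of_lt_le <;> omega
  · rw [Int.emod_eq_of_lt hx (by omega)] at e
    refine ⟨0, ?_, by push_cast; omega, Or.inl ⟨rfl, hx⟩⟩
    apply Nat.div_eq_of_lt; omega

variable {p : Par}

theorem gval_cast (hP : 0 < p.P) (z e : ℕ) :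
    (p.gval z e : ℤ) ≡ p.h z + (e / 2 : ℕ) * p.HH - (e % 2 : ℕ) [ZMOD p.P] := by
  unfold gval
  push_cast
  refine (Int.mod_modEq _ _).trans ?_
  rw [sub_eq_add_neg]
  refine Int.ModEq.add_left _ ?_
  have := pred_mul_cast hP (e % 2)
  push_cast at this
  exact this

theorem match_iff_modEq (hP : 0 < p.P) {x y z e : ℕ} : (p.h x + p.h y) % p.P = p.gval z e ↔
    (p.h x + p.h y : ℤ) ≡ p.h z + (e / 2 : ℕ) * p.HH - (e % 2 : ℕ) [ZMOD p.P] := by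
  have hg : p.gval z e < p.P := Nat.mod_lt _ hP
  have h1 := Int.natCast_modEq_iff (a := p.h x + p.h y) (b := p.gval z e) (n := p.P)
  rw [Nat.ModEq, Nat.mod_eq_of_lt hg] at h1
  rw [← h1]
  push_cast
  exact ⟨fun h => h.trans (gval_cast hP z e), fun h => h.trans (gval_cast hP z e).symm⟩

/-- The hash values are those of the words in `A`. -/
structure Hashes (p : Par) (w H r : ℕ) (A : ℕ → ℕ) : Prop where
  HH : p.HH = 2 ^ H
  P : p.P = 8 * 2 ^ H
  h : ∀ i, p.h i = hsh w H r (A i)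
  A : ∀ i, A i < 2 ^ w
  hw : 0 < w
  hH : H ≤ w
  hH1 : 1 ≤ H

variable {A : ℕ → ℕ}

theorem Hashes.lt (h : Hashes p w H r A) (i : ℕ) : p.h i < p.P := by
  have := hsh_lt (r := r) h.hw h.hH (h.A i)
  rw [h.h, h.P]
  have : 0 < 2 ^ H := by positivity
  omega

theorem Hashes.P_pos (h : Hashes p w H r A) : 0 < p.P := (Nat.zero_le _).trans_lt (h.lt 0)

/-- In unsigned words the sum exceeds `A z` by `k * 2 ^ w`, where `k` is the difference `s + t - v`
of the sign bits, and comparing sizes gives `k ≤ 1`. The sign bits have weight `2 * 2 ^ H` in the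
hash, so together with the wrap-around `κ` of the multiples the surplus is `(2 * k + κ) * 2 ^ H`, up
to the low carry. This gives the eight patterns. -/
theorem Hashes.exists_match (h : Hashes p w H r A) {a b c : ℤ}
    (ha : -(2 : ℤ) ^ w ≤ 2 * a ∧ 2 * a < (2 : ℤ) ^ w)
    (hb : -(2 : ℤ) ^ w ≤ 2 * b ∧ 2 * b < (2 : ℤ) ^ w)
    (hc : -(2 : ℤ) ^ w ≤ 2 * c ∧ 2 * c < (2 : ℤ) ^ w) {x y z : ℕ}
    (hx : A x = (BitVec.ofInt w a).toNat) (hy : A y = (BitVec.ofInt w b).toNat)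
    (hz : A z = (BitVec.ofInt w c).toNat) (habc : a + b = c) :
    (A x + A y) % 2 ^ w = A z ∧ ∃ e < 8, (p.h x + p.h y) % p.P = p.gval z e := by
  obtain ⟨s, s1, s2, -⟩ := exists_sign h.hw ha.1 ha.2
  obtain ⟨t, t1, t2, -⟩ := exists_sign h.hw hb.1 hb.2
  obtain ⟨v, v1, v2, -⟩ := exists_sign h.hw hc.1 hc.2
  rw [← hx] at s1 s2
  rw [← hy] at t1 t2
  rw [← hz] at v1 v2
  have lx := h.A x; have ly := h.A y; have lz := h.A z
  have hW : (0 : ℤ) < 2 ^ w := by positivity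
  have hcast : ((2 ^ w : ℕ) : ℤ) = 2 ^ w := by push_cast; rfl
  have key : (A x : ℤ) + A y = A z + ((s : ℤ) + t - v) * 2 ^ w := by
    rw [s2, t2, v2, ← habc]; ring
  have hk0 : -1 < (s : ℤ) + t - v := by
    by_contra hcon
    have : ((s : ℤ) + t - v) * 2 ^ w ≤ (-1) * 2 ^ w := mul_le_mul_of_nonneg_right (by omega) hW.le
    omega
  have hk1 : (s : ℤ) + t - v < 2 := by
    by_contra hcon
    have : 2 * 2 ^ w ≤ ((s : ℤ) + t - v) * 2 ^ w := mul_le_mul_of_nonneg_right (by omega) hW.le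
    omega
  obtain ⟨k, hk⟩ : ∃ k : ℕ, s + t = v + k := ⟨s + t - v, by omega⟩
  have hk1' : k ≤ 1 := by omega
  have hsum : A x + A y = A z + k * 2 ^ w := by
    have : (s : ℤ) + t - v = k := by omega
    rw [this] at key
    exact_mod_cast key
  have hmod : (A x + A y) % 2 ^ w = A z := by
    rw [hsum, Nat.add_mul_mod_self_right, Nat.mod_eq_of_lt lz]
  refine ⟨hmod, ?_⟩
  obtain ⟨κ, e, hκ, he, hcar⟩ := exists_carry (r := r) h.hH hmod
  refine ⟨2 * (2 * k + κ) + e, by omega, ?_⟩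
  rw [match_iff_modEq h.P_pos]
  have e1 : (2 * (2 * k + κ) + e) / 2 = 2 * k + κ := by omega
  have e2 : (2 * (2 * k + κ) + e) % 2 = e := by omega
  rw [e1, e2, h.h, h.h, h.h, h.HH]
  unfold hsh
  rw [s1, t1, v1]
  rw [Int.modEq_iff_dvd]
  refine ⟨0, ?_⟩
  push_cast
  have hk' : (s : ℤ) + t = v + k := by exact_mod_cast hk
  have hcar' : (top w H r (A x) : ℤ) + top w H r (A y) + e
    = top w H r (A z) + κ * 2 ^ H := by exact_mod_cast hcar
  linear_combination -(2 * 2 ^ H : ℤ) * hk' - hcar'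

/-- Comparing the match with `exists_carry`, a multiple of `2 ^ H` equals a difference of two bits.
Both vanish, since `H ≥ 1`, and `2 * (s + t - v) + κ` is congruent modulo 8 to a number from 0 to 3.
This excludes the values `-1` and `2` of `s + t - v`, which are the two patterns of signed overflow.
In the other cases the ranges of the integers force equality. -/
theorem Hashes.sum_eq (h : Hashes p w H r A) {a b c : ℤ}
    (ha : -(2 : ℤ) ^ w ≤ 2 * a ∧ 2 * a < (2 : ℤ) ^ w)
    (hb : -(2 : ℤ) ^ w ≤ 2 * b ∧ 2 * b < (2 : ℤ) ^ w)
    (hc : -(2 : ℤ) ^ w ≤ 2 * c ∧ 2 * c < (2 : ℤ) ^ w) {x y z : ℕ}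
    (hx : A x = (BitVec.ofInt w a).toNat) (hy : A y = (BitVec.ofInt w b).toNat)
    (hz : A z = (BitVec.ofInt w c).toNat) (hmod : (A x + A y) % 2 ^ w = A z) {e : ℕ} (he : e < 8)
    (hm : (p.h x + p.h y) % p.P = p.gval z e) : a + b = c := by
  obtain ⟨s, s1, s2, s3⟩ := exists_sign h.hw ha.1 ha.2
  obtain ⟨t, t1, t2, t3⟩ := exists_sign h.hw hb.1 hb.2
  obtain ⟨v, v1, v2, v3⟩ := exists_sign h.hw hc.1 hc.2
  rw [← hx] at s1 s2
  rw [← hy] at t1 t2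
  rw [← hz] at v1 v2
  have lx := h.A x; have ly := h.A y; have lz := h.A z
  have hW0 : 0 < 2 ^ w := by positivity
  obtain ⟨κ, f, hκ, hf, hcar⟩ := exists_carry (r := r) h.hH hmod
  rw [match_iff_modEq h.P_pos, h.h, h.h, h.h, h.HH, h.P] at hm
  unfold hsh at hm
  rw [s1, t1, v1] at hm
  have hcar' : (top w H r (A x) : ℤ) + top w H r (A y) + f
    = top w H r (A z) + κ * 2 ^ H := by exact_mod_cast hcar
  obtain ⟨j, hj⟩ := hm.symm.dvd
  push_cast at hj
  have hH2 : (2 : ℤ) ≤ 2 ^ H := by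
    calc (2 : ℤ) = 2 ^ 1 := by norm_num
      _ ≤ 2 ^ H := pow_le_pow_right₀ (by norm_num) h.hH1
  set E : ℤ := ((e : ℤ) / 2) with hE
  have hE0 : 0 ≤ E := by omega
  have hE3 : E ≤ 3 := by omega
  set e' : ℤ := (e : ℤ) % 2 with he'
  have hj' : (2 ^ H : ℤ) * (2 * ((s : ℤ) + t - v) + κ - E - 8 * j) = f - e' := by
    linear_combination hj - hcar'
  have hf' : (f : ℤ) = e' := by
    have h1 : (2 ^ H : ℤ) ∣ f - e' := ⟨_, hj'.symm⟩
    have h2 := Int.eq_zero_of_abs_lt_dvd h1 (by rw [abs_lt]; constructor <;> omega)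
    omega
  have hz0 : 2 * ((s : ℤ) + t - v) + κ - E - 8 * j = 0 := by
    rw [hf', sub_self] at hj'
    rcases mul_eq_zero.1 hj' with h1 | h1
    · omega
    · exact h1
  have hdm := Nat.div_add_mod (A x + A y) (2 ^ w)
  rw [hmod] at hdm
  set k := (A x + A y) / 2 ^ w with hk
  have hk1 : k ≤ 1 := by
    rw [← Nat.lt_succ_iff, hk, Nat.div_lt_iff_lt_mul hW0]; omega
  have hdm' : (2 ^ w : ℤ) * k + A z = A x + A y := by exact_mod_cast hdm
  rw [s2, t2, v2] at hdm'
  have hW : (0 : ℤ) < 2 ^ w := by positivity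
  have hk01 := Nat.le_one_iff_eq_zero_or_eq_one.1 hk1
  clear_value k E e'
  clear hdm hmod lx ly lz hj hj' hm hcar hcar' hx hy hz
  generalize (2 : ℤ) ^ w = W at *
  rcases s3 with ⟨rfl, s3⟩ | ⟨rfl, s3⟩ <;> rcases t3 with ⟨rfl, t3⟩ | ⟨rfl, t3⟩ <;>
    rcases v3 with ⟨rfl, v3⟩ | ⟨rfl, v3⟩ <;> rcases hk01 with hk0 | hk0 <;>
    rw [hk0] at hdm' <;> push_cast at * <;> omega

/-- A pair with the right hash values is almost a solution, in a multiple of the numbers. -/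
theorem Hashes.near_zero (h : Hashes p w H r A) {x y z e : ℕ}
    (hm : (p.h x + p.h y) % p.P = p.gval z e) :
    (2 * r + 1) * (A x + A y + (2 ^ w - A z)) % 2 ^ w < 2 * 2 ^ (w - H) ∨
      2 ^ w < (2 * r + 1) * (A x + A y + (2 ^ w - A z)) % 2 ^ w + 2 * 2 ^ (w - H) := by
  have hH := h.hH
  rw [match_iff_modEq h.P_pos, h.h, h.h, h.h, h.HH, h.P] at hm
  unfold hsh at hm
  obtain ⟨j, hj⟩ := hm.symm.dvd
  push_cast at hj
  set Q := 2 ^ (w - H) with hQ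
  have hQ0 : 0 < Q := by positivity
  have hW : (2 : ℤ) ^ w = Q * 2 ^ H := by
    rw [hQ]; push_cast; rw [← pow_add]; congr 1; omega
  have lz := h.A z
  set v := (2 * r + 1) * (A x + A y + (2 ^ w - A z)) % 2 ^ w with hv
  have hvlt : v < 2 ^ w := Nat.mod_lt _ (by positivity)
  set u : ℕ → ℕ := fun x => (2 * r + 1) * x % 2 ^ w with hu
  have ucast : ∀ x, ((u x : ℕ) : ℤ) ≡ (2 * r + 1) * x [ZMOD 2 ^ w] := fun x => by
    simp only [hu]; push_cast; exact Int.mod_modEq _ _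
  have vcast : (v : ℤ) ≡ u (A x) + u (A y) - u (A z) [ZMOD 2 ^ w] := by
    rw [hv]
    push_cast [Nat.cast_sub lz.le]
    refine (Int.mod_modEq _ _).trans ?_
    have h1 := ((ucast (A x)).add (ucast (A y))).sub (ucast (A z))
    refine Int.ModEq.trans ?_ h1.symm
    rw [Int.modEq_iff_dvd]
    exact ⟨-(2 * r + 1), by ring⟩
  have d : ∀ x, (u x : ℤ) = Q * top w H r x + (u x % Q : ℕ) := fun x => by
    exact_mod_cast (Nat.div_add_mod (u x) Q).symm
  have m : ∀ x, u x % Q < Q := fun x => Nat.mod_lt _ hQ0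
  have mx := m (A x); have my := m (A y); have mz := m (A z)
  obtain ⟨i, hi⟩ := vcast.symm.dvd
  rw [d (A x), d (A y), d (A z)] at hi
  set sg : ℤ := (A x : ℤ) / 2 ^ (w - 1) + (A y : ℤ) / 2 ^ (w - 1) - (A z : ℤ) / 2 ^ (w - 1) with hsg
  have e0 : 0 ≤ (e : ℤ) % 2 := by omega
  have e1 : (e : ℤ) % 2 ≤ 1 := by omega
  -- As `2 ^ w = Q * 2 ^ H`, signs and wrap-arounds contribute multiples of `2 ^ w`. What is left
  -- are three remainders below `Q` and a carry of `0` or `Q`, so the multiple of the defect is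
  -- within `2 * Q` of zero modulo `2 ^ w`.
  have key : (v : ℤ) = (u (A x) % Q : ℕ) + (u (A y) % Q : ℕ) - (u (A z) % Q : ℕ) - (e : ℤ) % 2 * Q
      + 2 ^ w * (i + 8 * j + (e : ℤ) / 2 - 2 * sg) := by
    rw [hW] at hi ⊢
    linear_combination hi + (Q : ℤ) * hj
  have hWp : (0 : ℤ) < 2 ^ w := by positivity
  have hQe : (e : ℤ) % 2 * Q = 0 ∨ (e : ℤ) % 2 * Q = Q := by
    rcases (by omega : (e : ℤ) % 2 = 0 ∨ (e : ℤ) % 2 = 1) with h | h <;> rw [h] <;> simp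
  set K := i + 8 * j + (e : ℤ) / 2 - 2 * sg
  have hcast : ((2 ^ w : ℕ) : ℤ) = 2 ^ w := by push_cast; rfl
  rcases lt_trichotomy K 0 with hK | hK | hK
  · left
    have : (2 : ℤ) ^ w * K ≤ 2 ^ w * (-1) := mul_le_mul_of_nonneg_left (by omega) hWp.le
    omega
  · left
    rw [hK, mul_zero] at key
    omega
  · right
    have : (2 : ℤ) ^ w * 1 ≤ 2 ^ w * K := mul_le_mul_of_nonneg_left (by omega) hWp.le
    omega

end Par

/-! ### The expected number of spurious pairs -/

namespace Par

open Imp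

variable {w H n : ℕ} {A : ℕ → ℕ}

/-- Triples with a repeated number that satisfy the equation, with the data of a query. -/
def degenerate (w n : ℕ) (A : ℕ → ℕ) : Finset (ℕ × ℕ × ℕ × ℕ) :=
  (Finset.range n ×ˢ Finset.range n ×ˢ Finset.range n ×ˢ Finset.range 8).filter fun e =>
    (A e.1 + A e.2.1) % 2 ^ w = A e.2.2.1 ∧ (e.1 = e.2.1 ∨ e.1 = e.2.2.1 ∨ e.2.1 = e.2.2.1)

theorem mem_degenerate {x y z e : ℕ} : (x, y, z, e) ∈ degenerate w n A ↔
    (x < n ∧ y < n ∧ z < n ∧ e < 8) ∧ (A x + A y) % 2 ^ w = A z ∧ (x = y ∨ x = z ∨ y = z) := by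
  simp [degenerate]

theorem eq_zero_of_add_mod {a b W : ℕ} (hb : b < W) (h : (a + b) % W = a) : b = 0 := by
  have h1 := Nat.div_add_mod (a + b) W
  rw [h] at h1
  by_contra hb0
  have h2 := Nat.eq_zero_or_pos ((a + b) / W)
  rcases h2 with h2 | h2
  · rw [h2] at h1; omega
  · have := Nat.mul_le_mul_left W h2
    omega

/-- Each coincidence leaves one free index: `x = y` determines `z` by injectivity, while `x = z` and
`y = z` force the remaining word to be zero, which happens for at most one index. There are three
coincidences and eight values of `e`. -/
theorem card_degenerate_le (hA : ∀ i, A i < 2 ^ w) (inj : ∀ i < n, ∀ j < n, A i = A j → i = j) :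
    (degenerate w n A).card ≤ 24 * n := by
  have key : ∀ (Q : ℕ × ℕ × ℕ × ℕ → Prop) [DecidablePred Q] (f : ℕ × ℕ × ℕ × ℕ → ℕ),
      (∀ t ∈ degenerate w n A, f t < n) →
      (∀ t ∈ degenerate w n A, ∀ t' ∈ degenerate w n A, Q t → Q t' → f t = f t' → t.2.2.2 = t'.2.2.2 →
        t = t') → ((degenerate w n A).filter Q).card ≤ n * 8 := by
    intro Q _ f h1 h2
    refine le_of_le_of_eq (b := (Finset.range n ×ˢ Finset.range 8).card) ?_ (by simp)
    refine Finset.card_le_card_of_injOn (fun t => (f t, t.2.2.2)) ?_ ?_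
    · rintro ⟨x, y, z, e⟩ ht
      rw [Finset.mem_coe, Finset.mem_filter] at ht
      have h3 := mem_degenerate.1 ht.1
      simp only [Finset.coe_product, Set.mem_prod, Finset.coe_range, Set.mem_Iio]
      exact ⟨h1 _ ht.1, h3.1.2.2.2⟩
    · intro t ht t' ht' h
      rw [Finset.mem_coe, Finset.mem_filter] at ht ht'
      simp only [Prod.mk.injEq] at h
      exact h2 t ht.1 t' ht'.1 ht.2 ht'.2 h.1 h.2
  have h1 := key (fun t => t.1 = t.2.1) (fun t => t.1)
    (by rintro ⟨x, y, z, e⟩ ht; exact (mem_degenerate.1 ht).1.1) (by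
      rintro ⟨x, y, z, e⟩ ht ⟨x', y', z', e'⟩ ht' h h' hf he
      have k := mem_degenerate.1 ht
      have k' := mem_degenerate.1 ht'
      simp only at h h' hf he
      subst h h' hf he
      rw [inj _ k.1.2.2.1 _ k'.1.2.2.1 (k.2.1.symm.trans k'.2.1)])
  have h2 := key (fun t => t.1 = t.2.2.1) (fun t => t.1)
    (by rintro ⟨x, y, z, e⟩ ht; exact (mem_degenerate.1 ht).1.1) (by
      rintro ⟨x, y, z, e⟩ ht ⟨x', y', z', e'⟩ ht' h h' hf he
      have k := mem_degenerate.1 ht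
      have k' := mem_degenerate.1 ht'
      simp only at h h' hf he
      subst h h' hf he
      have e1 := eq_zero_of_add_mod (hA _) k.2.1
      have e2 := eq_zero_of_add_mod (hA _) k'.2.1
      rw [inj _ k.1.2.1 _ k'.1.2.1 (e1.trans e2.symm)])
  have h3 := key (fun t => t.2.1 = t.2.2.1) (fun t => t.2.1)
    (by rintro ⟨x, y, z, e⟩ ht; exact (mem_degenerate.1 ht).1.2.1) (by
      rintro ⟨x, y, z, e⟩ ht ⟨x', y', z', e'⟩ ht' h h' hf he
      have k := mem_degenerate.1 ht
      have k' := mem_degenerate.1 ht'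
      simp only at h h' hf he
      subst h h' hf he
      have e1 := eq_zero_of_add_mod (hA _) ((Nat.add_comm (A y) (A x)) ▸ k.2.1)
      have e2 := eq_zero_of_add_mod (hA _) ((Nat.add_comm (A y) (A x')) ▸ k'.2.1)
      rw [inj _ k.1.1 _ k'.1.1 (e1.trans e2.symm)])
  have hsub : degenerate w n A ⊆ (degenerate w n A).filter (fun t => t.1 = t.2.1) ∪
      ((degenerate w n A).filter (fun t => t.1 = t.2.2.1) ∪
        (degenerate w n A).filter (fun t => t.2.1 = t.2.2.1)) := by
    rintro ⟨x, y, z, e⟩ ht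
    have k := (mem_degenerate.1 ht).2.2
    simp only [Finset.mem_union, Finset.mem_filter, ht, true_and]
    exact k
  have h4 := Finset.card_le_card hsub
  have h5 := Finset.card_union_le ((degenerate w n A).filter (fun t => t.1 = t.2.1))
    ((degenerate w n A).filter (fun t => t.1 = t.2.2.1) ∪
        (degenerate w n A).filter (fun t => t.2.1 = t.2.2.1))
  have h6 := Finset.card_union_le ((degenerate w n A).filter (fun t => t.1 = t.2.2.1))
    ((degenerate w n A).filter (fun t => t.2.1 = t.2.2.1))
  omega

/-- The expected number of spurious pairs is small. -/
theorem sum_card_spurious_le {q : ℕ → Par} (hq : ∀ r < 2 ^ w, Hashes (q r) w H r A)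
    (hn : ∀ r < 2 ^ w, (q r).n = n) (hA : ∀ i, A i < 2 ^ w) (hH : H ≤ w)
    (inj : ∀ i < n, ∀ j < n, A i = A j → i = j) :
    ∑ r ∈ Finset.range (2 ^ w), ((q r).spurious (Good w A)).card
      ≤ 2 ^ w * (24 * n) + 64 * n ^ 3 * 2 ^ (w - H) := by
  classical
  set U := Finset.range n ×ˢ Finset.range n ×ˢ Finset.range n ×ˢ Finset.range 8 with hU
  set near : ℕ → ℕ → Prop := fun d r => (2 * r + 1) * d % 2 ^ w < 2 * 2 ^ (w - H) ∨
    2 ^ w < (2 * r + 1) * d % 2 ^ w + 2 * 2 ^ (w - H) with hnear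
  set δ : ℕ × ℕ × ℕ × ℕ → ℕ := fun t => A t.1 + A t.2.1 + (2 ^ w - A t.2.2.1) with hδ
  set V := U.filter fun t => ¬ 2 ^ w ∣ δ t with hV
  have hUcard : U.card = 8 * n ^ 3 := by
    simp only [hU, Finset.card_product, Finset.card_range]; ring
  have hdvd : ∀ x y z, 2 ^ w ∣ A x + A y + (2 ^ w - A z) → (A x + A y) % 2 ^ w = A z := by
    intro x y z h
    have hz := hA z
    have h1 : (A x + A y + (2 ^ w - A z) + A z) % 2 ^ w = A z := by
      rw [Nat.add_mod, Nat.mod_eq_zero_of_dvd h, Nat.zero_add, Nat.mod_mod, Nat.mod_eq_of_lt hz]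
    rwa [show A x + A y + (2 ^ w - A z) + A z = A x + A y + 2 ^ w by omega,
      Nat.add_mod_right] at h1
  -- If the equation holds in words, then failing `Good` means that indices coincide; this case is
  -- independent of `r`. Otherwise the defect is nonzero modulo `2 ^ w`, and its multiple is close
  -- to zero.
  have hsub : ∀ r < 2 ^ w, (q r).spurious (Good w A)
      ⊆ degenerate w n A ∪ V.filter fun t => near (δ t) r := by
    rintro r hr ⟨x, y, z, e⟩ ht
    obtain ⟨⟨hx, hy, hz, he⟩, hm, hg⟩ := mem_spurious.1 ht
    rw [hn r hr] at hx hy hz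
    rw [Finset.mem_union]
    by_cases hd : 2 ^ w ∣ δ (x, y, z, e)
    · left
      refine mem_degenerate.2 ⟨⟨hx, hy, hz, he⟩, hdvd _ _ _ hd, ?_⟩
      by_contra hcon
      push Not at hcon
      exact hg ⟨hdvd _ _ _ hd, hcon.1, hcon.2.1, hcon.2.2⟩
    · right
      rw [Finset.mem_filter, hV, Finset.mem_filter]
      refine ⟨⟨?_, hd⟩, (hq r hr).near_zero hm⟩
      simp [hU, hx, hy, hz, he]
  calc ∑ r ∈ Finset.range (2 ^ w), ((q r).spurious (Good w A)).card
      ≤ ∑ r ∈ Finset.range (2 ^ w), (24 * n + (V.filter fun t => near (δ t) r).card) := by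
        refine Finset.sum_le_sum fun r hr => ?_
        refine (Finset.card_le_card (hsub r (Finset.mem_range.1 hr))).trans ?_
        refine (Finset.card_union_le _ _).trans ?_
        exact Nat.add_le_add_right (card_degenerate_le hA inj) _
    _ = 2 ^ w * (24 * n) + ∑ t ∈ V, ((Finset.range (2 ^ w)).filter fun r => near (δ t) r).card := by
        rw [Finset.sum_add_distrib, Finset.sum_const, Finset.card_range, smul_eq_mul]
        congr 1
        simp_rw [Finset.card_filter]
        exact Finset.sum_comm
    _ ≤ 2 ^ w * (24 * n) + ∑ t ∈ V, 8 * 2 ^ (w - H) := by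
        refine Nat.add_le_add_left (Finset.sum_le_sum fun t ht => ?_) _
        exact card_odd_mul_near_zero hH (Finset.mem_filter.1 ht).2
    _ ≤ _ := by
        rw [Finset.sum_const, smul_eq_mul]
        refine Nat.add_le_add_left ?_ _
        have h1 : V.card ≤ 8 * n ^ 3 := hUcard ▸ Finset.card_filter_le _ _
        calc V.card * (8 * 2 ^ (w - H)) ≤ 8 * n ^ 3 * (8 * 2 ^ (w - H)) :=
              Nat.mul_le_mul_right _ h1
          _ = _ := by ring

end Par

/-! ### Computing the parameters and the hash values -/

namespace Imp

open Par

variable {w : ℕ} {σ : Env}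

/-- The logarithm of variable 1. -/
def cLog : Cmd :=
  .seq (.set 31 (.lit 1)) (.seq (.set 26 (.lit 0)) (.rep 21 (.var 1)
    (.ite (.bin .lt (.bin .addw (.var 31) (.var 31)) (.bin .addw (.var 1) (.lit 1)))
      (.seq (.set 31 (.bin .addw (.var 31) (.var 31))) (.set 26 (.bin .addw (.var 26) (.lit 1))))
      .skip)))

theorem run_cLog {n : ℕ} (hn : σ.v 1 = n) (hw : 2 * n + 2 < 2 ^ w) :
    (run w cLog σ).v 26 = Nat.log 2 n ∧ (run w cLog σ).t ≤ σ.t + 10 + 40 * n := by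
  have key := run_for (w := w) (r := 21) (e := .var 1)
    (c := .ite (.bin .lt (.bin .addw (.var 31) (.var 31)) (.bin .addw (.var 1) (.lit 1)))
      (.seq (.set 31 (.bin .addw (.var 31) (.var 31))) (.set 26 (.bin .addw (.var 26) (.lit 1))))
      .skip) (σ := run w (.set 26 (.lit 0)) (run w (.set 31 (.lit 1)) σ))
    (fun i τ => τ.v 26 = min i (Nat.log 2 n) ∧ τ.v 31 = 2 ^ min i (Nat.log 2 n) ∧
      τ.t ≤ σ.t + 10 + 40 * i) ⟨by simp, by simp, by simp⟩ ?_
  · have e : (Expr.var 1).eval w (run w (.set 26 (.lit 0)) (run w (.set 31 (.lit 1)) σ)) = n := by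
      simpa using hn
    rw [e, min_eq_right (Nat.log_le_self 2 n)] at key
    exact ⟨key.1, key.2.2⟩
  · intro i hi τ hv ha ⟨h1, h2, h3⟩
    have e1 : τ.v 1 = n := (hv 1 (by decide)).trans (by simpa using hn)
    have hi' : i < n := by simpa [hn] using hi
    have hn0 : n ≠ 0 := by omega
    set l := min i (Nat.log 2 n) with hl
    have hln : l ≤ Nat.log 2 n := min_le_right _ _
    have hpl : 2 ^ l ≤ n := (Nat.le_log_iff_pow_le (by norm_num) hn0).1 hln
    have m1 : (2 ^ l + 2 ^ l) % 2 ^ w = 2 ^ l + 2 ^ l := Nat.mod_eq_of_lt (by omega)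
    have m2 : (n + 1) % 2 ^ w = n + 1 := Nat.mod_eq_of_lt (by omega)
    have hl2 : l < 2 ^ l := Nat.lt_two_pow_self
    have m3 : (l + 1) % 2 ^ w = l + 1 := Nat.mod_eq_of_lt (by omega)
    have hiff : 2 ^ l + 2 ^ l < n + 1 ↔ l + 1 ≤ Nat.log 2 n := by
      rw [Nat.le_log_iff_pow_le (by norm_num) hn0, pow_succ]; omega
    have ev : (Expr.bin .lt (.bin .addw (.var 31) (.var 31)) (.bin .addw (.var 1) (.lit 1))).eval w
        (τ.setV 21 i) ≠ 0 ↔ l + 1 ≤ Nat.log 2 n := by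
      simp [Bop.eval, h2, e1, m1, m2, hiff]
    rw [run_ite]
    by_cases hc : l + 1 ≤ Nat.log 2 n
    · rw [if_pos (ev.2 hc)]
      have : min (i + 1) (Nat.log 2 n) = l + 1 := by omega
      rw [this]
      refine ⟨?_, ?_, ?_⟩
      · simp [Bop.eval, h1, m3]
      · simp [Bop.eval, h2, m1]; ring
      · simp; omega
    · rw [if_neg (fun h => hc (ev.1 h))]
      have : min (i + 1) (Nat.log 2 n) = l := by omega
      rw [this]
      refine ⟨?_, ?_, ?_⟩
      · simpa using h1
      · simpa using h2
      · simp; omega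

/-- The logarithms of the parameters: `k / D` is the exponent of the number of buckets. -/
def rho (k D n : ℕ) : ℕ := k * Nat.log 2 n / D
-- With `g = k / D`, the number of shifts is about `n ^ (1 - g + 1 / D)`. The surplus `1 / D`
-- enlarges the range of the hash so that `B` times the expected number of spurious pairs is below
-- `n ^ 2` by a power of `n`. The summand 1 ensures that there is a leading digit at all.
def sig (k D n : ℕ) : ℕ := (D - k + 1) * Nat.log 2 n / D + 1
def digits (k D n : ℕ) : ℕ := rho k D n + (sig k D n + sig k D n)

/-- The data of the reduction for given parameters. -/
def par (k D M n : ℕ) (h : ℕ → ℕ) : Par where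
  n := n
  R := 2 ^ (rho k D n + 3)
  S := 2 ^ sig k D n
  HH := 2 ^ digits k D n
  M := M
  h := h

def cPow (k D : ℕ) : Cmd :=
  .seq (.set 27 (.bin .mulw (.lit k) (.var 26) / .lit D))
  (.seq (.set 28 (.bin .addw (.bin .mulw (.lit (D - k + 1)) (.var 26) / .lit D) (.lit 1)))
  (.seq (.set 3 (.bin .shl (.lit 1) (.bin .addw (.var 27) (.lit 3))))
  (.seq (.set 4 (.bin .shl (.lit 1) (.var 28)))
  (.seq (.set 23 (.bin .addw (.var 27) (.bin .addw (.var 28) (.var 28))))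
  (.set 18 (.bin .shl (.lit 1) (.var 23)))))))

/-- A bound for the basic parameters. -/
def vbound (D M n : ℕ) : ℕ := (n + 1) * (16 * (D + 1) * (M + 1))

theorem two_pow_log_le (n : ℕ) : 2 ^ Nat.log 2 n ≤ n + 1 := by
  rcases Nat.eq_zero_or_pos n with rfl | hn
  · simp
  · exact (Nat.pow_log_le_self 2 hn.ne').trans n.le_succ

theorem rho_le {k D : ℕ} (hk : k ≤ D) (n : ℕ) : rho k D n ≤ Nat.log 2 n := by
  unfold rho
  exact Nat.div_le_of_le_mul (Nat.mul_le_mul_right _ hk)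

theorem sig_le {k D : ℕ} (hk : 1 ≤ k) (hkD : k ≤ D) (n : ℕ) : sig k D n ≤ Nat.log 2 n + 1 := by
  unfold sig
  refine Nat.succ_le_succ (Nat.div_le_of_le_mul (Nat.mul_le_mul_right _ ?_))
  omega

theorem le_vbound (D M n : ℕ) : 16 * (n + 1) ≤ vbound D M n ∧ 16 * (D * n) + 16 ≤ vbound D M n ∧
    16 * D + 16 ≤ vbound D M n ∧ M < vbound D M n := by
  have e : vbound D M n = 16 * (n + 1) + 16 * (D * n) + 16 * D + 16 * (n * M) + 16 * M
      + 16 * (D * n * M) + 16 * (D * M) := by unfold vbound; ring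
  rw [e]
  omega

theorem par_lt {k D M n : ℕ} (hk : 1 ≤ k) (hkD : k ≤ D) (h : ℕ → ℕ) :
    (par k D M n h).R < vbound D M n ∧ (par k D M n h).S < vbound D M n := by
  have h1 := two_pow_log_le n
  have h2 := Nat.pow_le_pow_right (n := 2) (by norm_num) (rho_le hkD n)
  have h3 := Nat.pow_le_pow_right (n := 2) (by norm_num) (sig_le hk hkD n)
  have h4 := le_vbound D M n
  simp only [par, pow_succ] at h3 ⊢
  omega

/-- The three extra bits of `R` are the factor 8 that leaves room for signs and carries. -/
theorem par_P (k D M n : ℕ) (h : ℕ → ℕ) : (par k D M n h).P = 8 * 2 ^ digits k D n := by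
  simp only [Par.P, Par.S2, par, digits, pow_add]; ring

theorem digits_lt {k D M n : ℕ} (hk : 1 ≤ k) (hkD : k ≤ D) (hV : vbound D M n ^ 30 ≤ 2 ^ w) :
    digits k D n < w := by
  obtain ⟨h1, h2⟩ := par_lt (M := M) (n := n) hk hkD 0
  have h3 := par_P k D M n 0
  have h4 : (par k D M n 0).P ≤ vbound D M n ^ 3 := by
    unfold Par.P Par.S2
    calc _ ≤ vbound D M n * (vbound D M n * vbound D M n) := by gcongr
      _ = _ := by ring
  have h5 : vbound D M n ^ 3 ≤ vbound D M n ^ 30 :=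
    Nat.pow_le_pow_right (by omega) (by norm_num)
  rw [h3] at h4
  have h0 : 0 < 2 ^ digits k D n := by positivity
  exact (Nat.pow_lt_pow_iff_right (a := 2) (by norm_num)).1 (by omega)

theorem run_cPow {k D M n : ℕ} (hk : 1 ≤ k) (hkD : k ≤ D) (hV : vbound D M n ^ 30 ≤ 2 ^ w)
    (h26 : σ.v 26 = Nat.log 2 n) (h : ℕ → ℕ) :
    (run w (cPow k D) σ).v 27 = rho k D n ∧ (run w (cPow k D) σ).v 28 = sig k D n ∧
    (run w (cPow k D) σ).v 3 = (par k D M n h).R ∧ (run w (cPow k D) σ).v 4 = (par k D M n h).S ∧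
    (run w (cPow k D) σ).v 23 = digits k D n ∧ (run w (cPow k D) σ).v 18 = (par k D M n h).HH ∧
    (run w (cPow k D) σ).t = σ.t + 34 := by
  obtain ⟨b1, b2, b3, b4⟩ := le_vbound D M n
  have hVw : vbound D M n ≤ 2 ^ w :=
    (Nat.le_self_pow (by norm_num) _).trans hV
  have hL := Nat.log_le_self 2 n
  have k1 : k * Nat.log 2 n ≤ D * n := Nat.mul_le_mul hkD hL
  have k2 : (D - k + 1) * Nat.log 2 n ≤ D * n := Nat.mul_le_mul (by omega) hL
  have r1 := rho_le hkD n
  have s1 := sig_le hk hkD n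
  obtain ⟨p1, p2⟩ := par_lt (M := M) (n := n) hk hkD h
  have hd := digits_lt hk hkD hV
  have m1 : k * Nat.log 2 n % 2 ^ w = k * Nat.log 2 n := Nat.mod_eq_of_lt (by omega)
  have m2 : (D - k + 1) * Nat.log 2 n % 2 ^ w = (D - k + 1) * Nat.log 2 n :=
    Nat.mod_eq_of_lt (by omega)
  have m3 : ((D - k + 1) * Nat.log 2 n / D + 1) % 2 ^ w = sig k D n := Nat.mod_eq_of_lt (by
    change sig k D n < _
    omega)
  have m4 : (rho k D n + 3) % 2 ^ w = rho k D n + 3 := Nat.mod_eq_of_lt (by omega)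
  have m5 : 2 ^ (rho k D n + 3) % 2 ^ w = 2 ^ (rho k D n + 3) :=
    Nat.mod_eq_of_lt (p1.trans_le hVw)
  have m6 : 2 ^ sig k D n % 2 ^ w = 2 ^ sig k D n := Nat.mod_eq_of_lt (p2.trans_le hVw)
  have m7 : (sig k D n + sig k D n) % 2 ^ w = sig k D n + sig k D n := Nat.mod_eq_of_lt (by omega)
  have m8 : (rho k D n + (sig k D n + sig k D n)) % 2 ^ w = digits k D n :=
    Nat.mod_eq_of_lt (by omega)
  have m9 : 2 ^ digits k D n % 2 ^ w = 2 ^ digits k D n :=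
    Nat.mod_eq_of_lt (Nat.pow_lt_pow_right (by norm_num) hd)
  have m10 : k * Nat.log 2 n / D = rho k D n := rfl
  simp [cPow, Bop.eval, h26, m1, m2, m3, m4, m5, m6, m7, m8, m9, m10, par]

/-- The hash values. -/
def cHash : Cmd :=
  .seq (.set 19 (.bin .addw (.lit 1) (.bin .addw (.var 2) (.var 2))))
    (.rep 21 (.var 1) (.put 2 (.var 21)
      (.bin .addw
        (.bin .mulw (.bin .shr (.get 0 (.var 21)) (.bin .subw .wlen (.lit 1)))
          (.bin .addw (.var 18) (.var 18)))
        (.bin .shr (.bin .mulw (.var 19) (.get 0 (.var 21))) (.bin .subw .wlen (.var 23))))))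

theorem run_cHash {n H r : ℕ} (h1 : σ.v 1 = n) (h2 : σ.v 2 = r) (h18 : σ.v 18 = 2 ^ H)
    (h23 : σ.v 23 = H) (ha2 : σ.a 2 = 0) (hA : ∀ i, σ.a 0 i < 2 ^ w)
    (hA0 : ∀ i, n ≤ i → σ.a 0 i = 0) (hw : 0 < w) (hH : 3 * 2 ^ H ≤ 2 ^ w) :
    (run w cHash σ).a 2 = (fun i => hsh w H r (σ.a 0 i)) ∧
      (run w cHash σ).t ≤ σ.t + 10 + 30 * n := by
  have h1w : 1 < 2 ^ w := Nat.one_lt_two_pow hw.ne'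
  have hww : w < 2 ^ w := Nat.lt_two_pow_self
  have hHw : H < w := by
    have h0 : 0 < 2 ^ H := by positivity
    exact (Nat.pow_lt_pow_iff_right (a := 2) (by norm_num)).1 (by omega)
  set σ₁ := run w (.set 19 (.bin .addw (.lit 1) (.bin .addw (.var 2) (.var 2)))) σ with hσ₁
  have g19 : σ₁.v 19 = (1 + (r + r) % 2 ^ w) % 2 ^ w := by simp [hσ₁, Bop.eval, h2]
  have g1 : σ₁.v 1 = n := by simp [hσ₁, h1]
  have gt : σ₁.t = σ.t + 6 := by simp [hσ₁]
  have w1 : (2 ^ w - 1 + w) % 2 ^ w = w - 1 := by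
    rw [show 2 ^ w - 1 + w = w - 1 + 2 ^ w by omega, Nat.add_mod_right, Nat.mod_eq_of_lt (by omega)]
  have w2 : (2 ^ w - H + w) % 2 ^ w = w - H := by
    rw [show 2 ^ w - H + w = w - H + 2 ^ w by omega, Nat.add_mod_right, Nat.mod_eq_of_lt (by omega)]
  have key := run_for (w := w) (r := 21) (e := .var 1)
    (c := .put 2 (.var 21)
      (.bin .addw
        (.bin .mulw (.bin .shr (.get 0 (.var 21)) (.bin .subw .wlen (.lit 1)))
          (.bin .addw (.var 18) (.var 18)))
        (.bin .shr (.bin .mulw (.var 19) (.get 0 (.var 21))) (.bin .subw .wlen (.var 23)))))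
    (σ := σ₁)
    (fun i τ => (τ.a 2 = fun j => if j < i then hsh w H r (σ.a 0 j) else 0) ∧
      τ.t ≤ σ.t + 10 + 30 * i) ⟨by simp [hσ₁, ha2]; rfl, by simp [gt]⟩ ?_
  · rw [eval_var, g1] at key
    refine ⟨key.1.trans ?_, key.2⟩
    funext j
    split_ifs with hj
    · rfl
    -- Cells from `n` on are never written, and 0 is also the hash value of the zero word, so the
    -- array equals the hash function everywhere.
    · simp [hA0 j (by omega), hsh, top]
  · intro i hi τ hv ha ⟨k1, k2⟩
    have a0 : τ.a 0 = σ.a 0 := ha 0 (by decide)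
    have e19 : τ.v 19 = (1 + (r + r) % 2 ^ w) % 2 ^ w := (hv 19 (by decide)).trans g19
    have e18 : τ.v 18 = 2 ^ H := (hv 18 (by decide)).trans (by simp [hσ₁, h18])
    have e23 : τ.v 23 = H := (hv 23 (by decide)).trans (by simp [hσ₁, h23])
    set x := σ.a 0 i with hx
    have s1 := sign_le hw (hA i)
    have t1 := top_lt (r := r) hHw.le x
    have l1 : hsh w H r x < 3 * 2 ^ H := hsh_lt hw hHw.le (hA i)
    have m1 : (2 ^ H + 2 ^ H) % 2 ^ w = 2 * 2 ^ H := by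
      rw [Nat.mod_eq_of_lt (by have : 0 < 2 ^ H := by positivity
                               omega)]
      ring
    have m2 : x / 2 ^ (w - 1) * (2 * 2 ^ H) % 2 ^ w = x / 2 ^ (w - 1) * (2 * 2 ^ H) :=
      Nat.mod_eq_of_lt (by unfold hsh at l1; omega)
    have m3 : (1 + (r + r) % 2 ^ w) % 2 ^ w * x % 2 ^ w / 2 ^ (w - H) = top w H r x := by
      unfold top
      rw [Nat.add_mod_mod, Nat.mod_mul_mod, show 1 + (r + r) = 2 * r + 1 by ring]
    have m4 : (x / 2 ^ (w - 1) * (2 * 2 ^ H) + top w H r x) % 2 ^ w = hsh w H r x :=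
      Nat.mod_eq_of_lt (by unfold hsh at l1; omega)
    refine ⟨?_, ?_⟩
    · funext j
      simp only [run_put, tick_a, setA_a, setV_a, if_true, eval_var, eval_bin, eval_get, eval_wlen,
        eval_lit, setV_v, Bop.eval, a0, ← hx, Nat.reduceEqDiff, if_false, e18, e19, e23, w1, w2, m1,
        m2, m3, m4, k1, Function.update_apply]
      by_cases hji : j = i
      · subst hji; simp [hx]
      · simp only [if_neg hji]
        congr 1
        simp only [eq_iff_iff]
        omega
    · simp; omega


/-- The parameters that depend on the basic ones. -/
def cDerive (M : ℕ) : Cmd :=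
  .seq (.set 5 (.var 4 * .var 4))
  (.seq (.set 6 (.var 3 * .var 5))
  (.seq (.set 7 (.var 1 / .var 3 + .lit 1))
  (.seq (.set 8 (.var 1 / .var 4 + .lit 1))
  (.seq (.set 10 ((.var 8 + .var 8) * .lit M))
  (.seq (.set 9 (.var 8 + .var 8 + .var 10))
  (.seq (.set 13 (.var 3 + .var 3))
  (.seq (.set 14 (.var 13 * .var 4))
  (.seq (.set 15 (.lit 1 + .var 14 + .var 10 + .var 3 * .var 4 + .var 10))
  (.seq (.set 12 (.var 15 + .lit 4 * .var 5 * .var 9))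
  (.seq (.set 16 (.lit 16 * .var 1 * .var 3))
  (.seq (.set 17 (.var 1 * .var 4 + .var 8 + .lit 1))
  (.seq (.set 11 (.var 12 + .var 16 + .var 17))
  (.set 20 (.bin .subw (.var 6) (.lit 1)))))))))))))))

/-- The types before the derived parameters are known. -/
def ty₀ : Ty where
  v := fun x => if x = 20 then 30 else ty.v x
  a := ty.a
  pos := fun _ => false

theorem cDerive_wt (M : ℕ) : (cDerive M).wt ty₀ = true := by
  simp only [cDerive]
  rfl

theorem run_cDerive {p : Par} (h1 : σ.v 1 = p.n) (h3 : σ.v 3 = p.R) (h4 : σ.v 4 = p.S)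
    (h18 : σ.v 18 = p.HH) (h2 : σ.a 2 = p.h) (hP0 : 0 < p.P) (hP : p.P < 2 ^ w) :
    Ctx p (run w (cDerive p.M) σ) ∧ (run w (cDerive p.M) σ).t ≤ σ.t + 100 := by
  have hm : (2 ^ w - 1 + p.P) % 2 ^ w = p.P - 1 := by
    rw [show 2 ^ w - 1 + p.P = p.P - 1 + 2 ^ w by omega, Nat.add_mod_right,
      Nat.mod_eq_of_lt (by omega)]
  have hm' : (2 ^ w - 1 + p.R * (p.S * p.S)) % 2 ^ w = p.R * (p.S * p.S) - 1 := hm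
  refine ⟨⟨?_, ?_, ?_, ?_, ?_, ?_, ?_, ?_, ?_, ?_, ?_, ?_, ?_, ?_, ?_, ?_, ?_, ?_, ?_⟩, ?_⟩
  all_goals simp [cDerive, Bop.eval, h1, h3, h4, h18, h2, hm', Par.S2, Par.P, Par.B, Par.b, Par.thr, Par.W,
    Par.R2, Par.nA, Par.base, Par.m, Par.st, Par.N, Par.cap]

/-- The preparation: copy `n` to variable 1, compute the parameters and the hash values. -/
def cInit (k D M : ℕ) : Cmd :=
  .seq (.seq (.set 1 (.var 0)) (.seq cLog (.seq (cPow k D)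
      (.seq cHash (.seq (.set 21 (.lit 0)) (.set 31 (.lit 0))))))) (cDerive M)

/-- All variables and arrays hold arbitrary words. -/
def words : Ty where
  v := fun _ => 30
  a := fun _ => 30
  pos := fun _ => false

theorem one_le_ty₀ (x : ℕ) : 1 ≤ ty₀.v x := by
  unfold ty₀
  by_cases h : x < 32
  · interval_cases x <;> decide
  · simp only [ty]
    rw [if_neg (by omega), List.getD_eq_default _ _ (by simpa using h)]
    norm_num

theorem digits_le {k D : ℕ} (hk : 1 ≤ k) (hkD : k ≤ D) (n : ℕ) : digits k D n ≤ 3 * n + 2 := by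
  have h1 := rho_le hkD n
  have h2 := sig_le hk hkD n
  have h3 := Nat.log_le_self 2 n
  unfold digits
  omega

/-- Overflow is excluded in stages. The first part uses no exact arithmetic and is well typed for
arbitrary words. The values it computes satisfy `ty₀`, under which the derived parameters are well
typed. Finally `P - 1`, obtained by a wrapping subtraction, and the positivity of the divisors are
checked directly, which gives `ty`. -/
theorem run_cInit {k D M n r : ℕ} {A : ℕ → ℕ} (hk : 1 ≤ k) (hkD : k ≤ D)
    (hV : vbound D M n ^ 30 ≤ 2 ^ w) (hv0 : σ.v 0 = n) (hv2 : σ.v 2 = r) (hr : r < 2 ^ w)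
    (hv : ∀ x, x ≠ 0 → x ≠ 2 → σ.v x = 0) (ha0 : σ.a 0 = A) (ha : ∀ x, x ≠ 0 → σ.a x = 0)
    (hA : ∀ i, A i < 2 ^ w) (hA0 : ∀ i, n ≤ i → A i = 0) :
    let p := par k D M n fun i => hsh w (digits k D n) r (A i)
    Ok w (cInit k D M) σ ∧ Ctx p (run w (cInit k D M) σ) ∧
      Bounded ty (vbound D M n) w (run w (cInit k D M) σ) ∧
      (run w (cInit k D M) σ).t ≤ σ.t + 200 * (n + 1) ∧
      ∀ x, x ≠ 2 → (run w (cInit k D M) σ).a x = σ.a x := by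
  intro p
  obtain ⟨b1, b2, b3, b4⟩ := le_vbound D M n
  have hVw : vbound D M n ≤ 2 ^ w := (Nat.le_self_pow (by norm_num) _).trans hV
  have hV2 : 2 ≤ vbound D M n := by omega
  have hd := digits_lt hk hkD hV
  have hw : 0 < w := by omega
  have hL := Nat.log_le_self 2 n
  obtain ⟨p1, p2⟩ := par_lt (M := M) (n := n) hk hkD p.h
  have hP : p.P = 8 * 2 ^ digits k D n := par_P _ _ _ _ _
  have hPV : p.P < vbound D M n ^ 3 := by
    unfold Par.P Par.S2
    calc _ < vbound D M n * (vbound D M n * vbound D M n) :=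
          Nat.mul_lt_mul'' p1 (Nat.mul_lt_mul'' p2 p2)
      _ = _ := by ring
  have hPw : p.P < 2 ^ w := hPV.trans_le
    ((Nat.pow_le_pow_right (by omega) (by norm_num)).trans hV)
  have hHH : 3 * 2 ^ digits k D n ≤ 2 ^ w := by omega
  set σ₁ := run w (.set 1 (.var 0)) σ with hσ₁
  have e1 : σ₁.v 1 = n := by simp [hσ₁, hv0]
  obtain ⟨l1, l2⟩ := run_cLog (w := w) e1 (by omega)
  set σ₂ := run w cLog σ₁ with hσ₂
  obtain ⟨q27, q28, q3, q4, q23, q18, qt⟩ := run_cPow (σ := σ₂) (M := M) hk hkD hV l1 p.h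
  set σ₃ := run w (cPow k D) σ₂ with hσ₃
  have f3v : ∀ x, x ∉ (cPow k D).wv → x ∉ cLog.wv → x ≠ 1 → σ₃.v x = σ.v x := fun x hx hx' hx'' =>
    (run_v _ hx).trans ((run_v _ hx').trans (by simp [hσ₁, hx'']))
  have f3a : ∀ x, σ₃.a x = σ.a x := fun x =>
    (run_a _ (by simp [cPow, Cmd.wa])).trans (run_a _ (by simp [cLog, Cmd.wa]))
  have e31 : σ₃.v 1 = n := (run_v _ (by simp [cPow, Cmd.wv])).trans
    ((run_v _ (by simp [cLog, Cmd.wv])).trans e1)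
  have e32 : σ₃.v 2 = r := (f3v 2 (by simp [cPow, Cmd.wv]) (by simp [cLog, Cmd.wv]) (by norm_num)).trans hv2
  obtain ⟨h1, h2⟩ := run_cHash (w := w) (σ := σ₃) e31 e32 q18 q23
    ((f3a 2).trans (ha 2 (by norm_num))) (by rw [f3a, ha0]; exact hA)
    (by rw [f3a, ha0]; exact hA0) hw hHH
  set σ₄ := run w (.seq cHash (.seq (.set 21 (.lit 0)) (.set 31 (.lit 0)))) σ₃ with hσ₄
  have h1' : σ₄.a 2 = (run w cHash σ₃).a 2 := rfl
  have h2' : σ₄.t = (run w cHash σ₃).t + 4 := rfl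
  have f4v : ∀ x, x ∉ [19, 21, 31] → σ₄.v x = σ₃.v x := fun x hx => run_v _ (by
    simpa [cHash, Cmd.wv] using hx)
  have f4a : ∀ x, x ≠ 2 → σ₄.a x = σ.a x := fun x hx =>
    (run_a _ (by simpa [cHash, Cmd.wa] using hx)).trans (f3a x)
  have g1 : σ₄.v 1 = n := (f4v 1 (by decide)).trans e31
  have g3 : σ₄.v 3 = p.R := (f4v 3 (by decide)).trans q3
  have g4 : σ₄.v 4 = p.S := (f4v 4 (by decide)).trans q4
  have g18 : σ₄.v 18 = p.HH := (f4v 18 (by decide)).trans q18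
  have ga2 : σ₄.a 2 = p.h := by rw [h1', h1, f3a, ha0]; rfl
  have hP0 : 0 < p.P := by rw [hP]; positivity
  obtain ⟨c1, c2⟩ : Ctx p (run w (cDerive M) σ₄) ∧ (run w (cDerive M) σ₄).t ≤ σ₄.t + 100 :=
    run_cDerive (w := w) (σ := σ₄) (p := p) g1 g3 g4 g18 ga2 hP0 hPw
  have hrun : run w (cInit k D M) σ = run w (cDerive M) σ₄ := rfl
  have hlit : ∀ x, x ≤ 16 ∨ x ≤ D ∨ x ≤ M → x < vbound D M n := by
    intro x hx; omega
  -- no overflow in the first part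
  have bw : Bounded words (vbound D M n) w σ := by
    refine ⟨fun x => ?_, fun a i => ?_, fun x hx => by cases hx⟩
    · change _ < 2 ^ w
      by_cases h0 : x = 0
      · rw [h0, hv0]; omega
      · by_cases h2 : x = 2
        · rw [h2, hv2]; exact hr
        · rw [hv x h0 h2]; positivity
    · change _ < 2 ^ w
      by_cases h0 : a = 0
      · rw [h0, ha0]; exact hA i
      · rw [ha a h0]; simp
  have ok1 := (Cmd.ok_of_wt hV2 hV (Γ := words)
    (.seq (.set 1 (.var 0)) (.seq cLog (.seq (cPow k D)
      (.seq cHash (.seq (.set 21 (.lit 0)) (.set 31 (.lit 0))))))) bw (by rfl) (by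
      simp only [cLog, cPow, cHash, Cmd.litsBelow, Expr.litsBelow, litsBelow_div, and_true, true_and]
      omega))
  have hrun₁ : run w (.seq (.set 1 (.var 0)) (.seq cLog (.seq (cPow k D)
      (.seq cHash (.seq (.set 21 (.lit 0)) (.set 31 (.lit 0))))))) σ = σ₄ := rfl
  rw [hrun₁] at ok1
  have b0 : Bounded ty₀ (vbound D M n) w σ₄ := by
    have hb : ∀ x y : ℕ, y < vbound D M n → y < bnd (vbound D M n) w (ty₀.v x) := fun x y hy => by
      refine hy.trans_le ?_
      have := bnd_mono (w := w) hV2 hV (one_le_ty₀ x)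
      simpa [bnd] using this
    refine ⟨fun x => ?_, fun a i => ?_, fun x hx => by cases hx⟩
    · by_cases hx : x ∈ [0, 1, 2, 3, 4, 18, 19, 21, 23, 26, 27, 28, 31]
      · simp only [List.mem_cons, List.not_mem_nil, or_false] at hx
        have hdd := digits_le hk hkD n
        have r1 := rho_le hkD n
        have s1 := sig_le hk hkD n
        rcases hx with rfl | rfl | rfl | rfl | rfl | rfl | rfl | rfl | rfl | rfl | rfl | rfl | rfl
        · rw [f4v 0 (by decide), f3v 0 (by simp [cPow, Cmd.wv]) (by simp [cLog, Cmd.wv])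
            (by norm_num), hv0]
          exact hb _ _ (by omega)
        · rw [g1]; exact hb _ _ (by omega)
        · exact ok1.2.v 2
        · rw [g3]; exact hb _ _ p1
        · rw [g4]; exact hb _ _ p2
        · rw [g18]
          change 2 ^ digits k D n < vbound D M n ^ 3
          omega
        · exact ok1.2.v 19
        · exact hb _ _ (by simp [hσ₄]; omega)
        · rw [f4v 23 (by decide), q23]; exact hb _ _ (by omega)
        · rw [f4v 26 (by decide), hσ₃, run_v _ (by simp [cPow, Cmd.wv]), l1]
          exact hb _ _ (by omega)
        · rw [f4v 27 (by decide), q27]; exact hb _ _ (by omega)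
        · rw [f4v 28 (by decide), q28]; exact hb _ _ (by omega)
        · exact hb _ _ (by simp [hσ₄]; omega)
      · have : σ₄.v x = 0 := by
          simp only [List.mem_cons, List.not_mem_nil, or_false, not_or] at hx
          rw [f4v x (by simp; omega), f3v x (by simp [cPow, Cmd.wv]; omega)
            (by simp [cLog, Cmd.wv]; omega) (by omega), hv x (by omega) (by omega)]
        rw [this]; exact hb _ _ (by omega)
    · by_cases ha2 : a = 2
      · rw [ha2, ga2]
        change hsh w (digits k D n) r (A i) < vbound D M n ^ 5
        have := hsh_lt (r := r) hw hd.le (hA i)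
        have h35 : vbound D M n ^ 3 ≤ vbound D M n ^ 5 :=
          Nat.pow_le_pow_right (by omega) (by norm_num)
        omega
      · by_cases h0 : a = 0
        · rw [h0, f4a 0 (by norm_num), ha0]; exact hA i
        · rw [f4a a ha2, ha a h0]
          unfold bnd
          split_ifs
          · exact Nat.pow_pos (by omega)
          · positivity
  obtain ⟨ok2, b5⟩ := Cmd.ok_of_wt hV2 hV (Γ := ty₀) (cDerive M) b0 (cDerive_wt M) (by
      simp only [cDerive, Cmd.litsBelow, Expr.litsBelow, litsBelow_div, and_true, true_and]
      exact ⟨hlit 1 (by norm_num), hlit 1 (by norm_num), hlit M (by simp), hlit 1 (by norm_num),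
        hlit 4 (by norm_num), hlit 16 (by norm_num), hlit 1 (by norm_num), hlit 1 (by norm_num)⟩)
  refine ⟨⟨ok1.1, ok2⟩, c1, ⟨fun x => ?_, b5.a, fun x hx => ?_⟩, ?_, fun x hx => ?_⟩
  · rw [hrun]
    by_cases hx : x = 20
    · rw [hx, c1.P1]
      change _ < vbound D M n ^ 3
      omega
    · have := b5.v x
      simpa [ty₀, hx] using this
  · have hx' : x ∈ [3, 4, 5, 6, 11, 13] := by simpa [ty] using hx
    have hR0 : 0 < p.R := by change 0 < 2 ^ _; positivity
    have hS0 : 0 < p.S := by change 0 < 2 ^ _; positivity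
    simp only [List.mem_cons, List.not_mem_nil, or_false] at hx'
    rcases hx' with rfl | rfl | rfl | rfl | rfl | rfl
    · rw [hrun, c1.R]; exact hR0
    · rw [hrun, c1.S]; exact hS0
    · rw [hrun, c1.S2]; exact S2_pos hS0
    · rw [hrun, c1.P]; exact hP0
    · rw [hrun, c1.cap]; exact (Nat.zero_le _).trans_lt (st_lt_cap p)
    · rw [hrun, c1.R2]; unfold Par.R2; omega
  · rw [hrun]
    have : σ₁.t = σ.t + 2 := rfl
    omega
  · rw [hrun]
    exact (run_a _ (by simp [cDerive, Cmd.wa])).trans (f4a x hx)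

end Imp

/-! ### The loop that passes the queries to the oracle -/

namespace WordRAM

variable {w : ℕ}

/-- One query of the embedded oracle: the queries are in arrays 24 and 26, the answers go to
array 30. -/
def queryBody (qry : Prog) : Prog :=
  -- Registers 2 and 5 are registers 0 and 1 of the oracle; 48, 63, 66 and 69 are the variables 16,
  -- 21, 22 and 23: the number of queries, the counter, the loop condition and the constant 1.
  .seq (.load 2 24 63) (.seq (.load 5 26 63) (.seq qry.embed (.seq (.store 30 63 2)
    (.seq (.op .add 63 63 69) (.op .lt 66 63 48)))))

def queryLoop (qry : Prog) : Prog := .loop 66 (queryBody qry)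

/-- The state of the query loop before query `i` of `m`. -/
structure QueryState (m i : ℕ) (f : ℕ → BitVec w × BitVec w) (S : State w) : Prop where
  bound : S.reg 48 = BitVec.ofNat w m
  idx : S.reg 63 = BitVec.ofNat w i
  one : S.reg 69 = BitVec.ofNat w 1
  cond : S.reg 66 ≠ 0 ↔ i < m
  calls : ∀ q < m, S.mem 24 (BitVec.ofNat w q) = (f q).1 ∧ S.mem 26 (BitVec.ofNat w q) = (f q).2

/-- The state after the answer to query `i`. -/
def afterQuery (S : State w) : State w :=
  let S₁ := S.setMem 30 (S.reg 63) (S.reg 2)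
  let S₂ := S₁.setReg 63 (S₁.reg 63 + S₁.reg 69)
  S₂.setReg 66 (Op.eval .lt (S₂.reg 63) (S₂.reg 48))

/-- The bookkeeping of the loop changes registers divisible by 3 and an array with an even name. The
oracle sees none of them, so its state persists from one query to the next. -/
theorem afterQuery_proj (S : State w) : (afterQuery S).proj = S.proj := by
  simp only [State.proj, afterQuery, State.setReg, State.setMem, State.mk.injEq, and_true]
  refine ⟨?_, ?_⟩
  · funext r
    rw [Function.update_of_ne (by omega), Function.update_of_ne (by omega)]
  · funext a
    rw [Function.update_of_ne (by omega)]

theorem afterQuery_mem (S : State w) {a : ℕ} (ha : a ≠ 30) : (afterQuery S).mem a = S.mem a := by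
  simp [afterQuery, State.setReg, State.setMem, ha]

theorem afterQuery_mem_ans (S : State w) :
    (afterQuery S).mem 30 = Function.update (S.mem 30) (S.reg 63) (S.reg 2) := by
  simp [afterQuery, State.setReg, State.setMem]

theorem afterQuery_reg (S : State w) {r : ℕ} (h : r ≠ 63) (h' : r ≠ 66) :
    (afterQuery S).reg r = S.reg r := by
  simp [afterQuery, State.setReg, State.setMem, h, h']

variable {m i : ℕ} {f : ℕ → BitVec w × BitVec w} {S : State w}

theorem QueryState.next (hw : 0 < w) (hm : m < 2 ^ w) (hS : QueryState m i f S) (hi : i < m)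
    {S₁ : State w} (h : SameOutside ((S.setReg 2 (f i).1).setReg 5 (f i).2) S₁) :
    QueryState m (i + 1) f (afterQuery S₁) := by
  have hr : ∀ r, r % 3 = 0 → S₁.reg r = S.reg r := fun r hr => by
    rw [h.1 r (by omega)]
    simp only [State.setReg]
    rw [Function.update_of_ne (by omega), Function.update_of_ne (by omega)]
  have ha : ∀ a, a % 2 ≠ 1 → S₁.mem a = S.mem a := fun a ha => h.2 a ha
  have h63 : (afterQuery S₁).reg 63 = BitVec.ofNat w (i + 1) := by
    simp only [afterQuery, State.setReg, State.setMem]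
    rw [Function.update_of_ne (by norm_num), Function.update_self, hr 63 (by norm_num),
      hr 69 (by norm_num), hS.idx, hS.one, BitVec.ofNat_add]
  refine ⟨?_, h63, ?_, ?_, fun q hq => ?_⟩
  · rw [afterQuery_reg _ (by norm_num) (by norm_num), hr 48 (by norm_num), hS.bound]
  · rw [afterQuery_reg _ (by norm_num) (by norm_num), hr 69 (by norm_num), hS.one]
  · have : (afterQuery S₁).reg 66 = Op.eval .lt ((afterQuery S₁).reg 63) ((afterQuery S₁).reg 48) := by
      simp [afterQuery, State.setReg, State.setMem]
    rw [this, h63, afterQuery_reg _ (by norm_num) (by norm_num), hr 48 (by norm_num), hS.bound, Op.eval,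
      BitVec.toNat_ofNat, BitVec.toNat_ofNat, Nat.mod_eq_of_lt hm, Nat.mod_eq_of_lt (by omega)]
    have h1w : 1 < 2 ^ w := Nat.one_lt_two_pow hw.ne'
    split_ifs with hlt
    · refine ⟨fun _ => hlt, fun _ h0 => ?_⟩
      have := congrArg BitVec.toNat h0
      simp [Nat.mod_eq_of_lt h1w] at this
    · simp [hlt]
  · rw [afterQuery_mem _ (by norm_num), afterQuery_mem _ (by norm_num), ha 24 (by norm_num),
      ha 26 (by norm_num)]
    exact hS.calls q hq

theorem QueryState.proj_eq (x y : BitVec w) :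
    ((S.setReg 2 x).setReg 5 y).proj = (S.proj.setReg 0 x).setReg 1 y := by
  rw [show (5 : ℕ) = 3 * 1 + 2 from rfl, State.proj_setReg, show (2 : ℕ) = 3 * 0 + 2 from rfl,
    State.proj_setReg]

theorem QueryState.load_eq (hS : QueryState m i f S) (hi : i < m) :
    let S₁ := S.setReg 2 (S.mem 24 (S.reg 63))
    S₁.setReg 5 (S₁.mem 26 (S₁.reg 63)) = (S.setReg 2 (f i).1).setReg 5 (f i).2 := by
  intro S₁
  have h1 : S.mem 24 (S.reg 63) = (f i).1 := by rw [hS.idx]; exact (hS.calls i hi).1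
  have h2 : S₁.mem 26 (S₁.reg 63) = (f i).2 := by
    have : S₁.reg 63 = S.reg 63 := by simp [S₁, State.setReg]
    rw [this, hS.idx]
    exact (hS.calls i hi).2
  rw [h2, show S₁ = S.setReg 2 (f i).1 by simp only [S₁, h1]]

/-- The query loop runs whenever the oracle does. -/
theorem queryLoop_exec (hw : 0 < w) (hm : m < 2 ^ w) {qry : Prog} (d : ℕ) :
    ∀ {i : ℕ} {S : State w} {ans : List (BitVec w)} {t : ℕ}, i + d = m → QueryState m i f S →
      Answers qry S.proj ((List.range' i d).map f) ans t →
      ∃ S', Exec (queryLoop qry) S (t + 6 * d + 1) S' ∧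
        (∀ j < d, S'.mem 30 (BitVec.ofNat w (i + j)) = ans.getD j 0) ∧
        (∀ q < i, S'.mem 30 (BitVec.ofNat w q) = S.mem 30 (BitVec.ofNat w q)) ∧
        (∀ a, a % 2 ≠ 1 → a ≠ 30 → S'.mem a = S.mem a) ∧
        ∀ r, r % 3 = 0 → r ≠ 63 → r ≠ 66 → S'.reg r = S.reg r := by
  induction d with
  | zero =>
    intro i S ans t hid hS hA
    rw [List.range'_zero, List.map_nil] at hA
    cases hA
    refine ⟨S, .loop_neg ?_, by simp, fun _ _ => rfl, fun _ _ _ => rfl, fun _ _ _ _ => rfl⟩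
    by_contra h0
    have := hS.cond.1 h0
    omega
  | succ d ih =>
    intro i S ans t hid hS hA
    rw [List.range'_succ, List.map_cons] at hA
    have hi : i < m := by omega
    generalize hfi : f i = xy at hA
    obtain ⟨x, y⟩ := xy
    cases hA with
    | @cons _ s' _ _ _ ans t₁ T hex hA =>
      rw [← QueryState.proj_eq] at hex
      obtain ⟨S₁, ex₁, pr₁, so₁⟩ := hex.embed _ rfl
      have hl := hS.load_eq hi
      have so₁' : SameOutside ((S.setReg 2 (f i).1).setReg 5 (f i).2) S₁ := by rw [hfi]; exact so₁
      have hn := hS.next hw hm hi so₁'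
      have hp : (afterQuery S₁).proj = s' := (afterQuery_proj S₁).trans pr₁
      rw [← hp] at hA
      obtain ⟨S', ex, h1, h2, h3, h4⟩ := ih (by omega) hn hA
      have hr : ∀ r, r % 3 = 0 → S₁.reg r = S.reg r := fun r hr => by
        rw [so₁.1 r (by omega)]
        simp only [State.setReg]
        rw [Function.update_of_ne (by omega), Function.update_of_ne (by omega)]
      have h63 : S₁.reg 63 = BitVec.ofNat w i := (hr 63 (by norm_num)).trans hS.idx
      have h30 : S₁.mem 30 = S.mem 30 := so₁.2 30 (by norm_num)
      have hans : S₁.reg 2 = s'.reg 0 := by rw [← pr₁]; rfl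
      have hne : ∀ q < i, BitVec.ofNat w q ≠ BitVec.ofNat w i := fun q hq he => by
        have := congrArg BitVec.toNat he
        rw [BitVec.toNat_ofNat, BitVec.toNat_ofNat, Nat.mod_eq_of_lt (by omega),
          Nat.mod_eq_of_lt (by omega)] at this
        omega
      have hbody : Exec (queryBody qry) S (t₁ + 5) (afterQuery S₁) := by
        have e5 : t₁ + 5 = 1 + (1 + (t₁ + (1 + (1 + 1)))) := by ring
        rw [e5]
        refine .seq (.load _ _ _ _) (.seq (.load _ _ _ _) (.seq ?_
          (.seq (.store _ _ _ _) (.seq (.op _ _ _ _ _) (.op _ _ _ _ _)))))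
        rw [hl, hfi]
        exact ex₁
      refine ⟨S', ?_, ?_, ?_, ?_, ?_⟩
      · have e6 : t₁ + T + 6 * (d + 1) + 1 = t₁ + 5 + (T + 6 * d + 1) + 1 := by ring
        rw [e6]
        exact .loop_pos (hS.cond.2 hi) hbody ex
      · intro j hj
        cases j with
        | zero =>
          rw [Nat.add_zero, h2 i (by omega), afterQuery_mem_ans, h63, Function.update_self, hans]
          rfl
        | succ j =>
          have := h1 j (by omega)
          rw [show i + (j + 1) = i + 1 + j by ring, this]
          rfl
      · intro q hq
        rw [h2 q (by omega), afterQuery_mem_ans, h63, Function.update_of_ne (hne q hq), h30]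
      · intro a ha ha'
        rw [h3 a ha ha', afterQuery_mem _ ha', so₁.2 a ha]
        rfl
      · intro r hr' h5 h6
        rw [h4 r hr' h5 h6, afterQuery_reg _ h5 h6, hr r hr']

/-- If the query loop halts, then so does the oracle. -/
theorem queryLoop_answers (hw : 0 < w) (hm : m < 2 ^ w) {qry : Prog} (d : ℕ) :
    ∀ {i : ℕ} {S S' : State w} {T : ℕ}, i + d = m → QueryState m i f S →
      Exec (queryLoop qry) S T S' →
      ∃ ans t, Answers qry S.proj ((List.range' i d).map f) ans t := by
  induction d with
  | zero => exact fun {i S _ _} _ _ _ => ⟨[], 0, .nil S.proj⟩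
  | succ d ih =>
    intro i S S' T hid hS hex
    have hi : i < m := by omega
    cases hex with
    | loop_neg h0 => exact absurd h0 (hS.cond.2 hi)
    | loop_pos h0 hb hl =>
      obtain _ | _ | _ | _ | _ | _ | _ | @⟨_, _, _, _, _, _, _, hb1, hb⟩ := hb
      obtain _ | _ | _ | _ | _ | _ | _ | @⟨_, _, _, _, _, _, _, hb2, hb⟩ := hb
      obtain _ | _ | _ | _ | _ | _ | _ | @⟨_, _, _, S₁, _, _, _, hb3, hb⟩ := hb
      have k1 := (hb1.det (.load _ _ _ _)).2
      subst k1
      have k2 := (hb2.det (.load _ _ _ _)).2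
      subst k2
      rw [hS.load_eq hi] at hb3
      have k4 := (hb.det (.seq (.store _ _ _ _) (.seq (.op _ _ _ _ _) (.op _ _ _ _ _)))).2
      have k4' : _ = afterQuery S₁ := k4
      have hex := hb3.of_embed qry rfl
      obtain ⟨S₁', ex₁, pr₁, so₁⟩ := hex.embed _ rfl
      have k5 := (hb3.det ex₁).2
      subst k5
      rw [QueryState.proj_eq] at hex
      have hn := hS.next hw hm hi so₁
      rw [k4'] at hl
      obtain ⟨ans, t, hA⟩ := ih (by omega) hn hl
      rw [afterQuery_proj] at hA
      rw [List.range'_succ, List.map_cons]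
      exact ⟨_, _, .cons (x := (f i).1) (y := (f i).2) hex hA⟩

end WordRAM

namespace Imp

open WordRAM

variable {w : ℕ}

/-! ### The reduction as a program -/

/-- The degrees after the oracle has used the arrays with odd names. -/
def tyCheck : Ty := { ty with a := fun x => if x % 2 = 1 then 30 else ty.a x }

theorem cCheck_wt_tyCheck : cCheck.wt tyCheck = true := by decide

/-- The input words. -/
def inputWord (w : ℕ) {n : ℕ} (x : Fin n → ℤ) (i : ℕ) : ℕ :=
  if h : i < n then (BitVec.ofInt w (x ⟨i, h⟩)).toNat else 0

/-- The abstract state after the first random word `r` has been read. -/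
def inputEnv (w : ℕ) {n : ℕ} (x : Fin n → ℤ) (r : ℕ) : Env where
  v := fun v => if v = 0 then n else if v = 2 then r else 0
  a := fun a => if a = 0 then inputWord w x else 0
  t := 0

/-- The abstract state in which the oracle is called. -/
def builtEnv (k D M w : ℕ) {n : ℕ} (x : Fin n → ℤ) (r : ℕ) : Env :=
  run w cBuild (run w (cInit k D M) (inputEnv w x r))

/-- The parameters for the input `x` and the random word `r`. -/
def inputPar (k D M w : ℕ) {n : ℕ} (x : Fin n → ℤ) (r : ℕ) : Par :=
  par k D M n fun i => Par.hsh w (digits k D n) r (inputWord w x i)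

/-- Build the array of colours and the queries. -/
def buildProg (k D M : ℕ) : Prog :=
  -- Register 6 is variable 2. The final copy puts the array size, variable 12, into register 0 of
  -- the oracle; array 1, filled by the construction, is its array 0.
  .seq (.rand 6) (.seq ((Cmd.seq (cInit k D M) cBuild).compile 0) (.op .or 2 36 36))

/-- The registers of the loop are cleared at the end because they are variables of the verification,
whose degrees they have to respect. -/
def queryProg (qry : Prog) : Prog :=
  .seq (.const 63 0) (.seq (.const 69 1) (.seq (.op .lt 66 63 48) (.seq (queryLoop qry)
    (.seq (.const 63 0) (.seq (.const 66 0) (.const 69 0))))))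

/-- The algorithm for 3SUM. -/
def threeSumProg (k D M : ℕ) (pre qry : Prog) : Prog :=
  .seq (buildProg k D M) (.seq pre.embed (.seq (queryProg qry) (cCheck.compile 0)))

theorem inputWord_lt (w : ℕ) {n : ℕ} (x : Fin n → ℤ) (i : ℕ) : inputWord w x i < 2 ^ w := by
  unfold inputWord
  split_ifs
  · exact (BitVec.ofInt w _).isLt
  · positivity

theorem inputWord_of_le (w : ℕ) {n : ℕ} (x : Fin n → ℤ) {i : ℕ} (h : n ≤ i) :
    inputWord w x i = 0 := dif_neg (by omega)

theorem eq_ofNat_of_toNat {x : BitVec w} {k : ℕ} (h : x.toNat = k) : x = BitVec.ofNat w k := by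
  rw [← h, BitVec.ofNat_toNat, BitVec.setWidth_eq]

theorem Rel.setReg_emb {σ : Env} {s : State w} (h : Rel σ s) (k : ℕ) (x : BitVec w) :
    Rel σ (s.setReg (3 * k + 2) x) := by
  refine ⟨fun v => ?_, h.mem⟩
  simp only [State.setReg, Function.update_apply]
  rw [if_neg (by omega)]
  exact h.reg v

/-- The state in which the oracle is called. -/
structure Ready (p : Par) (V : ℕ) (hR : 0 < p.R) (hS : 0 < p.S) (A : ℕ → ℕ)
    (tape : ℕ → BitVec w) (σ : Env) (S : State w) : Prop where
  rel : Rel σ S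
  built : Built p σ
  bounded : Bounded ty V w σ
  input : σ.a 0 = A
  proj : S.proj = initState p.N (fun i => BitVec.ofNat w (p.colours hR hS i)) tape

theorem par_pos (k D M n : ℕ) (h : ℕ → ℕ) : 0 < (par k D M n h).R ∧ 0 < (par k D M n h).S :=
  ⟨Nat.two_pow_pos _, Nat.two_pow_pos _⟩

/-- The construction has to leave the oracle in exactly its initial state: its registers are
untouched except for the array size, its arrays other than array 0 are zero, the array of colours is
zero from `N` on, and its tape is the original one without the first word. -/
theorem exec_buildProg {k D M n : ℕ} (hk : 1 ≤ k) (hkD : k ≤ D) (hV : vbound D M n ^ 30 ≤ 2 ^ w)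
    (x : Fin n → ℤ) (a : BitVec w) (tape : ℕ → BitVec w) :
    let p := inputPar k D M w x a.toNat
    ∃ t S, Exec (buildProg k D M)
        (initState n (fun i => BitVec.ofInt w (x i)) (consTape a tape)) t S ∧
      Ready p (vbound D M n) (par_pos _ _ _ _ _).1 (par_pos _ _ _ _ _).2 (inputWord w x) tape
        (builtEnv k D M w x a.toNat) S ∧
      t ≤ 2 + 200 * (n + 1) + 2000 * (p.N + p.m) := by
  intro p
  obtain ⟨b1, b2, b3, b4⟩ := le_vbound D M n
  have hV2 : 2 ≤ vbound D M n := by omega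
  have hd := digits_lt hk hkD hV
  have hw : 0 < w := by omega
  have hVw : vbound D M n ≤ 2 ^ w := (Nat.le_self_pow (by norm_num) _).trans hV
  have hR : 0 < p.R := (par_pos _ _ _ _ _).1
  have hS : 0 < p.S := (par_pos _ _ _ _ _).2
  set σ₀ := inputEnv w x a.toNat with hσ₀
  set s₀ := initState n (fun i => BitVec.ofInt w (x i)) (consTape a tape) with hs₀
  set s₁ : State w := ({ s₀ with tape := fun i => s₀.tape (i + 1) }).setReg 6 (s₀.tape 0) with hs₁
  have h1w : n < 2 ^ w := by omega
  have rel₁ : Rel σ₀ s₁ := by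
    refine ⟨fun v => ?_, fun b i => ?_⟩
    · simp only [hs₁, State.setReg, hs₀, initState, hσ₀, inputEnv, Function.update_apply, consTape]
      rcases eq_or_ne v 0 with rfl | h0
      · simp [Nat.mod_eq_of_lt h1w]
      · rcases eq_or_ne v 2 with rfl | h2
        · simp
        · rw [if_neg (by omega), if_neg (by omega), if_neg h0, if_neg h2]
          simp
    · simp only [hs₁, State.setReg, hs₀, initState, hσ₀, inputEnv]
      rcases eq_or_ne b 0 with rfl | h0
      · simp only [true_and, if_true, inputWord]
        split_ifs <;> simp
      · simp [h0]
  obtain ⟨ok₁, ctx₁, bd₁, t₁, ar₁⟩ := run_cInit (w := w) (σ := σ₀) (M := M) (A := inputWord w x)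
    (r := a.toNat) hk hkD hV rfl rfl a.isLt (fun v h0 h2 => by simp [hσ₀, inputEnv, h0, h2]) rfl
    (fun b hb => by simp [hσ₀, inputEnv, hb]) (inputWord_lt w x)
    (fun i hi => inputWord_of_le w x hi)
  set σ₁ := run w (cInit k D M) σ₀ with hσ₁
  obtain ⟨ok₂, bd₂⟩ := Cmd.ok_of_wt hV2 hV cBuild bd₁ cBuild_wt (cBuild_litsBelow (by omega))
  have z₁ : ∀ b, b ≠ 0 → b ≠ 2 → σ₁.a b = 0 := fun b h0 h2 => by
    rw [ar₁ b h2]; simp [hσ₀, inputEnv, h0]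
  obtain ⟨bu₂, X₂, t₂⟩ := run_cBuild (w := w) (p := p) hR hS ctx₁
    (fun b hb => z₁ b (by rintro rfl; revert hb; decide) (by rintro rfl; revert hb; decide))
  set σ₂ := run w cBuild σ₁ with hσ₂
  have hbe : builtEnv k D M w x a.toNat = σ₂ := by simp only [builtEnv, hσ₂, hσ₁, hσ₀]
  rw [hbe]
  obtain ⟨s₂, t, ex, ht, rel₂, kp⟩ := Cmd.exec_compile hw (Cmd.seq (cInit k D M) cBuild) 0 rel₁
    ⟨ok₁, ok₂⟩
  change σ₂.t = σ₀.t + t at ht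
  change Rel σ₂ s₂ at rel₂
  have ht0 : σ₀.t = 0 := rfl
  have e36 : s₂.reg 36 = BitVec.ofNat w p.N := eq_ofNat_of_toNat ((rel₂.reg 12).trans bu₂.ctx.N)
  have hNw : p.N < 2 ^ w := by
    rw [← bu₂.ctx.N, ← rel₂.reg 12]; exact (s₂.reg _).isLt
  have odd₂ : ∀ b, b ≠ 0 → σ₂.a (2 * b + 1) = 0 := fun b hb => by
    rw [hσ₂, run_a cBuild, z₁ _ (by omega) (by omega)]
    intro hm
    have : ∀ c ∈ cBuild.wa, c % 2 = 1 → c = 1 := by decide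
    have := this _ hm (by omega)
    omega
  refine ⟨1 + (t + 1), _, .seq (.rand _ _) (.seq ex (.op _ _ _ _ _)), ⟨?_, bu₂, bd₂, ?_, ?_⟩,
    by omega⟩
  · exact rel₂.setReg_emb 0 _
  · rw [hσ₂, run_a cBuild (by decide), ar₁ 0 (by norm_num)]
    rfl
  · simp only [State.proj, initState, State.setReg, State.mk.injEq]
    refine ⟨?_, ?_, ?_⟩
    · funext r
      rcases eq_or_ne r 0 with rfl | h0
      · simp [Op.toNat_eval_or_self, e36]
      · rw [Function.update_of_ne (by omega), kp.emb, if_neg h0, hs₁]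
        simp only [State.setReg, hs₀, initState]
        rw [Function.update_of_ne (by omega), if_neg (by omega)]
    · funext b i
      apply BitVec.eq_of_toNat_eq
      rw [rel₂.mem]
      rcases eq_or_ne b 0 with rfl | h0
      · rw [show 2 * 0 + 1 = 1 from rfl, X₂]
        split_ifs with h
        · have := Par.X_lt (p := p) hR hS i.toNat
          simp only [Par.colours, BitVec.toNat_ofNat]
          rw [Nat.mod_eq_of_lt (by omega)]
        · have h' : p.N ≤ i.toNat := by simpa using h
          rw [Par.X_eq_zero hR hS h']
          simp
      · rw [odd₂ b h0, dif_neg (by simp [h0])]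
        simp
    · rw [kp.tape]
      rfl

end Imp

/-! ### From the oracle to the verification -/

namespace Imp

open WordRAM

variable {w : ℕ} {p : Par} {V : ℕ} {hR : 0 < p.R} {hS : 0 < p.S} {A : ℕ → ℕ}
  {tape : ℕ → BitVec w} {σ : Env} {S : State w} {qry : Prog}

/-- The queries as words. -/
def queryWord (w : ℕ) (p : Par) (σ : Env) (q : ℕ) : BitVec w × BitVec w :=
  (BitVec.ofNat w (p.q1 q), BitVec.ofNat w (p.q2 (σ.a 22) q))

/-- Initialize the query loop. -/
def enter (S : State w) : State w :=
  let S₁ := (S.setReg 63 (BitVec.ofNat w 0)).setReg 69 (BitVec.ofNat w 1)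
  S₁.setReg 66 (Op.eval .lt (S₁.reg 63) (S₁.reg 48))

/-- Clear the registers of the query loop. -/
def leave (S : State w) : State w :=
  ((S.setReg 63 (BitVec.ofNat w 0)).setReg 66 (BitVec.ofNat w 0)).setReg 69 (BitVec.ofNat w 0)

theorem enter_proj (S : State w) : (enter S).proj = S.proj := by
  simp only [State.proj, enter, State.setReg, State.mk.injEq, and_true]
  funext r
  rw [Function.update_of_ne (by omega), Function.update_of_ne (by omega),
    Function.update_of_ne (by omega)]

theorem enter_reg (S : State w) {r : ℕ} (h : r ≠ 63) (h' : r ≠ 66) (h'' : r ≠ 69) :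
    (enter S).reg r = S.reg r := by
  simp [enter, State.setReg, h, h', h'']

theorem leave_reg (S : State w) {r : ℕ} (h : r ≠ 63) (h' : r ≠ 66) (h'' : r ≠ 69) :
    (leave S).reg r = S.reg r := by
  simp [leave, State.setReg, h, h', h'']

theorem Ready.m_lt (h : Ready p V hR hS A tape σ S) : p.m < 2 ^ w := by
  rw [← h.built.ctx.m, ← h.rel.reg 16]
  exact (S.reg _).isLt

theorem Ready.queryState (hw : 0 < w) (h : Ready p V hR hS A tape σ S) {S₁ : State w}
    (so : SameOutside S S₁) : QueryState p.m 0 (queryWord w p σ) (enter S₁) := by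
  have hm := h.m_lt
  have e48 : S₁.reg 48 = BitVec.ofNat w p.m := by
    rw [so.1 48 (by norm_num)]
    exact eq_ofNat_of_toNat ((h.rel.reg 16).trans h.built.ctx.m)
  refine ⟨?_, by simp [enter, State.setReg], by simp [enter, State.setReg], ?_, fun q hq => ?_⟩
  · rw [enter_reg _ (by norm_num) (by norm_num) (by norm_num), e48]
  · have : (enter S₁).reg 66 = Op.eval .lt (BitVec.ofNat w 0) (BitVec.ofNat w p.m) := by
      simp [enter, State.setReg, e48]
    rw [this]
    have h1w : 1 < 2 ^ w := Nat.one_lt_two_pow hw.ne'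
    simp only [Op.eval, BitVec.toNat_ofNat, Nat.zero_mod, Nat.mod_eq_of_lt hm]
    split_ifs with hlt
    · refine ⟨fun _ => hlt, fun _ h0 => ?_⟩
      have := congrArg BitVec.toNat h0
      simp [Nat.mod_eq_of_lt h1w] at this
    · simp [hlt]
  · have hq' : (BitVec.ofNat w q).toNat = q := by
      rw [BitVec.toNat_ofNat, Nat.mod_eq_of_lt (by omega)]
    obtain ⟨q1, q2, -⟩ := h.built.q q hq
    have e : ∀ b, (enter S₁).mem b = S₁.mem b := fun b => rfl
    rw [e, e, so.2 24 (by norm_num), so.2 26 (by norm_num)]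
    exact ⟨eq_ofNat_of_toNat (by rw [h.rel.mem, hq', q1]),
      eq_ofNat_of_toNat (by rw [h.rel.mem, hq', q2])⟩

theorem queries_map (w : ℕ) (p : Par) (hR : 0 < p.R) (hS : 0 < p.S) (σ : Env) :
    (p.queries hR hS (σ.a 22)).map (fun ab => (BitVec.ofNat w ab.1, BitVec.ofNat w ab.2))
      = (List.range' 0 p.m).map (queryWord w p σ) := by
  rw [Par.queries, List.map_map, List.range_eq_range']
  rfl

/-- The state after the answers `ans` have been received. -/
structure Answered (p : Par) (V : ℕ) (A : ℕ → ℕ) (ans : List (BitVec w)) (σ : Env) (S : State w) :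
    Prop where
  rel : Rel σ S
  built : Built p σ
  bounded : Bounded tyCheck V w σ
  input : σ.a 0 = A
  ans : ∀ q < p.m, σ.a 30 q = (ans.getD q 0).toNat

/-- The abstract state after the query loop. -/
def answeredEnv (σ : Env) (S : State w) : Env where
  v := fun v => if v = 21 ∨ v = 22 ∨ v = 23 then 0 else σ.v v
  -- The oracle may have changed the odd arrays, and array 30 holds its answers; these are read back
  -- from the machine, while everything else is as before.
  a := fun a => if a % 2 = 1 ∨ a = 30 then
    fun i => if i < 2 ^ w then (S.mem a (BitVec.ofNat w i)).toNat else 0 else σ.a a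
  t := 0

theorem exec_queryProg (hw : 0 < w) (h : Ready p V hR hS A tape σ S) {S₁ : State w}
    (so : SameOutside S S₁) {ans : List (BitVec w)} {t : ℕ}
    (hA : Answers qry S₁.proj ((List.range' 0 p.m).map (queryWord w p σ)) ans t) :
    ∃ σ' S', Exec (queryProg qry) S₁ (t + 6 * p.m + 7) S' ∧ Answered p V A ans σ' S' := by
  have hm := h.m_lt
  rw [← enter_proj] at hA
  obtain ⟨S₄, ex, h1, -, h3, h4⟩ :=
    queryLoop_exec hw hm p.m (Nat.zero_add _) (h.queryState hw so) hA
  have hmem : ∀ b, b % 2 ≠ 1 → b ≠ 30 → S₄.mem b = S.mem b := fun b hb hb' => by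
    rw [h3 b hb hb', ← so.2 b hb]; rfl
  have hreg : ∀ r, r % 3 = 0 → r ≠ 63 → r ≠ 66 → r ≠ 69 → S₄.reg r = S.reg r :=
    fun r hr h5 h6 h7 => by
      rw [h4 r hr h5 h6, enter_reg _ h5 h6 h7, so.1 r (by omega)]
  have ea : ∀ b, b % 2 ≠ 1 → b ≠ 30 → (answeredEnv σ S₄).a b = σ.a b := fun b hb hb' => by
    simp [answeredEnv, hb, hb']
  have ev : ∀ v < 21, (answeredEnv σ S₄).v v = σ.v v := fun v hv => by
    simp only [answeredEnv]; rw [if_neg (by omega)]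
  have e22 := ea 22 (by norm_num) (by norm_num)
  have bu := h.built
  refine ⟨answeredEnv σ S₄, leave S₄, ?_, ⟨fun v => ?_, fun b i => ?_⟩,
    ⟨?_, ?_, ?_, ?_, ?_⟩, ⟨?_, ?_, ?_⟩, ?_, ?_⟩
  · have e7 : t + 6 * p.m + 7 = 1 + (1 + (1 + (t + 6 * p.m + 1 + (1 + (1 + 1))))) := by ring
    rw [e7]
    exact .seq (.const _ _ _) (.seq (.const _ _ _) (.seq (.op _ _ _ _ _) (.seq ex
      (.seq (.const _ _ _) (.seq (.const _ _ _) (.const _ _ _))))))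
  · simp only [answeredEnv]
    split_ifs with hv
    · rcases hv with rfl | rfl | rfl <;> simp [leave, State.setReg]
    · rw [leave_reg _ (by omega) (by omega) (by omega),
        hreg _ (by omega) (by omega) (by omega) (by omega)]
      exact h.rel.reg v
  · change (S₄.mem b i).toNat = _
    simp only [answeredEnv]
    split_ifs with hb
    · beta_reduce
      rw [if_pos i.isLt, BitVec.ofNat_toNat, BitVec.setWidth_eq]
    · push Not at hb
      rw [hmem b hb.1 hb.2, h.rel.mem]
  · exact bu.ctx.congr (fun v hv _ => ev v hv) (ea 2 (by norm_num) (by norm_num))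
  · exact bu.HL.congr (ea 4 (by norm_num) (by norm_num)) (ea 6 (by norm_num) (by norm_num))
  · exact bu.ML.congr (ea 10 (by norm_num) (by norm_num)) (ea 12 (by norm_num) (by norm_num))
  · rw [e22]; exact bu.ip
  · rw [e22, ea 24 (by norm_num) (by norm_num), ea 26 (by norm_num) (by norm_num),
      ea 28 (by norm_num) (by norm_num)]
    exact bu.q
  · intro v
    simp only [answeredEnv]
    split_ifs
    · exact lt_of_le_of_lt (Nat.zero_le _) (h.bounded.v v)
    · exact h.bounded.v v
  · intro b i
    simp only [answeredEnv]
    split_ifs with hb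
    · have h30 : tyCheck.a b = 30 := by
        rcases hb with hb | rfl
        · simp [tyCheck, hb]
        · rfl
      rw [h30, bnd, if_neg (by norm_num)]
      beta_reduce
      split_ifs
      · exact (S₄.mem _ _).isLt
      · positivity
    · push Not at hb
      have : tyCheck.a b = ty.a b := by simp [tyCheck, hb.1]
      rw [this]
      exact h.bounded.a b i
  · intro v hv
    have hv' : ty.pos v = true := hv
    have : v < 21 := by
      simp only [ty, List.mem_cons, List.not_mem_nil, or_false, decide_eq_true_eq] at hv'
      omega
    rw [ev v this]
    exact h.bounded.pos v hv'
  · rw [ea 0 (by norm_num) (by norm_num)]; exact h.input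
  · intro q hq
    have hqw : q < 2 ^ w := by omega
    simp only [answeredEnv]
    rw [if_pos (by norm_num), if_pos hqw, ← h1 q hq, Nat.zero_add]

theorem exec_cCheck (hw : 0 < w) (hV : 16 ≤ V) (hVw : V ^ 30 ≤ 2 ^ w) {ans : List (BitVec w)}
    (h : Answered p V A ans σ S) (hR : 0 < p.R) (hS : 0 < p.S) (hh : ∀ x, p.h x < p.P)
    (hit : ∀ q < p.m, (ans.getD q 0).toNat ≤ p.thr → (p.hits q).Nonempty) :
    ∃ t S', Exec (cCheck.compile 0) S t S' ∧
      (S'.reg 0 ≠ 0 ↔ ∃ q < p.m, (ans.getD q 0).toNat ≤ p.thr ∧ Finds w A p q) ∧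
      t ≤ 10 + 50 * p.m + 200 * (p.B + 1) * ((p.spurious (Good w A)).card + (p.n + 1)) := by
  obtain ⟨ok, -⟩ := Cmd.ok_of_wt (by omega) hVw cCheck h.bounded cCheck_wt_tyCheck
    (cCheck_litsBelow hV)
  obtain ⟨S', t, ex, ht, rel, -⟩ := Cmd.exec_compile hw cCheck 0 h.rel ok
  obtain ⟨c1, c2⟩ := run_cCheck (w := w) hR hS h.built hh
    (fun q hq hle => hit q hq (by rw [← h.ans q hq]; exact hle))
  rw [h.input] at c1 c2
  refine ⟨t, S', ex, ?_, by omega⟩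
  have h0 : S'.reg 0 ≠ 0 ↔ (run w cCheck σ).v 0 ≠ 0 := by
    rw [← rel.reg 0, ne_eq, ne_eq, ← BitVec.toNat_inj]
    simp
  rw [h0, c1]
  refine exists_congr fun q => and_congr_right fun hq => ?_
  rw [h.ans q hq]

end Imp

/-! ### Correctness of the algorithm for 3SUM -/

namespace Imp

open WordRAM

variable {w k D M n : ℕ} {x : Fin n → ℤ}

theorem hashes_inputPar (hk : 1 ≤ k) (hkD : k ≤ D) (hV : vbound D M n ^ 30 ≤ 2 ^ w)
    (x : Fin n → ℤ) (r : ℕ) :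
    Par.Hashes (inputPar k D M w x r) w (digits k D n) r (inputWord w x) := by
  have hd := digits_lt hk hkD hV
  refine ⟨rfl, par_P _ _ _ _ _, fun _ => rfl, inputWord_lt w x, by omega, hd.le, ?_⟩
  have : 1 ≤ sig k D n := Nat.succ_pos _
  unfold digits
  omega

theorem inputWord_injOn (hw : 0 < w) (hx : Function.Injective x)
    (hb : ∀ i, -(2 : ℤ) ^ w ≤ 2 * x i ∧ 2 * x i < (2 : ℤ) ^ w) :
    ∀ i < n, ∀ j < n, inputWord w x i = inputWord w x j → i = j := by
  intro i hi j hj h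
  simp only [inputWord, hi, hj, dif_pos] at h
  obtain ⟨s, s1, s2, s3⟩ := Par.exists_sign hw (hb ⟨i, hi⟩).1 (hb ⟨i, hi⟩).2
  obtain ⟨t, t1, t2, t3⟩ := Par.exists_sign hw (hb ⟨j, hj⟩).1 (hb ⟨j, hj⟩).2
  rw [h] at s1 s2
  have hst : s = t := s1.symm.trans t1
  subst hst
  have : x ⟨i, hi⟩ = x ⟨j, hj⟩ := by rw [s2] at t2; linarith
  simpa using hx this

/-- The answers found among the pairs of small distance decide 3SUM. -/
theorem exists_finds_iff (hk : 1 ≤ k) (hkD : k ≤ D) (hV : vbound D M n ^ 30 ≤ 2 ^ w)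
    (hb : ∀ i, -(2 : ℤ) ^ w ≤ 2 * x i ∧ 2 * x i < (2 : ℤ) ^ w) {r : ℕ}
    (hR : 0 < (inputPar k D M w x r).R) (hS : 0 < (inputPar k D M w x r).S) {ip : ℕ → ℕ}
    (hip : ∀ c < (inputPar k D M w x r).S, ∀ i < (inputPar k D M w x r).n,
      ip ((inputPar k D M w x r).colA c i) = (inputPar k D M w x r).buck c i) {ans : ℕ → ℕ}
    (hans : ∀ q < (inputPar k D M w x r).m,
      ans q ≤ M * colorDist ((inputPar k D M w x r).colours hR hS)
        ⟨(inputPar k D M w x r).q1 q, Par.q1_lt hR hS q⟩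
        ⟨(inputPar k D M w x r).q2 ip q, Par.q2_lt hR hS ip q⟩) :
    (∃ q < (inputPar k D M w x r).m, ans q ≤ (inputPar k D M w x r).thr ∧
      Finds w (inputWord w x) (inputPar k D M w x r) q) ↔ HasThreeSum x := by
  have hH := hashes_inputPar hk hkD hV x r
  set p := inputPar k D M w x r with hp
  have hpn : p.n = n := rfl
  have hin : ∀ {i} (hi : i < n), inputWord w x i = (BitVec.ofInt w (x ⟨i, hi⟩)).toNat :=
    fun hi => dif_pos hi
  constructor
  · rintro ⟨q, hq, -, ⟨⟨c, i⟩, j⟩, he, hg⟩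
    obtain ⟨⟨⟨-, hi⟩, hj⟩, -, hsum⟩ := Par.mem_hits.1 he
    have hz := Par.qz_lt hR hq
    obtain ⟨g1, g2, g3, g4⟩ := hg
    refine ⟨⟨i, hi⟩, ⟨j, hj⟩, ⟨p.qz q, hz⟩, Fin.ne_of_val_ne g2,
      Fin.ne_of_val_ne g3, Fin.ne_of_val_ne g4, ?_⟩
    exact hH.sum_eq (hb _) (hb _) (hb _) (hin hi) (hin hj) (hin hz) g1
      (Nat.mod_lt _ (by norm_num)) hsum
  · rintro ⟨i, j, l, hij, hil, hjl, hs⟩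
    obtain ⟨h1, e, he, h2⟩ := hH.exists_match (hb i) (hb j) (hb l) (hin i.2) (hin j.2) (hin l.2) hs
    obtain ⟨q, hq, hqz, ⟨c, hc⟩, hd⟩ := Par.exists_query hR hS hip i.2 j.2 l.2 he h2
    refine ⟨q, hq, (hans q hq).trans ?_, ((c, i), j), hc, ?_⟩
    -- The distance is at most `2 * b`, so the stretched answer is at most `2 * b * M`, which is the
    -- threshold.
    · rw [Nat.mul_comm]
      exact Nat.mul_le_mul_right M hd
    · rw [hqz]
      exact ⟨h1, Fin.val_ne_of_ne hij, Fin.val_ne_of_ne hil, Fin.val_ne_of_ne hjl⟩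

/-- The array of colours for an input. -/
def inputColours (k D M w : ℕ) {n : ℕ} (x : Fin n → ℤ) (r : ℕ) :
    Fin (inputPar k D M w x r).N → Fin (inputPar k D M w x r).N :=
  (inputPar k D M w x r).colours (par_pos _ _ _ _ _).1 (par_pos _ _ _ _ _).2

/-- The queries for an input. -/
def inputQueries (k D M w : ℕ) {n : ℕ} (x : Fin n → ℤ) (r : ℕ) :
    List (Fin (inputPar k D M w x r).N × Fin (inputPar k D M w x r).N) :=
  (inputPar k D M w x r).queries (par_pos _ _ _ _ _).1 (par_pos _ _ _ _ _).2
    ((builtEnv k D M w x r).a 22)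

theorem inputQueries_map (k D M w : ℕ) {n : ℕ} (x : Fin n → ℤ) (r : ℕ) :
    (inputQueries k D M w x r).map (fun ab => (BitVec.ofNat w ab.1, BitVec.ofNat w ab.2))
      = (List.range' 0 (inputPar k D M w x r).m).map
        (queryWord w (inputPar k D M w x r) (builtEnv k D M w x r)) :=
  queries_map w (inputPar k D M w x r) _ _ _

/-- The work of the reduction outside of the oracle. -/
def work (p : Par) (spurious : ℕ) : ℕ :=
  19 + 200 * (p.n + 1) + 2000 * p.N + 2056 * p.m + 200 * (p.B + 1) * (spurious + (p.n + 1))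

/-- The session of the oracle in the algorithm. -/
abbrev InputSession (k D M w : ℕ) {n : ℕ} (pre qry : Prog) (x : Fin n → ℤ) (r : ℕ)
    (tape : ℕ → BitVec w) (ans : List (BitVec w)) (t : ℕ) : Prop :=
  Session pre qry (initState (inputPar k D M w x r).N
      (fun i => BitVec.ofNat w (inputColours k D M w x r i)) tape)
    ((inputQueries k D M w x r).map fun ab => (BitVec.ofNat w ab.1, BitVec.ofNat w ab.2)) ans t

variable {pre qry : Prog}

/-- If the algorithm halts, then so does the oracle. -/
theorem exists_session (hk : 1 ≤ k) (hkD : k ≤ D) (hV : vbound D M n ^ 30 ≤ 2 ^ w)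
    {a : BitVec w} {tape : ℕ → BitVec w} {t : ℕ} {s' : State w}
    (h : Exec (threeSumProg k D M pre qry)
      (initState n (fun i => BitVec.ofInt w (x i)) (consTape a tape)) t s') :
    ∃ ans t, InputSession k D M w pre qry x a.toNat tape ans t := by
  have hd := digits_lt hk hkD hV
  obtain ⟨t₁, S, ex, hr, -⟩ := exec_buildProg hk hkD hV x a tape
  obtain _ | _ | _ | _ | _ | _ | _ | @⟨_, _, _, _, _, _, _, h1, h⟩ := h
  obtain _ | _ | _ | _ | _ | _ | _ | @⟨_, _, _, S₁, _, _, t₂, h2, h⟩ := h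
  obtain _ | _ | _ | _ | _ | _ | _ | @⟨_, _, _, _, _, _, _, h3, h⟩ := h
  obtain _ | _ | _ | _ | _ | _ | _ | @⟨_, _, _, _, _, _, _, h4, h3⟩ := h3
  obtain _ | _ | _ | _ | _ | _ | _ | @⟨_, _, _, _, _, _, _, h5, h3⟩ := h3
  obtain _ | _ | _ | _ | _ | _ | _ | @⟨_, _, _, _, _, _, _, h6, h3⟩ := h3
  obtain _ | _ | _ | _ | _ | _ | _ | @⟨_, _, _, _, _, _, _, h7, h3⟩ := h3
  -- By determinism the intermediate states of the given run are the states constructed in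
  -- `exec_buildProg`.
  obtain rfl := (h1.det ex).2
  have hpre := h2.of_embed pre rfl
  obtain ⟨S₁', ex₁, pr₁, so₁⟩ := hpre.embed _ rfl
  obtain rfl := (h2.det ex₁).2
  obtain rfl := (h4.det (.const _ _ _)).2
  obtain rfl := (h5.det (.const _ _ _)).2
  obtain rfl := (h6.det (.op _ _ _ _ _)).2
  obtain ⟨ans, t₃, hA⟩ := queryLoop_answers (by omega) hr.m_lt _ (Nat.zero_add _)
    (hr.queryState (by omega) so₁) h7
  rw [enter_proj, ← inputQueries_map] at hA
  rw [hr.proj] at hpre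
  exact ⟨ans, _, _, _, _, hpre, hA, rfl⟩

/-- If the oracle halts with the right answers, then so does the algorithm. -/
theorem exec_threeSumProg (hk : 1 ≤ k) (hkD : k ≤ D) (hV : vbound D M n ^ 30 ≤ 2 ^ w)
    (hb : ∀ i, -(2 : ℤ) ^ w ≤ 2 * x i ∧ 2 * x i < (2 : ℤ) ^ w)
    {α : ℝ} (hα : α ≤ M) {a : BitVec w} {tape : ℕ → BitVec w} {ans : List (BitVec w)} {t : ℕ}
    (h : InputSession k D M w pre qry x a.toNat tape ans t)
    (hans : List.Forall₂ (fun ab (d : BitVec w) =>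
      colorDist (inputColours k D M w x a.toNat) ab.1 ab.2 ≤ d.toNat ∧
        (d.toNat : ℝ) ≤ α * colorDist (inputColours k D M w x a.toNat) ab.1 ab.2)
      (inputQueries k D M w x a.toNat) ans) :
    ∃ t' S', Exec (threeSumProg k D M pre qry)
        (initState n (fun i => BitVec.ofInt w (x i)) (consTape a tape)) t' S' ∧
      (S'.reg 0 ≠ 0 ↔ HasThreeSum x) ∧
      t' ≤ work (inputPar k D M w x a.toNat) ((inputPar k D M w x a.toNat).spurious
        (Good w (inputWord w x))).card + t := by
  have hd := digits_lt hk hkD hV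
  have hw : 0 < w := by omega
  obtain ⟨b1, b2, b3, b4⟩ := le_vbound D M n
  obtain ⟨t₁, S, ex, hr, ht₁⟩ := exec_buildProg hk hkD hV x a tape
  obtain ⟨t₂, s₂, t₃, hpre, hA, rfl⟩ := h
  have hH := hashes_inputPar hk hkD hV x a.toNat
  have hR : 0 < (inputPar k D M w x a.toNat).R := (par_pos _ _ _ _ _).1
  have hS : 0 < (inputPar k D M w x a.toNat).S := (par_pos _ _ _ _ _).2
  obtain ⟨S₁, ex₁, rfl, so₁⟩ := hpre.embed S hr.proj
  rw [inputQueries_map] at hA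
  obtain ⟨σ', S₂, ex₂, hr₂⟩ := exec_queryProg hw hr so₁ hA
  have hq : ∀ q < (inputPar k D M w x a.toNat).m,
      colorDist (inputColours k D M w x a.toNat) ⟨_, Par.q1_lt hR hS q⟩
        ⟨_, Par.q2_lt hR hS ((builtEnv k D M w x a.toNat).a 22) q⟩ ≤ (ans.getD q 0).toNat ∧
      ((ans.getD q 0).toNat : ℝ) ≤ α * colorDist (inputColours k D M w x a.toNat)
        ⟨_, Par.q1_lt hR hS q⟩ ⟨_, Par.q2_lt hR hS ((builtEnv k D M w x a.toNat).a 22) q⟩ := by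
    intro q hq
    have hlen := hans.length_eq
    have hl : (inputQueries k D M w x a.toNat).length = (inputPar k D M w x a.toNat).m := by
      simp [inputQueries, Par.queries]
    have := hans.get (i := q) (by omega) (by omega)
    rw [List.getD_eq_getElem _ _ (by omega)]
    simpa [inputQueries, Par.queries] using this
  obtain ⟨t₄, S', ex₃, hout, ht₄⟩ := exec_cCheck hw (by omega) hV hr₂ hR hS hH.lt
    (fun q hqm hle => Par.hits_nonempty hR hS hr.built.ip ((hq q hqm).1.trans hle))
  refine ⟨_, S', .seq ex (.seq ex₁ (.seq ex₂ ex₃)), hout.trans ?_, ?_⟩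
  · refine exists_finds_iff hk hkD hV hb hR hS hr.built.ip (fun q hqm => ?_)
    have h1 := (hq q hqm).2
    have h2 := mul_le_mul_of_nonneg_right hα (Nat.cast_nonneg (α := ℝ)
      (colorDist (inputColours k D M w x a.toNat) ⟨_, Par.q1_lt hR hS q⟩
        ⟨_, Par.q2_lt hR hS ((builtEnv k D M w x a.toNat).a 22) q⟩))
    exact_mod_cast h1.trans h2
  · have : (inputPar k D M w x a.toNat).n = n := rfl
    unfold work
    omega

end Imp

/-! ### The expected running time -/

namespace Imp

open WordRAM

variable {w k D M n : ℕ} {x : Fin n → ℤ} {pre qry : Prog} {α : ℝ} {c : ℕ} {tp tq : ℕ → ℝ≥0}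

theorem sum_bitVec (w : ℕ) {β : Type*} [AddCommMonoid β] (f : ℕ → β) :
    ∑ a : BitVec w, f a.toNat = ∑ r ∈ Finset.range (2 ^ w), f r := by
  rw [← Fin.sum_univ_eq_sum_range]
  exact Fintype.sum_equiv BitVec.equivFin.toEquiv _ _ fun _ => rfl

theorem length_inputQueries (k D M w : ℕ) (x : Fin n → ℤ) (r : ℕ) :
    (inputQueries k D M w x r).length = (inputPar k D M w x r).m := by
  simp [inputQueries, Par.queries]

/-- The random word influences the array and the queries but neither the size nor the number of
queries. Hence one bound holds for all first words; it is written with the zero hash as a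
representative. -/
theorem oracle_input (h : IsColorDistOracle α pre qry c tp tq) (k D M : ℕ) (x : Fin n → ℤ)
    (hc : c * (Nat.log 2 (par k D M n 0).N + 1) ≤ w) (r : ℕ) :
    (∀ tape ans t, InputSession k D M w pre qry x r tape ans t →
      List.Forall₂ (fun ab (d : BitVec w) =>
        colorDist (inputColours k D M w x r) ab.1 ab.2 ≤ d.toNat ∧
          (d.toNat : ℝ) ≤ α * colorDist (inputColours k D M w x r) ab.1 ab.2)
        (inputQueries k D M w x r) ans) ∧
    ∫⁻ tape, sessionCost pre qry (initState (inputPar k D M w x r).N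
        (fun i => BitVec.ofNat w (inputColours k D M w x r i)) tape)
      ((inputQueries k D M w x r).map fun ab => (BitVec.ofNat w ab.1, BitVec.ofNat w ab.2))
      ∂(tapeMeasure w) ≤ ((tp (par k D M n 0).N + (par k D M n 0).m * tq (par k D M n 0).N : ℝ≥0) :
        ℝ≥0∞) := by
  have := h (inputPar k D M w x r).N w hc (inputColours k D M w x r) (inputQueries k D M w x r) ?_
  · rw [length_inputQueries] at this
    exact this
  · intro ab hab
    obtain ⟨q, -, rfl⟩ := List.mem_map.1 hab
    exact ⟨Par.q1_mem_range _ _ q, Par.q2_mem_range _ _ _ q⟩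

/-- The inequality holds for each tape: without a halting session the right-hand side is infinite,
and otherwise the session extends to a run of the algorithm. -/
theorem cost_le (h : IsColorDistOracle α pre qry c tp tq)
    (hk : 1 ≤ k) (hkD : k ≤ D) (hV : vbound D M n ^ 30 ≤ 2 ^ w) (hα : α ≤ M)
    (hc : c * (Nat.log 2 (par k D M n 0).N + 1) ≤ w)
    (hb : ∀ i, -(2 : ℤ) ^ w ≤ 2 * x i ∧ 2 * x i < (2 : ℤ) ^ w) (a : BitVec w)
    (tape : ℕ → BitVec w) :
    cost (threeSumProg k D M pre qry)
        (initState n (fun i => BitVec.ofInt w (x i)) (consTape a tape))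
      ≤ (work (inputPar k D M w x a.toNat) ((inputPar k D M w x a.toNat).spurious
          (Good w (inputWord w x))).card : ℕ) +
        sessionCost pre qry (initState (inputPar k D M w x a.toNat).N
          (fun i => BitVec.ofNat w (inputColours k D M w x a.toNat i)) tape)
          ((inputQueries k D M w x a.toNat).map fun ab =>
            (BitVec.ofNat w ab.1, BitVec.ofNat w ab.2)) := by
  rw [← tsub_le_iff_left]
  refine le_iInf₂ fun t ht => ?_
  obtain ⟨ans, hs⟩ := ht
  obtain ⟨t', S', ex, -, ht'⟩ := exec_threeSumProg hk hkD hV hb hα hs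
    ((oracle_input h k D M x hc a.toNat).1 _ _ _ hs)
  rw [tsub_le_iff_left]
  refine (iInf₂_le t' ⟨S', ex⟩).trans ?_
  exact_mod_cast ht'

/-- The expected time of the reduction outside of the oracle. -/
noncomputable def reductionTime (k D M n : ℕ) : ℝ≥0 :=
  19 + 200 * (n + 1) + 2000 * (par k D M n 0).N + 2056 * (par k D M n 0).m +
    200 * ((par k D M n 0).B + 1) * (24 * n + 64 * n ^ 3 / 2 ^ digits k D n + (n + 1))

/-- The expected time of the reduction. -/
noncomputable def totalTime (k D M : ℕ) (tp tq : ℕ → ℝ≥0) (n : ℕ) : ℝ≥0 :=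
  reductionTime k D M n +
    (tp (par k D M n 0).N + (par k D M n 0).m * tq (par k D M n 0).N)

/-- The work is affine in the number of spurious pairs, with coefficients that do not depend on `r`;
so the average over `r` only requires the average of that number. -/
theorem sum_work_le (hk : 1 ≤ k) (hkD : k ≤ D) (hV : vbound D M n ^ 30 ≤ 2 ^ w)
    (hx : Function.Injective x) (hb : ∀ i, -(2 : ℤ) ^ w ≤ 2 * x i ∧ 2 * x i < (2 : ℤ) ^ w) :
    ∑ r ∈ Finset.range (2 ^ w), (work (inputPar k D M w x r) ((inputPar k D M w x r).spurious
      (Good w (inputWord w x))).card : ℝ≥0) ≤ 2 ^ w * reductionTime k D M n := by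
  have hd := digits_lt hk hkD hV
  have hs := Par.sum_card_spurious_le (w := w) (q := inputPar k D M w x) (H := digits k D n)
    (n := n) (A := inputWord w x)
    (fun r _ => hashes_inputPar hk hkD hV x r) (fun _ _ => rfl) (inputWord_lt w x) hd.le
    (inputWord_injOn (by omega) hx hb)
  set sp : ℕ → ℕ := fun r => ((inputPar k D M w x r).spurious (Good w (inputWord w x))).card
  have hs' : ∑ r ∈ Finset.range (2 ^ w), (sp r : ℝ≥0)
      ≤ 2 ^ w * (24 * n + 64 * n ^ 3 / 2 ^ digits k D n) := by
    calc ∑ r ∈ Finset.range (2 ^ w), (sp r : ℝ≥0)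
        = ((∑ r ∈ Finset.range (2 ^ w), sp r : ℕ) : ℝ≥0) := by push_cast; rfl
      _ ≤ ((2 ^ w * (24 * n) + 64 * n ^ 3 * 2 ^ (w - digits k D n) : ℕ) : ℝ≥0) := by
          exact_mod_cast hs
      _ = _ := by
          push_cast
          rw [pow_sub₀ _ two_ne_zero hd.le]
          ring
  have e : ∀ r, (work (inputPar k D M w x r) (sp r) : ℝ≥0) = 19 + 200 * (n + 1)
      + 2000 * (par k D M n 0).N + 2056 * (par k D M n 0).m
      + 200 * ((par k D M n 0).B + 1) * (n + 1) + 200 * ((par k D M n 0).B + 1) * sp r := by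
    intro r
    have : work (inputPar k D M w x r) (sp r) = 19 + 200 * (n + 1)
      + 2000 * (par k D M n 0).N + 2056 * (par k D M n 0).m
      + 200 * ((par k D M n 0).B + 1) * (sp r + (n + 1)) := rfl
    rw [this]
    push_cast
    ring
  calc _ = ∑ r ∈ Finset.range (2 ^ w), (work (inputPar k D M w x r) (sp r) : ℝ≥0) := rfl
    _ = 2 ^ w * (19 + 200 * (n + 1) + 2000 * (par k D M n 0).N + 2056 * (par k D M n 0).m
      + 200 * ((par k D M n 0).B + 1) * (n + 1))
      + 200 * ((par k D M n 0).B + 1) * ∑ r ∈ Finset.range (2 ^ w), (sp r : ℝ≥0) := by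
        simp_rw [e]
        rw [Finset.sum_add_distrib, Finset.sum_const, ← Finset.mul_sum, Finset.card_range]
        simp
        ring
    _ ≤ 2 ^ w * (19 + 200 * (n + 1) + 2000 * (par k D M n 0).N + 2056 * (par k D M n 0).m
      + 200 * ((par k D M n 0).B + 1) * (n + 1))
      + 200 * ((par k D M n 0).B + 1) * (2 ^ w * (24 * n + 64 * n ^ 3 / 2 ^ digits k D n)) := by
        gcongr
    _ = _ := by unfold reductionTime; ring

theorem lintegral_cost_le (h : IsColorDistOracle α pre qry c tp tq)
    (hk : 1 ≤ k) (hkD : k ≤ D) (hV : vbound D M n ^ 30 ≤ 2 ^ w) (hα : α ≤ M)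
    (hc : c * (Nat.log 2 (par k D M n 0).N + 1) ≤ w) (hx : Function.Injective x)
    (hb : ∀ i, -(2 : ℤ) ^ w ≤ 2 * x i ∧ 2 * x i < (2 : ℤ) ^ w) :
    ∫⁻ tape, cost (threeSumProg k D M pre qry)
        (initState n (fun i => BitVec.ofInt w (x i)) tape) ∂(tapeMeasure w)
      ≤ (totalTime k D M tp tq n : ℝ≥0∞) := by
  set K : ℝ≥0 := tp (par k D M n 0).N + (par k D M n 0).m * tq (par k D M n 0).N with hK
  set W : ℕ → ℕ := fun r => work (inputPar k D M w x r) ((inputPar k D M w x r).spurious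
      (Good w (inputWord w x))).card with hW
  rw [lintegral_tapeMeasure]
  have h1 : ∀ a : BitVec w, ∫⁻ tape, cost (threeSumProg k D M pre qry)
        (initState n (fun i => BitVec.ofInt w (x i)) (consTape a tape)) ∂(tapeMeasure w)
      ≤ ((W a.toNat + K : ℝ≥0) : ℝ≥0∞) := by
    intro a
    refine (lintegral_mono (cost_le h hk hkD hV hα hc hb a)).trans ?_
    -- For a fixed first word the reduction's own work is constant, so the integral splits without
    -- measurability of the cost of the session.
    rw [lintegral_add_left measurable_const, lintegral_const, measure_univ, mul_one]
    push_cast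
    exact add_le_add le_rfl ((oracle_input h k D M x hc a.toNat).2.trans_eq (by push_cast; rfl))
  have h2 : (2 ^ w : ℝ≥0∞)⁻¹ = (((2 ^ w : ℝ≥0)⁻¹ : ℝ≥0) : ℝ≥0∞) := by
    rw [ENNReal.coe_inv (by positivity)]; push_cast; rfl
  calc _ ≤ ∑ a : BitVec w, (2 ^ w : ℝ≥0∞)⁻¹ * ((W a.toNat + K : ℝ≥0) : ℝ≥0∞) :=
        Finset.sum_le_sum fun a _ => mul_le_mul_right (h1 a) _
    _ = ((∑ r ∈ Finset.range (2 ^ w), (2 ^ w : ℝ≥0)⁻¹ * (W r + K) : ℝ≥0) : ℝ≥0∞) := by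
        rw [h2, sum_bitVec w fun r => (((2 ^ w : ℝ≥0)⁻¹ : ℝ≥0) : ℝ≥0∞) * ((W r + K : ℝ≥0) : ℝ≥0∞)]
        push_cast
        rfl
    _ ≤ _ := by
        rw [ENNReal.coe_le_coe, ← Finset.mul_sum, Finset.sum_add_distrib, Finset.sum_const,
          Finset.card_range, nsmul_eq_mul, inv_mul_le_iff₀ (by positivity)]
        have := sum_work_le hk hkD hV hx hb
        rw [totalTime, ← hK, Nat.cast_pow, Nat.cast_ofNat, mul_add _ (reductionTime _ _ _ _)]
        exact add_le_add this le_rfl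

theorem consTape_tail (tape : ℕ → BitVec w) : consTape (tape 0) (fun i => tape (i + 1)) = tape := by
  funext i
  cases i <;> rfl

theorem vbound_le (D M n : ℕ) :
    vbound D M n ≤ 2 ^ ((16 * (D + 1) * (M + 1) + 1) * (Nat.log 2 n + 1)) := by
  set K := 16 * (D + 1) * (M + 1) with hK
  have h1 : n + 1 ≤ 2 ^ (Nat.log 2 n + 1) := Nat.lt_pow_succ_log_self (by norm_num) n
  have h2 : K ≤ 2 ^ (K * (Nat.log 2 n + 1)) :=
    (Nat.lt_two_pow_self).le.trans (Nat.pow_le_pow_right (by norm_num) (Nat.le_mul_of_pos_right _ (by omega)))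
  calc vbound D M n = (n + 1) * K := rfl
    _ ≤ 2 ^ (Nat.log 2 n + 1) * 2 ^ (K * (Nat.log 2 n + 1)) := Nat.mul_le_mul h1 h2
    _ = _ := by rw [← pow_add]; congr 1; ring

/-- `N` is polynomial in `n`, so a word length of a constant times `log n` also meets the demands of
the oracle. -/
theorem par_N_le (hk : 1 ≤ k) (hkD : k ≤ D) : (par k D M n 0).N ≤ vbound D M n ^ 6 := by
  obtain ⟨b1, b2, b3, b4⟩ := le_vbound D M n
  obtain ⟨p1, p2⟩ := par_lt (M := M) (n := n) hk hkD 0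
  have hb : (par k D M n 0).b ≤ vbound D M n := by
    have : n / (par k D M n 0).S ≤ n := Nat.div_le_self _ _
    have : (par k D M n 0).b = n / (par k D M n 0).S + 1 := rfl
    omega
  have hM : (par k D M n 0).M ≤ vbound D M n := b4.le
  set p := par k D M n 0
  set V := vbound D M n
  have hV : 16 ≤ V := by omega
  have hthr : p.thr ≤ 2 * V ^ 2 := by
    calc p.thr = (p.b + p.b) * p.M := rfl
      _ ≤ (V + V) * V := by gcongr
      _ = _ := by ring
  have hW : p.W ≤ 2 * V + 2 * V ^ 2 := by
    have : p.W = p.b + p.b + p.thr := rfl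
    omega
  have h2 : 4 * p.S2 * p.W ≤ 4 * V ^ 2 * (2 * V + 2 * V ^ 2) := by
    have : p.S2 ≤ V ^ 2 := by
      calc p.S2 = p.S * p.S := rfl
        _ ≤ V * V := by gcongr
        _ = _ := by ring
    gcongr
  have h3 : p.nA ≤ 2 * V ^ 2 := by
    calc p.nA = (p.R + p.R) * p.S := rfl
      _ ≤ (V + V) * V := by gcongr
      _ = _ := by ring
  have h4 : p.R * p.S ≤ V ^ 2 := by
    calc p.R * p.S ≤ V * V := by gcongr
      _ = _ := by ring
  have h5 : p.N ≤ 1 + 7 * V ^ 2 + 4 * V ^ 2 * (2 * V + 2 * V ^ 2) := by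
    have : p.N = 1 + p.nA + p.thr + p.R * p.S + p.thr + 4 * p.S2 * p.W := rfl
    omega
  refine h5.trans ?_
  have e1 : 1 ≤ V ^ 4 := Nat.one_le_pow _ _ (by omega)
  have e2 : V ^ 2 ≤ V ^ 4 := Nat.pow_le_pow_right (by omega) (by norm_num)
  have e3 : V ^ 3 ≤ V ^ 4 := Nat.pow_le_pow_right (by omega) (by norm_num)
  calc _ = 1 + 7 * V ^ 2 + 8 * V ^ 3 + 8 * V ^ 4 := by ring
    _ ≤ 24 * V ^ 4 := by omega
    _ ≤ (V * V) * V ^ 4 := Nat.mul_le_mul_right _ (by nlinarith)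
    _ = _ := by ring

/-- An oracle for distances of colours yields an algorithm for 3SUM. -/
theorem exists_solvesThreeSum (h : IsColorDistOracle α pre qry c tp tq) (hk : 1 ≤ k) (hkD : k ≤ D)
    (hα : α ≤ M) : ∃ c', SolvesThreeSum (threeSumProg k D M pre qry) c' (totalTime k D M tp tq) := by
  set E := 16 * (D + 1) * (M + 1) + 1 with hE
  refine ⟨30 * E + c * (7 * E), fun n w hw x hx hb => ?_⟩
  set L := Nat.log 2 n + 1 with hL
  have hv : vbound D M n ≤ 2 ^ (E * L) := vbound_le D M n
  have hEL : 1 ≤ E * L := Nat.mul_pos (by omega) (by omega)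
  have h1 : vbound D M n ^ 30 ≤ 2 ^ w := by
    calc vbound D M n ^ 30 ≤ (2 ^ (E * L)) ^ 30 := Nat.pow_le_pow_left hv 30
      _ = 2 ^ (30 * E * L) := by rw [← pow_mul]; congr 1; ring
      _ ≤ 2 ^ w := Nat.pow_le_pow_right (by norm_num) (by rw [Nat.add_mul] at hw; omega)
  have h2 : c * (Nat.log 2 (par k D M n 0).N + 1) ≤ w := by
    have h3 : Nat.log 2 (par k D M n 0).N ≤ 6 * (E * L) := by
      calc _ ≤ Nat.log 2 ((2 ^ (E * L)) ^ 6) :=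
            Nat.log_mono_right ((par_N_le hk hkD).trans (Nat.pow_le_pow_left hv 6))
        _ = _ := by rw [← pow_mul, Nat.log_pow (by norm_num)]; ring
    calc _ ≤ c * (7 * (E * L)) := Nat.mul_le_mul_left _ (by omega)
      _ = c * (7 * E) * L := by ring
      _ ≤ w := by rw [Nat.add_mul] at hw; omega
  refine ⟨fun tape t s' ex => ?_, lintegral_cost_le h hk hkD h1 hα h2 hx hb⟩
  rw [← consTape_tail tape] at ex
  -- A halting run contains a session of the oracle, whose answers are right. From this session a
  -- run with the right output is constructed, and it is the given one by determinism.
  obtain ⟨ans, t₁, hs⟩ := exists_session hk hkD h1 ex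
  obtain ⟨t₂, S, ex', hout, -⟩ := exec_threeSumProg hk hkD h1 hb hα hs
    ((oracle_input h k D M x h2 _).1 _ _ _ hs)
  rw [(ex.det ex').2]
  exact hout

end Imp

namespace Imp

/-! ### Asymptotics of the parameters -/

/-- Rounding the exponent down to an integer costs a factor of at most 2. -/
theorem rpow_le_two_pow_div {a D : ℕ} (hD : 0 < D) (L : ℕ) :
    ((2 : ℝ) ^ L) ^ ((a : ℝ) / D) ≤ 2 * 2 ^ (a * L / D) ∧
      (2 : ℝ) ^ (a * L / D) ≤ ((2 : ℝ) ^ L) ^ ((a : ℝ) / D) := by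
  have hD' : (0 : ℝ) < D := by exact_mod_cast hD
  have e : ((2 : ℝ) ^ L) ^ ((a : ℝ) / D) = 2 ^ ((a * L : ℝ) / D) := by
    rw [← Real.rpow_natCast, ← Real.rpow_mul (by norm_num)]
    congr 1
    ring
  rw [e]
  constructor
  · rw [← pow_succ', ← Real.rpow_natCast]
    apply Real.rpow_le_rpow_of_exponent_le (by norm_num)
    rw [div_le_iff₀ hD']
    have := Nat.lt_div_mul_add (a := a * L) hD
    have : a * L ≤ (a * L / D + 1) * D := by rw [Nat.add_mul]; omega
    exact_mod_cast this
  · rw [← Real.rpow_natCast]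
    apply Real.rpow_le_rpow_of_exponent_le (by norm_num)
    rw [le_div_iff₀ hD']
    exact_mod_cast Nat.div_mul_le_self (a * L) D

/-- The largest power of two below `n`. -/
noncomputable def scale (n : ℕ) : ℝ := 2 ^ Nat.log 2 n

theorem one_le_scale (n : ℕ) : 1 ≤ scale n := one_le_pow₀ (by norm_num)

theorem scale_le {n : ℕ} (hn : 1 ≤ n) : scale n ≤ n := by
  have := Nat.pow_log_le_self 2 (x := n) (by omega)
  unfold scale
  exact_mod_cast this

theorem le_two_mul_scale (n : ℕ) : (n : ℝ) ≤ 2 * scale n := by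
  have := (Nat.lt_pow_succ_log_self (b := 2) (by norm_num) n).le
  unfold scale
  rw [← pow_succ']
  exact_mod_cast this

theorem scale_rpow_le {n : ℕ} {e f : ℝ} (h : e ≤ f) : scale n ^ e ≤ scale n ^ f :=
  Real.rpow_le_rpow_of_exponent_le (one_le_scale n) h

section

variable {k D M n : ℕ} {g : ℝ}

theorem par_bounds (hk : 1 ≤ k) (hkD : k ≤ D) (hg : g = k / D) :
    4 * scale n ^ g ≤ (par k D M n 0).R ∧ ((par k D M n 0).R : ℝ) ≤ 8 * scale n ^ g ∧
    scale n ^ (1 - g + 1 / D) ≤ (par k D M n 0).S ∧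
    ((par k D M n 0).S : ℝ) ≤ 2 * scale n ^ (1 - g + 1 / D) ∧
    scale n ^ (2 - g + 2 / D) ≤ 2 * 2 ^ digits k D n := by
  have hD : 0 < D := by omega
  have hD' : (0 : ℝ) < D := by exact_mod_cast hD
  have hs : 1 - g + 1 / D = ((D - k + 1 : ℕ) : ℝ) / D := by
    rw [hg]; push_cast [Nat.cast_sub hkD]; field_simp
  obtain ⟨r1, r2⟩ := rpow_le_two_pow_div (a := k) hD (Nat.log 2 n)
  obtain ⟨s1, s2⟩ := rpow_le_two_pow_div (a := D - k + 1) hD (Nat.log 2 n)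
  rw [← hg] at r1 r2
  rw [← hs] at s1 s2
  have eR : ((par k D M n 0).R : ℝ) = 8 * 2 ^ (k * Nat.log 2 n / D) := by
    simp only [par, rho]; push_cast; ring
  have eS : ((par k D M n 0).S : ℝ) = 2 * 2 ^ ((D - k + 1) * Nat.log 2 n / D) := by
    simp only [par, sig]; push_cast; ring
  have eH : (2 : ℝ) ^ digits k D n = 2 ^ (k * Nat.log 2 n / D) *
      ((2 * 2 ^ ((D - k + 1) * Nat.log 2 n / D)) * (2 * 2 ^ ((D - k + 1) * Nat.log 2 n / D))) := by
    simp only [digits, rho, sig]; ring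
  rw [eR, eS, eH]
  change scale n ^ g ≤ _ at r1
  change _ ≤ scale n ^ g at r2
  change scale n ^ (1 - g + 1 / D) ≤ _ at s1
  change _ ≤ scale n ^ (1 - g + 1 / D) at s2
  refine ⟨by linarith, by linarith, s1, by linarith, ?_⟩
  have h0 := one_le_scale n
  have e : scale n ^ (2 - g + 2 / D) = scale n ^ g * (scale n ^ (1 - g + 1 / D) *
      scale n ^ (1 - g + 1 / D)) := by
    rw [← Real.rpow_add (by linarith), ← Real.rpow_add (by linarith)]
    congr 1; ring
  rw [e, ← mul_assoc 2]
  gcongr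

/-- The size is dominated by the blocks, that is, by `S ^ 2 * b` up to a factor depending on `M`.
This lies between `n * S` and `n * S + S ^ 2`, and `S` is at most `2 * scale n` because `1 / D ≤ g`.
-/
theorem par_N_bounds (hk : 1 ≤ k) (hkD : k ≤ D) (hg : g = k / D) (hn : 1 ≤ n) :
    scale n ^ (2 - g + 1 / D) ≤ (par k D M n 0).N ∧
    ((par k D M n 0).N : ℝ) ≤ 200 * (M + 1) * scale n ^ (2 - g + 1 / D) := by
  obtain ⟨-, r2, s1, s2, -⟩ := par_bounds (M := M) (n := n) hk hkD hg
  have h0 := one_le_scale n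
  have hpos : 0 < scale n := by linarith
  have hD' : (0 : ℝ) < D := by exact_mod_cast (by omega : 0 < D)
  have hk' : (1 : ℝ) ≤ k := by exact_mod_cast hk
  have hkD' : (k : ℝ) ≤ D := by exact_mod_cast hkD
  have hg1 : g ≤ 1 := by rw [hg]; exact (div_le_one hD').2 hkD'
  have hgD : 1 / (D : ℝ) ≤ g := by rw [hg]; gcongr
  have hn1 := scale_le hn
  have hn2 := le_two_mul_scale n
  set s := 1 - g + 1 / (D : ℝ) with hs
  have es : scale n ^ (2 - g + 1 / (D : ℝ)) = scale n * scale n ^ s := by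
    rw [← Real.rpow_one_add' hpos.le (by rw [hs]; have : 0 < 1 / (D : ℝ) := by positivity
                                         linarith)]
    congr 1; rw [hs]; ring
  have hs1 : scale n ^ s ≤ scale n := by
    conv_rhs => rw [← Real.rpow_one (scale n)]
    exact scale_rpow_le (by linarith)
  have hs0 : 1 ≤ scale n ^ s := Real.one_le_rpow h0 (by
    have : 0 < 1 / (D : ℝ) := by positivity
    linarith)
  have hgs : scale n ^ g ≤ scale n := by
    conv_rhs => rw [← Real.rpow_one (scale n)]
    exact scale_rpow_le hg1
  have hg0 : 0 ≤ scale n ^ g := by positivity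
  rw [es]
  have hSpos : 0 < (par k D M n 0).S := (par_pos _ _ _ _ _).2
  have eN : ((par k D M n 0).N : ℝ) = 1 + 3 * ((par k D M n 0).R * (par k D M n 0).S)
      + 4 * (par k D M n 0).b * M
      + 8 * ((par k D M n 0).S * (par k D M n 0).S * (par k D M n 0).b) * (1 + M) := by
    have : (par k D M n 0).M = M := rfl
    simp only [Par.N, Par.base, Par.nA, Par.R2, Par.thr, Par.S2, Par.W, this]
    push_cast
    ring
  have hb1 : ((par k D M n 0).b : ℝ) ≤ n / (par k D M n 0).S + 1 := by
    have : (par k D M n 0).b = n / (par k D M n 0).S + 1 := rfl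
    rw [this, Nat.cast_add, Nat.cast_one]
    gcongr
    exact Nat.cast_div_le
  have hb2 : (n : ℝ) ≤ (par k D M n 0).S * (par k D M n 0).b := by
    have : n < (par k D M n 0).S * (n / (par k D M n 0).S + 1) := Nat.lt_mul_div_succ n hSpos
    exact_mod_cast this.le
  have hb0 : (1 : ℝ) ≤ (par k D M n 0).b := by exact_mod_cast Nat.succ_pos _
  have hS1 : (1 : ℝ) ≤ (par k D M n 0).S := by exact_mod_cast hSpos
  rw [eN]
  set S : ℝ := ((par k D M n 0).S : ℝ)
  set R : ℝ := ((par k D M n 0).R : ℝ)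
  set b : ℝ := ((par k D M n 0).b : ℝ)
  have hR0 : 0 ≤ R := Nat.cast_nonneg _
  have hM0 : (0 : ℝ) ≤ M := Nat.cast_nonneg _
  set l := scale n
  set u := l ^ s
  constructor
  · have h1 : l * u ≤ S * S * b := by
      calc l * u ≤ n * S := by gcongr
        _ ≤ (S * b) * S := by gcongr
        _ = _ := by ring
    have h2 : 0 ≤ S * S * b * M := by positivity
    have h3 : 0 ≤ b * M := by positivity
    have h4 : 0 ≤ R * S := by positivity
    nlinarith
  · have h1 : R * S ≤ 16 * (l * u) := by
      calc R * S ≤ (8 * l ^ g) * (2 * u) := by gcongr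
        _ ≤ (8 * l) * (2 * u) := by gcongr
        _ = _ := by ring
    have h2 : S * S * b ≤ 8 * (l * u) := by
      calc S * S * b ≤ S * S * (n / S + 1) := by gcongr
        _ = S * n + S * S := by field_simp
        _ ≤ (2 * u) * (2 * l) + (2 * u) * (2 * u) := by gcongr
        _ ≤ (2 * u) * (2 * l) + (2 * u) * (2 * l) := by gcongr
        _ = _ := by ring
    have h3 : b ≤ S * S * b := by
      have : 1 ≤ S * S := by nlinarith
      nlinarith
    have h4 : 1 ≤ l * u := by nlinarith
    have h5 : b * M ≤ 8 * (l * u) * M := by gcongr; linarith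
    have h6 : S * S * b * M ≤ 8 * (l * u) * M := by gcongr
    nlinarith

theorem par_m_le (hk : 1 ≤ k) (hkD : k ≤ D) (hg : g = k / D) :
    ((par k D M n 0).m : ℝ) ≤ 256 * scale n ^ (1 + g) := by
  obtain ⟨-, r2, -⟩ := par_bounds (M := M) (n := n) hk hkD hg
  have h0 := one_le_scale n
  have hn2 := le_two_mul_scale n
  have e : ((par k D M n 0).m : ℝ) = 16 * n * (par k D M n 0).R := by
    have : (par k D M n 0).m = 16 * n * (par k D M n 0).R := rfl
    rw [this]; push_cast; ring
  rw [e, Real.rpow_add (by linarith), Real.rpow_one]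
  calc 16 * (n : ℝ) * (par k D M n 0).R ≤ 16 * (2 * scale n) * (8 * scale n ^ g) := by gcongr
    _ = _ := by ring

/-- The hypotheses on `δ` come from the size `n ^ (2 - g + 1 / D)`, the number `n ^ (1 + g)` of
queries, and the verification of spurious pairs: `B` times `n ^ 3 / 2 ^ H` is about `n ^ (1 - g)`
times `n ^ (1 + g - 2 / D)`. The term `B * n` imposes nothing new. -/
theorem reductionTime_le (hk : 1 ≤ k) (hkD : k ≤ D) (hg : g = k / D) (hn : 1 ≤ n) {δ : ℝ}
    (h1 : δ ≤ g - 1 / D) (h2 : δ ≤ 1 - g) (h3 : δ ≤ 2 / D) :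
    (reductionTime k D M n : ℝ) ≤ 10000000 * (M + 1) * scale n ^ (2 - δ) := by
  obtain ⟨r1, -, -, -, hH⟩ := par_bounds (M := M) (n := n) hk hkD hg
  obtain ⟨-, hN⟩ := par_N_bounds (M := M) hk hkD hg hn
  have hm := par_m_le (M := M) (n := n) hk hkD hg
  have h0 := one_le_scale n
  have hpos : 0 < scale n := by linarith
  have hD' : (0 : ℝ) < D := by exact_mod_cast (by omega : 0 < D)
  have hD0 : 0 < 1 / (D : ℝ) := by positivity
  have hkD' : (k : ℝ) ≤ D := by exact_mod_cast hkD
  have hg1 : g ≤ 1 := by rw [hg]; exact (div_le_one hD').2 hkD'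
  have hg0 : 0 ≤ g := by rw [hg]; positivity
  have hn2 := le_two_mul_scale n
  have hB : ((par k D M n 0).B : ℝ) + 1 ≤ 3 * scale n ^ (1 - g) := by
    have e : (par k D M n 0).B = n / (par k D M n 0).R + 1 := rfl
    have hd : ((n / (par k D M n 0).R : ℕ) : ℝ) ≤ n / (par k D M n 0).R := Nat.cast_div_le
    have hd2 : (n : ℝ) / (par k D M n 0).R ≤ scale n ^ (1 - g) := by
      have hp : 0 < scale n ^ g := by positivity
      rw [div_le_iff₀ (by linarith)]
      have : scale n ^ (1 - g) * scale n ^ g = scale n := by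
        rw [← Real.rpow_add hpos]; simp
      have h4 : scale n ^ (1 - g) * (4 * scale n ^ g) ≤ scale n ^ (1 - g) * (par k D M n 0).R := by
        gcongr
      nlinarith
    have hp : 1 ≤ scale n ^ (1 - g) := Real.one_le_rpow h0 (by linarith)
    rw [e]; push_cast
    linarith
  have hq : (n : ℝ) ^ 3 / 2 ^ digits k D n ≤ 16 * scale n ^ (1 + g - 2 / D) := by
    rw [div_le_iff₀ (by positivity)]
    have e : scale n ^ (1 + g - 2 / D) * scale n ^ (2 - g + 2 / D) = scale n ^ 3 := by
      rw [← Real.rpow_add hpos, ← Real.rpow_natCast]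
      congr 1; push_cast; ring
    calc (n : ℝ) ^ 3 ≤ (2 * scale n) ^ 3 := by gcongr
      _ = 8 * (scale n ^ (1 + g - 2 / D) * scale n ^ (2 - g + 2 / D)) := by rw [e]; ring
      _ ≤ 8 * (scale n ^ (1 + g - 2 / D) * (2 * 2 ^ digits k D n)) := by gcongr
      _ = _ := by ring
  have hn1 : (1 : ℝ) ≤ n := by exact_mod_cast hn
  have hM0 : (0 : ℝ) ≤ M := Nat.cast_nonneg _
  set l := scale n with hl
  set u := l ^ (2 - δ) with hu
  have e1 : l ≤ u := by
    calc l = l ^ (1 : ℝ) := (Real.rpow_one l).symm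
      _ ≤ u := scale_rpow_le (by linarith)
  have e2 : l ^ (2 - g + 1 / (D : ℝ)) ≤ u := scale_rpow_le (by linarith)
  have e3 : l ^ (1 + g) ≤ u := scale_rpow_le (by linarith)
  have e4 : l ^ (1 - g) * l ≤ u := by
    calc l ^ (1 - g) * l = l ^ (1 - g) * l ^ (1 : ℝ) := by rw [Real.rpow_one]
      _ = l ^ (1 - g + 1) := (Real.rpow_add hpos _ _).symm
      _ ≤ u := scale_rpow_le (by linarith)
  have e5 : l ^ (1 - g) * l ^ (1 + g - 2 / (D : ℝ)) ≤ u := by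
    rw [← Real.rpow_add hpos]
    exact scale_rpow_le (by linarith)
  have hu0 : 0 ≤ u := by linarith
  have hv : (200 : ℝ) * ((par k D M n 0).B + 1) *
      (24 * n + 64 * n ^ 3 / 2 ^ digits k D n + (n + 1)) ≤ 1000000 * u := by
    calc _ ≤ 200 * (3 * l ^ (1 - g)) * (24 * (2 * l) + 64 * (16 * l ^ (1 + g - 2 / (D : ℝ)))
            + (2 * l + l)) := by
          rw [mul_div_assoc]
          gcongr
      _ = 30600 * (l ^ (1 - g) * l) + 614400 * (l ^ (1 - g) * l ^ (1 + g - 2 / (D : ℝ))) := by ring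
      _ ≤ _ := by linarith
  have hN' : ((par k D M n 0).N : ℝ) ≤ 200 * (M + 1) * u := hN.trans (by gcongr)
  have hMu : 0 ≤ M * u := by positivity
  unfold reductionTime
  push_cast
  nlinarith

end

end Imp
-- The choice of the exponents
open MeasureTheory Filter Asymptotics
open scoped NNReal ENNReal

namespace Imp

/-- The asymptotic behaviour of the reduction: sizes `N n` and numbers `m n` of queries, for given
`γ` and `ε`, in terms of a `scale` between `n / 2` and `n`. -/
theorem exists_reduction {γ ε : ℝ} (hγ0 : 0 < γ) (hγ1 : γ < 1) (hε : 0 < ε) (hε1 : ε ≤ 1) (M : ℕ) :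
    ∃ k D : ℕ, 1 ≤ k ∧ k ≤ D ∧ ∃ δ ν C : ℝ, 0 < δ ∧ δ ≤ 1 ∧ 1 ≤ C ∧ 2 - γ ≤ ν ∧
      ν * (2 / (2 - γ) - ε) ≤ 2 - ε / 2 ∧ ∀ n : ℕ, 1 ≤ n →
        scale n ^ ν ≤ (par k D M n 0).N ∧ ((par k D M n 0).N : ℝ) ≤ C * scale n ^ ν ∧
        ((par k D M n 0).m : ℝ) ≤ C * scale n ^ (1 + γ) ∧
        (reductionTime k D M n : ℝ) ≤ C * scale n ^ (2 - δ) := by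
  -- The exponent `γ` is approximated by `k / D` from below. The first bound gives `1 / D ≤ ε / 8`;
  -- the second gives `k > 2`, so that `1 / D < k / D` and `δ` is positive.
  obtain ⟨D, hD⟩ := exists_nat_ge (max (8 / ε) (3 / γ))
  have hD1 : 8 ≤ D * ε := by
    rw [← div_le_iff₀ hε]; exact (le_max_left _ _).trans hD
  have hD2 : 3 ≤ D * γ := by
    rw [← div_le_iff₀ hγ0]; exact (le_max_right _ _).trans hD
  have hD0 : (0 : ℝ) < D := by
    by_contra h
    have : (D : ℝ) = 0 := le_antisymm (not_lt.1 h) (Nat.cast_nonneg _)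
    rw [this] at hD1
    linarith
  have hk1 := Nat.floor_le (a := D * γ) (by positivity)
  have hk2 := Nat.lt_floor_add_one (D * γ)
  set k := ⌊D * γ⌋₊
  have hk3 : (2 : ℝ) < k := by linarith
  have hkD : (k : ℝ) < D := by nlinarith
  have hk3' : 2 < k := by exact_mod_cast hk3
  have hkD' : k < D := by exact_mod_cast hkD
  set g : ℝ := k / D with hg
  have g1 : g ≤ γ := by rw [hg, div_le_iff₀ hD0]; linarith
  have g2 : γ ≤ g + 1 / D := by
    rw [hg, ← add_div, le_div_iff₀ hD0]; linarith
  have g3 : 1 / (D : ℝ) < g := by rw [hg]; gcongr; linarith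
  have d1 : 1 / (D : ℝ) ≤ ε / 8 := by rw [div_le_div_iff₀ hD0 (by norm_num)]; linarith
  have d0 : 0 < 1 / (D : ℝ) := by positivity
  have d2 : 2 / (D : ℝ) = 2 * (1 / D) := by ring
  set δ := min (g - 1 / D) (min (1 - g) (2 / D)) with hδ
  have hδ1 : δ ≤ 1 - g := (min_le_right _ _).trans (min_le_left _ _)
  refine ⟨k, D, by omega, hkD'.le, δ, 2 - g + 1 / D, 10000000 * (M + 1), ?_, by linarith, ?_,
    by linarith, ?_, fun n hn => ?_⟩
  · exact lt_min (by linarith) (lt_min (by linarith) (by linarith))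
  · have : (0 : ℝ) ≤ M := Nat.cast_nonneg _
    linarith
  · have hq : 2 / (2 - γ) ≤ 2 := by rw [div_le_iff₀ (by linarith)]; linarith
    have hq1 : 1 ≤ 2 / (2 - γ) := by rw [le_div_iff₀ (by linarith)]; linarith
    -- The exponent `ν` exceeds `2 - γ` by at most `2 / D`. This adds at most `ε / 2` to the
    -- product, whereas the `ε` in the second factor lowers it by `ε * (2 - γ) ≥ ε`.
    calc (2 - g + 1 / D) * (2 / (2 - γ) - ε) ≤ (2 - γ + 2 * (1 / D)) * (2 / (2 - γ) - ε) := by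
          apply mul_le_mul_of_nonneg_right <;> linarith
      _ = 2 - ε * (2 - γ) + 2 * (1 / D) * (2 / (2 - γ) - ε) := by
          have : 2 - γ ≠ 0 := by linarith
          field_simp
      _ ≤ 2 - ε * 1 + 2 * (ε / 8) * 2 := by
          have a1 : ε * 1 ≤ ε * (2 - γ) := by gcongr; linarith
          have a2 : 2 * (1 / (D : ℝ)) * (2 / (2 - γ) - ε) ≤ 2 * (ε / 8) * 2 := by
            gcongr <;> linarith
          linarith
      _ = _ := by ring
  · obtain ⟨n1, n2⟩ := par_N_bounds (M := M) (by omega) hkD'.le hg hn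
    have hM0 : (0 : ℝ) ≤ M := Nat.cast_nonneg _
    have h0 := one_le_scale n
    refine ⟨n1, n2.trans ?_, (par_m_le (by omega) hkD'.le hg).trans ?_,
      reductionTime_le (by omega) hkD'.le hg hn (min_le_left _ _) hδ1
        ((min_le_right _ _).trans (min_le_right _ _))⟩
    · gcongr
      norm_num
    · have : scale n ^ (1 + g) ≤ scale n ^ (1 + γ) := scale_rpow_le (by linarith)
      have h1 : 0 ≤ scale n ^ (1 + γ) := by positivity
      nlinarith [mul_nonneg hM0 h1]

theorem coe_totalTime (k D M : ℕ) (tp tq : ℕ → ℝ≥0) (n : ℕ) :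
    (totalTime k D M tp tq n : ℝ) = reductionTime k D M n +
      (tp (par k D M n 0).N + (par k D M n 0).m * tq (par k D M n 0).N) := by
  unfold totalTime
  push_cast
  rfl

end Imp

/-! ### The two conditional lower bounds -/

open Imp

section

variable {α : ℝ} {pre qry : WordRAM.Prog} {c : ℕ} {tp tq : ℕ → ℝ≥0} {γ ε : ℝ}

/-- The supposed bound, at the size of the constructed array, makes the oracle part `O(n ^ (2 - ε /
2))`, and the rest is `O(n ^ (2 - δ))`. The smaller saving contradicts the conjecture. -/
theorem not_isBigO_of_threeSumConjecture (horacle : IsColorDistOracle α pre qry c tp tq)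
    (hγ0 : 0 < γ) (hγ1 : γ < 1) (hε : 0 < ε) (hε1 : ε ≤ 1) (conj : ThreeSumConjecture) :
    ¬ (fun N : ℕ => (tp N : ℝ) + (N : ℝ) ^ ((1 + γ) / (2 - γ)) * (tq N : ℝ))
        =O[atTop] (fun N : ℕ => (N : ℝ) ^ (2 / (2 - γ) - ε)) := by
  intro hO
  obtain ⟨M, hM⟩ := exists_nat_ge α
  obtain ⟨k, D, hk, hkD, δ, ν, C, hδ, hδ1, hC, hν, hντ, hn⟩ := exists_reduction hγ0 hγ1 hε hε1 M
  obtain ⟨c', hs⟩ := exists_solvesThreeSum horacle hk hkD hM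
  set η := min δ (ε / 2) with hη
  refine conj _ _ _ hs η (lt_min hδ (by linarith)) ?_
  obtain ⟨A, hA, hO⟩ := hO.exists_pos
  rw [IsBigOWith, eventually_atTop] at hO
  obtain ⟨N₀, hO⟩ := hO
  set τ := 2 / (2 - γ) - ε with hτ
  have hτ0 : 0 ≤ τ := by
    have : 1 ≤ 2 / (2 - γ) := by rw [le_div_iff₀ (by linarith)]; linarith
    linarith
  refine IsBigO.of_bound (C + C * (A * C ^ τ)) ?_
  filter_upwards [eventually_ge_atTop (max 1 (2 * N₀))] with n hn'
  have hn1 : 1 ≤ n := (le_max_left _ _).trans hn'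
  obtain ⟨h1, h2, h3, h4⟩ := hn n hn1
  have l1 := one_le_scale n
  have hpos : 0 < scale n := by linarith
  have ln := scale_le hn1
  have hN : N₀ ≤ (par k D M n 0).N := by
    have a1 : (N₀ : ℝ) ≤ scale n := by
      have := le_two_mul_scale n
      have : (2 * N₀ : ℝ) ≤ n := by exact_mod_cast (le_max_right _ _).trans hn'
      linarith
    have a2 : scale n ≤ scale n ^ ν := by
      conv_lhs => rw [← Real.rpow_one (scale n)]
      exact scale_rpow_le (by linarith)
    exact_mod_cast a1.trans (a2.trans h1)
  have hO' := hO _ hN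
  rw [coe_totalTime]
  set N := (par k D M n 0).N
  have hNτ : (N : ℝ) ^ τ ≤ C ^ τ * scale n ^ (2 - η) := by
    calc (N : ℝ) ^ τ ≤ (C * scale n ^ ν) ^ τ := Real.rpow_le_rpow (Nat.cast_nonneg _) h2 hτ0
      _ = C ^ τ * scale n ^ (ν * τ) := by
        rw [Real.mul_rpow (by linarith) (by positivity), ← Real.rpow_mul hpos.le]
      _ ≤ C ^ τ * scale n ^ (2 - η) := by
        gcongr
        · have := min_le_right δ (ε / 2)
          linarith
  -- As `N ≥ scale n ^ ν` and `ν ≥ 2 - γ`, raising to the power `(1 + γ) / (2 - γ)` gives at least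
  -- `scale n ^ (1 + γ)`.
  have hNκ : ((par k D M n 0).m : ℝ) ≤ C * (N : ℝ) ^ ((1 + γ) / (2 - γ)) := by
    refine h3.trans ?_
    gcongr
    calc scale n ^ (1 + γ) ≤ scale n ^ (ν * ((1 + γ) / (2 - γ))) := by
          apply scale_rpow_le
          rw [mul_div_assoc', le_div_iff₀ (by linarith), mul_comm]
          gcongr
      _ = (scale n ^ ν) ^ ((1 + γ) / (2 - γ)) := Real.rpow_mul hpos.le _ _
      _ ≤ _ := by
        apply Real.rpow_le_rpow (by positivity) h1
        apply div_nonneg <;> linarith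
  have htp : (0 : ℝ) ≤ tp N := NNReal.coe_nonneg _
  have htq : (0 : ℝ) ≤ tq N := NNReal.coe_nonneg _
  have hNκ0 : 0 ≤ (N : ℝ) ^ ((1 + γ) / (2 - γ)) := by positivity
  rw [Real.norm_of_nonneg (by positivity), Real.norm_of_nonneg (by positivity)] at hO'
  have hl : scale n ^ (2 - η) ≤ (n : ℝ) ^ (2 - η) := by
    apply Real.rpow_le_rpow hpos.le ln
    have := min_le_left δ (ε / 2)
    linarith
  have hmain : (tp N + (par k D M n 0).m * tq N : ℝ) ≤ C * (A * C ^ τ) * scale n ^ (2 - η) := by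
    calc (tp N + (par k D M n 0).m * tq N : ℝ)
        ≤ C * tp N + C * (N : ℝ) ^ ((1 + γ) / (2 - γ)) * tq N := by
          gcongr
          nlinarith
      _ = C * (tp N + (N : ℝ) ^ ((1 + γ) / (2 - γ)) * tq N) := by ring
      _ ≤ C * (A * (C ^ τ * scale n ^ (2 - η))) := by
          gcongr
          exact hO'.trans (by gcongr)
      _ = _ := by ring
  have hred : (reductionTime k D M n : ℝ) ≤ C * scale n ^ (2 - η) := by
    refine h4.trans ?_
    gcongr
    exact min_le_left _ _
  rw [Real.norm_of_nonneg (by positivity), Real.norm_of_nonneg (by positivity)]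
  calc _ ≤ (C + C * (A * C ^ τ)) * scale n ^ (2 - η) := by rw [add_mul]; exact add_le_add hred hmain
    _ ≤ _ := by gcongr

/-- The reduction bounds the oracle only at the sizes of the arrays it builds. For arbitrary `N`,
take `n` to be the integer part of `(N / C) ^ (1 / ν)`; its array has size at most `N`, and
monotonicity carries the bound over. As `η < δ` strictly, the reduction's own time is eventually at
most half of what the conjecture demands, so the oracle accounts for the other half. -/
theorem isBigO_of_strongThreeSumConjecture (horacle : IsColorDistOracle α pre qry c tp tq)
    (hγ0 : 0 < γ) (hγ1 : γ < 1) (hε : 0 < ε) (hε1 : ε ≤ 1) (conj : StrongThreeSumConjecture)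
    (htp : Monotone tp) (htq : Monotone tq) :
    (fun N : ℕ => (N : ℝ) ^ (2 / (2 - γ) - ε))
      =O[atTop] (fun N : ℕ => (tp N : ℝ) + (N : ℝ) ^ ((1 + γ) / (2 - γ)) * (tq N : ℝ)) := by
  obtain ⟨M, hM⟩ := exists_nat_ge α
  obtain ⟨k, D, hk, hkD, δ, ν, C, hδ, hδ1, hC, hν, hντ, hn⟩ := exists_reduction hγ0 hγ1 hε hε1 M
  obtain ⟨c', hs⟩ := exists_solvesThreeSum horacle hk hkD hM
  set η := min (δ / 2) (ε / 2) with hη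
  have hη0 : 0 < η := lt_min (by linarith) (by linarith)
  have hηδ : η < δ := (min_le_left _ _).trans_lt (by linarith)
  obtain ⟨A, hA, hO⟩ := (conj _ _ _ hs η hη0).exists_pos
  rw [IsBigOWith] at hO
  set τ := 2 / (2 - γ) - ε with hτ
  have hν0 : 0 < ν := by linarith
  set κ := (1 + γ) / (2 - γ) with hκ
  -- the reduction itself is too fast
  have hrest : ∀ᶠ n : ℕ in atTop, (n : ℝ) ^ (2 - η) ≤
      2 * A * (tp (par k D M n 0).N + (par k D M n 0).m * tq (par k D M n 0).N) := by
    have hlarge : ∀ᶠ n : ℕ in atTop, 2 * A * C ≤ (n : ℝ) ^ (δ - η) :=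
      ((tendsto_rpow_atTop (by linarith)).comp tendsto_natCast_atTop_atTop).eventually_ge_atTop _
    filter_upwards [hO, hlarge, eventually_ge_atTop 1] with n h1 h2 h3
    obtain ⟨-, -, -, h4⟩ := hn n h3
    have hn1 : (0 : ℝ) < n := by exact_mod_cast h3
    rw [Real.norm_of_nonneg (by positivity), Real.norm_of_nonneg (by positivity),
      coe_totalTime] at h1
    have h5 : scale n ^ (2 - δ) ≤ (n : ℝ) ^ (2 - δ) :=
      Real.rpow_le_rpow (by linarith [one_le_scale n]) (scale_le h3) (by linarith)
    have h6 : (n : ℝ) ^ (2 - η) = (n : ℝ) ^ (δ - η) * (n : ℝ) ^ (2 - δ) := by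
      rw [← Real.rpow_add hn1]; congr 1; ring
    have h7 : 2 * (A * (C * (n : ℝ) ^ (2 - δ))) ≤ (n : ℝ) ^ (2 - η) := by
      rw [h6]
      calc _ = 2 * A * C * (n : ℝ) ^ (2 - δ) := by ring
        _ ≤ _ := by gcongr
    have h8 : A * (reductionTime k D M n : ℝ) ≤ A * (C * (n : ℝ) ^ (2 - δ)) := by
      gcongr
      exact h4.trans (by gcongr)
    nlinarith
  -- the size of 3SUM instances that fit into a given array
  set y : ℕ → ℝ := fun N => ((N : ℝ) / C) ^ ν⁻¹ with hy
  have hytop : Tendsto y atTop atTop :=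
    (tendsto_rpow_atTop (inv_pos.2 hν0)).comp
      (tendsto_natCast_atTop_atTop.atTop_div_const (by linarith))
  have hfloor : Tendsto (fun N => ⌊y N⌋₊) atTop atTop := tendsto_nat_floor_atTop.comp hytop
  refine IsBigO.of_bound (C ^ τ * 4 * (2 * A) * C) ?_
  filter_upwards [hfloor.eventually hrest, hfloor.eventually_ge_atTop 1, eventually_ge_atTop 1]
    with N h1 hn1 hN1
  set n := ⌊y N⌋₊
  obtain ⟨-, h2, h3, -⟩ := hn n hn1
  have hN1' : (1 : ℝ) ≤ N := by exact_mod_cast hN1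
  have hy0 : 0 ≤ y N := by simp only [hy]; positivity
  have hny : (n : ℝ) ≤ y N := Nat.floor_le hy0
  have hyn : y N ≤ 2 * n := by
    have := Nat.lt_floor_add_one (y N)
    have : (1 : ℝ) ≤ n := by exact_mod_cast hn1
    linarith
  have hn1' : (1 : ℝ) ≤ n := by exact_mod_cast hn1
  have hy1 : 1 ≤ y N := hn1'.trans hny
  have hyν : y N ^ ν = N / C := by
    simp only [hy]
    rw [← Real.rpow_mul (by positivity), inv_mul_cancel₀ hν0.ne', Real.rpow_one]
  have hly : scale n ≤ y N := (scale_le hn1).trans hny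
  have hl0 : 0 ≤ scale n := by linarith [one_le_scale n]
  have hNN : (par k D M n 0).N ≤ N := by
    have : ((par k D M n 0).N : ℝ) ≤ N := by
      calc _ ≤ C * scale n ^ ν := h2
        _ ≤ C * y N ^ ν := by gcongr
        _ = N := by rw [hyν]; field_simp
    exact_mod_cast this
  have hm : ((par k D M n 0).m : ℝ) ≤ C * (N : ℝ) ^ κ := by
    refine h3.trans ?_
    have hyNν : y N ^ ν ≤ N := by rw [hyν]; exact div_le_self (by linarith) hC
    gcongr
    calc scale n ^ (1 + γ) ≤ y N ^ (1 + γ) := by gcongr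
      _ ≤ y N ^ (ν * κ) := by
        apply Real.rpow_le_rpow_of_exponent_le hy1
        rw [hκ, mul_div_assoc', le_div_iff₀ (by linarith), mul_comm]
        gcongr
      _ = (y N ^ ν) ^ κ := Real.rpow_mul hy0 _ _
      _ ≤ _ := by
        apply Real.rpow_le_rpow (by positivity) hyNν
        apply div_nonneg <;> linarith
  have htp' : (tp (par k D M n 0).N : ℝ) ≤ tp N := by exact_mod_cast htp hNN
  have htq' : (tq (par k D M n 0).N : ℝ) ≤ tq N := by exact_mod_cast htq hNN
  have hp0 : (0 : ℝ) ≤ tp N := NNReal.coe_nonneg _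
  rw [Real.norm_of_nonneg (by positivity), Real.norm_of_nonneg (by positivity)]
  have hC0 : 0 < C := by linarith
  calc (N : ℝ) ^ τ = (C * y N ^ ν) ^ τ := by rw [hyν]; congr 1; field_simp
    _ = C ^ τ * y N ^ (ν * τ) := by
      rw [Real.mul_rpow hC0.le (by positivity), ← Real.rpow_mul hy0]
    _ ≤ C ^ τ * y N ^ (2 - η) := by
      gcongr
      · have := min_le_right (δ / 2) (ε / 2)
        linarith
    _ ≤ C ^ τ * (2 * n) ^ (2 - η) := by
      have : 0 ≤ 2 - η := by linarith
      gcongr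
    _ ≤ C ^ τ * (4 * (n : ℝ) ^ (2 - η)) := by
      rw [Real.mul_rpow (by norm_num) (by positivity)]
      gcongr
      calc (2 : ℝ) ^ (2 - η) ≤ 2 ^ (2 : ℝ) := by
            apply Real.rpow_le_rpow_of_exponent_le <;> linarith
        _ = 4 := by norm_num
    _ ≤ C ^ τ * (4 * (2 * A * (C * tp N + C * (N : ℝ) ^ κ * tq N))) := by
      gcongr
      refine h1.trans ?_
      gcongr
      nlinarith
    _ = _ := by ring

/-- The exponent of a bound may be relaxed. -/
theorem isBigO_natCast_rpow {e f : ℝ} (h : e ≤ f) :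
    (fun N : ℕ => (N : ℝ) ^ e) =O[atTop] (fun N : ℕ => (N : ℝ) ^ f) := by
  refine IsBigO.of_bound 1 ?_
  filter_upwards [eventually_ge_atTop 1] with N hN
  rw [Real.norm_of_nonneg (by positivity), Real.norm_of_nonneg (by positivity), one_mul]
  exact Real.rpow_le_rpow_of_exponent_le (by exact_mod_cast hN) h

end

theorem mainTheorem11 (α : ℝ) (hα : 1 ≤ α) (pre qry : WordRAM.Prog) (c : ℕ) (tp tq : ℕ → ℝ≥0)
    (horacle : IsColorDistOracle α pre qry c tp tq)
    (γ : ℝ) (hγ0 : 0 < γ) (hγ1 : γ < 1) :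
    (ThreeSumConjecture → ∀ ε : ℝ, 0 < ε →
      ¬ (fun N : ℕ => (tp N : ℝ) + (N : ℝ) ^ ((1 + γ) / (2 - γ)) * (tq N : ℝ))
          =O[atTop] (fun N : ℕ => (N : ℝ) ^ (2 / (2 - γ) - ε))) ∧
    (StrongThreeSumConjecture → Monotone tp → Monotone tq → ∀ ε : ℝ, 0 < ε →
      (fun N : ℕ => (N : ℝ) ^ (2 / (2 - γ) - ε))
          =O[atTop] (fun N : ℕ => (tp N : ℝ) + (N : ℝ) ^ ((1 + γ) / (2 - γ)) * (tq N : ℝ))) := by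
  refine ⟨fun conj ε hε h => ?_, fun conj htp htq ε hε => ?_⟩
  -- Replacing `ε` by `min ε 1` keeps the exponent nonnegative and only strengthens the claim.
  · refine not_isBigO_of_threeSumConjecture horacle hγ0 hγ1 (lt_min hε one_pos) (min_le_right ε 1)
      conj (h.trans (isBigO_natCast_rpow ?_))
    have := min_le_left ε 1
    linarith
  · refine (isBigO_natCast_rpow ?_).trans (isBigO_of_strongThreeSumConjecture horacle hγ0 hγ1
      (lt_min hε one_pos) (min_le_right ε 1) conj htp htq)
    have := min_le_left ε 1
    linarith
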